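/- All manifolds and maps are of class $C^\infty$ unless stated otherwise. Let $Y$ be a $5$-manifold and let $D\subset TY$ be a distribution with small growth $(2,3,5)$, that is, $D$, $D^{(2)}=D+[D,D]$ and $D^{(3)}=D^{(2)}+[D,D^{(2)}]$ are subbundles of $TY$ of ranks $2,3,5$. *Control systems and singular paths.* Let $\pi:N\to M$ be a map of manifolds and $G\subset TN$ a subbundle such that the composite of $G\to N$ and $\pi$ is a submersion; consider the control system $G\to TM$, $v\mapsto\pi_*v$. An admissible control is an $L^\infty$ map $c:[a,b]\to G$ for which the curve $\gamma$ in $M$ under $c$ is Lipschitz with $\dot\gamma(t)=\pi_*c(t)$ for almost every $t$; $\gamma$ is its trajectory. The control $c$ is singular if the differential at $c$ of the endpoint map $c\mapsto\gamma(b)$, on the Banach manifold of admissible controls on $[a,b]$ with fixed initial point $\gamma(a)$, is not surjective. A singular path is a smooth immersed curve $\gamma:[a,b]\to M$, $a<b$, which is the trajectory of a singular control, considered up to parametrisation. A singular $D$-path is a singular path of $D\hookrightarrow TY$ (the case $\pi=\mathrm{id}_Y$, $G=D$). *Double fibration.* For an open set $V\subset Y$ let $Z$ be the $6$-manifold of all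 oriented lines in the planes $D_y$, $y\in V$, with projection $\pi_Y:Z\to V$, a circle bundle. A smooth immersed curve in $V$ tangent to $D$ lifts to $Z$ through its oriented tangent lines. A double fibration $V\xleftarrow{\pi_Y}Z\xrightarrow{\pi_X}X$ consists of a Hausdorff $5$-manifold $X$ and a surjective submersion $\pi_X:Z\to X$ such that two points of $Z$ lie on one fibre of $\pi_X$ if and only if some singular $D$-path in $V$ lifts through both; so $X$ is the space of (complete, oriented) singular $D$-paths in $V$. Let $L=\mathrm{Ker}(\pi_{Y*})\subset TZ$, and let $\mathbb C$ be the control system $L\to TX$, $v\mapsto\pi_{X*}v$, on $X$, with bundle projection $L\to Z\xrightarrow{\pi_X}X$. **Theorem.** Every point $y_0\in Y$ has an open neighbourhood $V_0$ such that for every open set $V\subset V_0$ and every double fibration $V\xleftarrow{\pi_Y}Z\xrightarrow{\pi_X}X$ the following holds. 1. A curve $\gamma:[a,b]\to X$, $a<b$, is a singular $\mathbb C$-path if and only if $\gamma=\pi_X\circ\sigma$ for a smooth immersed curve $\sigma$ in some fibre $\pi_Y^{-1}(y)$, $y\in V$. So, up to parametrisation, the singular $\mathbb C$-paths are the $\pi_X$-images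 of (arcs of) $\pi_Y$-fibres. 2. For every singular $\mathbb C$-path $\gamma$ there is exactly one $y\in V$ with $\gamma([a,b])\subset\pi_X(\pi_Y^{-1}(y))$. 3. The map $y\mapsto\pi_X(\pi_Y^{-1}(y))$ is a bijection from $V$ onto the set of complete singular $\mathbb C$-paths, that is, of the maximal ones among the subsets $\gamma([a,b])$ of $X$ that singular $\mathbb C$-paths trace out. So $V$ is identified with the space of singular $\mathbb C$-paths on $X$, dually to $X$ being the space of singular $D$-paths in $V$. -/

import Mathlib

open Set Filter Topology MeasureTheory TopologicalSpace
open scoped Manifold ContDiff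

universe u v

noncomputable section

/-! ## Distributions and their derived systems -/

section Distributions

variable {E : Type*} [NormedAddCommGroup E] [NormedSpace ℝ E] {H : Type*} [TopologicalSpace H]
  (I : ModelWithCorners ℝ E H) {M : Type*} [TopologicalSpace M] [ChartedSpace H M]
  [IsManifold I ∞ M]

/-- The vector field `ξ` is smooth on the set `U`. -/
def IsSmoothFieldOn (ξ : ∀ x : M, TangentSpace I x) (U : Set M) : Prop :=
  ContMDiffOn I I.tangent ∞ (fun x => (⟨x, ξ x⟩ : TangentBundle I M)) U

/-- The vector field `ξ` represents a germ at `x` of smooth sections of the field of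
subspaces `D`. -/
def IsSectionGerm (D : ∀ x : M, Submodule ℝ (TangentSpace I x))
    (ξ : ∀ x : M, TangentSpace I x) (x : M) : Prop :=
  ∃ U : Set M, IsOpen U ∧ x ∈ U ∧ IsSmoothFieldOn I ξ U ∧ ∀ y ∈ U, ξ y ∈ D y

/-- `ξ` is a smooth frame of `D` on the set `U`. -/
def IsFrameOn (D : ∀ x : M, Submodule ℝ (TangentSpace I x)) {r : ℕ}
    (ξ : Fin r → ∀ x : M, TangentSpace I x) (U : Set M) : Prop :=
  (∀ i, IsSmoothFieldOn I (ξ i) U) ∧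
    ∀ y ∈ U, LinearIndependent ℝ (fun i => ξ i y) ∧
      D y = Submodule.span ℝ (range fun i => ξ i y)

/-- `D` is a smooth distribution (a vector subbundle of the tangent bundle) of rank `r`. -/
def IsDistribution (D : ∀ x : M, Submodule ℝ (TangentSpace I x)) (r : ℕ) : Prop :=
  ∀ x : M, ∃ (U : Set M) (ξ : Fin r → ∀ x : M, TangentSpace I x),
    IsOpen U ∧ x ∈ U ∧ IsFrameOn I D ξ U

/-- The values of the system `D' + [D, D']`. -/
def derivedSystem (D D' : ∀ x : M, Submodule ℝ (TangentSpace I x)) (x : M) :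
    Submodule ℝ (TangentSpace I x) :=
  D' x ⊔ Submodule.span ℝ {w | ∃ ξ ζ : ∀ x : M, TangentSpace I x,
    IsSectionGerm I D ξ x ∧ IsSectionGerm I D' ζ x ∧ w = VectorField.mlieBracket I ξ ζ x}

/-- `D` is a distribution with small growth `(2, 3, 5)`: the systems `D`, `D + [D, D]` and
`D⁽²⁾ + [D, D⁽²⁾]` are subbundles of ranks `2`, `3` and `5`. -/
structure HasGrowth235 (D : ∀ x : M, Submodule ℝ (TangentSpace I x)) : Prop where
  rank_one : IsDistribution I D 2
  rank_two : IsDistribution I (derivedSystem I D D) 3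
  rank_three : IsDistribution I (derivedSystem I D (derivedSystem I D D)) 5

end Distributions

/-! ## Control systems, singular controls and singular paths

For a subbundle `G` of `TN` and a map `π : N → M`, the composite `G → TN → TM` (inclusion, then
the differential of `π`) is a control system on `M`: its control bundle is `G`, with projection
`G → N → M`.  A distribution `D` on `M` is the case `N = M`, `π = id`. -/

section Control

variable {E : Type*} [NormedAddCommGroup E] [NormedSpace ℝ E] {H : Type*} [TopologicalSpace H]
  (I : ModelWithCorners ℝ E H) {M : Type*} [TopologicalSpace M] [ChartedSpace H M]
  {E' : Type*} [NormedAddCommGroup E'] [NormedSpace ℝ E'] {H' : Type*} [TopologicalSpace H']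
  (J : ModelWithCorners ℝ E' H') {N : Type*} [TopologicalSpace N] [ChartedSpace H' N]

/-- The curve `γ` has at time `t` (relative to the time interval `s`) the velocity `w ∈ TM`; in
particular `w` is attached at `γ t`. -/
def HasVelocityWithinAt (γ : ℝ → M) (s : Set ℝ) (t : ℝ) (w : TangentBundle I M) : Prop :=
  w.proj = γ t ∧
    HasMFDerivWithinAt 𝓘(ℝ, ℝ) I γ s t ((1 : ℝ →L[ℝ] ℝ).smulRight (w.snd : E))

/-- The curve `γ` on the manifold `M` is Lipschitz on `[a, b]` (locally in charts, which is the
same on a compact interval). -/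
def IsLipschitzCurve (a b : ℝ) (γ : ℝ → M) : Prop :=
  ContinuousOn γ (Icc a b) ∧ ∀ t ∈ Icc a b, ∃ (K : NNReal), ∃ s ∈ 𝓝[Icc a b] t,
    LipschitzOnWith K (fun t' => extChartAt I (γ t) (γ t')) s

/-- `γ` is a smooth immersed curve on `[a, b]`. -/
def IsSmoothImmersed (a b : ℝ) (γ : ℝ → M) : Prop :=
  ContMDiffOn 𝓘(ℝ, ℝ) I ∞ γ (Icc a b) ∧
    ∀ t ∈ Icc a b, mfderivWithin 𝓘(ℝ, ℝ) I γ (Icc a b) t ≠ 0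

variable [IsManifold J ∞ N]

/-- `c` is an admissible `L^∞` control on `[a, b]` of the control system `G → TM`, and the
Lipschitz curve `γ` is its trajectory: `γ' = π_* c` almost everywhere, which contains that `c t`
lies over `γ t`. Two controls are the same if they agree almost everywhere. -/
structure IsControl (G : ∀ z : N, Submodule ℝ (TangentSpace J z)) (π : N → M) (a b : ℝ)
    (c : ℝ → TangentBundle J N) (γ : ℝ → M) : Prop where
  measurable : AEStronglyMeasurable c (volume.restrict (Icc a b))
  bounded : ∃ K : Set (TangentBundle J N), IsCompact K ∧
    ∀ᵐ t ∂(volume.restrict (Icc a b)), c t ∈ K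
  mem : ∀ᵐ t ∂(volume.restrict (Icc a b)), (c t).snd ∈ G (c t).proj
  lipschitz : IsLipschitzCurve I a b γ
  velocity : ∀ᵐ t ∂(volume.restrict (Icc a b)),
    HasVelocityWithinAt I γ (Icc a b) t (tangentMap J I π (c t))

/-- `s ↦ C s` is a curve of admissible controls on `[a, b]`, with trajectories `Γ s` issuing from
the fixed initial point `γ a`, that passes through the control `c` (with trajectory `γ`) at `s = 0`
and is differentiable there.  Differentiability refers to the Banach manifold of `L^∞` maps into
the control bundle, for which a curve is differentiable at `0` if and only if for every smooth
function `f` the curve `s ↦ f ∘ C s` in the Banach space `L^∞([a, b])` is. -/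
structure IsVariation (G : ∀ z : N, Submodule ℝ (TangentSpace J z)) (π : N → M) (a b : ℝ)
    (c : ℝ → TangentBundle J N) (γ : ℝ → M)
    (C : ℝ → ℝ → TangentBundle J N) (Γ : ℝ → ℝ → M) : Prop where
  control_zero : C 0 =ᵐ[volume.restrict (Icc a b)] c
  trajectory_zero : EqOn (Γ 0) γ (Icc a b)
  control : ∀ᶠ s in 𝓝 (0 : ℝ), IsControl I J G π a b (C s) (Γ s)
  initial : ∀ᶠ s in 𝓝 (0 : ℝ), Γ s a = γ a
  differentiable : ∀ f : TangentBundle J N → ℝ, ContMDiff J.tangent 𝓘(ℝ, ℝ) ∞ f →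
    ∃ Φ : ℝ → Lp ℝ ⊤ (volume.restrict (Icc a b)), DifferentiableAt ℝ Φ 0 ∧
      ∀ᶠ s in 𝓝 (0 : ℝ), Φ s =ᵐ[volume.restrict (Icc a b)] fun t => f (C s t)

/-- The image of the differential at `c` of the endpoint mapping `c ↦ γ b` on the space of the
admissible controls on `[a, b]` with initial point `γ a`: the velocities at `s = 0` of the
endpoints of the differentiable curves of such controls through `c`. -/
def endpointImage (G : ∀ z : N, Submodule ℝ (TangentSpace J z)) (π : N → M) (a b : ℝ)
    (c : ℝ → TangentBundle J N) (γ : ℝ → M) : Set (TangentSpace I (γ b)) :=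
  {v | ∃ (C : ℝ → ℝ → TangentBundle J N) (Γ : ℝ → ℝ → M), IsVariation I J G π a b c γ C Γ ∧
    HasVelocityWithinAt I (fun s => Γ s b) univ 0 (⟨γ b, v⟩ : TangentBundle I M)}

/-- `c` is a singular control with trajectory `γ`: the differential at `c` of the endpoint mapping
is not surjective. -/
def IsSingularControl (G : ∀ z : N, Submodule ℝ (TangentSpace J z)) (π : N → M) (a b : ℝ)
    (c : ℝ → TangentBundle J N) (γ : ℝ → M) : Prop :=
  IsControl I J G π a b c γ ∧ endpointImage I J G π a b c γ ≠ univ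

/-- `γ : [a, b] → M` parametrises a singular path of the control system `G → TM`: it is a smooth
immersed curve, and the trajectory of a singular control. -/
def IsSingularPath (G : ∀ z : N, Submodule ℝ (TangentSpace J z)) (π : N → M) (a b : ℝ)
    (γ : ℝ → M) : Prop :=
  a < b ∧ IsSmoothImmersed I a b γ ∧ ∃ c, IsSingularControl I J G π a b c γ

end Control

/-! ## The prolongation and the double fibration -/

section DoubleFibration

variable {Y : Type u} [TopologicalSpace Y] [ChartedSpace (EuclideanSpace ℝ (Fin 5)) Y]

/-- The space `Z` of oriented lines in the planes `D y`, `y ∈ V`, for a distribution `D` with a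
frame `η` on the open set `V`: the point `(y, u)` is the oriented line that
`lineVector η (y, u) = (re u) η₀(y) + (im u) η₁(y)` generates. -/
abbrev LineSpace (V : Opens Y) : Type u := V × Circle

/-- The model of the `6`-manifold `Z`. -/
abbrev modelZ : ModelWithCorners ℝ (EuclideanSpace ℝ (Fin 5) × EuclideanSpace ℝ (Fin 1))
    (ModelProd (EuclideanSpace ℝ (Fin 5)) (EuclideanSpace ℝ (Fin 1))) :=
  (𝓡 5).prod (𝓡 1)

/-- A vector that generates the oriented line `z`. -/
def lineVector (η : Fin 2 → ∀ y : Y, TangentSpace (𝓡 5) y) {V : Opens Y} (z : LineSpace V) :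
    TangentSpace (𝓡 5) (z.1 : Y) :=
  (z.2 : ℂ).re • η 0 (z.1 : Y) + (z.2 : ℂ).im • η 1 (z.1 : Y)

/-- The projection `π_Y : Z → Y`. -/
def projY {V : Opens Y} (z : LineSpace V) : Y := (z.1 : Y)

/-- The prolongation `E ⊂ TZ` of `D`: `E_z` is the preimage of the line `z` under `π_{Y*}`. -/
def prolongation (η : Fin 2 → ∀ y : Y, TangentSpace (𝓡 5) y) {V : Opens Y} (z : LineSpace V) :
    Submodule ℝ (TangentSpace modelZ z) :=
  Submodule.comap (mfderiv modelZ (𝓡 5) projY z).toLinearMap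
    (Submodule.span ℝ {(lineVector η z : TangentSpace (𝓡 5) (projY z))})

/-- The line bundle `L = Ker(π_{Y*}) ⊂ TZ`. -/
def kerY {V : Opens Y} (z : LineSpace V) : Submodule ℝ (TangentSpace modelZ z) :=
  LinearMap.ker (mfderiv modelZ (𝓡 5) projY z).toLinearMap

theorem kerY_le_prolongation (η : Fin 2 → ∀ y : Y, TangentSpace (𝓡 5) y) {V : Opens Y}
    (z : LineSpace V) : kerY z ≤ prolongation η z :=
  LinearMap.ker_le_comap _

/-- At time `t` the lift to `Z` of the curve `γ : [a, b] → Y` is `z`: the curve passes through the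
point `π_Y z` with the oriented direction `z`. -/
def LiftsThrough (η : Fin 2 → ∀ y : Y, TangentSpace (𝓡 5) y) {V : Opens Y} (a b : ℝ) (γ : ℝ → Y)
    (t : ℝ) (z : LineSpace V) : Prop :=
  ∃ r : ℝ, 0 < r ∧
    HasVelocityWithinAt (𝓡 5) γ (Icc a b) t (⟨(z.1 : Y), r • lineVector η z⟩ :
      TangentBundle (𝓡 5) Y)

variable [IsManifold (𝓡 5) ∞ Y]

/-- `π_X : Z → X` is a fibration of the space `Z` over `V` whose fibres are the lifts of the
(complete, oriented) singular `D`-paths in `V`: it is a surjective submersion, and two points of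
`Z` lie on the same fibre if and only if one singular `D`-path in `V` lifts through both of them.
So `X` is the space of singular `D`-paths in `V`. -/
structure IsDoubleFibration (D : ∀ y : Y, Submodule ℝ (TangentSpace (𝓡 5) y))
    (η : Fin 2 → ∀ y : Y, TangentSpace (𝓡 5) y) (V : Opens Y)
    {X : Type v} [TopologicalSpace X] [ChartedSpace (EuclideanSpace ℝ (Fin 5)) X]
    (πX : LineSpace V → X) : Prop where
  smooth : ContMDiff modelZ (𝓡 5) ∞ πX
  surjective : Function.Surjective πX
  submersion : ∀ z, Function.Surjective (mfderiv modelZ (𝓡 5) πX z)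
  fibre : ∀ z z' : LineSpace V, πX z = πX z' ↔
    ∃ (a b : ℝ) (γ : ℝ → Y), IsSingularPath (𝓡 5) (𝓡 5) D (id : Y → Y) a b γ ∧
      (∀ t ∈ Icc a b, γ t ∈ V) ∧
      ∃ s ∈ Icc a b, ∃ t ∈ Icc a b, LiftsThrough η a b γ s z ∧ LiftsThrough η a b γ t z'

/-- Singular `ℂ`-paths on `X`, for the cone structure regarded as the control system
`ℂ : L = Ker(π_{Y*}) → TX`, `v ↦ π_{X*} v`. -/
def IsSingularConePath {V : Opens Y} {X : Type v} [TopologicalSpace X]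
    [ChartedSpace (EuclideanSpace ℝ (Fin 5)) X] (πX : LineSpace V → X) (a b : ℝ) (γ : ℝ → X) :
    Prop :=
  IsSingularPath (𝓡 5) modelZ (kerY (V := V)) πX a b γ

/-- The `π_X`-image of the `π_Y`-fibre over `y`. -/
def fibreImage {V : Opens Y} {X : Type v} (πX : LineSpace V → X) (y : V) : Set X :=
  πX '' {z | projY z = (y : Y)}

/-- The complete singular `ℂ`-paths, as unparametrised curves: the maximal ones among the sets that
singular `ℂ`-paths trace out. -/
def completeConePaths {V : Opens Y} {X : Type v} [TopologicalSpace X]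
    [ChartedSpace (EuclideanSpace ℝ (Fin 5)) X] (πX : LineSpace V → X) : Set (Set X) :=
  {A | Maximal (fun A' : Set X => ∃ (a b : ℝ) (γ : ℝ → X),
    IsSingularConePath πX a b γ ∧ A' = γ '' Icc a b) A}

end DoubleFibration

end

/-!
# Duality between `(2, 3, 5)`-distributions and cone structures

A frame `A`, `B` of the distribution, together with `C = [A, B]`, `[A, C]` and `[B, C]`, is a frame
of the tangent bundle (`GrowthFrame`). On the space of oriented lines, with coordinates `(x, θ)` for
the line generated by `ell = cos θ A + sin θ B`, the vertical field `∂/∂θ` spans `L`, and there is a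
second field, the characteristic field `char = (ell, angVel)`. The bracket of these two fields
projects to `ell'`, the derivative of `ell` with respect to `θ`.

*Costates.* If the differential of the endpoint map is not onto at a control, then the adjoint
equation has a nowhere vanishing solution that annihilates the control directions along the
trajectory (`exists_linearised_solution_or_costate`, `exists_costate_of_isSingularControl`). For a
singular path of the distribution, repeated differentiation of the relations `l A = l B = 0` shows
that its lift to the oriented lines is an integral curve of `char` up to parametrisation
(`GrowthFrame.angle_deriv_eq`, `IsLocalModel.exists_isCharCurve`). Hence any two points on a fibre
of `π_X` are joined by a characteristic curve inside this fibre (`IsLocalModel.isFibration`). The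
neighbourhood `V₀` is so small that characteristic curves over it are short
(`GrowthFrame.exists_radius`). It follows that the kernel of the differential of `π_X` is spanned by
`char` (`GrowthFrame.IsFibration.eq_smul_char_of_fderiv_eq_zero`), and that a nonzero vector tangent
to `X` is the image of a vertical vector at no more than one oriented line
(`GrowthFrame.IsFibration.eq_of_fderiv_eq`).

*Singular paths of the cone come from one point.* The velocity of such a path `γ` is the image of a
vertical vector `r ∂/∂θ`, unique by the last statement. Since
`(p, r) ↦ r • dπ_X (∂/∂θ)` is an immersion for `r ≠ 0`, the vector depends smoothly on the time, and
`γ` is the image of a curve `z' = r ∂/∂θ + q char` (`GrowthFrame.IsFibration.exists_lift`). The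
costate of the singular control, pulled back to the oriented lines, annihilates `∂/∂θ` and `char`,
and therefore also their bracket. So its base component annihilates the planes of the distribution,
along the curve `x' = q ell` whose angle moves by `θ' = r + q angVel`. Where `q ≠ 0`, however,
`θ' = q angVel`, which contradicts `r ≠ 0`. So `q = 0` and the base point is constant
(`GrowthFrame.eq_zero_of_costate`, `IsLocalModel.exists_of_isSingularConePath`).

*Arcs of fibres are singular.* A covector `l` at `x₀` that annihilates the plane there descends,
locally along the fibre over `x₀`, to the differential of a function on `X`, and the derivative of
this function along `∂/∂θ` vanishes to second order at the fibre
(`GrowthFrame.IsFibration.exists_potential`). In a variation of the arc the controls stay at a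
distance `O(s)` from it, so that the function changes by `O(s²)` along the varied trajectories. The
velocities of the endpoints therefore satisfy a nontrivial linear equation
(`GrowthFrame.IsFibration.exists_not_endpoint`, `IsLocalModel.isSingularConePath`).

*The point is determined by the path.* If an arc of the fibre over `y` has its image in the image of
the fibre over `y'`, then the two images are tangent at some point of the arc, and
`eq_of_fderiv_eq` gives `y = y'` (`IsLocalModel.eq_of_arc_subset_fibreImage`). The image of a whole
fibre is traced out by a singular path, and so it is maximal; every other traced set lies in one.
-/

/-! ### Ordinary differential equations on a compact interval -/

section ODE

variable {F : Type*} [NormedAddCommGroup F] [NormedSpace ℝ F]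

theorem HasDerivWithinAt.Ici_of_Icc {f : ℝ → F} {f' : F} {a b t : ℝ}
    (h : HasDerivWithinAt f f' (Icc a b) t) (ht : t ∈ Ico a b) :
    HasDerivWithinAt f f' (Ici t) t :=
  h.mono_of_mem_nhdsWithin (Icc_mem_nhdsGE_of_mem ht)

theorem norm_le_mul_of_norm_deriv_le {f f' : ℝ → F} {K ε a b : ℝ} (hK : 0 < K) (hε : 0 ≤ ε)
    (hf : ∀ t ∈ Icc a b, HasDerivWithinAt f (f' t) (Icc a b) t) (ha : f a = 0)
    (bound : ∀ t ∈ Icc a b, ‖f' t‖ ≤ K * ‖f t‖ + ε) :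
    ∀ t ∈ Icc a b, ‖f t‖ ≤ ε * (Real.exp (K * (b - a)) / K) := by
  intro t ht
  have h := norm_le_gronwallBound_of_norm_deriv_right_le (f := f) (f' := f') (δ := 0) (K := K)
    (ε := ε) (a := a) (b := b) (fun t ht => (hf t ht).continuousWithinAt)
    (fun x hx => (hf x (Ico_subset_Icc_self hx)).Ici_of_Icc hx) (by simp [ha])
    (fun x hx => bound x (Ico_subset_Icc_self hx)) t ht
  refine h.trans ?_
  rw [gronwallBound_of_K_ne_0 hK.ne']
  have h1 : Real.exp (K * (t - a)) ≤ Real.exp (K * (b - a)) := by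
    apply Real.exp_le_exp.2; have := ht.2; gcongr
  have h2 : ε / K * (Real.exp (K * (t - a)) - 1) ≤ ε / K * Real.exp (K * (b - a)) := by
    apply mul_le_mul_of_nonneg_left _ (by positivity); linarith
  calc _ = ε / K * (Real.exp (K * (t - a)) - 1) := by simp
    _ ≤ _ := h2
    _ = _ := by ring

/-- A bounded, globally Lipschitz time-dependent field has solutions on the whole interval. -/
theorem exists_solution_of_bounded_lipschitz [CompleteSpace F] {a b : ℝ} (hab : a ≤ b)
    {f : ℝ → F → F}
    {K M : NNReal} (hK : ∀ t ∈ Icc a b, LipschitzWith K (f t))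
    (hc : ∀ x, ContinuousOn (fun t => f t x) (Icc a b))
    (hM : ∀ t ∈ Icc a b, ∀ x, ‖f t x‖ ≤ M) (x₀ : F) :
    ∃ x : ℝ → F, x a = x₀ ∧ ∀ t ∈ Icc a b, HasDerivWithinAt x (f t (x t)) (Icc a b) t := by
  have h : IsPicardLindelof f (⟨a, left_mem_Icc.2 hab⟩ : Icc a b) x₀
      (M * Real.toNNReal (b - a)) 0 M K :=
    { lipschitzOnWith := fun t ht => (hK t ht).lipschitzOnWith
      continuousOn := fun x _ => hc x
      norm_le := fun t ht x _ => hM t ht x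
      mul_max_le := by simp [hab] }
  exact h.exists_eq_forall_mem_Icc_hasDerivWithinAt₀

/-- The closed-ball cutoff of a linear differential equation is bounded and Lipschitz, and by
Grönwall its solution never leaves the ball, so linear equations have global solutions. -/
theorem exists_linear_solution [FiniteDimensional ℝ F] {a b : ℝ} (hab : a ≤ b)
    {L : ℝ → F →L[ℝ] F} (hL : ContinuousOn L (Icc a b)) (x₀ : F) :
    ∃ x : ℝ → F, x a = x₀ ∧ ∀ t ∈ Icc a b, HasDerivWithinAt x (L t (x t)) (Icc a b) t := by
  have : CompleteSpace F := FiniteDimensional.complete ℝ F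
  obtain ⟨C, hC⟩ := isCompact_Icc.exists_bound_of_continuousOn hL
  set N : ℝ := max C 0 with hN
  have hN0 : 0 ≤ N := le_max_right _ _
  have hLN : ∀ t ∈ Icc a b, ‖L t‖ ≤ N := fun t ht => (hC t ht).trans (le_max_left _ _)
  set R : ℝ := ‖x₀‖ * Real.exp (N * (b - a)) + 1 with hR
  have hR0 : 0 < R := by positivity
  let χ : ContDiffBump (0 : F) := ⟨R, R + 1, hR0, by linarith⟩
  set g : F → F := fun x => χ x • x with hg
  have hgs : HasCompactSupport g := χ.hasCompactSupport.smul_right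
  have hgc : ContDiff ℝ 1 g := χ.contDiff.smul contDiff_id
  obtain ⟨K, hK⟩ := hgc.lipschitzWith_of_hasCompactSupport hgs one_ne_zero
  obtain ⟨M, hM⟩ := hgc.continuous.bounded_above_of_compact_support hgs
  have hM0 : 0 ≤ M := (norm_nonneg _).trans (hM 0)
  obtain ⟨x, hxa, hx⟩ := exists_solution_of_bounded_lipschitz hab (f := fun t x => L t (g x))
    (K := ⟨N, hN0⟩ * K) (M := ⟨N * M, by positivity⟩)
    (fun t ht => ((L t).lipschitz.weaken (hLN t ht)).comp hK)
    (fun x => hL.clm_apply continuousOn_const)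
    (fun t ht x => (((L t).le_opNorm _).trans
      (mul_le_mul (hLN t ht) (hM x) (norm_nonneg _) hN0))) x₀
  refine ⟨x, hxa, fun t ht => ?_⟩
  have key : ∀ t ∈ Icc a b, ‖x t‖ ≤ R := by
    intro t ht
    have h := norm_le_gronwallBound_of_norm_deriv_right_le (f := x)
      (f' := fun t => L t (g (x t))) (δ := ‖x₀‖) (K := N)
      (ε := 0) (a := a) (b := b) (fun t ht => (hx t ht).continuousWithinAt)
      (fun s hs => (hx s (Ico_subset_Icc_self hs)).Ici_of_Icc hs) (by simp [hxa])
      (fun s hs => by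
        have h1 : ‖g (x s)‖ ≤ ‖x s‖ := by
          rw [hg, norm_smul, Real.norm_of_nonneg χ.nonneg]
          exact mul_le_of_le_one_left (norm_nonneg _) χ.le_one
        have := (L s).le_opNorm (g (x s))
        have h2 := hLN s (Ico_subset_Icc_self hs)
        calc _ ≤ ‖L s‖ * ‖g (x s)‖ := this
          _ ≤ N * ‖x s‖ := mul_le_mul h2 h1 (norm_nonneg _) hN0
          _ = _ := by ring) t ht
    rw [gronwallBound_ε0] at h
    have : Real.exp (N * (t - a)) ≤ Real.exp (N * (b - a)) := by
      apply Real.exp_le_exp.2; have := ht.2; gcongr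
    have := mul_le_mul_of_nonneg_left this (norm_nonneg x₀)
    linarith
  have : g (x t) = x t := by
    have : χ (x t) = 1 := χ.one_of_mem_closedBall (by simpa using key t ht)
    simp [hg, this]
  simpa [this] using hx t ht

theorem norm_sub_sub_fderiv_le {G : Type*} [NormedAddCommGroup G] [NormedSpace ℝ G]
    {Y : F → G} {K : NNReal} (hY : Differentiable ℝ Y)
    (hK : LipschitzWith K (fderiv ℝ Y)) (x y : F) :
    ‖Y y - Y x - fderiv ℝ Y x (y - x)‖ ≤ K * ‖y - x‖ ^ 2 := by
  have h := (convex_segment x y).norm_image_sub_le_of_norm_fderiv_le'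
    (𝕜 := ℝ) (f := Y) (φ := fderiv ℝ Y x) (C := K * ‖y - x‖) (fun z _ => hY z)
    (fun z hz => by
      have := hK.dist_le_mul z x
      rw [dist_eq_norm, dist_eq_norm] at this
      refine this.trans ?_
      gcongr
      obtain ⟨α, β, hα, hβ, hαβ, rfl⟩ := hz
      have : α • x + β • y - x = β • (y - x) := by
        have : α = 1 - β := by linarith
        subst this; module
      rw [this, norm_smul, Real.norm_of_nonneg hβ]
      exact mul_le_of_le_one_left (norm_nonneg _) (by linarith))
    (left_mem_segment ℝ x y) (right_mem_segment ℝ x y)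
  calc _ ≤ _ := h
    _ = _ := by ring

/-- A compactly supported smooth field on the whole space that agrees with a smooth field on an open
set near a given compact subset. -/
theorem exists_contDiff_compactSupport_eqOn [FiniteDimensional ℝ F] (G : Type*)
    [NormedAddCommGroup G] [NormedSpace ℝ G] {Ω k : Set F} (hΩ : IsOpen Ω)
    (hk : IsCompact k) (hkΩ : k ⊆ Ω) :
    ∃ (O : Set F) (χ : F → ℝ), IsOpen O ∧ k ⊆ O ∧ O ⊆ Ω ∧ ∀ X : F → G, ContDiffOn ℝ ∞ X Ω →
      ContDiff ℝ ∞ (fun x => χ x • X x) ∧ HasCompactSupport (fun x => χ x • X x) ∧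
      ∀ x ∈ O, χ x • X x = X x := by
  have : ProperSpace F := FiniteDimensional.proper ℝ F
  obtain ⟨L, hL, hkL, hLΩ⟩ := exists_compact_between hk hΩ hkΩ
  obtain ⟨L', hL', hLL', hLΩ'⟩ := exists_compact_between hL hΩ hLΩ
  obtain ⟨f, hf0, hf1, -⟩ := exists_contMDiffMap_zero_one_of_isClosed (n := ⊤) 𝓘(ℝ, F)
    (s := (interior L')ᶜ) (t := L) isOpen_interior.isClosed_compl hL.isClosed
    (disjoint_left.2 fun x hx hx' => hx (hLL' hx'))
  have hts : tsupport (f : F → ℝ) ⊆ L' := by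
    apply closure_minimal _ hL'.isClosed
    intro x hx
    by_contra h
    exact hx (hf0 (fun h' => h (interior_subset h')))
  have hc : HasCompactSupport (f : F → ℝ) := hL'.of_isClosed_subset (isClosed_tsupport _) hts
  refine ⟨interior L, f, isOpen_interior, hkL, interior_subset.trans hLΩ, fun X hX =>
    ⟨?_, hc.smul_right, fun x hx => ?_⟩⟩
  · rw [contDiff_iff_contDiffAt]
    intro x
    by_cases hx : x ∈ Ω
    · exact f.contMDiff.contDiff.contDiffAt.smul (hX.contDiffAt (hΩ.mem_nhds hx))
    · have : (fun x => f x • X x) =ᶠ[𝓝 x] fun _ => 0 := by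
        filter_upwards [(isClosed_tsupport (f : F → ℝ)).isOpen_compl.mem_nhds
          (fun h => hx (hLΩ' (hts h)))] with y hy
        rw [image_eq_zero_of_notMem_tsupport hy, zero_smul]
      exact contDiffAt_const.congr_of_eventuallyEq this
  · rw [hf1 (interior_subset hx)]; simp

/-- The solutions of a control-linear equation for the controls `wᵢ + s oᵢ`, expanded to first order
in `s`, for compactly supported fields. -/
theorem exists_variation_of_compactSupport [FiniteDimensional ℝ F] {a b : ℝ} (hab : a ≤ b)
    {X Y : F → F} (hX : ContDiff ℝ ∞ X) (hY : ContDiff ℝ ∞ Y) (hXs : HasCompactSupport X)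
    (hYs : HasCompactSupport Y) {w v o p : ℝ → ℝ} (hw : ContinuousOn w (Icc a b))
    (hv : ContinuousOn v (Icc a b)) (ho : ContinuousOn o (Icc a b))
    (hp : ContinuousOn p (Icc a b)) {z δ : ℝ → F}
    (hz : ∀ t ∈ Icc a b, HasDerivWithinAt z (w t • X (z t) + v t • Y (z t)) (Icc a b) t)
    (hδ : ∀ t ∈ Icc a b, HasDerivWithinAt δ (w t • fderiv ℝ X (z t) (δ t) +
      v t • fderiv ℝ Y (z t) (δ t) + (o t • X (z t) + p t • Y (z t))) (Icc a b) t)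
    (hδa : δ a = 0) :
    ∃ (Z : ℝ → ℝ → F) (C : ℝ), 0 ≤ C ∧ ∀ s, |s| ≤ 1 → Z s a = z a ∧ ∀ t ∈ Icc a b,
      HasDerivWithinAt (Z s) ((w t + s * o t) • X (Z s t) + (v t + s * p t) • Y (Z s t))
        (Icc a b) t ∧ ‖Z s t - z t‖ ≤ C * |s| ∧ ‖Z s t - z t - s • δ t‖ ≤ C * s ^ 2 := by
  have : CompleteSpace F := FiniteDimensional.complete ℝ F
  have lip : ∀ X : F → F, ContDiff ℝ ∞ X → HasCompactSupport X → ∃ N : ℝ, 0 ≤ N ∧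
      (∀ x, ‖X x‖ ≤ N) ∧ (∀ x y, ‖X y - X x‖ ≤ N * ‖y - x‖) ∧ (∀ x u, ‖fderiv ℝ X x u‖ ≤ N * ‖u‖) ∧
      ∀ x y, ‖X y - X x - fderiv ℝ X x (y - x)‖ ≤ N * ‖y - x‖ ^ 2 := by
    intro X hX hXs
    obtain ⟨M, hM⟩ := hX.continuous.bounded_above_of_compact_support hXs
    obtain ⟨K, hK⟩ := hX.lipschitzWith_of_hasCompactSupport hXs (by simp)
    have hX1 : ContDiff ℝ 1 (fderiv ℝ X) := hX.fderiv_right (by norm_cast)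
    obtain ⟨K', hK'⟩ := hX1.lipschitzWith_of_hasCompactSupport (hXs.fderiv (𝕜 := ℝ)) one_ne_zero
    refine ⟨max M (max K K'), le_max_of_le_right (le_max_of_le_left K.2),
      fun x => (hM x).trans (le_max_left _ _), fun x y => ?_, fun x u => ?_, fun x y => ?_⟩
    · have := hK.dist_le_mul y x
      rw [dist_eq_norm, dist_eq_norm] at this
      refine this.trans ?_
      gcongr
      exact le_max_of_le_right (le_max_left _ _)
    · refine ((fderiv ℝ X x).le_opNorm u).trans ?_
      gcongr
      exact (norm_fderiv_le_of_lipschitz ℝ hK).trans (le_max_of_le_right (le_max_left _ _))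
    · refine (norm_sub_sub_fderiv_le (hX.differentiable (by simp)) hK' x y).trans ?_
      gcongr
      exact le_max_of_le_right (le_max_right _ _)
  have bdd : ∀ w : ℝ → ℝ, ContinuousOn w (Icc a b) → ∃ N : ℝ, 0 ≤ N ∧ ∀ t ∈ Icc a b, |w t| ≤ N :=
    fun w hw => by
      obtain ⟨C, hC⟩ := isCompact_Icc.exists_bound_of_continuousOn hw
      exact ⟨max C 0, le_max_right _ _, fun t ht => (hC t ht).trans (le_max_left _ _)⟩
  obtain ⟨NX, hNX0, hX0, hX1, hX2, hX3⟩ := lip X hX hXs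
  obtain ⟨NY, hNY0, hY0, hY1, hY2, hY3⟩ := lip Y hY hYs
  obtain ⟨Nw, hNw0, hNw⟩ := bdd w hw
  obtain ⟨Nv, hNv0, hNv⟩ := bdd v hv
  obtain ⟨No, hNo0, hNo⟩ := bdd o ho
  obtain ⟨Np, hNp0, hNp⟩ := bdd p hp
  have hsol : ∀ s : ℝ, ∃ Z : ℝ → F, Z a = z a ∧ ∀ t ∈ Icc a b,
      HasDerivWithinAt Z ((w t + s * o t) • X (Z t) + (v t + s * p t) • Y (Z t)) (Icc a b) t := by
    intro s
    have h1 : ∀ t ∈ Icc a b, |w t + s * o t| ≤ Nw + |s| * No := fun t ht =>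
      (abs_add_le _ _).trans (add_le_add (hNw t ht) (by
        rw [abs_mul]; exact mul_le_mul_of_nonneg_left (hNo t ht) (abs_nonneg s)))
    have h2 : ∀ t ∈ Icc a b, |v t + s * p t| ≤ Nv + |s| * Np := fun t ht =>
      (abs_add_le _ _).trans (add_le_add (hNv t ht) (by
        rw [abs_mul]; exact mul_le_mul_of_nonneg_left (hNp t ht) (abs_nonneg s)))
    refine exists_solution_of_bounded_lipschitz hab
      (f := fun t x => (w t + s * o t) • X x + (v t + s * p t) • Y x)
      (K := Real.toNNReal ((Nw + |s| * No) * NX + (Nv + |s| * Np) * NY))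
      (M := Real.toNNReal ((Nw + |s| * No) * NX + (Nv + |s| * Np) * NY))
      (fun t ht => LipschitzWith.of_dist_le_mul fun x y => ?_) (fun x => ?_) (fun t ht x => ?_) _
    · rw [dist_eq_norm, dist_eq_norm]
      have : (w t + s * o t) • X x + (v t + s * p t) • Y x -
          ((w t + s * o t) • X y + (v t + s * p t) • Y y) =
          (w t + s * o t) • (X x - X y) + (v t + s * p t) • (Y x - Y y) := by module
      rw [this]
      refine (norm_add_le _ _).trans ?_
      rw [norm_smul, norm_smul, Real.norm_eq_abs, Real.norm_eq_abs]
      calc _ ≤ (Nw + |s| * No) * (NX * ‖x - y‖) + (Nv + |s| * Np) * (NY * ‖x - y‖) := by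
            gcongr
            exacts [h1 t ht, hX1 _ _, h2 t ht, hY1 _ _]
        _ = _ := by rw [Real.coe_toNNReal _ (by positivity)]; ring
    · fun_prop
    · refine (norm_add_le _ _).trans ?_
      rw [norm_smul, norm_smul, Real.norm_eq_abs, Real.norm_eq_abs]
      rw [Real.coe_toNNReal _ (by positivity)]
      gcongr
      exacts [h1 t ht, hX0 _, h2 t ht, hY0 _]
  choose Z hZa hZ using hsol
  set A : ℝ := Nw * NX + Nv * NY + 1 with hA
  have hA0 : 0 < A := by positivity
  set B : ℝ := No * NX + Np * NY with hB
  have hB0 : 0 ≤ B := by positivity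
  set G : ℝ := Real.exp (A * (b - a)) / A with hG
  have hG0 : 0 ≤ G := by positivity
  -- the first-order estimate
  have e1 : ∀ s, |s| ≤ 1 → ∀ t ∈ Icc a b, ‖Z s t - z t‖ ≤ (|s| * B) * G := by
    intro s _
    refine norm_le_mul_of_norm_deriv_le hA0 (by positivity)
      (f' := fun t => ((w t + s * o t) • X (Z s t) + (v t + s * p t) • Y (Z s t)) -
        (w t • X (z t) + v t • Y (z t)))
      (fun t ht => (hZ s t ht).sub (hz t ht)) (by simp [hZa]) (fun t ht => ?_)
    have : ((w t + s * o t) • X (Z s t) + (v t + s * p t) • Y (Z s t)) -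
        (w t • X (z t) + v t • Y (z t)) = (w t • (X (Z s t) - X (z t)) +
        v t • (Y (Z s t) - Y (z t))) + s • (o t • X (Z s t) + p t • Y (Z s t)) := by module
    rw [this]
    calc _ ≤ (|w t| * ‖X (Z s t) - X (z t)‖ + |v t| * ‖Y (Z s t) - Y (z t)‖) +
          |s| * (|o t| * ‖X (Z s t)‖ + |p t| * ‖Y (Z s t)‖) := by
          simp only [← Real.norm_eq_abs (w t), ← Real.norm_eq_abs (v t),
            ← Real.norm_eq_abs (o t), ← Real.norm_eq_abs (p t), ← norm_smul]
          refine (norm_add_le _ _).trans (add_le_add (norm_add_le _ _) ?_)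
          rw [norm_smul, Real.norm_eq_abs]
          gcongr
          exact norm_add_le _ _
      _ ≤ (Nw * (NX * ‖Z s t - z t‖) + Nv * (NY * ‖Z s t - z t‖)) + |s| * (No * NX + Np * NY) := by
          gcongr
          exacts [hNw t ht, hX1 _ _, hNv t ht, hY1 _ _, hNo t ht, hX0 _, hNp t ht, hY0 _]
      _ ≤ _ := by
          have := norm_nonneg (Z s t - z t)
          rw [hA, hB]; linarith
  set D : ℝ := (Nw * NX + Nv * NY) * (B * G) ^ 2 + (No * NX + Np * NY) * (B * G) with hD
  have hD0 : 0 ≤ D := by positivity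
  have e2 : ∀ s, |s| ≤ 1 → ∀ t ∈ Icc a b, ‖Z s t - z t - s • δ t‖ ≤ (s ^ 2 * D) * G := by
    intro s hs
    refine norm_le_mul_of_norm_deriv_le hA0 (by positivity)
      (f' := fun t => ((w t + s * o t) • X (Z s t) + (v t + s * p t) • Y (Z s t)) -
        (w t • X (z t) + v t • Y (z t)) - s • (w t • fderiv ℝ X (z t) (δ t) +
      v t • fderiv ℝ Y (z t) (δ t) + (o t • X (z t) + p t • Y (z t))))
      (fun t ht => ((hZ s t ht).sub (hz t ht)).sub ((hδ t ht).const_smul s))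
      (by simp [hZa, hδa]) (fun t ht => ?_)
    have : ((w t + s * o t) • X (Z s t) + (v t + s * p t) • Y (Z s t)) -
        (w t • X (z t) + v t • Y (z t)) - s • (w t • fderiv ℝ X (z t) (δ t) +
      v t • fderiv ℝ Y (z t) (δ t) + (o t • X (z t) + p t • Y (z t))) =
        ((w t • (X (Z s t) - X (z t) - fderiv ℝ X (z t) (Z s t - z t)) +
        v t • (Y (Z s t) - Y (z t) - fderiv ℝ Y (z t) (Z s t - z t))) +
        s • (o t • (X (Z s t) - X (z t)) + p t • (Y (Z s t) - Y (z t)))) +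
        (w t • fderiv ℝ X (z t) (Z s t - z t - s • δ t) +
          v t • fderiv ℝ Y (z t) (Z s t - z t - s • δ t)) := by
      simp only [map_sub, map_smul]; module
    rw [this]
    set u := Z s t - z t with hu
    have hu1 : ‖u‖ ≤ |s| * (B * G) := by
      have := e1 s hs t ht; rw [← hu] at this; linarith
    calc _ ≤ ((|w t| * ‖X (Z s t) - X (z t) - fderiv ℝ X (z t) u‖ +
          |v t| * ‖Y (Z s t) - Y (z t) - fderiv ℝ Y (z t) u‖) +
          |s| * (|o t| * ‖X (Z s t) - X (z t)‖ + |p t| * ‖Y (Z s t) - Y (z t)‖)) +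
          (|w t| * ‖fderiv ℝ X (z t) (u - s • δ t)‖ +
            |v t| * ‖fderiv ℝ Y (z t) (u - s • δ t)‖) := by
          simp only [← Real.norm_eq_abs (w t), ← Real.norm_eq_abs (v t),
            ← Real.norm_eq_abs (o t), ← Real.norm_eq_abs (p t), ← norm_smul]
          refine (norm_add_le _ _).trans (add_le_add ((norm_add_le _ _).trans
            (add_le_add (norm_add_le _ _) ?_)) (norm_add_le _ _))
          rw [norm_smul, Real.norm_eq_abs]
          gcongr
          exact norm_add_le _ _
      _ ≤ ((Nw * (NX * (|s| * (B * G)) ^ 2) + Nv * (NY * (|s| * (B * G)) ^ 2)) +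
          |s| * (No * (NX * (|s| * (B * G))) + Np * (NY * (|s| * (B * G))))) +
          (Nw * (NX * ‖u - s • δ t‖) + Nv * (NY * ‖u - s • δ t‖)) := by
          gcongr
          · exact hNw t ht
          · exact (hX3 _ _).trans (by gcongr)
          · exact hNv t ht
          · exact (hY3 _ _).trans (by gcongr)
          · exact hNo t ht
          · exact (hX1 _ _).trans (by gcongr)
          · exact hNp t ht
          · exact (hY1 _ _).trans (by gcongr)
          · exact hNw t ht
          · exact hX2 _ _
          · exact hNv t ht
          · exact hY2 _ _
      _ = |s| ^ 2 * D + (Nw * NX + Nv * NY) * ‖u - s • δ t‖ := by rw [hD]; ring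
      _ ≤ _ := by
          have := norm_nonneg (u - s • δ t)
          rw [sq_abs, hA]; linarith
  refine ⟨Z, B * G + D * G, by positivity, fun s hs => ⟨hZa s, fun t ht => ⟨hZ s t ht, ?_, ?_⟩⟩⟩
  · refine (e1 s hs t ht).trans ?_
    have : 0 ≤ D * G * |s| := by positivity
    linarith
  · refine (e2 s hs t ht).trans ?_
    have : 0 ≤ B * G * s ^ 2 := by positivity
    linarith

/-- The solutions of a control-linear equation for the controls `wᵢ + s oᵢ`, expanded to first order
in `s`: for small `s` they exist on the whole interval. -/
theorem exists_variation [FiniteDimensional ℝ F] {a b : ℝ} (hab : a ≤ b) {Ω : Set F}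
    (hΩ : IsOpen Ω) {X Y : F → F} (hX : ContDiffOn ℝ ∞ X Ω) (hY : ContDiffOn ℝ ∞ Y Ω)
    {w v o p : ℝ → ℝ} (hw : ContinuousOn w (Icc a b))
    (hv : ContinuousOn v (Icc a b)) (ho : ContinuousOn o (Icc a b))
    (hp : ContinuousOn p (Icc a b)) {z δ : ℝ → F} (hzΩ : ∀ t ∈ Icc a b, z t ∈ Ω)
    (hz : ∀ t ∈ Icc a b, HasDerivWithinAt z (w t • X (z t) + v t • Y (z t)) (Icc a b) t)
    (hδ : ∀ t ∈ Icc a b, HasDerivWithinAt δ (w t • fderiv ℝ X (z t) (δ t) +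
      v t • fderiv ℝ Y (z t) (δ t) + (o t • X (z t) + p t • Y (z t))) (Icc a b) t)
    (hδa : δ a = 0) :
    ∃ (Z : ℝ → ℝ → F) (C s₀ : ℝ), 0 ≤ C ∧ 0 < s₀ ∧ ∀ s, |s| ≤ s₀ → Z s a = z a ∧ ∀ t ∈ Icc a b,
      Z s t ∈ Ω ∧
      HasDerivWithinAt (Z s) ((w t + s * o t) • X (Z s t) + (v t + s * p t) • Y (Z s t))
        (Icc a b) t ∧ ‖Z s t - z t - s • δ t‖ ≤ C * s ^ 2 := by
  have hzc : ContinuousOn z (Icc a b) := fun t ht => (hz t ht).continuousWithinAt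
  have hk : IsCompact (z '' Icc a b) := isCompact_Icc.image_of_continuousOn hzc
  obtain ⟨O, χ, hO, hkO, hOΩ, H⟩ := exists_contDiff_compactSupport_eqOn F hΩ hk
    (image_subset_iff.2 hzΩ)
  obtain ⟨hX1, hX2, hX3⟩ := H X hX
  obtain ⟨hY1, hY2, hY3⟩ := H Y hY
  have hzO : ∀ t ∈ Icc a b, z t ∈ O := fun t ht => hkO (mem_image_of_mem z ht)
  have fX : ∀ t ∈ Icc a b, fderiv ℝ (fun x => χ x • X x) (z t) = fderiv ℝ X (z t) := fun t ht =>
    Filter.EventuallyEq.fderiv_eq (eventually_of_mem (hO.mem_nhds (hzO t ht)) hX3)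
  have fY : ∀ t ∈ Icc a b, fderiv ℝ (fun x => χ x • Y x) (z t) = fderiv ℝ Y (z t) := fun t ht =>
    Filter.EventuallyEq.fderiv_eq (eventually_of_mem (hO.mem_nhds (hzO t ht)) hY3)
  obtain ⟨Z, C, hC, hZ⟩ := exists_variation_of_compactSupport hab hX1 hY1 hX2 hY2 hw hv ho hp
    (z := z) (δ := δ) (fun t ht => by
      rw [hX3 _ (hzO t ht), hY3 _ (hzO t ht)]; exact hz t ht)
    (fun t ht => by
      rw [hX3 _ (hzO t ht), hY3 _ (hzO t ht), fX t ht, fY t ht]; exact hδ t ht) hδa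
  obtain ⟨ε, hε, hεO⟩ := hk.exists_thickening_subset_open hO hkO
  refine ⟨Z, C, min 1 (ε / (2 * (C + 1))), hC, by positivity, fun s hs => ⟨(hZ s (hs.trans
    (min_le_left _ _))).1, fun t ht => ?_⟩⟩
  obtain ⟨h1, h2, h3⟩ := (hZ s (hs.trans (min_le_left _ _))).2 t ht
  have hm : Z s t ∈ O := by
    apply hεO
    rw [Metric.mem_thickening_iff]
    refine ⟨z t, mem_image_of_mem z ht, ?_⟩
    rw [dist_eq_norm]
    calc _ ≤ C * |s| := h2
      _ ≤ C * (ε / (2 * (C + 1))) := by gcongr; exact hs.trans (min_le_right _ _)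
      _ ≤ ε / 2 := by
          rw [mul_div_assoc', div_le_div_iff₀ (by positivity) (by positivity)]
          nlinarith
      _ < ε := by linarith
  rw [hX3 _ hm, hY3 _ hm] at h1
  exact ⟨hOΩ hm, h1, h3⟩

/-- The alternative of the Pontryagin maximum principle for control-linear systems: either every
vector is the image under `T` of the endpoint `δ b` of a solution of the linearised system, or
there is a nowhere vanishing solution of the adjoint equation that annihilates both fields along the
trajectory and ends in a covector pulled back by `T`. -/
theorem exists_linearised_solution_or_costate [FiniteDimensional ℝ F] {a b : ℝ} (hab' : a < b)
    {Ω : Set F} (hΩ : IsOpen Ω) {X Y : F → F} (hX : ContDiffOn ℝ ∞ X Ω) (hY : ContDiffOn ℝ ∞ Y Ω)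
    {w v : ℝ → ℝ} (hw : ContinuousOn w (Icc a b)) (hv : ContinuousOn v (Icc a b)) {z : ℝ → F}
    (hzΩ : ∀ t ∈ Icc a b, z t ∈ Ω) (hz : ContinuousOn z (Icc a b)) {G : Type*}
    [NormedAddCommGroup G] [NormedSpace ℝ G] [FiniteDimensional ℝ G] (T : F →L[ℝ] G)
    (hT : Function.Surjective T) :
    (∀ g : G, ∃ (o p : ℝ → ℝ) (δ : ℝ → F), ContinuousOn o (Icc a b) ∧ ContinuousOn p (Icc a b) ∧
      (∀ t ∈ Icc a b, HasDerivWithinAt δ (w t • fderiv ℝ X (z t) (δ t) +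
        v t • fderiv ℝ Y (z t) (δ t) + (o t • X (z t) + p t • Y (z t))) (Icc a b) t) ∧
      δ a = 0 ∧ T (δ b) = g) ∨
    ∃ (q : G →L[ℝ] ℝ) (l : ℝ → F →L[ℝ] ℝ), q ≠ 0 ∧ l b = q.comp T ∧ ∀ t ∈ Icc a b, l t ≠ 0 ∧
      HasDerivWithinAt l
        (-(l t).comp (w t • fderiv ℝ X (z t) + v t • fderiv ℝ Y (z t))) (Icc a b) t ∧
      l t (X (z t)) = 0 ∧ l t (Y (z t)) = 0 := by
  have : CompleteSpace F := FiniteDimensional.complete ℝ F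
  have hab := hab'.le
  have hXz : ContinuousOn (fun t => X (z t)) (Icc a b) := hX.continuousOn.comp hz hzΩ
  have hYz : ContinuousOn (fun t => Y (z t)) (Icc a b) := hY.continuousOn.comp hz hzΩ
  have hdX : ContinuousOn (fun t => fderiv ℝ X (z t)) (Icc a b) :=
    (hX.continuousOn_fderiv_of_isOpen hΩ (by simp)).comp hz hzΩ
  have hdY : ContinuousOn (fun t => fderiv ℝ Y (z t)) (Icc a b) :=
    (hY.continuousOn_fderiv_of_isOpen hΩ (by simp)).comp hz hzΩ
  set A : ℝ → F →L[ℝ] F := fun t => w t • fderiv ℝ X (z t) + v t • fderiv ℝ Y (z t) with hA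
  have hAc : ContinuousOn A (Icc a b) := (hw.smul hdX).add (hv.smul hdY)
  -- the fundamental solution `R` and its inverse `S`
  obtain ⟨R, hRa, hR⟩ := exists_linear_solution hab
    (L := fun t => ContinuousLinearMap.compL ℝ F F F (A t))
    (((ContinuousLinearMap.compL ℝ F F F).continuous.comp_continuousOn hAc))
    (ContinuousLinearMap.id ℝ F)
  obtain ⟨S, hSa, hS⟩ := exists_linear_solution hab
    (L := fun t => -(ContinuousLinearMap.compL ℝ F F F).flip (A t))
    (((ContinuousLinearMap.compL ℝ F F F).flip.continuous.comp_continuousOn hAc).neg)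
    (ContinuousLinearMap.id ℝ F)
  simp only [ContinuousLinearMap.compL_apply] at hR
  simp only [neg_apply, ContinuousLinearMap.flip_apply,
    ContinuousLinearMap.compL_apply] at hS
  have hSR : ∀ t ∈ Icc a b, (S t).comp (R t) = ContinuousLinearMap.id ℝ F := by
    have hd : ∀ t ∈ Icc a b, HasDerivWithinAt (fun t => (S t).comp (R t)) 0 (Icc a b) t :=
      fun t ht => by
        refine ((hS t ht).clm_comp (hR t ht)).congr_deriv ?_
        ext x; simp
    intro t ht
    have := constant_of_has_deriv_right_zero (fun t ht => (hd t ht).continuousWithinAt)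
      (fun t ht => (hd t (Ico_subset_Icc_self ht)).Ici_of_Icc ht) t ht
    rw [this, hSa, hRa]; rfl
  have hRS : ∀ t ∈ Icc a b, (R t).comp (S t) = ContinuousLinearMap.id ℝ F := by
    intro t ht
    have h1 : ((S t : F →ₗ[ℝ] F)) * (R t : F →ₗ[ℝ] F) = 1 := by
      ext x; exact congrArg (fun f : F →L[ℝ] F => f x) (hSR t ht)
    have h2 := mul_eq_one_comm.1 h1
    ext x; exact congrArg (fun f : F →ₗ[ℝ] F => f x) h2
  have hSc : ContinuousOn S (Icc a b) := fun t ht => (hS t ht).continuousWithinAt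
  have hsol : ∀ o p : ℝ → ℝ, ContinuousOn o (Icc a b) → ContinuousOn p (Icc a b) →
      ∃ δ : ℝ → F, δ a = 0 ∧ ∀ t ∈ Icc a b, HasDerivWithinAt δ (w t • fderiv ℝ X (z t) (δ t) +
        v t • fderiv ℝ Y (z t) (δ t) + (o t • X (z t) + p t • Y (z t))) (Icc a b) t := by
    intro o p ho hp
    have hf : ContinuousOn (fun t => S t (o t • X (z t) + p t • Y (z t))) (Icc a b) :=
      hSc.clm_apply ((ho.smul hXz).add (hp.smul hYz))
    obtain ⟨M, hM⟩ := isCompact_Icc.exists_bound_of_continuousOn hf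
    obtain ⟨g, hga, hg⟩ := exists_solution_of_bounded_lipschitz hab (K := 0)
      (M := Real.toNNReal M)
      (f := fun t _ => S t (o t • X (z t) + p t • Y (z t)))
      (fun t _ => LipschitzWith.const _) (fun x => hf)
      (fun t ht x => (hM t ht).trans (Real.le_coe_toNNReal M)) (0 : F)
    refine ⟨fun t => R t (g t), by simp [hga], fun t ht => ?_⟩
    refine ((hR t ht).clm_apply (hg t ht)).congr_deriv ?_
    have := congrArg (fun f : F →L[ℝ] F => f (o t • X (z t) + p t • Y (z t))) (hRS t ht)
    simp only [ContinuousLinearMap.comp_apply, ContinuousLinearMap.id_apply] at this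
    rw [this]
    simp [hA]
  let W : Submodule ℝ G :=
    { carrier := {g | ∃ (o p : ℝ → ℝ) (δ : ℝ → F), ContinuousOn o (Icc a b) ∧
        ContinuousOn p (Icc a b) ∧
        (∀ t ∈ Icc a b, HasDerivWithinAt δ (w t • fderiv ℝ X (z t) (δ t) +
          v t • fderiv ℝ Y (z t) (δ t) + (o t • X (z t) + p t • Y (z t))) (Icc a b) t) ∧
        δ a = 0 ∧ T (δ b) = g}
      add_mem' := by
        rintro _ _ ⟨o, p, δ, ho, hp, hδ, hδa, rfl⟩ ⟨o', p', δ', ho', hp', hδ', hδa', rfl⟩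
        refine ⟨o + o', p + p', δ + δ', ho.add ho', hp.add hp', fun t ht =>
          ((hδ t ht).add (hδ' t ht)).congr_deriv ?_, by simp [hδa, hδa'], by simp⟩
        simp only [Pi.add_apply, map_add]; module
      zero_mem' := ⟨0, 0, 0, continuousOn_const, continuousOn_const, fun t _ =>
        (hasDerivWithinAt_const _ _ (0 : F)).congr_deriv (by simp), rfl, by simp⟩
      smul_mem' := by
        rintro c _ ⟨o, p, δ, ho, hp, hδ, hδa, rfl⟩
        refine ⟨c • o, c • p, c • δ, ho.const_smul c, hp.const_smul c, fun t ht =>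
          ((hδ t ht).const_smul c).congr_deriv ?_, by simp [hδa], by simp⟩
        simp only [Pi.smul_apply, map_smul, smul_eq_mul]; module }
  by_cases hW : W = ⊤
  · left
    intro g
    have : g ∈ W := hW ▸ Submodule.mem_top
    exact this
  · right
    obtain ⟨q', hq'0, hq'⟩ := W.exists_le_ker_of_lt_top (lt_top_iff_ne_top.2 hW)
    set q : G →L[ℝ] ℝ := q'.toContinuousLinearMap with hq
    have hq0 : q ≠ 0 := by
      intro h; apply hq'0; ext x; exact congrArg (fun f : G →L[ℝ] ℝ => f x) h
    have hb : b ∈ Icc a b := right_mem_Icc.2 hab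
    set l : ℝ → F →L[ℝ] ℝ := fun t => ((q.comp T).comp (R b)).comp (S t) with hl
    have hlb : l b = q.comp T := by
      rw [hl]; simp only [ContinuousLinearMap.comp_assoc, hRS b hb]; rfl
    have hld : ∀ t ∈ Icc a b, HasDerivWithinAt l (-(l t).comp (A t)) (Icc a b) t := by
      intro t ht
      refine ((hasDerivWithinAt_const t _ ((q.comp T).comp (R b))).clm_comp
        (hS t ht)).congr_deriv ?_
      ext x; simp [hl]
    have hlX : ContinuousOn (fun t => l t (X (z t))) (Icc a b) :=
      ContinuousOn.clm_apply (fun t ht => (hld t ht).continuousWithinAt) hXz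
    have hlY : ContinuousOn (fun t => l t (Y (z t))) (Icc a b) :=
      ContinuousOn.clm_apply (fun t ht => (hld t ht).continuousWithinAt) hYz
    -- the variation in the direction of the values of the costate on the fields
    obtain ⟨δ, hδa, hδ⟩ := hsol _ _ hlX hlY
    have hh : ∀ t ∈ Icc a b, HasDerivWithinAt (fun t => l t (δ t))
        (l t (X (z t)) ^ 2 + l t (Y (z t)) ^ 2) (Icc a b) t := by
      intro t ht
      refine ((hld t ht).clm_apply (hδ t ht)).congr_deriv ?_
      simp [hA]; ring
    have hmono : MonotoneOn (fun t => l t (δ t)) (Icc a b) :=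
      monotoneOn_of_hasDerivWithinAt_nonneg (convex_Icc a b)
        (fun t ht => (hh t ht).continuousWithinAt)
        (fun t ht => (hh t (interior_subset ht)).mono interior_subset)
        (fun t _ => by positivity)
    have hδb : l b (δ b) = 0 := by
      rw [hlb]
      exact hq' ⟨_, _, δ, hlX, hlY, hδ, hδa, rfl⟩
    have hzero : ∀ t ∈ Icc a b, l t (δ t) = 0 := by
      intro t ht
      have h1 := hmono (left_mem_Icc.2 hab) ht ht.1
      have h2 := hmono ht hb ht.2
      simp only [hδa, map_zero, hδb] at h1 h2
      exact le_antisymm h2 h1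
    refine ⟨q, l, hq0, hlb, fun t ht => ⟨fun h0 => ?_, hld t ht, ?_⟩⟩
    · apply hq0
      have h1 : (l t).comp (R t) = (q.comp T).comp (R b) := by
        rw [hl]; simp only [ContinuousLinearMap.comp_assoc, hSR t ht]; rfl
      have h2 : (q.comp T) = 0 := by
        have : ((q.comp T).comp (R b)).comp (S b) = 0 := by rw [← h1, h0]; simp
        rwa [ContinuousLinearMap.comp_assoc, hRS b hb] at this
      ext g
      obtain ⟨x, rfl⟩ := hT g
      exact congrArg (fun f : F →L[ℝ] ℝ => f x) h2
    · have h1 := (uniqueDiffOn_Icc hab' t ht).eq_deriv _ (hh t ht)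
        ((hasDerivWithinAt_const t _ (0 : ℝ)).congr hzero (hzero t ht))
      constructor <;> nlinarith [sq_nonneg (l t (X (z t))), sq_nonneg (l t (Y (z t)))]

end ODE

/-! ### Singular controls and costates -/

section SmoothCurves

variable {F : Type*} [NormedAddCommGroup F] [NormedSpace ℝ F]

/-- A Nemytskii operator is differentiable along a family of curves with a uniform first-order
expansion. -/
theorem exists_differentiableAt_toLp [FiniteDimensional ℝ F] {a b : ℝ} {Ω : Set F} (hΩ : IsOpen Ω)
    {f : F → ℝ} (hf : ContDiffOn ℝ ∞ f Ω) {z δ : ℝ → F} {Z : ℝ → ℝ → F} {C s₀ : ℝ} (hs₀ : 0 < s₀)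
    (hzΩ : ∀ t ∈ Icc a b, z t ∈ Ω) (hz : ContinuousOn z (Icc a b)) (hδ : ContinuousOn δ (Icc a b))
    (hZ : ∀ s, |s| ≤ s₀ → ContinuousOn (Z s) (Icc a b) ∧
      ∀ t ∈ Icc a b, ‖Z s t - z t - s • δ t‖ ≤ C * s ^ 2) :
    ∃ Φ : ℝ → Lp ℝ ⊤ (volume.restrict (Icc a b)), DifferentiableAt ℝ Φ 0 ∧
      ∀ᶠ s in 𝓝 (0 : ℝ), Φ s =ᵐ[volume.restrict (Icc a b)] fun t => f (Z s t) := by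
  classical
  rcases (Icc a b).eq_empty_or_nonempty with hemp | ⟨t₀, ht₀⟩
  · refine ⟨fun _ => 0, differentiableAt_const _, Eventually.of_forall fun s => ?_⟩
    rw [hemp, Measure.restrict_empty]; simp [Filter.EventuallyEq]
  have hC : 0 ≤ C := by
    have := (norm_nonneg _).trans ((hZ s₀ (abs_of_pos hs₀).le).2 t₀ ht₀)
    have h2 : 0 < s₀ ^ 2 := by positivity
    exact nonneg_of_mul_nonneg_left this h2
  have hk : IsCompact (z '' Icc a b) := isCompact_Icc.image_of_continuousOn hz
  obtain ⟨O, χ, hO, hkO, hOΩ, H⟩ := exists_contDiff_compactSupport_eqOn ℝ hΩ hk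
    (image_subset_iff.2 hzΩ)
  obtain ⟨hg, hgs, hgO⟩ := H f hf
  set g : F → ℝ := fun x => χ x • f x with hgdef
  have hg1 : ContDiff ℝ 1 (fderiv ℝ g) := hg.fderiv_right (by norm_cast)
  obtain ⟨K, hK⟩ := hg1.lipschitzWith_of_hasCompactSupport (hgs.fderiv (𝕜 := ℝ)) one_ne_zero
  obtain ⟨L, hL⟩ := hg.lipschitzWith_of_hasCompactSupport hgs (by simp)
  obtain ⟨M, hM⟩ := hg.continuous.bounded_above_of_compact_support hgs
  have taylor := norm_sub_sub_fderiv_le (hg.differentiable (by simp)) hK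
  obtain ⟨Nδ', hNδ'⟩ := isCompact_Icc.exists_bound_of_continuousOn hδ
  set Nδ := max Nδ' 0
  have hNδ : ∀ t ∈ Icc a b, ‖δ t‖ ≤ Nδ := fun t ht => (hNδ' t ht).trans (le_max_left _ _)
  have hNδ0 : 0 ≤ Nδ := le_max_right _ _
  have near : ∀ s, |s| ≤ min s₀ 1 → ∀ t ∈ Icc a b, ‖Z s t - z t‖ ≤ (C + Nδ) * |s| := by
    intro s hs t ht
    have h1 := (hZ s (hs.trans (min_le_left _ _))).2 t ht
    have h2 : s ^ 2 ≤ |s| := by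
      rw [← sq_abs]; nlinarith [abs_nonneg s, hs.trans (min_le_right _ _)]
    calc ‖Z s t - z t‖ = ‖(Z s t - z t - s • δ t) + s • δ t‖ := by simp
      _ ≤ C * s ^ 2 + |s| * ‖δ t‖ := by
          refine (norm_add_le _ _).trans (add_le_add h1 ?_)
          rw [norm_smul, Real.norm_eq_abs]
      _ ≤ C * |s| + |s| * Nδ := by gcongr; exact hNδ t ht
      _ = _ := by ring
  have meas : ∀ h : ℝ → ℝ, ContinuousOn h (Icc a b) →
      AEStronglyMeasurable h (volume.restrict (Icc a b)) :=
    fun h hh => hh.aestronglyMeasurable measurableSet_Icc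
  have memg : ∀ s, |s| ≤ s₀ → MemLp (fun t => g (Z s t)) ⊤ (volume.restrict (Icc a b)) :=
    fun s hs => memLp_top_of_bound (meas _ (hg.continuous.comp_continuousOn (hZ s hs).1)) M
      (Eventually.of_forall fun t => hM _)
  have hdc : ContinuousOn (fun t => fderiv ℝ g (z t) (δ t)) (Icc a b) :=
    (hg1.continuous.comp_continuousOn hz).clm_apply hδ
  have memd : MemLp (fun t => fderiv ℝ g (z t) (δ t)) ⊤ (volume.restrict (Icc a b)) := by
    obtain ⟨B, hB⟩ := isCompact_Icc.exists_bound_of_continuousOn hdc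
    exact memLp_top_of_bound (meas _ hdc) B
      ((ae_restrict_mem measurableSet_Icc).mono fun t ht => hB t ht)
  set Φ : ℝ → Lp ℝ ⊤ (volume.restrict (Icc a b)) := fun s =>
    if hs : |s| ≤ s₀ then (memg s hs).toLp else 0 with hΦ
  have hΦs : ∀ s, |s| ≤ s₀ → Φ s =ᵐ[volume.restrict (Icc a b)] fun t => g (Z s t) := by
    intro s hs
    rw [hΦ]; simp only [hs, dite_true]
    exact (memg s hs).coeFn_toLp
  have ev : ∀ r : ℝ, 0 < r → ∀ᶠ s in 𝓝 (0 : ℝ), |s| ≤ r := fun r hr => by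
    filter_upwards [Metric.ball_mem_nhds (0 : ℝ) hr] with s hs
    rw [Metric.mem_ball, dist_zero_right, Real.norm_eq_abs] at hs; exact hs.le
  have h00 : |(0 : ℝ)| ≤ s₀ := by simpa using hs₀.le
  have hZ0 : ∀ t ∈ Icc a b, Z 0 t = z t := fun t ht => by
    have := (hZ 0 h00).2 t ht
    simpa [sub_eq_zero] using this
  refine ⟨Φ, ?_, ?_⟩
  · set B : ℝ := K * (C + Nδ) ^ 2 + L * C with hB
    have hB0 : 0 ≤ B := by positivity
    have hbound : ∀ s, |s| ≤ min s₀ 1 → ‖Φ s - Φ 0 - s • memd.toLp‖ ≤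
        (measureUnivNNReal (volume.restrict (Icc a b)) : ℝ) ^ (⊤ : ENNReal).toReal⁻¹ *
          (B * s ^ 2) := by
      intro s hs
      refine Lp.norm_le_of_ae_bound (by positivity) ?_
      filter_upwards [Lp.coeFn_sub (Φ s - Φ 0) (s • memd.toLp), Lp.coeFn_sub (Φ s) (Φ 0),
        Lp.coeFn_smul s memd.toLp, hΦs s (hs.trans (min_le_left _ _)), hΦs 0 h00,
        memd.coeFn_toLp, ae_restrict_mem measurableSet_Icc] with t h1 h2 h3 h4 h5 h6 ht
      rw [h1, Pi.sub_apply, h2, Pi.sub_apply, h3, Pi.smul_apply, h4, h5, h6, hZ0 t ht]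
      have e1 := taylor (z t) (Z s t)
      have e2 := (hZ s (hs.trans (min_le_left _ _))).2 t ht
      have e3 := near s hs t ht
      have e4 : ‖fderiv ℝ g (z t) (Z s t - z t - s • δ t)‖ ≤ L * (C * s ^ 2) :=
        ((fderiv ℝ g (z t)).le_opNorm _).trans
          (mul_le_mul (norm_fderiv_le_of_lipschitz ℝ hL) e2 (norm_nonneg _) L.2)
      calc ‖g (Z s t) - g (z t) - s • fderiv ℝ g (z t) (δ t)‖ =
            ‖(g (Z s t) - g (z t) - fderiv ℝ g (z t) (Z s t - z t)) +
              fderiv ℝ g (z t) (Z s t - z t - s • δ t)‖ := by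
            congr 1; simp only [map_sub, map_smul]; abel
        _ ≤ K * ((C + Nδ) * |s|) ^ 2 + L * (C * s ^ 2) := by
            refine (norm_add_le _ _).trans (add_le_add (e1.trans ?_) e4)
            gcongr
        _ = B * s ^ 2 := by rw [mul_pow, sq_abs, hB]; ring
    have hO : (fun s => Φ s - Φ 0 - s • memd.toLp) =O[𝓝 (0 : ℝ)] fun s => ‖s - 0‖ ^ 2 := by
      refine Asymptotics.IsBigO.of_bound
        ((measureUnivNNReal (volume.restrict (Icc a b)) : ℝ) ^ (⊤ : ENNReal).toReal⁻¹ * B) ?_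
      filter_upwards [ev (min s₀ 1) (by positivity)] with s hs
      refine (hbound s hs).trans_eq ?_
      simp only [sub_zero, norm_pow, Real.norm_eq_abs, sq_abs]; ring
    have hd := hO.hasFDerivAt (𝕜 := ℝ) one_lt_two
    have : Φ = fun s => (Φ s - Φ 0 - s • memd.toLp) + (Φ 0 + s • memd.toLp) := by
      funext s; abel
    rw [this]
    exact hd.differentiableAt.add (by fun_prop)
  · obtain ⟨ε, hε, hεO⟩ := hk.exists_thickening_subset_open hO hkO
    filter_upwards [ev (min s₀ 1) (by positivity), ev (ε / (2 * (C + Nδ + 1))) (by positivity)]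
      with s hs hs'
    filter_upwards [hΦs s (hs.trans (min_le_left _ _)), ae_restrict_mem measurableSet_Icc]
      with t h1 ht
    rw [h1]
    refine hgO _ (hεO ?_)
    rw [Metric.mem_thickening_iff]
    refine ⟨z t, mem_image_of_mem z ht, ?_⟩
    rw [dist_eq_norm]
    calc _ ≤ (C + Nδ) * |s| := near s hs t ht
      _ ≤ (C + Nδ) * (ε / (2 * (C + Nδ + 1))) := by gcongr
      _ ≤ ε / 2 := by
          rw [mul_div_assoc', div_le_div_iff₀ (by positivity) (by positivity)]
          nlinarith
      _ < ε := by linarith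

theorem map_smul_add_smul {G : Type*} [NormedAddCommGroup G] [NormedSpace ℝ G] (A : F →L[ℝ] G)
    (r s : ℝ) (x y : F) : A (r • x + s • y) = r • A x + s • A y := by
  rw [map_add, map_smul, map_smul]

theorem ContinuousOn.aestronglyMeasurable_Icc {α : Type*} [TopologicalSpace α] {c : ℝ → α} {a b : ℝ}
    (hab : a ≤ b) (hc : ContinuousOn c (Icc a b)) :
    AEStronglyMeasurable c (volume.restrict (Icc a b)) := by
  have h1 : Continuous (IccExtend hab ((Icc a b).domRestrict c)) :=
    (continuousOn_iff_continuous_domRestrict.1 hc).Icc_extend'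
  have h2 : StronglyMeasurable (IccExtend hab ((Icc a b).domRestrict c)) :=
    h1.comp_stronglyMeasurable stronglyMeasurable_id
  refine h2.aestronglyMeasurable.congr ?_
  filter_upwards [ae_restrict_mem measurableSet_Icc] with t ht
  rw [IccExtend_of_mem hab _ ht]; rfl

end SmoothCurves

section ManifoldCurves

variable {E : Type*} [NormedAddCommGroup E] [NormedSpace ℝ E] {H : Type*} [TopologicalSpace H]
  {I : ModelWithCorners ℝ E H} {M : Type*} [TopologicalSpace M] [ChartedSpace H M]
  {W : Type*} [NormedAddCommGroup W] [NormedSpace ℝ W]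

theorem hasVelocityWithinAt_comp {f : W → M} {z : ℝ → W} {s : Set ℝ} {t : ℝ} {v : W}
    (hf : MDifferentiableAt 𝓘(ℝ, W) I f (z t)) (hz : HasDerivWithinAt z v s t) :
    HasVelocityWithinAt I (fun t => f (z t)) s t
      (⟨f (z t), mfderiv 𝓘(ℝ, W) I f (z t) v⟩ : TangentBundle I M) := by
  refine ⟨rfl, ?_⟩
  have h1 : HasMFDerivWithinAt 𝓘(ℝ, ℝ) 𝓘(ℝ, W) z s t ((1 : ℝ →L[ℝ] ℝ).smulRight v) :=
    hz.hasFDerivWithinAt.hasMFDerivWithinAt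
  refine (hf.hasMFDerivAt.comp_hasMFDerivWithinAt t h1).congr_mfderiv ?_
  ext
  change mfderiv 𝓘(ℝ, W) I f (z t) ((1 : ℝ) • v) = (1 : ℝ) • mfderiv 𝓘(ℝ, W) I f (z t) v
  rw [one_smul, one_smul]

theorem contDiffAt_extChartAt_comp {n : WithTop ℕ∞} {f : W → M} {z : W}
    (hf : ContMDiffAt 𝓘(ℝ, W) I n f z) : ContDiffAt ℝ n (fun x => extChartAt I (f z) (f x)) z :=
  (contMDiffAt_iff_target.1 hf).2.contDiffAt

theorem isLipschitzCurve_comp {f : W → M} {z : ℝ → W} {a b : ℝ} {K : NNReal}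
    (hf : ∀ t ∈ Icc a b, ContMDiffAt 𝓘(ℝ, W) I 1 f (z t)) (hz : LipschitzOnWith K z (Icc a b)) :
    IsLipschitzCurve I a b (fun t => f (z t)) := by
  refine ⟨fun t ht => (hf t ht).continuousAt.comp_continuousWithinAt (hz.continuousOn t ht),
    fun t ht => ?_⟩
  obtain ⟨L, s, hs, hL⟩ := (contDiffAt_extChartAt_comp (hf t ht)).exists_lipschitzOnWith
  refine ⟨L * K, Icc a b ∩ z ⁻¹' s, inter_mem self_mem_nhdsWithin
    (hz.continuousOn t ht hs), ?_⟩
  exact hL.comp (hz.mono inter_subset_left) (fun x hx => hx.2)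

variable {P : W → M} {Ω : Set W}

theorem contMDiff_totalSpace_mk_prod : ContMDiff 𝓘(ℝ, W × W) 𝓘(ℝ, W).tangent ∞
    (fun p : W × W => (⟨p.1, p.2⟩ : TangentBundle 𝓘(ℝ, W) W)) := by
  intro p
  apply Bundle.contMDiffAt_totalSpace.2
  refine ⟨contDiff_fst.contMDiff.contMDiffAt, ?_⟩
  have h : ContMDiffAt 𝓘(ℝ, W × W) 𝓘(ℝ, W) ∞ (fun p : W × W => p.2) p :=
    contDiff_snd.contMDiff.contMDiffAt
  convert! h with y
  simp
  rfl

variable [IsManifold I ∞ M]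

theorem contMDiffOn_tangentMap_mk (hΩ : IsOpen Ω) (hP : ContMDiffOn 𝓘(ℝ, W) I ∞ P Ω) :
    ContMDiffOn 𝓘(ℝ, W × W) I.tangent ∞
      (fun p : W × W => tangentMap 𝓘(ℝ, W) I P ⟨p.1, p.2⟩) (Ω ×ˢ univ) := by
  have h1 := hP.contMDiffOn_tangentMapWithin (m := ∞) (by simp) hΩ.uniqueMDiffOn
  have h2 := h1.comp (t := (Bundle.TotalSpace.proj ⁻¹' Ω)) (s := Ω ×ˢ univ)
    (contMDiff_totalSpace_mk_prod (W := W)).contMDiffOn (fun p hp => hp.1)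
  refine h2.congr fun p hp => ?_
  rw [Function.comp_apply, tangentMapWithin_eq_tangentMap]
  · exact hΩ.uniqueMDiffOn p.1 hp.1
  · exact ((hP p.1 hp.1).contMDiffAt (hΩ.mem_nhds hp.1)).mdifferentiableAt (by simp)

end ManifoldCurves

section Costates

variable {E : Type*} [NormedAddCommGroup E] [NormedSpace ℝ E] {H : Type*} [TopologicalSpace H]
  {I : ModelWithCorners ℝ E H} {M : Type*} [TopologicalSpace M] [ChartedSpace H M]
  {E' : Type*} [NormedAddCommGroup E'] [NormedSpace ℝ E'] {H' : Type*} [TopologicalSpace H']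
  {J : ModelWithCorners ℝ E' H'} {N : Type*} [TopologicalSpace N] [ChartedSpace H' N]
  [IsManifold J ∞ N] {W : Type*} [NormedAddCommGroup W] [NormedSpace ℝ W]

/-- A curve in a parameter space `W` of `N` that moves by `v + (kernel of the differential of the
projection to M)` gives an admissible control with value `v`. -/
theorem isControl_of_lift {G : ∀ z : N, Submodule ℝ (TangentSpace J z)} {π : N → M}
    (hπ : ContMDiff J I ∞ π) {Ω : Set W} (hΩ : IsOpen Ω) {P : W → N}
    (hP : ContMDiffOn 𝓘(ℝ, W) J ∞ P Ω) {a b : ℝ} (hab : a ≤ b) {z z' v : ℝ → W}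
    (hzΩ : ∀ t ∈ Icc a b, z t ∈ Ω)
    (hz : ∀ t ∈ Icc a b, HasDerivWithinAt z (z' t) (Icc a b) t)
    (hz' : ContinuousOn z' (Icc a b)) (hv : ContinuousOn v (Icc a b))
    (hG : ∀ t ∈ Icc a b, mfderiv 𝓘(ℝ, W) J P (z t) (v t) ∈ G (P (z t)))
    (hzv : ∀ t ∈ Icc a b, mfderiv 𝓘(ℝ, W) I (fun x => π (P x)) (z t) (z' t) =
      mfderiv 𝓘(ℝ, W) I (fun x => π (P x)) (z t) (v t)) :
    IsControl I J G π a b (fun t => tangentMap 𝓘(ℝ, W) J P ⟨z t, v t⟩) (fun t => π (P (z t))) := by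
  have hPat : ∀ x ∈ Ω, ContMDiffAt 𝓘(ℝ, W) J ∞ P x := fun x hx =>
    (hP x hx).contMDiffAt (hΩ.mem_nhds hx)
  have hzc : ContinuousOn z (Icc a b) := fun t ht => (hz t ht).continuousWithinAt
  have hc : ContinuousOn (fun t => tangentMap 𝓘(ℝ, W) J P ⟨z t, v t⟩) (Icc a b) :=
    (contMDiffOn_tangentMap_mk hΩ hP).continuousOn.comp (hzc.prodMk hv)
      (fun t ht => ⟨hzΩ t ht, mem_univ _⟩)
  obtain ⟨K, hK⟩ := isCompact_Icc.exists_bound_of_continuousOn hz'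
  have hlip : LipschitzOnWith (Real.toNNReal K) z (Icc a b) :=
    (convex_Icc a b).lipschitzOnWith_of_nnnorm_hasDerivWithin_le hz
      (fun t ht => by
        rw [← NNReal.coe_le_coe, coe_nnnorm]
        exact (hK t ht).trans (Real.le_coe_toNNReal K))
  refine ⟨hc.aestronglyMeasurable_Icc hab, ⟨_, isCompact_Icc.image_of_continuousOn hc, ?_⟩, ?_,
    isLipschitzCurve_comp (f := fun x => π (P x)) (fun t ht => ?_) hlip, ?_⟩
  · filter_upwards [ae_restrict_mem measurableSet_Icc] with t ht using mem_image_of_mem _ ht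
  · filter_upwards [ae_restrict_mem measurableSet_Icc] with t ht using hG t ht
  · exact (hπ.contMDiffAt.comp (z t) (hPat _ (hzΩ t ht))).of_le (by norm_cast)
  · filter_upwards [ae_restrict_mem measurableSet_Icc] with t ht
    have hPd := (hPat _ (hzΩ t ht)).mdifferentiableAt (by simp)
    have hπd := (hπ (P (z t))).mdifferentiableAt (by simp)
    have h := hasVelocityWithinAt_comp (hπd.comp (z t) hPd) (hz t ht)
    have e : tangentMap J I π (tangentMap 𝓘(ℝ, W) J P ⟨z t, v t⟩) =
        ⟨π (P (z t)), mfderiv 𝓘(ℝ, W) I (fun x => π (P x)) (z t) (z' t)⟩ := by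
      rw [hzv t ht]
      have := mfderiv_comp (z t) hπd hPd
      simp only [tangentMap]
      congr 1
      exact (congrArg (fun f => f (v t)) this).symm
    rw [e]
    exact h

variable [FiniteDimensional ℝ W] [FiniteDimensional ℝ E]

/-- A singular control of a system that is written, along the parametrisation `P`, as
`w • Y + w' • Y'`, and whose trajectory lifts to `z' = w • X + w' • X'`, where `X` and `Y`
(respectively `X'` and `Y'`) have the same image in `TM`, has a costate. -/
theorem exists_costate_of_isSingularControl {G : ∀ z : N, Submodule ℝ (TangentSpace J z)}
    {π : N → M} (hπ : ContMDiff J I ∞ π) {Ω : Set W} (hΩ : IsOpen Ω) {P : W → N}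
    (hP : ContMDiffOn 𝓘(ℝ, W) J ∞ P Ω) {X X' Y Y' : W → W} (hX : ContDiffOn ℝ ∞ X Ω)
    (hX' : ContDiffOn ℝ ∞ X' Ω) (hY : ContDiffOn ℝ ∞ Y Ω) (hY' : ContDiffOn ℝ ∞ Y' Ω)
    (hYG : ∀ x ∈ Ω, mfderiv 𝓘(ℝ, W) J P x (Y x) ∈ G (P x))
    (hYG' : ∀ x ∈ Ω, mfderiv 𝓘(ℝ, W) J P x (Y' x) ∈ G (P x))
    (hXY : ∀ x ∈ Ω, mfderiv 𝓘(ℝ, W) I (fun x => π (P x)) x (X x) =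
      mfderiv 𝓘(ℝ, W) I (fun x => π (P x)) x (Y x))
    (hXY' : ∀ x ∈ Ω, mfderiv 𝓘(ℝ, W) I (fun x => π (P x)) x (X' x) =
      mfderiv 𝓘(ℝ, W) I (fun x => π (P x)) x (Y' x))
    {a b : ℝ} (hab : a < b) {w w' : ℝ → ℝ} (hw : ContinuousOn w (Icc a b))
    (hw' : ContinuousOn w' (Icc a b)) {z : ℝ → W} (hzΩ : ∀ t ∈ Icc a b, z t ∈ Ω)
    (hz : ∀ t ∈ Icc a b, HasDerivWithinAt z (w t • X (z t) + w' t • X' (z t)) (Icc a b) t)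
    {c : ℝ → TangentBundle J N} {γ : ℝ → M} (hc : endpointImage I J G π a b c γ ≠ univ)
    (hcz : c =ᵐ[volume.restrict (Icc a b)]
      fun t => tangentMap 𝓘(ℝ, W) J P ⟨z t, w t • Y (z t) + w' t • Y' (z t)⟩)
    (hγ : ∀ t ∈ Icc a b, γ t = π (P (z t)))
    (hT : Function.Surjective (mfderiv 𝓘(ℝ, W) I (fun x => π (P x)) (z b))) :
    ∃ l : ℝ → W →L[ℝ] ℝ, ∀ t ∈ Icc a b, l t ≠ 0 ∧
      HasDerivWithinAt l
        (-(l t).comp (w t • fderiv ℝ X (z t) + w' t • fderiv ℝ X' (z t))) (Icc a b) t ∧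
      l t (X (z t)) = 0 ∧ l t (X' (z t)) = 0 := by
  have hzc : ContinuousOn z (Icc a b) := fun t ht => (hz t ht).continuousWithinAt
  have hb : b ∈ Icc a b := right_mem_Icc.2 hab.le
  have ha : a ∈ Icc a b := left_mem_Icc.2 hab.le
  set T : W →L[ℝ] E := mfderiv 𝓘(ℝ, W) I (fun x => π (P x)) (z b) with hTdef
  rcases exists_linearised_solution_or_costate hab hΩ hX hX' hw hw' hzΩ hzc T hT with h | h
  swap
  · obtain ⟨-, l, -, -, hl⟩ := h
    exact ⟨l, hl⟩
  exfalso
  apply hc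
  rw [eq_univ_iff_forall]
  intro v
  obtain ⟨o, p, δ, ho, hp, hδ, hδa, hδb⟩ := h v
  obtain ⟨Z, C, s₀, hC, hs₀, hZ⟩ := exists_variation hab.le hΩ hX hX' hw hw' ho hp hzΩ hz hδ hδa
  have ev : ∀ᶠ s in 𝓝 (0 : ℝ), |s| ≤ s₀ := by
    filter_upwards [Metric.ball_mem_nhds (0 : ℝ) hs₀] with s hs
    rw [Metric.mem_ball, dist_zero_right, Real.norm_eq_abs] at hs; exact hs.le
  have h00 : |(0 : ℝ)| ≤ s₀ := by simpa using hs₀.le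
  have hZ0 : ∀ t ∈ Icc a b, Z 0 t = z t := fun t ht => by
    have := ((hZ 0 h00).2 t ht).2.2
    simpa [sub_eq_zero] using this
  have hZc : ∀ s, |s| ≤ s₀ → ContinuousOn (Z s) (Icc a b) := fun s hs t ht =>
    ((hZ s hs).2 t ht).2.1.continuousWithinAt
  set V : ℝ → ℝ → W := fun s t => (w t + s * o t) • Y (Z s t) + (w' t + s * p t) • Y' (Z s t)
    with hV
  have hmaps : ∀ s, |s| ≤ s₀ → MapsTo (Z s) (Icc a b) Ω := fun s hs t ht => ((hZ s hs).2 t ht).1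
  have hVc : ∀ s, |s| ≤ s₀ → ContinuousOn (V s) (Icc a b) := fun s hs =>
    ((hw.add (continuousOn_const.mul ho)).smul (hY.continuousOn.comp (hZc s hs) (hmaps s hs))).add
      ((hw'.add (continuousOn_const.mul hp)).smul
        (hY'.continuousOn.comp (hZc s hs) (hmaps s hs)))
  refine ⟨fun s t => tangentMap 𝓘(ℝ, W) J P ⟨Z s t, V s t⟩, fun s t => π (P (Z s t)),
    ⟨?_, fun t ht => ?_, ?_, ?_, fun f hf => ?_⟩, ?_⟩
  · refine EventuallyEq.trans ?_ hcz.symm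
    filter_upwards [ae_restrict_mem measurableSet_Icc] with t ht
    simp only [hV, zero_mul, add_zero]
    rw [hZ0 t ht]
  · simp only [hZ0 t ht, hγ t ht]
  · filter_upwards [ev] with s hs
    refine isControl_of_lift hπ hΩ hP hab.le
      (z' := fun t => (w t + s * o t) • X (Z s t) + (w' t + s * p t) • X' (Z s t)) (hmaps s hs)
      (fun t ht => ((hZ s hs).2 t ht).2.1) ?_ (hVc s hs) (fun t ht => ?_) (fun t ht => ?_)
    · exact ((hw.add (continuousOn_const.mul ho)).smul
        (hX.continuousOn.comp (hZc s hs) (hmaps s hs))).add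
        ((hw'.add (continuousOn_const.mul hp)).smul
        (hX'.continuousOn.comp (hZc s hs) (hmaps s hs)))
    · refine (congrArg (· ∈ G (P (Z s t)))
        (map_smul_add_smul (F := W) (G := E') (mfderiv 𝓘(ℝ, W) J P (Z s t)) _ _ _ _)).mpr ?_
      exact add_mem (Submodule.smul_mem _ _ (hYG _ (hmaps s hs ht)))
        (Submodule.smul_mem _ _ (hYG' _ (hmaps s hs ht)))
    · refine (map_smul_add_smul (F := W) (G := E) (mfderiv 𝓘(ℝ, W) I (fun x => π (P x)) (Z s t))
        _ _ _ _).trans (Eq.trans ?_ (map_smul_add_smul (F := W) (G := E)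
          (mfderiv 𝓘(ℝ, W) I (fun x => π (P x)) (Z s t)) _ _ _ _).symm)
      exact congrArg₂ (fun x y : E => (w t + s * o t) • x + (w' t + s * p t) • y)
        (hXY _ (hmaps s hs ht)) (hXY' _ (hmaps s hs ht))
  · filter_upwards [ev] with s hs
    rw [(hZ s hs).1, hγ a ha]
  · -- the control is a smooth function of the state and of the control parameters
    let Q : W × ℝ × ℝ → W × W := fun q => (q.1, q.2.1 • Y q.1 + q.2.2 • Y' q.1)
    have hQ : ContDiffOn ℝ ∞ Q (Ω ×ˢ univ) := by
      have hf1 : MapsTo (fun q : W × ℝ × ℝ => q.1) (Ω ×ˢ univ) Ω := fun q hq => hq.1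
      have h1 : ContDiffOn ℝ ∞ (fun q : W × ℝ × ℝ => Y q.1) (Ω ×ˢ univ) :=
        hY.comp contDiffOn_fst hf1
      have h2 : ContDiffOn ℝ ∞ (fun q : W × ℝ × ℝ => Y' q.1) (Ω ×ˢ univ) :=
        hY'.comp contDiffOn_fst hf1
      have h3 : ContDiff ℝ ∞ (fun q : W × ℝ × ℝ => q.2.1) := by fun_prop
      have h4 : ContDiff ℝ ∞ (fun q : W × ℝ × ℝ => q.2.2) := by fun_prop
      exact contDiffOn_fst.prodMk ((h3.contDiffOn.smul h1).add (h4.contDiffOn.smul h2))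
    have hfQ : ContDiffOn ℝ ∞ (fun q => f (tangentMap 𝓘(ℝ, W) J P ⟨(Q q).1, (Q q).2⟩))
        (Ω ×ˢ univ) := by
      have h1 : ContDiffOn ℝ ∞ (fun p : W × W => f (tangentMap 𝓘(ℝ, W) J P ⟨p.1, p.2⟩))
          (Ω ×ˢ univ) :=
        (hf.comp_contMDiffOn (contMDiffOn_tangentMap_mk hΩ hP)).contDiffOn
      exact h1.comp hQ (fun q hq => ⟨hq.1, mem_univ _⟩)
    obtain ⟨Φ, hΦ1, hΦ2⟩ := exists_differentiableAt_toLp (hΩ.prod isOpen_univ) hfQ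
      (z := fun t => (z t, w t, w' t)) (δ := fun t => (δ t, o t, p t))
      (Z := fun s t => (Z s t, w t + s * o t, w' t + s * p t)) (C := C) hs₀
      (fun t ht => ⟨hzΩ t ht, mem_univ _⟩) (hzc.prodMk (hw.prodMk hw'))
      (ContinuousOn.prodMk (fun t ht => (hδ t ht).continuousWithinAt) (ho.prodMk hp))
      (fun s hs => ⟨(hZc s hs).prodMk ((hw.add (continuousOn_const.mul ho)).prodMk
        (hw'.add (continuousOn_const.mul hp))), fun t ht => by
          have := ((hZ s hs).2 t ht).2.2
          have h0 : 0 ≤ C * s ^ 2 := by positivity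
          simpa [Prod.norm_def, h0] using this⟩)
    exact ⟨Φ, hΦ1, hΦ2⟩
  · have hder : HasDerivAt (fun s => Z s b) (δ b) 0 := by
      have hO : (fun s => Z s b - z b - s • δ b) =O[𝓝 (0 : ℝ)] fun s => ‖s - 0‖ ^ 2 := by
        refine Asymptotics.IsBigO.of_bound C ?_
        filter_upwards [ev] with s hs
        refine (((hZ s hs).2 b hb).2.2).trans_eq ?_
        simp only [sub_zero, norm_pow, Real.norm_eq_abs, sq_abs]
      have hd := (hO.hasFDerivAt (𝕜 := ℝ) one_lt_two).hasDerivAt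
      have h2 : HasDerivAt (fun s : ℝ => z b + s • δ b) (δ b) 0 := by
        simpa using ((hasDerivAt_id (0 : ℝ)).smul_const (δ b)).const_add (z b)
      convert! hd.add h2 using 1
      · funext s; simp
      · simp
    have hPd : MDifferentiableAt 𝓘(ℝ, W) I (fun x => π (P x)) (Z 0 b) := by
      rw [hZ0 b hb]
      exact ((hπ _).mdifferentiableAt (by simp)).comp (z b)
        (((hP _ (hzΩ b hb)).contMDiffAt (hΩ.mem_nhds (hzΩ b hb))).mdifferentiableAt (by simp))
    have := hasVelocityWithinAt_comp (z := fun s => Z s b) (s := univ) (t := 0) hPd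
      hder.hasDerivWithinAt
    have e : (⟨π (P (Z 0 b)), mfderiv 𝓘(ℝ, W) I (fun x => π (P x)) (Z 0 b) (δ b)⟩ :
        TangentBundle I M) = ⟨γ b, v⟩ := by
      have e1 : Z 0 b = z b := hZ0 b hb
      rw [e1, hγ b hb]
      congr 1
    rw [← e]
    exact this

end Costates

/-! ### Frames of `(2, 3, 5)` distributions and their characteristic direction field -/

section DualFrame

variable {F : Type*} [NormedAddCommGroup F] [NormedSpace ℝ F]

theorem exists_dual_frame [FiniteDimensional ℝ F] {n : ℕ} (hn : Module.finrank ℝ F = n)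
    {Ω : Set F} {X : Fin n → F → F}
    (hX : ∀ i, ContDiffOn ℝ ∞ (X i) Ω) (hli : ∀ x ∈ Ω, LinearIndependent ℝ fun i => X i x) :
    ∃ α : Fin n → F → F →L[ℝ] ℝ, (∀ i, ContDiffOn ℝ ∞ (α i) Ω) ∧ ∀ x ∈ Ω,
      (∀ i j, α i x (X j x) = if i = j then 1 else 0) ∧ ∀ v, v = ∑ i, α i x v • X i x := by
  have : CompleteSpace F := FiniteDimensional.complete ℝ F
  let S : F → (Fin n → ℝ) →L[ℝ] F := fun x =>
    ∑ i, (ContinuousLinearMap.proj (R := ℝ) (φ := fun _ : Fin n => ℝ) i).smulRight (X i x)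
  have hSapp : ∀ x v, S x v = ∑ i, v i • X i x := fun x v => by
    simp [S]
  have hS : ContDiffOn ℝ ∞ S Ω := by
    apply ContDiffOn.sum
    intro i _
    exact (ContinuousLinearMap.smulRightL ℝ (Fin n → ℝ) F
      (ContinuousLinearMap.proj (R := ℝ) (φ := fun _ : Fin n => ℝ) i)).contDiff.comp_contDiffOn
      (hX i)
  have hinv : ∀ x ∈ Ω, ∃ e : (Fin n → ℝ) ≃L[ℝ] F, (e : (Fin n → ℝ) →L[ℝ] F) = S x := by
    intro x hx
    have hc : Fintype.card (Fin n) = Module.finrank ℝ F := by simp [hn]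
    rcases Nat.eq_zero_or_pos n with rfl | hpos
    · have h0 : Subsingleton F := Module.finrank_zero_iff.1 hn
      refine ⟨ContinuousLinearEquiv.ofFinrankEq (by simp [hn]), ?_⟩
      ext v
      exact Subsingleton.elim _ _
    have : Nonempty (Fin n) := ⟨⟨0, hpos⟩⟩
    let bs := basisOfLinearIndependentOfCardEqFinrank (hli x hx) hc
    refine ⟨bs.equivFun.symm.toContinuousLinearEquiv, ?_⟩
    ext v
    change bs.equivFun.symm _ = S x _
    rw [Module.Basis.equivFun_symm_apply, hSapp]
    simp [bs]
  refine ⟨fun i x => (ContinuousLinearMap.proj (R := ℝ) (φ := fun _ : Fin n => ℝ) i).comp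
    (S x).inverse, fun i => ?_, fun x hx => ?_⟩
  · refine ContDiffOn.clm_comp contDiffOn_const fun x hx => ?_
    obtain ⟨e, he⟩ := hinv x hx
    have h1 : ContDiffAt ℝ ∞ ContinuousLinearMap.inverse (S x) := he ▸ contDiffAt_map_inverse e
    exact h1.comp_contDiffWithinAt x (hS x hx)
  · obtain ⟨e, he⟩ := hinv x hx
    have hi : (S x).inverse = (e.symm : F →L[ℝ] (Fin n → ℝ)) := by
      rw [← he, ContinuousLinearMap.inverse_equiv]
    simp only [hi]
    refine ⟨fun i j => ?_, fun v => ?_⟩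
    · have h1 : X j x = e (Pi.single j 1) := by
        change _ = (e : (Fin n → ℝ) →L[ℝ] F) (Pi.single j 1)
        rw [he, hSapp]
        simp [Pi.single_apply]
      simp [h1, Pi.single_apply]
    · have h1 : v = (e : (Fin n → ℝ) →L[ℝ] F) (e.symm v) := by simp
      conv_lhs => rw [h1, he, hSapp]
      simp

theorem hasDerivWithinAt_costate_apply {X X' V : F → F} {w w' : ℝ → ℝ} {z : ℝ → F}
    {l : ℝ → F →L[ℝ] ℝ} {s : Set ℝ} {t : ℝ}
    (hz : HasDerivWithinAt z (w t • X (z t) + w' t • X' (z t)) s t)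
    (hl : HasDerivWithinAt l
      (-(l t).comp (w t • fderiv ℝ X (z t) + w' t • fderiv ℝ X' (z t))) s t)
    (hV : DifferentiableAt ℝ V (z t)) :
    HasDerivWithinAt (fun t => l t (V (z t)))
      (w t * l t (VectorField.lieBracket ℝ X V (z t)) +
        w' t * l t (VectorField.lieBracket ℝ X' V (z t))) s t := by
  refine (hl.clm_apply (hV.hasFDerivAt.comp_hasDerivWithinAt t hz)).congr_deriv ?_
  simp only [VectorField.lieBracket, neg_apply, ContinuousLinearMap.comp_apply,
    add_apply, smul_apply, map_add, map_sub, map_smul, smul_eq_mul, Function.comp_apply]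
  ring

end DualFrame

open VectorField in
/-- A frame `A`, `B` of a distribution with small growth `(2, 3, 5)` on an open set of a vector
space: with `C = [A, B]`, `[A, C]` and `[B, C]` it is a frame of the tangent bundle. The forms
`α` are the dual frame. -/
structure GrowthFrame (F : Type*) [NormedAddCommGroup F] [NormedSpace ℝ F] where
  /-- the domain of the frame -/
  Ω : Set F
  /-- the first field -/
  A : F → F
  /-- the second field -/
  B : F → F
  /-- the dual frame of `A`, `B`, `[A, B]`, `[A, [A, B]]`, `[B, [A, B]]` -/
  α : Fin 5 → F → F →L[ℝ] ℝ
  isOpen : IsOpen Ω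
  smoothA : ContDiffOn ℝ ∞ A Ω
  smoothB : ContDiffOn ℝ ∞ B Ω
  smoothα : ∀ i, ContDiffOn ℝ ∞ (α i) Ω
  dual : ∀ x ∈ Ω, ∀ i j, α i x (![A x, B x, lieBracket ℝ A B x,
    lieBracket ℝ A (lieBracket ℝ A B) x, lieBracket ℝ B (lieBracket ℝ A B) x] j) =
      if i = j then 1 else 0
  expand : ∀ x ∈ Ω, ∀ v, v = α 0 x v • A x + α 1 x v • B x + α 2 x v • lieBracket ℝ A B x +
    α 3 x v • lieBracket ℝ A (lieBracket ℝ A B) x + α 4 x v • lieBracket ℝ B (lieBracket ℝ A B) x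

theorem ContDiffOn.lieBracket_of_isOpen {F : Type*} [NormedAddCommGroup F] [NormedSpace ℝ F]
    {V W : F → F} {Ω : Set F} (hΩ : IsOpen Ω)
    (hV : ContDiffOn ℝ ∞ V Ω) (hW : ContDiffOn ℝ ∞ W Ω) :
    ContDiffOn ℝ ∞ (VectorField.lieBracket ℝ V W) Ω := fun x hx =>
  (ContDiffAt.lieBracket_vectorField (hV.contDiffAt (hΩ.mem_nhds hx))
    (hW.contDiffAt (hΩ.mem_nhds hx)) (m := ∞) (by simp)).contDiffWithinAt

namespace GrowthFrame

open VectorField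

variable {F : Type*} [NormedAddCommGroup F] [NormedSpace ℝ F]

theorem exists_of_linearIndependent [FiniteDimensional ℝ F] (hF : Module.finrank ℝ F = 5)
    {Ω : Set F} (hΩ : IsOpen Ω) {A B : F → F} (hA : ContDiffOn ℝ ∞ A Ω) (hB : ContDiffOn ℝ ∞ B Ω)
    (hli : ∀ x ∈ Ω, LinearIndependent ℝ ![A x, B x, lieBracket ℝ A B x,
      lieBracket ℝ A (lieBracket ℝ A B) x, lieBracket ℝ B (lieBracket ℝ A B) x]) :
    ∃ 𝓕 : GrowthFrame F, 𝓕.Ω = Ω ∧ 𝓕.A = A ∧ 𝓕.B = B := by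
  have hC := hA.lieBracket_of_isOpen hΩ hB
  obtain ⟨α, h1, h2⟩ := exists_dual_frame hF (Ω := Ω)
    (X := fun i x => ![A x, B x, lieBracket ℝ A B x,
      lieBracket ℝ A (lieBracket ℝ A B) x, lieBracket ℝ B (lieBracket ℝ A B) x] i)
    (fun i => by
      fin_cases i
      exacts [hA, hB, hC, hA.lieBracket_of_isOpen hΩ hC, hB.lieBracket_of_isOpen hΩ hC])
    hli
  refine ⟨⟨Ω, A, B, α, hΩ, hA, hB, h1, fun x hx => (h2 x hx).1, fun x hx v => ?_⟩, rfl, rfl, rfl⟩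
  have := (h2 x hx).2 v
  rw [Fin.sum_univ_five] at this
  exact this

variable (𝓕 : GrowthFrame F)

/-- The bracket of the two frame fields. -/
noncomputable def C : F → F := lieBracket ℝ 𝓕.A 𝓕.B

/-- The bracket of the first frame field with `C`. -/
noncomputable def D : F → F := lieBracket ℝ 𝓕.A 𝓕.C

/-- The bracket of the second frame field with `C`. -/
noncomputable def E : F → F := lieBracket ℝ 𝓕.B 𝓕.C

theorem smoothC : ContDiffOn ℝ ∞ 𝓕.C 𝓕.Ω := 𝓕.smoothA.lieBracket_of_isOpen 𝓕.isOpen 𝓕.smoothB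

theorem smoothD : ContDiffOn ℝ ∞ 𝓕.D 𝓕.Ω := 𝓕.smoothA.lieBracket_of_isOpen 𝓕.isOpen 𝓕.smoothC

theorem smoothE : ContDiffOn ℝ ∞ 𝓕.E 𝓕.Ω := 𝓕.smoothB.lieBracket_of_isOpen 𝓕.isOpen 𝓕.smoothC

/-- The unit vector `cos θ A + sin θ B` of the plane spanned by the frame. -/
noncomputable def ell (p : F × ℝ) : F := Real.cos p.2 • 𝓕.A p.1 + Real.sin p.2 • 𝓕.B p.1

/-- The unit vector orthogonal to `ell`, in the plane spanned by the frame. -/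
noncomputable def ell' (p : F × ℝ) : F := -Real.sin p.2 • 𝓕.A p.1 + Real.cos p.2 • 𝓕.B p.1

/-- The covector that annihilates `A`, `B`, `C` and the bracket of `ell` and `C`. -/
noncomputable def mu (p : F × ℝ) : F →L[ℝ] ℝ := -Real.sin p.2 • 𝓕.α 3 p.1 + Real.cos p.2 • 𝓕.α 4 p.1

/-- The angular velocity of the characteristic direction field. -/
noncomputable def angVel (p : F × ℝ) : ℝ :=
  -(Real.cos p.2 * 𝓕.mu p (Real.cos p.2 • lieBracket ℝ 𝓕.A 𝓕.D p.1 +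
      Real.sin p.2 • lieBracket ℝ 𝓕.B 𝓕.D p.1) +
    Real.sin p.2 * 𝓕.mu p (Real.cos p.2 • lieBracket ℝ 𝓕.A 𝓕.E p.1 +
      Real.sin p.2 • lieBracket ℝ 𝓕.B 𝓕.E p.1))

/-- The characteristic direction field `K` on the space of oriented lines in the planes, with the
angle as a coordinate: the singular curves are the projections of its integral curves. -/
noncomputable def char (p : F × ℝ) : F × ℝ := (𝓕.ell p, 𝓕.angVel p)

/-- The bracket of `∂/∂θ` and `char`. -/
noncomputable def charDeriv (p : F × ℝ) : F × ℝ := fderiv ℝ 𝓕.char p (0, 1)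

variable {𝓕}

theorem dualA {x : F} (hx : x ∈ 𝓕.Ω) (i : Fin 5) : 𝓕.α i x (𝓕.A x) = if i = 0 then 1 else 0 :=
  𝓕.dual x hx i 0

theorem dualB {x : F} (hx : x ∈ 𝓕.Ω) (i : Fin 5) : 𝓕.α i x (𝓕.B x) = if i = 1 then 1 else 0 :=
  𝓕.dual x hx i 1

variable (𝓕) in
theorem prod_isOpen : IsOpen (𝓕.Ω ×ˢ (univ : Set ℝ)) := 𝓕.isOpen.prod isOpen_univ

variable (𝓕) in
theorem smooth_ell : ContDiffOn ℝ ∞ 𝓕.ell (𝓕.Ω ×ˢ univ) := by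
  have hf : MapsTo (fun p : F × ℝ => p.1) (𝓕.Ω ×ˢ univ) 𝓕.Ω := fun p hp => hp.1
  have hA := 𝓕.smoothA.comp contDiffOn_fst hf
  have hB := 𝓕.smoothB.comp contDiffOn_fst hf
  exact ((Real.contDiff_cos.comp contDiff_snd).contDiffOn.smul hA).add
    ((Real.contDiff_sin.comp contDiff_snd).contDiffOn.smul hB)

variable (𝓕) in
theorem smooth_angVel : ContDiffOn ℝ ∞ 𝓕.angVel (𝓕.Ω ×ˢ univ) := by
  have hf : MapsTo (fun p : F × ℝ => p.1) (𝓕.Ω ×ˢ univ) 𝓕.Ω := fun p hp => hp.1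
  have hc : ContDiffOn ℝ ∞ (fun p : F × ℝ => Real.cos p.2) (𝓕.Ω ×ˢ univ) :=
    (Real.contDiff_cos.comp contDiff_snd).contDiffOn
  have hs : ContDiffOn ℝ ∞ (fun p : F × ℝ => Real.sin p.2) (𝓕.Ω ×ˢ univ) :=
    (Real.contDiff_sin.comp contDiff_snd).contDiffOn
  have hmu : ContDiffOn ℝ ∞ 𝓕.mu (𝓕.Ω ×ˢ univ) :=
    (hs.neg.smul ((𝓕.smoothα 3).comp contDiffOn_fst hf)).add
      (hc.smul ((𝓕.smoothα 4).comp contDiffOn_fst hf))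
  have h1 := (𝓕.smoothA.lieBracket_of_isOpen 𝓕.isOpen 𝓕.smoothD).comp contDiffOn_fst hf
  have h2 := (𝓕.smoothB.lieBracket_of_isOpen 𝓕.isOpen 𝓕.smoothD).comp contDiffOn_fst hf
  have h3 := (𝓕.smoothA.lieBracket_of_isOpen 𝓕.isOpen 𝓕.smoothE).comp contDiffOn_fst hf
  have h4 := (𝓕.smoothB.lieBracket_of_isOpen 𝓕.isOpen 𝓕.smoothE).comp contDiffOn_fst hf
  exact ((hc.mul (hmu.clm_apply ((hc.smul h1).add (hs.smul h2)))).add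
    (hs.mul (hmu.clm_apply ((hc.smul h3).add (hs.smul h4))))).neg

variable (𝓕) in
theorem smooth_char : ContDiffOn ℝ ∞ 𝓕.char (𝓕.Ω ×ˢ univ) :=
  𝓕.smooth_ell.prodMk 𝓕.smooth_angVel

variable (𝓕) in
theorem smooth_charDeriv : ContDiffOn ℝ ∞ 𝓕.charDeriv (𝓕.Ω ×ˢ univ) :=
  (𝓕.smooth_char.fderiv_of_isOpen 𝓕.prod_isOpen (by simp)).clm_apply contDiffOn_const

theorem differentiableAt_char {p : F × ℝ} (hp : p.1 ∈ 𝓕.Ω) : DifferentiableAt ℝ 𝓕.char p :=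
  (𝓕.smooth_char.contDiffAt (𝓕.prod_isOpen.mem_nhds ⟨hp, mem_univ _⟩)).differentiableAt (by simp)

theorem charDeriv_fst {p : F × ℝ} (hp : p.1 ∈ 𝓕.Ω) : (𝓕.charDeriv p).1 = 𝓕.ell' p := by
  have h1 : HasDerivAt (fun s : ℝ => (p.1, s)) ((0, 1) : F × ℝ) p.2 :=
    (hasDerivAt_const _ _).prodMk (hasDerivAt_id _)
  have h2 : HasDerivAt (fun s : ℝ => (𝓕.char (p.1, s)).1) (𝓕.charDeriv p).1 p.2 :=
    (ContinuousLinearMap.fst ℝ F ℝ).hasFDerivAt.comp_hasDerivAt p.2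
      ((show HasFDerivAt 𝓕.char (fderiv ℝ 𝓕.char p) (p.1, p.2) from
        (differentiableAt_char hp).hasFDerivAt).comp_hasDerivAt p.2 h1)
  have h3 : HasDerivAt (fun s : ℝ => (𝓕.char (p.1, s)).1) (𝓕.ell' p) p.2 :=
    ((Real.hasDerivAt_cos p.2).smul_const (𝓕.A p.1)).add
      ((Real.hasDerivAt_sin p.2).smul_const (𝓕.B p.1))
  exact h2.unique h3

theorem fderiv_ell_inl {p : F × ℝ} (hp : p.1 ∈ 𝓕.Ω) (u : F) :
    (fderiv ℝ 𝓕.char p (u, 0)).1 =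
      Real.cos p.2 • fderiv ℝ 𝓕.A p.1 u + Real.sin p.2 • fderiv ℝ 𝓕.B p.1 u := by
  have hA := (𝓕.smoothA.contDiffAt (𝓕.isOpen.mem_nhds hp)).differentiableAt (by simp)
  have hB := (𝓕.smoothB.contDiffAt (𝓕.isOpen.mem_nhds hp)).differentiableAt (by simp)
  have h1 : HasFDerivAt (fun x : F => (x, p.2)) (ContinuousLinearMap.inl ℝ F ℝ) p.1 :=
    hasFDerivAt_prodMk_left _ _
  have h2 : HasFDerivAt (fun x : F => (𝓕.char (x, p.2)).1) ((ContinuousLinearMap.fst ℝ F ℝ).comp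
      ((fderiv ℝ 𝓕.char p).comp (ContinuousLinearMap.inl ℝ F ℝ))) p.1 :=
    (ContinuousLinearMap.fst ℝ F ℝ).hasFDerivAt.comp p.1
      (HasFDerivAt.comp (f := fun x : F => (x, p.2)) p.1 (show HasFDerivAt 𝓕.char
        (fderiv ℝ 𝓕.char p) (p.1, p.2) from (differentiableAt_char hp).hasFDerivAt) h1)
  have h3 : HasFDerivAt (fun x : F => (𝓕.char (x, p.2)).1)
      (Real.cos p.2 • fderiv ℝ 𝓕.A p.1 + Real.sin p.2 • fderiv ℝ 𝓕.B p.1) p.1 :=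
    (hA.hasFDerivAt.const_smul (Real.cos p.2)).add (hB.hasFDerivAt.const_smul (Real.sin p.2))
  exact congrArg (fun L : F →L[ℝ] F => L u) (h2.unique h3)

theorem ell_add_two_pi (x : F) (θ : ℝ) (n : ℤ) :
    𝓕.char (x, θ + n * (2 * Real.pi)) = 𝓕.char (x, θ) := by
  simp [char, ell, angVel, mu, Real.cos_add_int_mul_two_pi, Real.sin_add_int_mul_two_pi]

/-- Along a curve `x' = q (cos θ A + sin θ B)` with a costate that annihilates `A` and `B`, the
direction moves along the characteristic direction field wherever `q ≠ 0`: differentiating the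
relations `l A = l B = 0` gives `l C = 0`, then `l [ell, C] = 0`, and finally `θ' = q angVel`. -/
theorem angle_deriv_eq {a b : ℝ} (hab : a < b) {x : ℝ → F}
    {θ θ' q : ℝ → ℝ} {l : ℝ → F →L[ℝ] ℝ} (hxΩ : ∀ t ∈ Icc a b, x t ∈ 𝓕.Ω)
    (hq : ContinuousOn q (Icc a b))
    (hx : ∀ t ∈ Icc a b, HasDerivWithinAt x (q t • 𝓕.ell (x t, θ t)) (Icc a b) t)
    (hθ : ∀ t ∈ Icc a b, HasDerivWithinAt θ (θ' t) (Icc a b) t)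
    (hl : ∀ t ∈ Icc a b, HasDerivWithinAt l (-(l t).comp ((q t * Real.cos (θ t)) •
      fderiv ℝ 𝓕.A (x t) + (q t * Real.sin (θ t)) • fderiv ℝ 𝓕.B (x t))) (Icc a b) t)
    (hlA : ∀ t ∈ Icc a b, l t (𝓕.A (x t)) = 0) (hlB : ∀ t ∈ Icc a b, l t (𝓕.B (x t)) = 0)
    (hl0 : ∀ t ∈ Icc a b, l t ≠ 0) :
    ∀ t ∈ Icc a b, q t ≠ 0 → θ' t = q t * 𝓕.angVel (x t, θ t) := by
  have ud : ∀ t ∈ Icc a b, UniqueDiffWithinAt ℝ (Icc a b) t := uniqueDiffOn_Icc hab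
  have hx' : ∀ t ∈ Icc a b, HasDerivWithinAt x ((q t * Real.cos (θ t)) • 𝓕.A (x t) +
      (q t * Real.sin (θ t)) • 𝓕.B (x t)) (Icc a b) t := fun t ht => by
    refine (hx t ht).congr_deriv ?_
    simp only [ell]; module
  have D1 : ∀ V : F → F, ContDiffOn ℝ ∞ V 𝓕.Ω → ∀ t ∈ Icc a b, HasDerivWithinAt
      (fun t => l t (V (x t))) ((q t * Real.cos (θ t)) * l t (lieBracket ℝ 𝓕.A V (x t)) +
        (q t * Real.sin (θ t)) * l t (lieBracket ℝ 𝓕.B V (x t))) (Icc a b) t :=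
    fun V hV t ht => hasDerivWithinAt_costate_apply (X := 𝓕.A) (X' := 𝓕.B) (V := V)
      (w := fun t => q t * Real.cos (θ t)) (w' := fun t => q t * Real.sin (θ t)) (z := x) (l := l)
      (hx' t ht) (hl t ht)
      ((hV.contDiffAt (𝓕.isOpen.mem_nhds (hxΩ t ht))).differentiableAt (by simp))
  have unq : ∀ {f : ℝ → ℝ} {f' t : ℝ}, t ∈ Icc a b → HasDerivWithinAt f f' (Icc a b) t →
      (∀ᶠ s in 𝓝[Icc a b] t, f s = 0) → f' = 0 := fun ht hf h0 =>
    (ud _ ht).eq_deriv _ hf ((hasDerivWithinAt_const _ _ (0 : ℝ)).congr_of_eventuallyEq h0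
      (h0.self_of_nhdsWithin ht))
  have onIcc : ∀ {f : ℝ → ℝ} {t : ℝ}, (∀ s ∈ Icc a b, f s = 0) → ∀ᶠ s in 𝓝[Icc a b] t, f s = 0 :=
    fun h => eventually_of_mem self_mem_nhdsWithin h
  have hC : ∀ t ∈ Icc a b, q t ≠ 0 → l t (𝓕.C (x t)) = 0 := by
    intro t ht hqt
    have e1 := unq ht (D1 𝓕.A 𝓕.smoothA t ht) (onIcc hlA)
    have e2 := unq ht (D1 𝓕.B 𝓕.smoothB t ht) (onIcc hlB)
    rw [lieBracket_swap (V := 𝓕.B) (W := 𝓕.A)] at e1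
    simp only [lieBracket_self, Pi.zero_apply, map_zero, map_neg, mul_zero, zero_add,
      add_zero] at e1 e2
    change _ * -(l t (𝓕.C (x t))) = 0 at e1
    change _ * (l t (𝓕.C (x t))) = 0 at e2
    have h1 := Real.sin_sq_add_cos_sq (θ t)
    have h2 : q t * l t (𝓕.C (x t)) = 0 := by
      linear_combination (-Real.sin (θ t)) * e1 + Real.cos (θ t) * e2 -
        (q t * l t (𝓕.C (x t))) * h1
    exact (mul_eq_zero.1 h2).resolve_left hqt
  have hqn : ∀ t ∈ Icc a b, q t ≠ 0 → ∀ᶠ s in 𝓝[Icc a b] t, s ∈ Icc a b ∧ q s ≠ 0 :=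
    fun t ht hqt => (eventually_mem_nhdsWithin).and ((hq t ht).eventually_ne hqt)
  have hDE : ∀ t ∈ Icc a b, q t ≠ 0 →
      Real.cos (θ t) * l t (𝓕.D (x t)) + Real.sin (θ t) * l t (𝓕.E (x t)) = 0 := by
    intro t ht hqt
    have e1 := unq ht (D1 𝓕.C 𝓕.smoothC t ht)
      ((hqn t ht hqt).mono fun s hs => hC s hs.1 hs.2)
    change _ * l t (𝓕.D (x t)) + _ * l t (𝓕.E (x t)) = 0 at e1
    have h2 : q t * (Real.cos (θ t) * l t (𝓕.D (x t)) +
      Real.sin (θ t) * l t (𝓕.E (x t))) = 0 := by linear_combination e1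
    exact (mul_eq_zero.1 h2).resolve_left hqt
  intro t ht hqt
  have hcos : HasDerivWithinAt (fun t => Real.cos (θ t)) (-Real.sin (θ t) * θ' t) (Icc a b) t :=
    (Real.hasDerivAt_cos (θ t)).comp_hasDerivWithinAt t (hθ t ht)
  have hsin : HasDerivWithinAt (fun t => Real.sin (θ t)) (Real.cos (θ t) * θ' t) (Icc a b) t :=
    (Real.hasDerivAt_sin (θ t)).comp_hasDerivWithinAt t (hθ t ht)
  have e := unq ht ((hcos.mul (D1 𝓕.D 𝓕.smoothD t ht)).add (hsin.mul (D1 𝓕.E 𝓕.smoothE t ht)))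
    ((hqn t ht hqt).mono fun s hs => hDE s hs.1 hs.2)
  have hf := hDE t ht hqt
  have h1 := Real.sin_sq_add_cos_sq (θ t)
  set ρ := -Real.sin (θ t) * l t (𝓕.D (x t)) + Real.cos (θ t) * l t (𝓕.E (x t)) with hρ
  have hlD : l t (𝓕.D (x t)) = -Real.sin (θ t) * ρ := by
    rw [hρ]; linear_combination Real.cos (θ t) * hf - l t (𝓕.D (x t)) * h1
  have hlE : l t (𝓕.E (x t)) = Real.cos (θ t) * ρ := by
    rw [hρ]; linear_combination Real.sin (θ t) * hf - l t (𝓕.E (x t)) * h1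
  -- the costate is a multiple of `mu`
  have hlmu : ∀ v, l t v = ρ * 𝓕.mu (x t, θ t) v := by
    intro v
    have hv := congrArg (l t) (𝓕.expand (x t) (hxΩ t ht) v)
    have hC0 := hC t ht hqt
    simp only [map_add, map_smul, smul_eq_mul] at hv
    change _ = _ + _ * l t (𝓕.C (x t)) + _ * l t (𝓕.D (x t)) + _ * l t (𝓕.E (x t)) at hv
    rw [hlA t ht, hlB t ht, hC0, hlD, hlE] at hv
    rw [hv]
    simp [mu]; ring
  have hρ0 : ρ ≠ 0 := by
    intro h
    apply hl0 t ht
    ext v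
    rw [hlmu v, h]; simp
  rw [hlD, hlE] at e
  simp only [hlmu] at e
  have hang : 𝓕.angVel (x t, θ t) = -(Real.cos (θ t) * (Real.cos (θ t) * 𝓕.mu (x t, θ t)
      (lieBracket ℝ 𝓕.A 𝓕.D (x t)) + Real.sin (θ t) * 𝓕.mu (x t, θ t)
      (lieBracket ℝ 𝓕.B 𝓕.D (x t))) + Real.sin (θ t) * (Real.cos (θ t) * 𝓕.mu (x t, θ t)
      (lieBracket ℝ 𝓕.A 𝓕.E (x t)) + Real.sin (θ t) * 𝓕.mu (x t, θ t)
      (lieBracket ℝ 𝓕.B 𝓕.E (x t)))) := by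
    simp only [angVel, map_add, map_smul, smul_eq_mul]
  apply mul_left_cancel₀ hρ0
  rw [hang]
  linear_combination e - (ρ * θ' t) * h1

end GrowthFrame

namespace GrowthFrame

open VectorField

variable {F : Type*} [NormedAddCommGroup F] [NormedSpace ℝ F] {𝓕 : GrowthFrame F}

theorem A_eq (p : F × ℝ) : 𝓕.A p.1 = Real.cos p.2 • 𝓕.ell p - Real.sin p.2 • 𝓕.ell' p := by
  have h := Real.sin_sq_add_cos_sq p.2
  have : Real.cos p.2 • 𝓕.ell p - Real.sin p.2 • 𝓕.ell' p =
    (Real.sin p.2 ^ 2 + Real.cos p.2 ^ 2) • 𝓕.A p.1 := by simp only [ell, ell']; module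
  rw [this, h, one_smul]

theorem B_eq (p : F × ℝ) : 𝓕.B p.1 = Real.sin p.2 • 𝓕.ell p + Real.cos p.2 • 𝓕.ell' p := by
  have h := Real.sin_sq_add_cos_sq p.2
  have : Real.sin p.2 • 𝓕.ell p + Real.cos p.2 • 𝓕.ell' p =
    (Real.sin p.2 ^ 2 + Real.cos p.2 ^ 2) • 𝓕.B p.1 := by simp only [ell, ell']; module
  rw [this, h, one_smul]

theorem lieBracket_const_char (p : F × ℝ) :
    lieBracket ℝ (fun _ => ((0, 1) : F × ℝ)) 𝓕.char p = 𝓕.charDeriv p := by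
  simp [lieBracket, charDeriv]

theorem lieBracket_char_const (p : F × ℝ) :
    lieBracket ℝ 𝓕.char (fun _ => ((0, 1) : F × ℝ)) p = -𝓕.charDeriv p := by
  simp [lieBracket, charDeriv]

/-- A curve on the space of lines that is transverse to `char` in the plane spanned by `∂/∂θ` and
`char`, and that moves along `char` at all, has no costate annihilating this plane. -/
theorem eq_zero_of_costate {a b : ℝ} (hab : a < b) {z : ℝ → F × ℝ}
    {r q : ℝ → ℝ} {l : ℝ → F × ℝ →L[ℝ] ℝ} (hzΩ : ∀ t ∈ Icc a b, (z t).1 ∈ 𝓕.Ω)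
    (hq : ContinuousOn q (Icc a b)) (hr0 : ∀ t ∈ Icc a b, r t ≠ 0)
    (hz : ∀ t ∈ Icc a b, HasDerivWithinAt z
      (r t • (0, 1) + q t • 𝓕.char (z t)) (Icc a b) t)
    (hl : ∀ t ∈ Icc a b, HasDerivWithinAt l (-(l t).comp
      (r t • fderiv ℝ (fun _ => ((0, 1) : F × ℝ)) (z t) + q t • fderiv ℝ 𝓕.char (z t)))
      (Icc a b) t)
    (hlθ : ∀ t ∈ Icc a b, l t (0, 1) = 0) (hlk : ∀ t ∈ Icc a b, l t (𝓕.char (z t)) = 0)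
    (hl0 : ∀ t ∈ Icc a b, l t ≠ 0) : ∀ t ∈ Icc a b, q t = 0 := by
  have hsplit : ∀ t ∈ Icc a b, ∀ v : F × ℝ, l t v = l t (v.1, 0) := by
    intro t ht v
    have : v = (v.1, 0) + v.2 • ((0, 1) : F × ℝ) := by ext <;> simp
    conv_lhs => rw [this, map_add, map_smul, hlθ t ht, smul_zero, add_zero]
  have hm : ∀ t ∈ Icc a b, l t (𝓕.charDeriv (z t)) = 0 := by
    intro t ht
    have h1 := hasDerivWithinAt_costate_apply (X := fun _ => ((0, 1) : F × ℝ)) (X' := 𝓕.char)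
      (V := 𝓕.char) (w := r) (w' := q) (hz t ht) (hl t ht) (differentiableAt_char (hzΩ t ht))
    have h2 := (uniqueDiffOn_Icc hab t ht).eq_deriv _ h1
      ((hasDerivWithinAt_const t _ (0 : ℝ)).congr hlk (hlk t ht))
    rw [lieBracket_const_char, lieBracket_self] at h2
    simp only [Pi.zero_apply, map_zero, mul_zero, add_zero] at h2
    exact (mul_eq_zero.1 h2).resolve_left (hr0 t ht)
  have hell : ∀ t ∈ Icc a b, l t (𝓕.ell (z t), 0) = 0 := fun t ht =>
    (hsplit t ht (𝓕.char (z t))).symm.trans (hlk t ht)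
  have hell' : ∀ t ∈ Icc a b, l t (𝓕.ell' (z t), 0) = 0 := fun t ht => by
    have h := hsplit t ht (𝓕.charDeriv (z t))
    rw [charDeriv_fst (hzΩ t ht), hm t ht] at h
    exact h.symm
  have hsub : ∀ u v : F, ∀ c d : ℝ, ((c • u + d • v, 0) : F × ℝ) = c • (u, 0) + d • (v, 0) := by
    intro u v c d; ext <;> simp
  have key := angle_deriv_eq (𝓕 := 𝓕) hab (x := fun t => (z t).1) (θ := fun t => (z t).2)
    (θ' := fun t => r t + q t * 𝓕.angVel (z t)) (q := q)
    (l := fun t => (l t).comp (ContinuousLinearMap.inl ℝ F ℝ)) hzΩ hq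
    (fun t ht => by
      have := (ContinuousLinearMap.fst ℝ F ℝ).hasFDerivAt.comp_hasDerivWithinAt t (hz t ht)
      refine this.congr_deriv ?_
      simp [char])
    (fun t ht => by
      have := (ContinuousLinearMap.snd ℝ F ℝ).hasFDerivAt.comp_hasDerivWithinAt t (hz t ht)
      refine this.congr_deriv ?_
      simp [char])
    (fun t ht => by
      have h1 := (hl t ht).clm_comp
        (hasDerivWithinAt_const t _ (ContinuousLinearMap.inl ℝ F ℝ))
      refine h1.congr_deriv ?_
      ext u
      have h2 := fderiv_ell_inl (hzΩ t ht) u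
      have h3 := hsplit t ht (fderiv ℝ 𝓕.char (z t) (u, 0))
      rw [h2, hsub, map_add, map_smul, map_smul] at h3
      simp only [fderiv_fun_const, Pi.zero_apply, smul_zero, zero_add, add_zero, neg_apply,
        add_apply, smul_apply, ContinuousLinearMap.comp_apply, map_smul, map_add,
        ContinuousLinearMap.inl_apply, ContinuousLinearMap.comp_zero, h3, smul_eq_mul]
      ring)
    (fun t ht => by
      change l t (𝓕.A (z t).1, 0) = 0
      rw [A_eq (𝓕 := 𝓕) (z t), sub_eq_add_neg, ← neg_smul, hsub, map_add, map_smul, map_smul,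
        hell t ht, hell' t ht]; simp)
    (fun t ht => by
      change l t (𝓕.B (z t).1, 0) = 0
      rw [B_eq (𝓕 := 𝓕) (z t), hsub, map_add, map_smul, map_smul,
        hell t ht, hell' t ht]; simp)
    (fun t ht h0 => by
      apply hl0 t ht
      ext v
      · exact congrArg (fun L : F →L[ℝ] ℝ => L v) h0
      · simpa using hlθ t ht)
  intro t ht
  by_contra hqt
  have := key t ht hqt
  exact hr0 t ht (by simpa using this)

end GrowthFrame

/-! ### Characteristic curves near a point are short -/

theorem sub_le_sub_of_hasDerivWithinAt_le {f g f' g' : ℝ → ℝ} {a b : ℝ} (hab : a ≤ b)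
    (hf : ∀ t ∈ Icc a b, HasDerivWithinAt f (f' t) (Icc a b) t)
    (hg : ∀ t ∈ Icc a b, HasDerivWithinAt g (g' t) (Icc a b) t)
    (h : ∀ t ∈ Icc a b, g' t ≤ f' t) : g b - g a ≤ f b - f a := by
  have hm : MonotoneOn (fun t => f t - g t) (Icc a b) :=
    monotoneOn_of_hasDerivWithinAt_nonneg (convex_Icc a b)
      (fun t ht => ((hf t ht).sub (hg t ht)).continuousWithinAt)
      (fun t ht => ((hf t (interior_subset ht)).sub (hg t (interior_subset ht))).mono
        interior_subset)
      (fun t ht => sub_nonneg.2 (h t (interior_subset ht)))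
  have := hm (left_mem_Icc.2 hab) (right_mem_Icc.2 hab) hab
  simp only at this
  linarith

theorem norm_sub_le_mul_of_hasDerivWithinAt {F : Type*} [NormedAddCommGroup F] [NormedSpace ℝ F]
    {f f' : ℝ → F} {Q q : ℝ → ℝ} {a b K : ℝ} (hab : a ≤ b)
    (hf : ∀ t ∈ Icc a b, HasDerivWithinAt f (f' t) (Icc a b) t)
    (hQ : ∀ t ∈ Icc a b, HasDerivWithinAt Q (q t) (Icc a b) t)
    (h : ∀ t ∈ Icc a b, ‖f' t‖ ≤ K * q t) : ‖f b - f a‖ ≤ K * (Q b - Q a) := by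
  have := image_norm_le_of_norm_deriv_right_le_deriv_boundary' (f := fun t => f t - f a)
    (f' := f') (a := a) (b := b) (B := fun t => K * (Q t - Q a)) (B' := fun t => K * q t)
    (fun t ht => ((hf t ht).sub_const (f a)).continuousWithinAt)
    (fun t ht => (((hf t (Ico_subset_Icc_self ht)).sub_const (f a)).Ici_of_Icc ht)) (by simp)
    (fun t ht => (((hQ t ht).sub_const (Q a)).const_mul K).continuousWithinAt)
    (fun t ht => ((((hQ t (Ico_subset_Icc_self ht)).sub_const (Q a)).const_mul K).Ici_of_Icc ht))
    (fun t ht => h t (Ico_subset_Icc_self ht)) (right_mem_Icc.2 hab)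
  exact this

namespace GrowthFrame

open VectorField

variable {F : Type*} [NormedAddCommGroup F] [NormedSpace ℝ F] (𝓕 : GrowthFrame F)

/-- `z` is on `[a, b]` an integral curve of the characteristic direction field, over the set `V`,
with the positive speed `q`; the function `Q` is the arc length from `a`. -/
structure IsCharCurve (V : Set F) (a b : ℝ) (z : ℝ → F × ℝ) (q Q : ℝ → ℝ) : Prop where
  le : a ≤ b
  mem : ∀ t ∈ Icc a b, (z t).1 ∈ V
  pos : ∀ t ∈ Icc a b, 0 < q t
  deriv : ∀ t ∈ Icc a b, HasDerivWithinAt z (q t • 𝓕.char (z t)) (Icc a b) t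
  length_zero : Q a = 0
  length_deriv : ∀ t ∈ Icc a b, HasDerivWithinAt Q (q t) (Icc a b) t

variable {𝓕}

namespace IsCharCurve

variable {V : Set F} {a b : ℝ} {z : ℝ → F × ℝ} {q Q : ℝ → ℝ}

theorem mono_right (h : 𝓕.IsCharCurve V a b z q Q) {t : ℝ} (ht : t ∈ Icc a b) :
    𝓕.IsCharCurve V a t z q Q :=
  have hs : Icc a t ⊆ Icc a b := Icc_subset_Icc_right ht.2
  ⟨ht.1, fun s hs' => h.mem s (hs hs'), fun s hs' => h.pos s (hs hs'),
    fun s hs' => (h.deriv s (hs hs')).mono hs, h.length_zero,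
    fun s hs' => (h.length_deriv s (hs hs')).mono hs⟩

theorem length_strictMono (h : 𝓕.IsCharCurve V a b z q Q) : StrictMonoOn Q (Icc a b) :=
  strictMonoOn_of_hasDerivWithinAt_pos (convex_Icc a b)
    (fun t ht => (h.length_deriv t ht).continuousWithinAt)
    (fun t ht => (h.length_deriv t (interior_subset ht)).mono interior_subset)
    (fun t ht => h.pos t (interior_subset ht))

theorem length_mono (h : 𝓕.IsCharCurve V a b z q Q) {t : ℝ} (ht : t ∈ Icc a b) : Q t ≤ Q b :=
  h.length_strictMono.monotoneOn ht (right_mem_Icc.2 h.le) ht.2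

theorem length_nonneg (h : 𝓕.IsCharCurve V a b z q Q) {t : ℝ} (ht : t ∈ Icc a b) : 0 ≤ Q t := by
  rw [← h.length_zero]
  exact h.length_strictMono.monotoneOn (left_mem_Icc.2 h.le) ht ht.1

end IsCharCurve

/-- The constant `M` bounds the characteristic direction field, its bracket with `∂/∂θ`, their
derivatives, and the dual frame over the set `V`. -/
structure IsBound (𝓕 : GrowthFrame F) (V : Set F) (M : ℝ) : Prop where
  one_le : 1 ≤ M
  subset : V ⊆ 𝓕.Ω
  char_le : ∀ p : F × ℝ, p.1 ∈ V → ‖𝓕.char p‖ ≤ M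
  fderiv_char_le : ∀ p : F × ℝ, p.1 ∈ V → ‖fderiv ℝ 𝓕.char p‖ ≤ M
  charDeriv_le : ∀ p : F × ℝ, p.1 ∈ V → ‖𝓕.charDeriv p‖ ≤ M
  fderiv_charDeriv_le : ∀ p : F × ℝ, p.1 ∈ V → ‖fderiv ℝ 𝓕.charDeriv p‖ ≤ M
  dual_le : ∀ x ∈ V, ‖𝓕.α 0 x‖ + ‖𝓕.α 1 x‖ ≤ M

theorem IsBound.mono {V V' : Set F} {M : ℝ} (h : 𝓕.IsBound V M) (hV : V' ⊆ V) :
    𝓕.IsBound V' M :=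
  ⟨h.one_le, hV.trans h.subset, fun p hp => h.char_le p (hV hp),
    fun p hp => h.fderiv_char_le p (hV hp), fun p hp => h.charDeriv_le p (hV hp),
    fun p hp => h.fderiv_charDeriv_le p (hV hp), fun x hx => h.dual_le x (hV hx)⟩

theorem exists_bound_of_periodic [FiniteDimensional ℝ F] {G : Type*} [NormedAddCommGroup G]
    {f : F × ℝ → G}
    (hf : ContinuousOn f (𝓕.Ω ×ˢ univ))
    (hp : ∀ (x : F) (θ : ℝ) (n : ℤ), f (x, θ + n * (2 * Real.pi)) = f (x, θ)) {k : Set F}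
    (hk : IsCompact k) (hkΩ : k ⊆ 𝓕.Ω) : ∃ M, ∀ p : F × ℝ, p.1 ∈ k → ‖f p‖ ≤ M := by
  obtain ⟨M, hM⟩ := (hk.prod (isCompact_Icc (a := (0 : ℝ)) (b := 2 * Real.pi))
    ).exists_bound_of_continuousOn (hf.mono (prod_mono hkΩ (subset_univ _)))
  refine ⟨M, fun p hpk => ?_⟩
  obtain ⟨n, hn, -⟩ := existsUnique_add_zsmul_mem_Ico Real.two_pi_pos p.2 0
  have h1 := hp p.1 p.2 n
  rw [zsmul_eq_mul] at hn
  have h2 := hM (p.1, p.2 + n * (2 * Real.pi)) ⟨hpk, hn.1, by simpa using hn.2.le⟩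
  rwa [h1] at h2

theorem fderiv_periodic {G : Type*} [NormedAddCommGroup G] [NormedSpace ℝ G] {f : F × ℝ → G}
    (hp : ∀ (x : F) (θ : ℝ) (n : ℤ), f (x, θ + n * (2 * Real.pi)) = f (x, θ)) (x : F) (θ : ℝ)
    (n : ℤ) : fderiv ℝ f (x, θ + n * (2 * Real.pi)) = fderiv ℝ f (x, θ) := by
  have h1 : (fun p => f (p + (0, n * (2 * Real.pi)))) = f := by
    funext p; obtain ⟨y, η⟩ := p
    simp [hp]
  have h2 := fderiv_comp_add_right (𝕜 := ℝ) (f := f) (x := (x, θ)) (0, n * (2 * Real.pi))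
  rw [h1] at h2
  rw [h2]; simp

theorem exists_isBound [FiniteDimensional ℝ F] {k : Set F} (hk : IsCompact k) (hkΩ : k ⊆ 𝓕.Ω) :
    ∃ M, 𝓕.IsBound k M := by
  have p1 := 𝓕.ell_add_two_pi
  have p2 := fderiv_periodic p1
  have p3 : ∀ (x : F) (θ : ℝ) (n : ℤ),
      𝓕.charDeriv (x, θ + n * (2 * Real.pi)) = 𝓕.charDeriv (x, θ) := fun x θ n => by
    rw [charDeriv, p2, charDeriv]
  obtain ⟨M1, h1⟩ := exists_bound_of_periodic 𝓕.smooth_char.continuousOn p1 hk hkΩ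
  obtain ⟨M2, h2⟩ := exists_bound_of_periodic
    (𝓕.smooth_char.continuousOn_fderiv_of_isOpen 𝓕.prod_isOpen (by simp)) p2 hk hkΩ
  obtain ⟨M3, h3⟩ := exists_bound_of_periodic 𝓕.smooth_charDeriv.continuousOn p3 hk hkΩ
  obtain ⟨M4, h4⟩ := exists_bound_of_periodic
    (𝓕.smooth_charDeriv.continuousOn_fderiv_of_isOpen 𝓕.prod_isOpen (by simp))
    (fderiv_periodic p3) hk hkΩ
  obtain ⟨M5, h5⟩ := hk.exists_bound_of_continuousOn ((𝓕.smoothα 0).continuousOn.mono hkΩ)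
  obtain ⟨M6, h6⟩ := hk.exists_bound_of_continuousOn ((𝓕.smoothα 1).continuousOn.mono hkΩ)
  refine ⟨max 1 (max M1 (max M2 (max M3 (max M4 (M5 + M6))))), le_max_left _ _, hkΩ,
    fun p hp => (h1 p hp).trans (by simp), fun p hp => (h2 p hp).trans (by simp),
    fun p hp => (h3 p hp).trans (by simp), fun p hp => (h4 p hp).trans (by simp),
    fun x hx => (add_le_add (h5 x hx) (h6 x hx)).trans (by simp)⟩

namespace IsCharCurve

variable {V : Set F} {a b M : ℝ} {z : ℝ → F × ℝ} {q Q : ℝ → ℝ}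

theorem norm_sub_le (h : 𝓕.IsCharCurve V a b z q Q) (hM : 𝓕.IsBound V M) :
    ‖z b - z a‖ ≤ M * Q b := by
  have := norm_sub_le_mul_of_hasDerivWithinAt h.le h.deriv h.length_deriv (K := M) (fun t ht => by
    rw [norm_smul, Real.norm_of_nonneg (h.pos t ht).le, mul_comm]
    exact mul_le_mul_of_nonneg_right (hM.char_le _ (h.mem t ht)) (h.pos t ht).le)
  rwa [h.length_zero, sub_zero] at this

theorem norm_sub_start_le (h : 𝓕.IsCharCurve V a b z q Q) (hM : 𝓕.IsBound V M) {t : ℝ}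
    (ht : t ∈ Icc a b) : ‖z t - z a‖ ≤ M * Q b :=
  ((h.mono_right ht).norm_sub_le hM).trans (mul_le_mul_of_nonneg_left (h.length_mono ht)
    (zero_le_one.trans hM.one_le))

/-- The chord of a characteristic curve, compared with the direction field at any of its points. -/
theorem norm_sub_sub_le (h : 𝓕.IsCharCurve V a b z q Q) (hM : 𝓕.IsBound V M) (hV : Convex ℝ V)
    {τ : ℝ} (hτ : τ ∈ Icc a b) :
    ‖z b - z a - Q b • 𝓕.char (z τ)‖ ≤ 2 * M ^ 2 * Q b ^ 2 := by
  have hM0 : 0 ≤ M := zero_le_one.trans hM.one_le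
  have hlip : ∀ p p' : F × ℝ, p.1 ∈ V → p'.1 ∈ V → ‖𝓕.char p - 𝓕.char p'‖ ≤ M * ‖p - p'‖ :=
    fun p p' hp hp' => (hV.prod convex_univ).norm_image_sub_le_of_norm_fderiv_le (𝕜 := ℝ)
      (fun x hx => differentiableAt_char (hM.subset hx.1)) (fun x hx => hM.fderiv_char_le x hx.1)
      (show p' ∈ V ×ˢ univ from ⟨hp', mem_univ _⟩) ⟨hp, mem_univ _⟩
  have hd : ∀ t ∈ Icc a b, HasDerivWithinAt (fun t => z t - Q t • 𝓕.char (z τ))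
      (q t • (𝓕.char (z t) - 𝓕.char (z τ))) (Icc a b) t := fun t ht => by
    refine ((h.deriv t ht).sub ((h.length_deriv t ht).smul_const _)).congr_deriv ?_
    module
  have hQ0 := h.length_nonneg (right_mem_Icc.2 h.le)
  have := norm_sub_le_mul_of_hasDerivWithinAt h.le hd h.length_deriv (K := 2 * M ^ 2 * Q b)
    (fun t ht => by
      rw [norm_smul, Real.norm_of_nonneg (h.pos t ht).le, mul_comm]
      refine mul_le_mul_of_nonneg_right ?_ (h.pos t ht).le
      have h1 := h.norm_sub_start_le hM ht
      have h2 := h.norm_sub_start_le hM hτ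
      have h3 : ‖z t - z τ‖ ≤ M * Q b + M * Q b := by
        have : z t - z τ = (z t - z a) - (z τ - z a) := by abel
        rw [this]
        exact (_root_.norm_sub_le _ _).trans (add_le_add h1 h2)
      calc _ ≤ M * ‖z t - z τ‖ := hlip _ _ (h.mem t ht) (h.mem τ hτ)
        _ ≤ M * (M * Q b + M * Q b) := by gcongr
        _ = _ := by ring)
  rw [h.length_zero, sub_zero, zero_smul, sub_zero] at this
  calc _ = ‖z b - Q b • 𝓕.char (z τ) - z a‖ := by congr 1; abel
    _ ≤ _ := this
    _ = _ := by ring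

/-- Along a short characteristic curve, a costate that vanishes on `∂/∂θ` at the start, and whose
value on the transverse direction `charDeriv` is one, is negative on `∂/∂θ` at the end. -/
theorem costate_neg (h : 𝓕.IsCharCurve V a b z q Q) (hM : 𝓕.IsBound V M) (hab : a < b)
    (hQ : Q b ≤ 1 / (16 * M ^ 3)) {l : ℝ → F × ℝ →L[ℝ] ℝ}
    (hl : ∀ t ∈ Icc a b, HasDerivWithinAt l (-(l t).comp (q t • fderiv ℝ 𝓕.char (z t)))
      (Icc a b) t)
    (hla : l a = (-Real.sin (z a).2 • 𝓕.α 0 (z a).1 + Real.cos (z a).2 • 𝓕.α 1 (z a).1).comp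
      (ContinuousLinearMap.fst ℝ F ℝ)) : l b (0, 1) < 0 := by
  have hM0 : 0 < M := zero_lt_one.trans_le hM.one_le
  have haI : a ∈ Icc a b := left_mem_Icc.2 h.le
  have hbI : b ∈ Icc a b := right_mem_Icc.2 h.le
  have hQ0 := h.length_nonneg hbI
  have haΩ := hM.subset (h.mem a haI)
  have hla_norm : ‖l a‖ ≤ M := by
    rw [hla]
    refine (ContinuousLinearMap.opNorm_comp_le _ _).trans ?_
    have h1 : ‖-Real.sin (z a).2 • 𝓕.α 0 (z a).1 + Real.cos (z a).2 • 𝓕.α 1 (z a).1‖ ≤ M := by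
      refine (norm_add_le _ _).trans (le_trans ?_ (hM.dual_le _ (h.mem a haI)))
      rw [norm_smul, norm_smul, norm_neg]
      exact add_le_add (mul_le_of_le_one_left (norm_nonneg _) (Real.abs_sin_le_one _))
        (mul_le_of_le_one_left (norm_nonneg _) (Real.abs_cos_le_one _))
    calc _ ≤ M * 1 := mul_le_mul h1 (ContinuousLinearMap.norm_fst_le ..) (norm_nonneg _) hM0.le
      _ = M := mul_one M
  have hlc : ContinuousOn l (Icc a b) := fun t ht => (hl t ht).continuousWithinAt
  have hlb : ∀ t ∈ Icc a b, ‖l t‖ ≤ 2 * M := by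
    obtain ⟨s, hs, hmax⟩ := isCompact_Icc.exists_isMaxOn (nonempty_Icc.2 h.le) hlc.norm
    have hmax' : ∀ t ∈ Icc a b, ‖l t‖ ≤ ‖l s‖ := fun t ht => hmax ht
    have h1 := h.mono_right hs
    have hss : Icc a s ⊆ Icc a b := Icc_subset_Icc_right hs.2
    have h2 := norm_sub_le_mul_of_hasDerivWithinAt h1.le
      (fun t ht => (hl t (hss ht)).mono hss) h1.length_deriv (K := ‖l s‖ * M)
      (fun t ht => by
        rw [norm_neg, ContinuousLinearMap.comp_smul, norm_smul,
          Real.norm_of_nonneg (h1.pos t ht).le, mul_comm]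
        refine mul_le_mul_of_nonneg_right ?_ (h1.pos t ht).le
        exact (ContinuousLinearMap.opNorm_comp_le _ _).trans (mul_le_mul (hmax' t (hss ht))
          (hM.fderiv_char_le _ (h1.mem t ht)) (norm_nonneg _) (norm_nonneg _)))
    rw [h.length_zero, sub_zero] at h2
    have h3 : ‖l s‖ ≤ M + ‖l s‖ * M * Q s := by
      have : l s = l a + (l s - l a) := by abel
      calc ‖l s‖ = ‖l a + (l s - l a)‖ := by rw [← this]
        _ ≤ _ := (norm_add_le _ _).trans (add_le_add hla_norm h2)
    have h4 : M * Q s ≤ 1 / 2 := by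
      have h5 : Q s ≤ 1 / (16 * M ^ 3) := (h.length_mono hs).trans hQ
      have h6 : M * (1 / (16 * M ^ 3)) ≤ 1 / 2 := by
        rw [mul_one_div, div_le_div_iff₀ (by positivity) (by norm_num)]
        have : M ≤ M ^ 3 := le_self_pow₀ hM.one_le (by norm_num)
        nlinarith
      exact (mul_le_mul_of_nonneg_left h5 hM0.le).trans h6
    intro t ht
    have h5 := hmax' t ht
    have h6 : ‖l s‖ * (M * Q s) ≤ ‖l s‖ * (1 / 2) := mul_le_mul_of_nonneg_left h4 (norm_nonneg _)
    nlinarith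
  have hz' : ∀ t ∈ Icc a b, HasDerivWithinAt z (q t • 𝓕.char (z t) + (0 : ℝ) • 0) (Icc a b) t :=
    fun t ht => by simpa using h.deriv t ht
  have hl' : ∀ t ∈ Icc a b, HasDerivWithinAt l (-(l t).comp (q t • fderiv ℝ 𝓕.char (z t) +
      (0 : ℝ) • fderiv ℝ (fun _ => (0 : F × ℝ)) (z t))) (Icc a b) t :=
    fun t ht => by simpa using hl t ht
  have hθ : ∀ t ∈ Icc a b, HasDerivWithinAt (fun t => l t (0, 1))
      (-(q t * l t (𝓕.charDeriv (z t)))) (Icc a b) t := fun t ht => by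
    refine (hasDerivWithinAt_costate_apply (X := 𝓕.char) (X' := fun _ => 0) (w := q)
      (w' := fun _ => 0) (V := fun _ => ((0, 1) : F × ℝ)) (hz' t ht) (hl' t ht)
      (differentiableAt_const _)).congr_deriv ?_
    rw [lieBracket_char_const]; simp
  have hβ : ∀ t ∈ Icc a b, HasDerivWithinAt (fun t => l t (𝓕.charDeriv (z t)))
      (q t * l t (lieBracket ℝ 𝓕.char 𝓕.charDeriv (z t))) (Icc a b) t := fun t ht => by
    have hd : DifferentiableAt ℝ 𝓕.charDeriv (z t) :=
      (𝓕.smooth_charDeriv.contDiffAt (𝓕.prod_isOpen.mem_nhds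
        ⟨hM.subset (h.mem t ht), mem_univ _⟩)).differentiableAt (by simp)
    refine (hasDerivWithinAt_costate_apply (X := 𝓕.char) (X' := fun _ => 0) (w := q)
      (w' := fun _ => 0) (V := 𝓕.charDeriv) (hz' t ht) (hl' t ht) hd).congr_deriv ?_
    simp
  have hβa : l a (𝓕.charDeriv (z a)) = 1 := by
    rw [hla]
    have h1 := Real.sin_sq_add_cos_sq (z a).2
    simp [charDeriv_fst haΩ, ell', dualA haΩ, dualB haΩ]
    linear_combination h1
  have hβt : ∀ t ∈ Icc a b, 3 / 4 ≤ l t (𝓕.charDeriv (z t)) := by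
    intro s hs
    have h1 := h.mono_right hs
    have hss : Icc a s ⊆ Icc a b := Icc_subset_Icc_right hs.2
    have h2 := norm_sub_le_mul_of_hasDerivWithinAt h1.le
      (fun t ht => (hβ t (hss ht)).mono hss) h1.length_deriv (K := 4 * M ^ 3)
      (fun t ht => by
        rw [norm_mul, Real.norm_of_nonneg (h1.pos t ht).le, mul_comm]
        refine mul_le_mul_of_nonneg_right ?_ (h1.pos t ht).le
        have hm := h1.mem t ht
        have e1 : ‖lieBracket ℝ 𝓕.char 𝓕.charDeriv (z t)‖ ≤ M * M + M * M := by
          rw [lieBracket]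
          refine (_root_.norm_sub_le _ _).trans (add_le_add ?_ ?_)
          · exact (ContinuousLinearMap.le_opNorm _ _).trans (mul_le_mul
              (hM.fderiv_charDeriv_le _ hm) (hM.char_le _ hm) (norm_nonneg _) hM0.le)
          · exact (ContinuousLinearMap.le_opNorm _ _).trans (mul_le_mul
              (hM.fderiv_char_le _ hm) (hM.charDeriv_le _ hm) (norm_nonneg _) hM0.le)
        calc _ ≤ ‖l t‖ * ‖lieBracket ℝ 𝓕.char 𝓕.charDeriv (z t)‖ :=
              ContinuousLinearMap.le_opNorm _ _
          _ ≤ (2 * M) * (M * M + M * M) :=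
              mul_le_mul (hlb t (hss ht)) e1 (norm_nonneg _) (by positivity)
          _ = _ := by ring)
    rw [h.length_zero, sub_zero, hβa, Real.norm_eq_abs] at h2
    have h3 : 4 * M ^ 3 * Q s ≤ 4 * M ^ 3 * (1 / (16 * M ^ 3)) :=
      mul_le_mul_of_nonneg_left ((h.length_mono hs).trans hQ) (by positivity)
    have h4 : 4 * M ^ 3 * (1 / (16 * M ^ 3)) = 1 / 4 := by field_simp; norm_num
    have := (abs_le.1 h2).1
    linarith
  have hfin := sub_le_sub_of_hasDerivWithinAt_le h.le (f := fun t => -(l t (0, 1)))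
    (g := fun t => (3 / 4) * Q t) (fun t ht => (hθ t ht).neg)
    (fun t ht => (h.length_deriv t ht).const_mul (3 / 4))
    (fun t ht => by
      have := hβt t ht
      have := (h.pos t ht)
      simp only [neg_neg]
      nlinarith)
  have hla0 : l a (0, 1) = 0 := by rw [hla]; simp
  have hQb : 0 < Q b := by
    rw [← h.length_zero]; exact h.length_strictMono haI hbI hab
  simp only [hla0, h.length_zero] at hfin
  linarith

end IsCharCurve

/-- Characteristic curves over a small ball are short, and their chords are comparable to their
lengths. -/
theorem exists_radius [FiniteDimensional ℝ F] {x₀ : F} (hx₀ : x₀ ∈ 𝓕.Ω) : ∃ ρ M κ : ℝ, 0 < ρ ∧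
    0 < κ ∧ 𝓕.IsBound (Metric.ball x₀ ρ) M ∧ ∀ {V : Set F}, V ⊆ Metric.ball x₀ ρ →
    ∀ {a b : ℝ} {z : ℝ → F × ℝ} {q Q : ℝ → ℝ}, 𝓕.IsCharCurve V a b z q Q →
      Q b ≤ 1 / (16 * M ^ 3) ∧ κ * Q b ≤ ‖(z b).1 - (z a).1‖ := by
  have : ProperSpace F := FiniteDimensional.proper ℝ F
  obtain ⟨ρ₁, hρ₁, hball⟩ := Metric.isOpen_iff.1 𝓕.isOpen x₀ hx₀
  have hcl : Metric.closedBall x₀ (ρ₁ / 2) ⊆ 𝓕.Ω :=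
    (Metric.closedBall_subset_ball (by linarith)).trans hball
  obtain ⟨M, hM⟩ := exists_isBound (isCompact_closedBall x₀ (ρ₁ / 2)) hcl
  have hM0 : 0 < M := zero_lt_one.trans_le hM.one_le
  -- the frame is almost constant near `x₀`
  have near : ∀ (β : F →L[ℝ] ℝ) (X : F → F), ContDiffOn ℝ ∞ X 𝓕.Ω →
      ∀ᶠ x in 𝓝 x₀, |β (X x) - β (X x₀)| < 1 / 16 := by
    intro β X hX
    have hc : ContinuousAt (fun x => β (X x)) x₀ :=
      β.continuous.continuousAt.comp (hX.continuousOn.continuousAt (𝓕.isOpen.mem_nhds hx₀))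
    exact (Metric.continuousAt_iff'.1 hc (1 / 16) (by norm_num)).mono fun x hx => by
      rwa [Real.dist_eq] at hx
  obtain ⟨ρ₂, hρ₂, hnear⟩ := Metric.eventually_nhds_iff_ball.1
    ((near (𝓕.α 0 x₀) 𝓕.A 𝓕.smoothA).and ((near (𝓕.α 0 x₀) 𝓕.B 𝓕.smoothB).and
      ((near (𝓕.α 1 x₀) 𝓕.A 𝓕.smoothA).and (near (𝓕.α 1 x₀) 𝓕.B 𝓕.smoothB))))
  set τ : ℝ := 1 / (16 * M ^ 3) with hτ
  have hτ0 : 0 < τ := by positivity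
  have hτM : M * τ ≤ 1 / 2 := by
    rw [hτ, mul_one_div, div_le_div_iff₀ (by positivity) (by norm_num)]
    have : M ≤ M ^ 3 := le_self_pow₀ hM.one_le (by norm_num)
    nlinarith
  set ρ : ℝ := min (min (ρ₁ / 2) ρ₂) (τ / (8 * M)) with hρ
  have hρ0 : 0 < ρ := by positivity
  have hsub1 : Metric.ball x₀ ρ ⊆ Metric.closedBall x₀ (ρ₁ / 2) :=
    Metric.ball_subset_closedBall.trans (Metric.closedBall_subset_closedBall
      ((min_le_left _ _).trans (min_le_left _ _)))
  have hsub2 : Metric.ball x₀ ρ ⊆ Metric.ball x₀ ρ₂ :=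
    Metric.ball_subset_ball ((min_le_left _ _).trans (min_le_right _ _))
  have hMρ : 𝓕.IsBound (Metric.ball x₀ ρ) M := hM.mono hsub1
  -- chords of short curves
  have chord : ∀ {V : Set F}, V ⊆ Metric.ball x₀ ρ →
      ∀ {a b : ℝ} {z : ℝ → F × ℝ} {q Q : ℝ → ℝ}, 𝓕.IsCharCurve V a b z q Q → Q b ≤ τ →
      Q b / 2 ≤ M * ‖(z b).1 - (z a).1‖ := by
    intro V hV a b z q Q h hQ
    have hMV := hMρ.mono hV
    set φ := (z a).2 with hφ
    set ξ : F →L[ℝ] ℝ := Real.cos φ • 𝓕.α 0 x₀ + Real.sin φ • 𝓕.α 1 x₀ with hξ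
    have hξn : ‖ξ‖ ≤ M := by
      refine (norm_add_le _ _).trans (le_trans ?_ (hM.dual_le x₀
        (Metric.mem_closedBall_self (by linarith))))
      rw [norm_smul, norm_smul]
      exact add_le_add (mul_le_of_le_one_left (norm_nonneg _) (Real.abs_cos_le_one _))
        (mul_le_of_le_one_left (norm_nonneg _) (Real.abs_sin_le_one _))
    have hd : ∀ t ∈ Icc a b, HasDerivWithinAt (fun t => ξ (z t).1) (q t * ξ (𝓕.ell (z t)))
        (Icc a b) t := fun t ht => by
      have := (ξ.comp (ContinuousLinearMap.fst ℝ F ℝ)).hasFDerivAt.comp_hasDerivWithinAt t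
        (h.deriv t ht)
      refine this.congr_deriv ?_
      simp [char]
    have hlow : ∀ t ∈ Icc a b, 1 / 2 ≤ ξ (𝓕.ell (z t)) := by
      intro t ht
      obtain ⟨e1, e2, e3, e4⟩ := hnear _ (hsub2 (hV (h.mem t ht)))
      simp only [dualA hx₀, dualB hx₀] at e1 e2 e3 e4
      norm_num at e1 e2 e3 e4
      have hang : |(z t).2 - φ| ≤ 1 / 2 := by
        have h1 := h.norm_sub_start_le hMV ht
        have h2 : |(z t).2 - φ| ≤ ‖z t - z a‖ := by
          rw [← Real.norm_eq_abs]; exact norm_snd_le (z t - z a)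
        exact h2.trans (h1.trans ((mul_le_mul_of_nonneg_left hQ hM0.le).trans hτM))
      have hcos : 7 / 8 ≤ Real.cos ((z t).2 - φ) := by
        have h1 := Real.one_sub_sq_div_two_le_cos (x := (z t).2 - φ)
        have h2 : ((z t).2 - φ) ^ 2 ≤ (1 / 2) ^ 2 := sq_le_sq' (by linarith [(abs_le.1 hang).1])
          (abs_le.1 hang).2
        linarith
      have expand : ξ (𝓕.ell (z t)) = Real.cos ((z t).2 - φ) +
          (Real.cos φ * Real.cos (z t).2 * (𝓕.α 0 x₀ (𝓕.A (z t).1) - 1) +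
           Real.cos φ * Real.sin (z t).2 * 𝓕.α 0 x₀ (𝓕.B (z t).1) +
           Real.sin φ * Real.cos (z t).2 * 𝓕.α 1 x₀ (𝓕.A (z t).1) +
           Real.sin φ * Real.sin (z t).2 * (𝓕.α 1 x₀ (𝓕.B (z t).1) - 1)) := by
        rw [Real.cos_sub]; simp [hξ, ell]; ring
      have tri : ∀ c d e : ℝ, |c| ≤ 1 → |d| ≤ 1 → |e| < 1 / 16 → -(1 / 16) ≤ c * d * e := by
        intro c d e hc hd he
        have h1 : |c * d * e| ≤ 1 * 1 * (1 / 16) := by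
          rw [abs_mul, abs_mul]
          gcongr
        have := (abs_le.1 h1).1
        linarith
      have t1 := tri _ _ _ (Real.abs_cos_le_one φ) (Real.abs_cos_le_one (z t).2) e1
      have t2 := tri _ _ _ (Real.abs_cos_le_one φ) (Real.abs_sin_le_one (z t).2) e2
      have t3 := tri _ _ _ (Real.abs_sin_le_one φ) (Real.abs_cos_le_one (z t).2) e3
      have t4 := tri _ _ _ (Real.abs_sin_le_one φ) (Real.abs_sin_le_one (z t).2) e4
      rw [expand]
      linarith
    have hfin := sub_le_sub_of_hasDerivWithinAt_le h.le hd
      (fun t ht => (h.length_deriv t ht).const_mul (1 / 2)) (fun t ht => by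
        have := hlow t ht
        have := h.pos t ht
        nlinarith)
    rw [h.length_zero, ← map_sub] at hfin
    have := (le_abs_self _).trans (ξ.le_opNorm ((z b).1 - (z a).1))
    have h2 := mul_le_mul_of_nonneg_right hξn (norm_nonneg ((z b).1 - (z a).1))
    linarith
  refine ⟨ρ, M, 1 / (2 * M), hρ0, by positivity, hMρ, fun {V} hV {a b z q Q} h => ?_⟩
  have hlen : Q b ≤ τ := by
    by_contra! hlt
    obtain ⟨t, ht, hQt⟩ : τ ∈ Q '' Icc a b := by
      apply intermediate_value_Icc h.le (fun t ht => (h.length_deriv t ht).continuousWithinAt)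
      exact ⟨by rw [h.length_zero]; exact hτ0.le, hlt.le⟩
    have h1 := chord hV (h.mono_right ht) hQt.le
    rw [hQt] at h1
    have h2 : ‖(z t).1 - (z a).1‖ < ρ + ρ := by
      have e1 := hV (h.mem t ht)
      have e2 := hV (h.mem a (left_mem_Icc.2 h.le))
      rw [Metric.mem_ball, dist_eq_norm] at e1 e2
      have : (z t).1 - (z a).1 = ((z t).1 - x₀) - ((z a).1 - x₀) := by abel
      rw [this]
      exact (norm_sub_le _ _).trans_lt (add_lt_add e1 e2)
    have h3 : M * (ρ + ρ) ≤ τ / 4 := by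
      have : ρ ≤ τ / (8 * M) := min_le_right _ _
      calc _ ≤ M * (τ / (8 * M) + τ / (8 * M)) := by gcongr
        _ = τ / 4 := by field_simp; norm_num
    have h4 := mul_lt_mul_of_pos_left h2 hM0
    linarith
  refine ⟨hlen, ?_⟩
  have := chord hV h hlen
  rw [div_mul_eq_mul_div, one_mul, div_le_iff₀ (by positivity)]
  linarith

end GrowthFrame

/-! ### The small growth condition in a local parametrisation -/

section Growth

variable {F : Type*} [NormedAddCommGroup F] [NormedSpace ℝ F] [FiniteDimensional ℝ F]

/-- Linearly independent smooth fields have smooth coefficient functions: the coefficients of a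
vector in their span depend smoothly on the base point. -/
theorem exists_smooth_coefficients {n : ℕ} {Ω : Set F} (hΩ : IsOpen Ω) {X : Fin n → F → F}
    (hX : ∀ i, ContDiffOn ℝ ∞ (X i) Ω) {x : F} (hx : x ∈ Ω)
    (hli : LinearIndependent ℝ fun i => X i x) :
    ∃ O : Set F, IsOpen O ∧ x ∈ O ∧ O ⊆ Ω ∧ ∃ α : Fin n → F → F →L[ℝ] ℝ,
      (∀ i, ContDiffOn ℝ ∞ (α i) O) ∧ ∀ y ∈ O, ∀ v ∈ Submodule.span ℝ (range fun i => X i y),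
        v = ∑ i, α i y v • X i y := by
  have : CompleteSpace F := FiniteDimensional.complete ℝ F
  let S : F → (Fin n → ℝ) →L[ℝ] F := fun x =>
    ∑ i, (ContinuousLinearMap.proj (R := ℝ) (φ := fun _ : Fin n => ℝ) i).smulRight (X i x)
  have hSapp : ∀ x v, S x v = ∑ i, v i • X i x := fun x v => by simp [S]
  have hS : ContDiffOn ℝ ∞ S Ω := by
    apply ContDiffOn.sum
    intro i _
    exact (ContinuousLinearMap.smulRightL ℝ (Fin n → ℝ) F
      (ContinuousLinearMap.proj (R := ℝ) (φ := fun _ : Fin n => ℝ) i)).contDiff.comp_contDiffOn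
      (hX i)
  -- a left inverse of the frame at `x` is almost a left inverse nearby
  obtain ⟨T₀, hT₀⟩ := (S x : (Fin n → ℝ) →ₗ[ℝ] F).exists_leftInverse_of_injective (by
    rw [LinearMap.ker_eq_bot']
    intro v hv
    have h1 := Fintype.linearIndependent_iff.1 hli v (by rw [← hSapp]; exact hv)
    exact funext h1)
  let T : F →L[ℝ] (Fin n → ℝ) := LinearMap.toContinuousLinearMap T₀
  have hTS : ContDiffOn ℝ ∞ (fun y => T.comp (S y)) Ω := contDiffOn_const.clm_comp hS
  have hTx : T.comp (S x) = ContinuousLinearMap.id ℝ _ := by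
    ext1 v
    exact LinearMap.congr_fun hT₀ v
  have hopen : IsOpen (range ((↑) : ((Fin n → ℝ) ≃L[ℝ] (Fin n → ℝ)) →
      (Fin n → ℝ) →L[ℝ] (Fin n → ℝ))) := ContinuousLinearEquiv.isOpen
  refine ⟨Ω ∩ (fun y => T.comp (S y)) ⁻¹' range ((↑) : ((Fin n → ℝ) ≃L[ℝ] (Fin n → ℝ)) →
      (Fin n → ℝ) →L[ℝ] (Fin n → ℝ)), hTS.continuousOn.isOpen_inter_preimage hΩ hopen,
    ⟨hx, ⟨ContinuousLinearEquiv.refl ℝ _, hTx.symm⟩⟩, inter_subset_left,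
    fun i y => (ContinuousLinearMap.proj (R := ℝ) (φ := fun _ : Fin n => ℝ) i).comp
      ((T.comp (S y)).inverse.comp T), fun i => ?_, ?_⟩
  · refine contDiffOn_const.clm_comp (ContDiffOn.clm_comp (fun y hy => ?_) contDiffOn_const)
    obtain ⟨e, he : (e : (Fin n → ℝ) →L[ℝ] (Fin n → ℝ)) = T.comp (S y)⟩ := hy.2
    have h1 : ContDiffAt ℝ ∞ ContinuousLinearMap.inverse (T.comp (S y)) :=
      he ▸ contDiffAt_map_inverse e
    exact h1.comp_contDiffWithinAt y (f := fun y => T.comp (S y))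
      ((hTS y hy.1).mono inter_subset_left)
  · rintro y ⟨-, e, he : (e : (Fin n → ℝ) →L[ℝ] (Fin n → ℝ)) = T.comp (S y)⟩ v hv
    obtain ⟨c, rfl⟩ := (Submodule.mem_span_range_iff_exists_fun ℝ).1 hv
    have h1 : (T.comp (S y)).inverse (T (∑ i, c i • X i y)) = c := by
      rw [← hSapp, ← ContinuousLinearMap.comp_apply T (S y), ← he,
        ContinuousLinearMap.inverse_equiv]
      exact e.symm_apply_apply c
    simp only [ContinuousLinearMap.comp_apply] at h1 ⊢
    rw [h1]
    rfl

open VectorField in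
/-- The bracket of two combinations of fields, modulo the fields, is the combination of their
brackets. -/
theorem lieBracket_mem_of_eventually_eq_sum {F : Type*} [NormedAddCommGroup F]
    [NormedSpace ℝ F] {m n : ℕ} {X : Fin m → F → F} {Z : Fin n → F → F}
    {f : Fin m → F → ℝ} {g : Fin n → F → ℝ} {ξ ζ : F → F} {x : F} {S : Submodule ℝ F}
    (hX : ∀ i, DifferentiableAt ℝ (X i) x) (hZ : ∀ j, DifferentiableAt ℝ (Z j) x)
    (hf : ∀ i, DifferentiableAt ℝ (f i) x) (hg : ∀ j, DifferentiableAt ℝ (g j) x)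
    (hξ : ξ =ᶠ[𝓝 x] fun y => ∑ i, f i y • X i y) (hζ : ζ =ᶠ[𝓝 x] fun y => ∑ j, g j y • Z j y)
    (hXS : ∀ i, X i x ∈ S) (hZS : ∀ j, Z j x ∈ S)
    (hS : ∀ i j, lieBracket ℝ (X i) (Z j) x ∈ S) : lieBracket ℝ ξ ζ x ∈ S := by
  rw [hξ.lieBracket_vectorField_eq hζ]
  have d1 : ∀ v, fderiv ℝ (fun y => ∑ i, f i y • X i y) x v =
      ∑ i, (f i x • fderiv ℝ (X i) x v + fderiv ℝ (f i) x v • X i x) := fun v => by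
    have := HasFDerivAt.fun_sum (u := Finset.univ) fun i _ =>
      (hf i).hasFDerivAt.smul (hX i).hasFDerivAt
    exact (congrArg (fun L : F →L[ℝ] F => L v) (HasFDerivAt.fderiv this)).trans (by simp)
  have d2 : ∀ v, fderiv ℝ (fun y => ∑ j, g j y • Z j y) x v =
      ∑ j, (g j x • fderiv ℝ (Z j) x v + fderiv ℝ (g j) x v • Z j x) := fun v => by
    have := HasFDerivAt.fun_sum (u := Finset.univ) fun i _ =>
      (hg i).hasFDerivAt.smul (hZ i).hasFDerivAt
    exact (congrArg (fun L : F →L[ℝ] F => L v) (HasFDerivAt.fderiv this)).trans (by simp)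
  have key : lieBracket ℝ (fun y => ∑ i, f i y • X i y) (fun y => ∑ j, g j y • Z j y) x =
      (∑ i, ∑ j, (f i x * g j x) • lieBracket ℝ (X i) (Z j) x) +
      (∑ j, fderiv ℝ (g j) x (∑ i, f i x • X i x) • Z j x -
        ∑ i, fderiv ℝ (f i) x (∑ j, g j x • Z j x) • X i x) := by
    have e1 : ∑ i, f i x • fderiv ℝ (X i) x (∑ j, g j x • Z j x) =
        ∑ i, ∑ j, (f i x * g j x) • fderiv ℝ (X i) x (Z j x) := by
      refine Finset.sum_congr rfl fun i _ => ?_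
      rw [map_sum, Finset.smul_sum]
      refine Finset.sum_congr rfl fun j _ => ?_
      rw [map_smul, smul_smul]
    have e2 : ∑ j, g j x • fderiv ℝ (Z j) x (∑ i, f i x • X i x) =
        ∑ i, ∑ j, (f i x * g j x) • fderiv ℝ (Z j) x (X i x) := by
      rw [Finset.sum_comm]
      refine Finset.sum_congr rfl fun j _ => ?_
      rw [map_sum, Finset.smul_sum]
      refine Finset.sum_congr rfl fun i _ => ?_
      rw [map_smul, smul_smul, mul_comm]
    simp only [lieBracket, d1, d2, Finset.sum_add_distrib, e1, e2, smul_sub,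
      Finset.sum_sub_distrib]
    abel
  rw [key]
  exact S.add_mem (S.sum_mem fun i _ => S.sum_mem fun j _ => S.smul_mem _ (hS i j))
    (S.sub_mem (S.sum_mem fun j _ => S.smul_mem _ (hZS j))
      (S.sum_mem fun i _ => S.smul_mem _ (hXS i)))

variable {H : Type*} [TopologicalSpace H] {I : ModelWithCorners ℝ F H} {M : Type*}
  [TopologicalSpace M] [ChartedSpace H M] [IsManifold I ∞ M]

open VectorField

theorem contDiffOn_mpullback {g : F → M} {Ω : Set F} (hΩ : IsOpen Ω)
    (hg : ContMDiffOn 𝓘(ℝ, F) I ∞ g Ω)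
    (hg' : ∀ x ∈ Ω, (mfderiv 𝓘(ℝ, F) I g x).IsInvertible) {ξ : ∀ y : M, TangentSpace I y}
    {U : Set M} (hU : IsOpen U) (hξ : IsSmoothFieldOn I ξ U) (hΩU : MapsTo g Ω U) :
    ContDiffOn ℝ ∞ (fun x => (mpullback 𝓘(ℝ, F) I g ξ x : F)) Ω := by
  have : CompleteSpace F := FiniteDimensional.complete ℝ F
  intro x hx
  have h1 := ContMDiffAt.mpullback_vectorField_preimage (m := ∞) (n := ∞)
    (hξ.contMDiffAt (hU.mem_nhds (hΩU hx))) (hg.contMDiffAt (hΩ.mem_nhds hx)) (hg' x hx) (by simp)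
  rw [contMDiffAt_vectorSpace_iff_contDiffAt] at h1
  exact h1.contDiffWithinAt

theorem mpullback_mlieBracket_eq_lieBracket {g : F → M} {Ω : Set F} (hΩ : IsOpen Ω)
    (hg : ContMDiffOn 𝓘(ℝ, F) I ∞ g Ω) {ξ ζ : ∀ y : M, TangentSpace I y} {x : F} (hx : x ∈ Ω)
    {U U' : Set M} (hU : U ∈ 𝓝 (g x)) (hU' : U' ∈ 𝓝 (g x)) (hξ : IsSmoothFieldOn I ξ U)
    (hζ : IsSmoothFieldOn I ζ U') :
    mpullback 𝓘(ℝ, F) I g (mlieBracket I ξ ζ) x =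
      lieBracket ℝ (fun x => (mpullback 𝓘(ℝ, F) I g ξ x : F))
        (fun x => (mpullback 𝓘(ℝ, F) I g ζ x : F)) x := by
  have : CompleteSpace F := FiniteDimensional.complete ℝ F
  have two_le : (2 : ℕ∞ω) ≤ ∞ := WithTop.coe_le_coe.2 le_top
  have : IsManifold I (minSmoothness ℝ 2) M := IsManifold.of_le (n := ∞) (by simpa using two_le)
  rw [mpullback_mlieBracket (n := ∞) ((hξ.contMDiffAt hU).mdifferentiableAt (by simp))
    ((hζ.contMDiffAt hU').mdifferentiableAt (by simp)) (hg.contMDiffAt (hΩ.mem_nhds hx))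
    (by simpa using two_le),
    ← mlieBracketWithin_univ, mlieBracketWithin_eq_lieBracketWithin]
  exact congrFun (lieBracketWithin_univ (𝕜 := ℝ) (E := F)) x

/-- The derived system, in a local parametrisation, lies in the span of the fields and of their
brackets. -/
theorem derivedSystem_le_of_span {g : F → M} {Ω : Set F} (hΩ : IsOpen Ω)
    (hg : ContMDiffOn 𝓘(ℝ, F) I ∞ g Ω)
    (hg' : ∀ x ∈ Ω, (mfderiv 𝓘(ℝ, F) I g x).IsInvertible)
    {D D' : ∀ y : M, Submodule ℝ (TangentSpace I y)} {m n : ℕ} {X : Fin m → F → F}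
    {Z : Fin n → F → F} (hX : ∀ i, ContDiffOn ℝ ∞ (X i) Ω) (hZ : ∀ i, ContDiffOn ℝ ∞ (Z i) Ω)
    (hXli : ∀ x ∈ Ω, LinearIndependent ℝ fun i => X i x)
    (hZli : ∀ x ∈ Ω, LinearIndependent ℝ fun i => Z i x)
    (hD : ∀ x ∈ Ω, ∀ v ∈ D (g x), (mfderiv 𝓘(ℝ, F) I g x).inverse v ∈
      Submodule.span ℝ (range fun i => X i x))
    (hD' : ∀ x ∈ Ω, ∀ v ∈ D' (g x), (mfderiv 𝓘(ℝ, F) I g x).inverse v ∈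
      Submodule.span ℝ (range fun i => Z i x)) {x : F} (hx : x ∈ Ω) {S : Submodule ℝ F}
    (hXS : ∀ i, X i x ∈ S) (hZS : ∀ j, Z j x ∈ S)
    (hS : ∀ i j, lieBracket ℝ (X i) (Z j) x ∈ S) :
    ∀ v ∈ derivedSystem I D D' (g x), ((mfderiv 𝓘(ℝ, F) I g x).inverse v : F) ∈ S := by
  suffices derivedSystem I D D' (g x) ≤
      Submodule.comap ((mfderiv 𝓘(ℝ, F) I g x).inverse).toLinearMap S from fun v hv => this hv
  refine sup_le (fun v hv => ?_) (Submodule.span_le.2 ?_)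
  · refine (Submodule.span_le (p := S)).2 ?_ (hD' x hx v hv)
    rintro _ ⟨j, rfl⟩
    exact hZS j
  rintro w ⟨ξ, ζ, ⟨U, hU, hxU, hξ, hξD⟩, ⟨U', hU', hxU', hζ, hζD⟩, rfl⟩
  have hd : ∀ {f : F → F}, ContDiffOn ℝ ∞ f Ω → DifferentiableAt ℝ f x := fun hf =>
    (hf.contDiffAt (hΩ.mem_nhds hx)).differentiableAt (by simp)
  change ((mpullback 𝓘(ℝ, F) I g (mlieBracket I ξ ζ) x : F)) ∈ S
  rw [mpullback_mlieBracket_eq_lieBracket hΩ hg hx (hU.mem_nhds hxU) (hU'.mem_nhds hxU') hξ hζ]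
  obtain ⟨O, hO, hxO, hOΩ, α, hα, hαX⟩ := exists_smooth_coefficients hΩ hX hx (hXli x hx)
  obtain ⟨O', hO', hxO', hOΩ', β, hβ, hβZ⟩ := exists_smooth_coefficients hΩ hZ hx (hZli x hx)
  have hW : IsOpen (Ω ∩ g ⁻¹' U) := hg.continuousOn.isOpen_inter_preimage hΩ hU
  have hW' : IsOpen (Ω ∩ g ⁻¹' U') := hg.continuousOn.isOpen_inter_preimage hΩ hU'
  have hξs := contDiffOn_mpullback hW (hg.mono inter_subset_left) (fun x hx => hg' x hx.1) hU hξ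
    (fun x hx => hx.2)
  have hζs := contDiffOn_mpullback hW' (hg.mono inter_subset_left) (fun x hx => hg' x hx.1) hU' hζ
    (fun x hx => hx.2)
  refine lieBracket_mem_of_eventually_eq_sum (fun i => hd (hX i)) (fun j => hd (hZ j))
    (f := fun i y => α i y (mpullback 𝓘(ℝ, F) I g ξ y : F))
    (g := fun i y => β i y (mpullback 𝓘(ℝ, F) I g ζ y : F)) (fun i => ?_) (fun j => ?_) ?_ ?_
    hXS hZS hS
  · exact (((hα i).contDiffAt (hO.mem_nhds hxO)).clm_apply
      (hξs.contDiffAt (hW.mem_nhds ⟨hx, hxU⟩))).differentiableAt (by simp)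
  · exact (((hβ j).contDiffAt (hO'.mem_nhds hxO')).clm_apply
      (hζs.contDiffAt (hW'.mem_nhds ⟨hx, hxU'⟩))).differentiableAt (by simp)
  · filter_upwards [hO.mem_nhds hxO, hW.mem_nhds ⟨hx, hxU⟩] with y hy hy'
    exact hαX y hy _ (hD y hy'.1 _ (hξD _ hy'.2))
  · filter_upwards [hO'.mem_nhds hxO', hW'.mem_nhds ⟨hx, hxU'⟩] with y hy hy'
    exact hβZ y hy _ (hD' y hy'.1 _ (hζD _ hy'.2))

theorem IsDistribution.linearIndependent_of_le {D : ∀ y : M, Submodule ℝ (TangentSpace I y)}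
    {r : ℕ} (hD : IsDistribution I D r) {y : M} {L : TangentSpace I y →L[ℝ] F}
    (hL : Function.Injective L) {e : Fin r → F}
    (he : ∀ v ∈ D y, L v ∈ Submodule.span ℝ (range e)) : LinearIndependent ℝ e := by
  obtain ⟨U, ξ, -, hyU, hξ⟩ := hD y
  obtain ⟨hli, hsp⟩ := hξ.2 y hyU
  have h1 : LinearIndependent ℝ fun i => L (ξ i y) := hli.map' L.toLinearMap
    (LinearMap.ker_eq_bot.2 hL)
  have h2 : Submodule.span ℝ (range fun i => L (ξ i y)) ≤ Submodule.span ℝ (range e) := by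
    rw [Submodule.span_le]
    rintro _ ⟨i, rfl⟩
    exact he _ (hsp ▸ Submodule.subset_span ⟨i, rfl⟩)
  rw [linearIndependent_iff_card_le_finrank_span]
  refine (linearIndependent_iff_card_le_finrank_span.1 h1).trans ?_
  exact Submodule.finrank_mono h2

/-- A frame of a distribution with small growth `(2, 3, 5)` becomes a `GrowthFrame` in every local
parametrisation. -/
theorem HasGrowth235.exists_growthFrame (hF : Module.finrank ℝ F = 5)
    {D : ∀ y : M, Submodule ℝ (TangentSpace I y)} (hD : HasGrowth235 I D) {U : Set M}
    (hU : IsOpen U) {η : Fin 2 → ∀ y : M, TangentSpace I y} (hη : IsFrameOn I D η U)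
    {g : F → M} {Ω : Set F} (hΩ : IsOpen Ω) (hg : ContMDiffOn 𝓘(ℝ, F) I ∞ g Ω)
    (hg' : ∀ x ∈ Ω, (mfderiv 𝓘(ℝ, F) I g x).IsInvertible) (hΩU : MapsTo g Ω U) :
    ∃ 𝓕 : GrowthFrame F, 𝓕.Ω = Ω ∧ (∀ x ∈ Ω, mfderiv 𝓘(ℝ, F) I g x (𝓕.A x) = η 0 (g x)) ∧
      ∀ x ∈ Ω, mfderiv 𝓘(ℝ, F) I g x (𝓕.B x) = η 1 (g x) := by
  set A : F → F := fun x => (mpullback 𝓘(ℝ, F) I g (η 0) x : F) with hAdef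
  set B : F → F := fun x => (mpullback 𝓘(ℝ, F) I g (η 1) x : F) with hBdef
  have hA : ContDiffOn ℝ ∞ A Ω := contDiffOn_mpullback hΩ hg hg' hU (hη.1 0) hΩU
  have hB : ContDiffOn ℝ ∞ B Ω := contDiffOn_mpullback hΩ hg hg' hU (hη.1 1) hΩU
  have hC := hA.lieBracket_of_isOpen hΩ hB
  have hinj : ∀ x ∈ Ω, Function.Injective (mfderiv 𝓘(ℝ, F) I g x).inverse := by
    intro x hx
    obtain ⟨e, he⟩ := hg' x hx
    rw [← he, ContinuousLinearMap.inverse_equiv]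
    exact e.symm.injective
  have hself : ∀ x ∈ Ω, ∀ w : TangentSpace I (g x),
      mfderiv 𝓘(ℝ, F) I g x ((mfderiv 𝓘(ℝ, F) I g x).inverse w) = w := by
    intro x hx w
    obtain ⟨e, he⟩ := hg' x hx
    rw [← he, ContinuousLinearMap.inverse_equiv]
    exact e.apply_symm_apply w
  have hD1 : ∀ x ∈ Ω, ∀ v ∈ D (g x), (mfderiv 𝓘(ℝ, F) I g x).inverse v ∈
      Submodule.span ℝ (range fun i => (![A, B] : Fin 2 → F → F) i x) := by
    intro x hx v hv
    have h1 : v ∈ Submodule.span ℝ (range fun i => η i (g x)) :=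
      ((hη.2 _ (hΩU hx)).2.le) hv
    have h2 : Submodule.span ℝ (range fun i => η i (g x)) ≤ Submodule.comap
        ((mfderiv 𝓘(ℝ, F) I g x).inverse).toLinearMap
        (Submodule.span ℝ (range fun i => (![A, B] : Fin 2 → F → F) i x)) := by
      rw [Submodule.span_le]
      rintro _ ⟨i, rfl⟩
      refine Submodule.subset_span ⟨i, ?_⟩
      fin_cases i <;> rfl
    exact h2 h1
  have hAB : ∀ i, ContDiffOn ℝ ∞ ((![A, B] : Fin 2 → F → F) i) Ω := by
    intro i; fin_cases i
    exacts [hA, hB]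
  have hABC : ∀ i, ContDiffOn ℝ ∞ ((![A, B, lieBracket ℝ A B] : Fin 3 → F → F) i) Ω := by
    intro i; fin_cases i
    exacts [hA, hB, hC]
  have hABli : ∀ x ∈ Ω, LinearIndependent ℝ fun i => (![A, B] : Fin 2 → F → F) i x :=
    fun x hx => hD.rank_one.linearIndependent_of_le (hinj x hx) (hD1 x hx)
  have hD2 : ∀ x ∈ Ω, ∀ v ∈ derivedSystem I D D (g x), (mfderiv 𝓘(ℝ, F) I g x).inverse v ∈
      Submodule.span ℝ (range fun i => (![A, B, lieBracket ℝ A B] : Fin 3 → F → F) i x) := by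
    intro x hx
    have m0 := Submodule.subset_span (R := ℝ)
      (mem_range_self (f := fun i => (![A, B, lieBracket ℝ A B] : Fin 3 → F → F) i x) 0)
    have m1 := Submodule.subset_span (R := ℝ)
      (mem_range_self (f := fun i => (![A, B, lieBracket ℝ A B] : Fin 3 → F → F) i x) 1)
    have m2 := Submodule.subset_span (R := ℝ)
      (mem_range_self (f := fun i => (![A, B, lieBracket ℝ A B] : Fin 3 → F → F) i x) 2)
    refine derivedSystem_le_of_span hΩ hg hg' hAB hAB hABli hABli hD1 hD1 hx ?_ ?_ ?_
    · intro i; fin_cases i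
      exacts [m0, m1]
    · intro i; fin_cases i
      exacts [m0, m1]
    · intro i j; fin_cases i <;> fin_cases j
      · simp
      · exact m2
      · have : lieBracket ℝ B A x = -lieBracket ℝ A B x := VectorField.lieBracket_swap
        simpa [this] using m2
      · simp
  have hABCli : ∀ x ∈ Ω, LinearIndependent ℝ
      fun i => (![A, B, lieBracket ℝ A B] : Fin 3 → F → F) i x :=
    fun x hx => hD.rank_two.linearIndependent_of_le (hinj x hx) (hD2 x hx)
  obtain ⟨𝓕, h1, h2, h3⟩ := GrowthFrame.exists_of_linearIndependent hF hΩ hA hB (fun x hx => by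
    refine hD.rank_three.linearIndependent_of_le (hinj x hx) ?_
    set e := ![A x, B x, lieBracket ℝ A B x, lieBracket ℝ A (lieBracket ℝ A B) x,
      lieBracket ℝ B (lieBracket ℝ A B) x] with he
    have m : ∀ i, e i ∈ Submodule.span ℝ (range e) := fun i =>
      Submodule.subset_span (mem_range_self i)
    refine derivedSystem_le_of_span hΩ hg hg' hAB hABC hABli hABCli hD1 hD2 hx ?_ ?_ ?_
    · intro i; fin_cases i
      exacts [m 0, m 1]
    · intro i; fin_cases i
      exacts [m 0, m 1, m 2]
    · intro i j; fin_cases i <;> fin_cases j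
      · simp
      · exact m 2
      · exact m 3
      · have : lieBracket ℝ B A x = -lieBracket ℝ A B x := VectorField.lieBracket_swap
        exact this ▸ Submodule.neg_mem _ (m 2)
      · simp
      · exact m 4)
  refine ⟨𝓕, h1, fun x hx => ?_, fun x hx => ?_⟩
  · rw [h2]; exact hself x hx _
  · rw [h3]; exact hself x hx _

end Growth

/-! ### Submersions whose fibres are characteristic curves -/

section CharFibration

variable {F : Type*} [NormedAddCommGroup F] [NormedSpace ℝ F]

/-- `f` is a submersion, defined on the oriented lines over the open set `W` (with the angle as a
coordinate), such that any two points of a fibre are joined by a characteristic curve inside that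
fibre. The set `B` is a convex neighbourhood of `W` on which the geometry is controlled by the
constants `M` and `κ`, as in `GrowthFrame.exists_radius`. -/
structure GrowthFrame.IsFibration (𝓕 : GrowthFrame F) {X : Type*} [TopologicalSpace X]
    [ChartedSpace F X] (B W : Set F) (M κ : ℝ) (f : F × ℝ → X) : Prop where
  isOpen : IsOpen W
  subset : W ⊆ B
  convex : Convex ℝ B
  bound : 𝓕.IsBound B M
  pos : 0 < κ
  length_le : ∀ {a b : ℝ} {z : ℝ → F × ℝ} {q Q : ℝ → ℝ}, 𝓕.IsCharCurve W a b z q Q →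
    Q b ≤ 1 / (16 * M ^ 3)
  le_chord : ∀ {a b : ℝ} {z : ℝ → F × ℝ} {q Q : ℝ → ℝ}, 𝓕.IsCharCurve W a b z q Q →
    κ * Q b ≤ ‖(z b).1 - (z a).1‖
  smooth : ContMDiffOn 𝓘(ℝ, F × ℝ) 𝓘(ℝ, F) ∞ f (W ×ˢ univ)
  submersion : ∀ p : F × ℝ, p.1 ∈ W → Function.Surjective (mfderiv 𝓘(ℝ, F × ℝ) 𝓘(ℝ, F) f p)
  periodic : ∀ (x : F) (θ : ℝ) (n : ℤ), f (x, θ + n * (2 * Real.pi)) = f (x, θ)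
  fibre : ∀ p p' : F × ℝ, p.1 ∈ W → p'.1 ∈ W → f p = f p' →
    ∃ (a b : ℝ) (z : ℝ → F × ℝ) (q Q : ℝ → ℝ), 𝓕.IsCharCurve W a b z q Q ∧
      (∀ t ∈ Icc a b, f (z t) = f p) ∧
      ((∃ m n : ℤ, z a = p + (0, m * (2 * Real.pi)) ∧ z b = p' + (0, n * (2 * Real.pi))) ∨
        ∃ m n : ℤ, z a = p' + (0, m * (2 * Real.pi)) ∧ z b = p + (0, n * (2 * Real.pi)))

namespace GrowthFrame

theorem IsCharCurve.mono_set {𝓕 : GrowthFrame F} {V V' : Set F} {a b : ℝ} {z : ℝ → F × ℝ}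
    {q Q : ℝ → ℝ} (h : 𝓕.IsCharCurve V a b z q Q) (hV : V ⊆ V') : 𝓕.IsCharCurve V' a b z q Q :=
  ⟨h.le, fun t ht => hV (h.mem t ht), h.pos, h.deriv, h.length_zero, h.length_deriv⟩

theorem eq_zero_of_ell_add_ell'_eq_zero {𝓕 : GrowthFrame F} {p : F × ℝ} (hp : p.1 ∈ 𝓕.Ω) (a b : ℝ)
    (h : a • 𝓕.ell p + b • 𝓕.ell' p = 0) : a = 0 ∧ b = 0 := by
  have hsc := Real.sin_sq_add_cos_sq p.2
  have h0 := congrArg (𝓕.α 0 p.1) h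
  have h1 := congrArg (𝓕.α 1 p.1) h
  simp [ell, ell', dualA hp, dualB hp] at h0 h1
  constructor
  · linear_combination Real.cos p.2 * h0 + Real.sin p.2 * h1 - a * hsc
  · linear_combination -Real.sin p.2 * h0 + Real.cos p.2 * h1 - b * hsc

theorem char_periodic {𝓕 : GrowthFrame F} (p : F × ℝ) (n : ℤ) :
    𝓕.char (p + (0, n * (2 * Real.pi))) = 𝓕.char p := by
  have := 𝓕.ell_add_two_pi p.1 p.2 n
  simpa [Prod.add_def] using this

/-- The coefficient of `char p`, with respect to the frame of the base. -/
noncomputable def charCoeff (𝓕 : GrowthFrame F) (p : F × ℝ) : F × ℝ →L[ℝ] ℝ :=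
  (Real.cos p.2 • 𝓕.α 0 p.1 + Real.sin p.2 • 𝓕.α 1 p.1).comp (ContinuousLinearMap.fst ℝ F ℝ)

theorem charCoeff_char {𝓕 : GrowthFrame F} {p : F × ℝ} (hp : p.1 ∈ 𝓕.Ω) :
    𝓕.charCoeff p (𝓕.char p) = 1 := by
  have hsc := Real.sin_sq_add_cos_sq p.2
  simp [charCoeff, char, ell, dualA hp, dualB hp]
  linear_combination hsc

theorem charCoeff_const {𝓕 : GrowthFrame F} (p : F × ℝ) (r : ℝ) : 𝓕.charCoeff p (0, r) = 0 := by
  simp [charCoeff]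

namespace IsFibration

variable {𝓕 : GrowthFrame F} {X : Type*} [TopologicalSpace X] [ChartedSpace F X] {B W : Set F}
  {M κ : ℝ} {f : F × ℝ → X}

theorem subset_domain (h : 𝓕.IsFibration B W M κ f) : W ⊆ 𝓕.Ω := h.subset.trans h.bound.subset

theorem prod_isOpen (h : 𝓕.IsFibration B W M κ f) : IsOpen (W ×ˢ (univ : Set ℝ)) :=
  h.isOpen.prod isOpen_univ

theorem contMDiffAt (h : 𝓕.IsFibration B W M κ f) {p : F × ℝ} (hp : p.1 ∈ W) :
    ContMDiffAt 𝓘(ℝ, F × ℝ) 𝓘(ℝ, F) ∞ f p :=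
  h.smooth.contMDiffAt (h.prod_isOpen.mem_nhds ⟨hp, mem_univ _⟩)

theorem periodic' (h : 𝓕.IsFibration B W M κ f) (p : F × ℝ) (n : ℤ) :
    f (p + (0, n * (2 * Real.pi))) = f p := by
  simpa [Prod.add_def] using h.periodic p.1 p.2 n

variable {y₁ : X}

theorem inChart_periodic (h : 𝓕.IsFibration B W M κ f) (p : F × ℝ) (n : ℤ) :
    fderiv ℝ (fun p => extChartAt 𝓘(ℝ, F) y₁ (f p)) (p + (0, n * (2 * Real.pi))) =
      fderiv ℝ (fun p => extChartAt 𝓘(ℝ, F) y₁ (f p)) p := by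
  have := GrowthFrame.fderiv_periodic (f := fun p => extChartAt 𝓘(ℝ, F) y₁ (f p))
    (fun x θ n => by rw [h.periodic]) p.1 p.2 n
  simpa [Prod.add_def] using this

theorem isOpen_chartDomain (h : 𝓕.IsFibration B W M κ f) (y₁ : X) :
    IsOpen (W ×ˢ (univ : Set ℝ) ∩ f ⁻¹' (chartAt F y₁).source) :=
  h.smooth.continuousOn.isOpen_inter_preimage h.prod_isOpen (chartAt F y₁).open_source

theorem eventually_mem_chartDomain (h : 𝓕.IsFibration B W M κ f) {p : F × ℝ} (hp : p.1 ∈ W)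
    (hy : f p ∈ (chartAt F y₁).source) :
    ∀ᶠ p' in 𝓝 p, p'.1 ∈ W ∧ f p' ∈ (chartAt F y₁).source :=
  by
  filter_upwards [(h.isOpen_chartDomain y₁).mem_nhds ⟨⟨hp, mem_univ _⟩, hy⟩] with p' hp'
  exact ⟨hp'.1.1, hp'.2⟩

variable [IsManifold 𝓘(ℝ, F) ∞ X]

theorem contDiffAt_inChart (h : 𝓕.IsFibration B W M κ f) {p : F × ℝ} (hp : p.1 ∈ W)
    (hy : f p ∈ (chartAt F y₁).source) :
    ContDiffAt ℝ ∞ (fun p => extChartAt 𝓘(ℝ, F) y₁ (f p)) p :=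
  contMDiffAt_iff_contDiffAt.1
    ((contMDiffAt_extChartAt' (n := ∞) hy).comp p (h.contMDiffAt hp))

theorem fderiv_inChart (h : 𝓕.IsFibration B W M κ f) {p : F × ℝ} (hp : p.1 ∈ W)
    (hy : f p ∈ (chartAt F y₁).source) :
    fderiv ℝ (fun p => extChartAt 𝓘(ℝ, F) y₁ (f p)) p =
      (mfderiv 𝓘(ℝ, F) 𝓘(ℝ, F) (extChartAt 𝓘(ℝ, F) y₁) (f p)).comp
        (mfderiv 𝓘(ℝ, F × ℝ) 𝓘(ℝ, F) f p) := by
  rw [← mfderiv_eq_fderiv]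
  exact mfderiv_comp p ((contMDiffAt_extChartAt' (n := ∞) hy).mdifferentiableAt (by simp))
    ((h.contMDiffAt hp).mdifferentiableAt (by simp))

theorem surjective_fderiv_inChart (h : 𝓕.IsFibration B W M κ f) {p : F × ℝ} (hp : p.1 ∈ W)
    (hy : f p ∈ (chartAt F y₁).source) :
    Function.Surjective (fderiv ℝ (fun p => extChartAt 𝓘(ℝ, F) y₁ (f p)) p) := by
  rw [h.fderiv_inChart hp hy]
  obtain ⟨e, he⟩ := isInvertible_mfderiv_extChartAt (I := 𝓘(ℝ, F)) (x := y₁) (y := f p)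
    (by simpa using hy)
  rw [← he]
  exact e.surjective.comp (h.submersion p hp)

theorem mfderiv_eq_zero_iff (h : 𝓕.IsFibration B W M κ f) {p : F × ℝ} (hp : p.1 ∈ W)
    (hy : f p ∈ (chartAt F y₁).source) (v : F × ℝ) :
    fderiv ℝ (fun p => extChartAt 𝓘(ℝ, F) y₁ (f p)) p v = 0 ↔
      mfderiv 𝓘(ℝ, F × ℝ) 𝓘(ℝ, F) f p v = 0 := by
  rw [h.fderiv_inChart hp hy]
  obtain ⟨e, he⟩ := isInvertible_mfderiv_extChartAt (I := 𝓘(ℝ, F)) (x := y₁) (y := f p)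
    (by simpa using hy)
  rw [← he]
  exact e.map_eq_zero_iff

variable [FiniteDimensional ℝ F]

/-- The kernel of the differential consists of characteristic vectors: the fibre through `p` leaves
`p` in such a direction, and nearby points of the fibre lie on short characteristic curves. -/
theorem eq_smul_char_of_fderiv_eq_zero (h : 𝓕.IsFibration B W M κ f) {p : F × ℝ} (hp : p.1 ∈ W)
    {v : F × ℝ} (hv : fderiv ℝ (fun p' => extChartAt 𝓘(ℝ, F) (f p) (f p')) p v = 0) :
    v = 𝓕.charCoeff p v • 𝓕.char p := by
  set G : F × ℝ → F := fun p' => extChartAt 𝓘(ℝ, F) (f p) (f p') with hG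
  have hsrc : f p ∈ (chartAt F (f p)).source := mem_chart_source F (f p)
  have hstrict : HasStrictFDerivAt G (fderiv ℝ G p) p :=
    (h.contDiffAt_inChart hp hsrc).hasStrictFDerivAt (by simp)
  have hrange : (fderiv ℝ G p).range = ⊤ :=
    LinearMap.range_eq_top.2 (h.surjective_fderiv_inChart hp hsrc)
  have : CompleteSpace F := FiniteDimensional.complete ℝ F
  -- the curve in the fibre through `p` with the velocity `v`
  set ζ : ℝ → F × ℝ := fun τ => hstrict.implicitFunction G (fderiv ℝ G p) hrange (G p)
    (τ • (⟨v, hv⟩ : (fderiv ℝ G p).ker)) with hζ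
  have hζ0 : ζ 0 = p := by
    simp only [hζ, zero_smul]
    exact hstrict.implicitFunction_apply_image hrange
  have hζd : HasDerivAt ζ v 0 := by
    have h1 := (hstrict.to_implicitFunction hrange).hasFDerivAt
    have h2 : HasDerivAt (fun τ : ℝ => τ • (⟨v, hv⟩ : (fderiv ℝ G p).ker)) ⟨v, hv⟩ 0 := by
      simpa using (hasDerivAt_id (0 : ℝ)).smul_const (⟨v, hv⟩ : (fderiv ℝ G p).ker)
    have h3 : HasFDerivAt (hstrict.implicitFunction G (fderiv ℝ G p) hrange (G p))
        (fderiv ℝ G p).ker.subtypeL ((fun τ : ℝ => τ • (⟨v, hv⟩ : (fderiv ℝ G p).ker)) 0) := by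
      simpa using h1
    exact h3.comp_hasDerivAt (0 : ℝ) h2
  have hζc : ContinuousAt ζ 0 := hζd.continuousAt
  have hζG : ∀ᶠ τ in 𝓝 (0 : ℝ), G (ζ τ) = G p := by
    have h1 := hstrict.map_implicitFunction_eq hrange
    have h2 : Tendsto (fun τ : ℝ => (G p, τ • (⟨v, hv⟩ : (fderiv ℝ G p).ker))) (𝓝 0)
        (𝓝 (G p, 0)) := by
      have : Continuous fun τ : ℝ => (G p, τ • (⟨v, hv⟩ : (fderiv ℝ G p).ker)) := by fun_prop
      simpa using this.tendsto 0
    exact h2.eventually h1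
  have hζW : ∀ᶠ τ in 𝓝 (0 : ℝ), (ζ τ).1 ∈ W := by
    have : ContinuousAt (fun τ => (ζ τ).1) 0 := continuous_fst.continuousAt.comp hζc
    exact this.eventually_mem (by rw [hζ0]; exact h.isOpen.mem_nhds hp)
  have hζf : ∀ᶠ τ in 𝓝 (0 : ℝ), f (ζ τ) = f p := by
    have h1 : ContinuousAt (fun τ => f (ζ τ)) 0 := by
      refine ContinuousAt.comp (g := f) ?_ hζc
      rw [hζ0]; exact (h.contMDiffAt hp).continuousAt
    have h2 : ∀ᶠ τ in 𝓝 (0 : ℝ), f (ζ τ) ∈ (chartAt F (f p)).source :=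
      h1.eventually_mem (by rw [hζ0]; exact (chartAt F (f p)).open_source.mem_nhds hsrc)
    filter_upwards [h2, hζG] with τ hτ hτ'
    exact (extChartAt 𝓘(ℝ, F) (f p)).injOn (by simpa using hτ) (by simp) hτ'
  have hM0 : 0 < M := zero_lt_one.trans_le h.bound.one_le
  have hsmall : ∀ᶠ τ in 𝓝 (0 : ℝ), (1 + M / κ) * ‖ζ τ - p‖ < 2 * Real.pi := by
    have : ContinuousAt (fun τ => (1 + M / κ) * ‖ζ τ - p‖) 0 := by fun_prop
    exact this.eventually_lt_const (by simpa [hζ0] using Real.two_pi_pos)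
  -- the projection along the characteristic direction
  set T : F × ℝ →L[ℝ] F × ℝ := ContinuousLinearMap.id ℝ _ -
    (𝓕.charCoeff p).smulRight (𝓕.char p) with hT
  have hTchar : T (𝓕.char p) = 0 := by
    simp [hT, charCoeff_char (h.subset_domain hp)]
  have hquad : ∀ᶠ τ in 𝓝 (0 : ℝ), ‖T (ζ τ - p)‖ ≤ ‖T‖ * (2 * M ^ 2 / κ ^ 2) * ‖ζ τ - p‖ ^ 2 := by
    filter_upwards [hζW, hζf, hsmall] with τ hW hf hs
    obtain ⟨a, b, z, q, Q, hz, -, hzab⟩ := h.fibre p (ζ τ) hp hW hf.symm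
    have hzB := hz.mono_set h.subset
    have ha := left_mem_Icc.2 hz.le
    have hb := right_mem_Icc.2 hz.le
    have hQ0 := hz.length_nonneg hb
    have hch := h.le_chord hz
    have hlen := hzB.norm_sub_le h.bound
    have main : ∀ {t : ℝ}, t ∈ Icc a b → 𝓕.char (z t) = 𝓕.char p →
        (z b - z a = ζ τ - p ∨ z b - z a = -(ζ τ - p)) → Q b ≤ ‖ζ τ - p‖ / κ →
        ‖T (ζ τ - p)‖ ≤ ‖T‖ * (2 * M ^ 2 / κ ^ 2) * ‖ζ τ - p‖ ^ 2 := by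
      intro t ht hchar hdiff hQ
      have h1 := hzB.norm_sub_sub_le h.bound h.convex ht
      have h2 : T (z b - z a) = T (z b - z a - Q b • 𝓕.char (z t)) := by
        rw [map_sub T (z b - z a), map_smul, hchar, hTchar, smul_zero, sub_zero]
      have h3 : ‖T (ζ τ - p)‖ = ‖T (z b - z a)‖ := by
        rcases hdiff with hd | hd <;> rw [hd]
        rw [map_neg, norm_neg]
      rw [h3, h2]
      calc _ ≤ ‖T‖ * (2 * M ^ 2 * Q b ^ 2) := (T.le_opNorm _).trans (by gcongr)
        _ ≤ ‖T‖ * (2 * M ^ 2 * (‖ζ τ - p‖ / κ) ^ 2) := by gcongr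
        _ = _ := by ring
    -- the angles agree exactly, not only modulo `2π`
    have turn : ∀ k : ℤ, ‖(0, k * (2 * Real.pi)) + (ζ τ - p)‖ ≤ M * Q b → κ * Q b ≤ ‖ζ τ - p‖ →
        k = 0 := by
      intro k hk hQ
      have h1 : |k * (2 * Real.pi)| ≤ ‖ζ τ - p‖ + M * Q b := by
        have e1 : ((0 : F), (k * (2 * Real.pi) : ℝ)) =
            ((0, k * (2 * Real.pi)) + (ζ τ - p)) - (ζ τ - p) := by abel
        have e2 : |k * (2 * Real.pi)| ≤ ‖((0 : F), (k * (2 * Real.pi) : ℝ))‖ :=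
          norm_snd_le ((0 : F), (k * (2 * Real.pi) : ℝ))
        rw [e1] at e2
        have e3 := norm_sub_le ((0, k * (2 * Real.pi)) + (ζ τ - p)) (ζ τ - p)
        linarith
      have h2 : Q b ≤ ‖ζ τ - p‖ / κ := by
        rw [le_div_iff₀ h.pos]; linarith
      have h3 : M * Q b ≤ M / κ * ‖ζ τ - p‖ := by
        calc _ ≤ M * (‖ζ τ - p‖ / κ) := by gcongr
          _ = _ := by ring
      have h4 : |(k : ℝ)| * (2 * Real.pi) < 1 * (2 * Real.pi) := by
        rw [abs_mul, abs_of_pos Real.two_pi_pos] at h1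
        nlinarith
      have h5 := lt_of_mul_lt_mul_right h4 Real.two_pi_pos.le
      have h6 : |k| < 1 := by exact_mod_cast h5
      exact Int.abs_lt_one_iff.1 h6
    have hfst : ∀ w : F × ℝ, ‖w.1‖ ≤ ‖w‖ := norm_fst_le
    rcases hzab with ⟨m, n, hza, hzb⟩ | ⟨m, n, hza, hzb⟩
    · have hd : z b - z a = (0, ((n - m : ℤ) : ℝ) * (2 * Real.pi)) + (ζ τ - p) := by
        rw [hza, hzb]; ext <;> simp
        ring
      have hQ : κ * Q b ≤ ‖ζ τ - p‖ := by
        refine hch.trans ?_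
        have : (z b).1 - (z a).1 = (ζ τ - p).1 := by rw [hza, hzb]; simp
        rw [this]; exact hfst _
      have hk := turn (n - m) (by rw [← hd]; exact hlen) hQ
      refine main ha (by rw [hza, char_periodic]) (Or.inl ?_) (by rw [le_div_iff₀ h.pos]; linarith)
      rw [hd, hk]; ext <;> simp
    · have hd : -(z b - z a) = (0, ((m - n : ℤ) : ℝ) * (2 * Real.pi)) + (ζ τ - p) := by
        rw [hza, hzb]; ext <;> simp
        ring
      have hQ : κ * Q b ≤ ‖ζ τ - p‖ := by
        refine hch.trans ?_
        have : (z b).1 - (z a).1 = -(ζ τ - p).1 := by rw [hza, hzb]; simp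
        rw [this, norm_neg]; exact hfst _
      have hk := turn (m - n) (by rw [← hd, norm_neg]; exact hlen) hQ
      refine main hb (by rw [hzb, char_periodic]) (Or.inr ?_) (by rw [le_div_iff₀ h.pos]; linarith)
      rw [← neg_eq_iff_eq_neg, hd, hk]; ext <;> simp
  -- hence `T v = 0`
  have hTd : HasDerivAt (fun τ => T (ζ τ - p)) (T v) 0 :=
    T.hasFDerivAt.comp_hasDerivAt (0 : ℝ) (hζd.sub_const p)
  have hTd0 : HasDerivAt (fun τ => T (ζ τ - p)) 0 0 := by
    have hO : (fun τ => ζ τ - p) =O[𝓝 0] fun τ : ℝ => τ := by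
      have := hζd.isBigO_sub
      simpa [hζ0] using this
    have h2 : (fun τ => T (ζ τ - p)) =O[𝓝 0] fun τ : ℝ => ‖ζ τ - p‖ ^ 2 :=
      Asymptotics.IsBigO.of_bound _ (hquad.mono fun τ hτ => by simpa using hτ)
    have h3 : (fun τ : ℝ => ‖ζ τ - p‖ ^ 2) =o[𝓝 0] fun τ : ℝ => τ := by
      have h4 : (fun τ : ℝ => ‖ζ τ - p‖ ^ 2) =O[𝓝 0] fun τ : ℝ => τ ^ 2 := hO.norm_left.pow 2
      exact h4.trans_isLittleO (by simpa using Asymptotics.isLittleO_pow_id (𝕜 := ℝ) one_lt_two)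
    rw [hasDerivAt_iff_isLittleO]
    simpa [hζ0] using h2.trans_isLittleO h3
  have hTv : T v = 0 := hTd.unique hTd0
  have : v - 𝓕.charCoeff p v • 𝓕.char p = 0 := by simpa [hT] using hTv
  exact sub_eq_zero.1 this

theorem mfderiv_char (h : 𝓕.IsFibration B W M κ f) {p : F × ℝ} (hp : p.1 ∈ W) :
    mfderiv 𝓘(ℝ, F × ℝ) 𝓘(ℝ, F) f p (𝓕.char p) = 0 := by
  have hsrc : f p ∈ (chartAt F (f p)).source := mem_chart_source F (f p)
  rw [← h.mfderiv_eq_zero_iff hp hsrc]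
  set L := fderiv ℝ (fun p' => extChartAt 𝓘(ℝ, F) (f p) (f p')) p with hL
  have h1 : LinearMap.ker L.toLinearMap ≠ ⊥ := by
    intro h0
    have := LinearMap.finrank_le_finrank_of_injective (LinearMap.ker_eq_bot.1 h0)
    simp at this
  obtain ⟨v, hv, hv0⟩ := Submodule.exists_mem_ne_zero_of_ne_bot h1
  have h2 := h.eq_smul_char_of_fderiv_eq_zero hp hv
  have h3 : 𝓕.charCoeff p v ≠ 0 := fun h0 => hv0 (by rw [h2, h0, zero_smul])
  have h4 : 𝓕.charCoeff p v • L (𝓕.char p) = 0 := by rw [← map_smul, ← h2]; exact hv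
  exact (smul_eq_zero.1 h4).resolve_left h3

theorem eq_smul_char_of_mfderiv_eq_zero (h : 𝓕.IsFibration B W M κ f) {p : F × ℝ} (hp : p.1 ∈ W)
    {v : F × ℝ} (hv : mfderiv 𝓘(ℝ, F × ℝ) 𝓘(ℝ, F) f p v = 0) :
    v = 𝓕.charCoeff p v • 𝓕.char p :=
  h.eq_smul_char_of_fderiv_eq_zero hp
    ((h.mfderiv_eq_zero_iff hp (mem_chart_source F (f p)) v).2 hv)

theorem fderiv_inChart_eq_zero (h : 𝓕.IsFibration B W M κ f) {p : F × ℝ} (hp : p.1 ∈ W)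
    (hy : f p ∈ (chartAt F y₁).source) {v : F × ℝ}
    (hv : fderiv ℝ (fun p => extChartAt 𝓘(ℝ, F) y₁ (f p)) p v = 0) :
    v = 𝓕.charCoeff p v • 𝓕.char p :=
  h.eq_smul_char_of_mfderiv_eq_zero hp ((h.mfderiv_eq_zero_iff hp hy v).1 hv)

theorem fderiv_inChart_char (h : 𝓕.IsFibration B W M κ f) {p : F × ℝ} (hp : p.1 ∈ W)
    (hy : f p ∈ (chartAt F y₁).source) :
    fderiv ℝ (fun p => extChartAt 𝓘(ℝ, F) y₁ (f p)) p (𝓕.char p) = 0 :=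
  (h.mfderiv_eq_zero_iff hp hy _).2 (h.mfderiv_char hp)

/-- The second derivative of `f` in a chart, in the direction `char`: differentiate
`Df (char) = 0`. -/
theorem fderiv_fderiv_inChart_char (h : 𝓕.IsFibration B W M κ f) {p : F × ℝ} (hp : p.1 ∈ W)
    (hy : f p ∈ (chartAt F y₁).source) (u : F × ℝ) :
    fderiv ℝ (fderiv ℝ (fun p => extChartAt 𝓘(ℝ, F) y₁ (f p))) p (𝓕.char p) u =
      -fderiv ℝ (fun p => extChartAt 𝓘(ℝ, F) y₁ (f p)) p (fderiv ℝ 𝓕.char p u) := by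
  set G : F × ℝ → F := fun p => extChartAt 𝓘(ℝ, F) y₁ (f p) with hG
  have hGs : ContDiffAt ℝ ∞ G p := h.contDiffAt_inChart hp hy
  have hd : DifferentiableAt ℝ (fderiv ℝ G) p :=
    (hGs.fderiv_right (m := ∞) (by simp)).differentiableAt (by simp)
  have hsymm : IsSymmSndFDerivAt ℝ G p := hGs.isSymmSndFDerivAt (by
    rw [minSmoothness_of_isRCLikeNormedField]; exact WithTop.coe_le_coe.2 le_top)
  have hchar : DifferentiableAt ℝ 𝓕.char p := differentiableAt_char (h.subset_domain hp)
  have h1 : HasFDerivAt (fun w => fderiv ℝ G w (𝓕.char w)) _ p :=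
    hd.hasFDerivAt.clm_apply hchar.hasFDerivAt
  have h2 : HasFDerivAt (fun w => fderiv ℝ G w (𝓕.char w)) (0 : F × ℝ →L[ℝ] F) p := by
    refine (hasFDerivAt_const (0 : F) p).congr_of_eventuallyEq ?_
    filter_upwards [h.eventually_mem_chartDomain hp hy] with w hw
    exact h.fderiv_inChart_char hw.1 hw.2
  have h3 := congrArg (fun L : F × ℝ →L[ℝ] F => L u) (h1.unique h2)
  simp only [add_apply, ContinuousLinearMap.comp_apply, ContinuousLinearMap.flip_apply,
    zero_apply] at h3
  rw [hsymm.eq, eq_neg_iff_add_eq_zero, ← h3]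
  abel

end IsFibration

end GrowthFrame

end CharFibration

/-! ### Uniqueness of the lift of a velocity -/

section Polar

/-- Polar coordinates along a `C¹` curve in the punctured plane. -/
theorem exists_polar_angle {a b : ℝ} (hab : a ≤ b) {u u' : ℝ → ℂ}
    (hu : ∀ t ∈ Icc a b, HasDerivWithinAt u (u' t) (Icc a b) t) (hu' : ContinuousOn u' (Icc a b))
    (hu0 : ∀ t ∈ Icc a b, u t ≠ 0) :
    ∃ θ θ' : ℝ → ℝ, ContinuousOn θ' (Icc a b) ∧
      (∀ t ∈ Icc a b, HasDerivWithinAt θ (θ' t) (Icc a b) t) ∧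
      ∀ t ∈ Icc a b, u t = (‖u t‖ : ℂ) * Complex.exp (θ t * Complex.I) := by
  have huc : ContinuousOn u (Icc a b) := fun t ht => (hu t ht).continuousWithinAt
  set w : ℝ → ℂ := fun t => u' t / u t with hw
  have hwc : ContinuousOn w (Icc a b) := hu'.div huc hu0
  set g : ℝ → ℂ := IccExtend hab ((Icc a b).domRestrict w) with hg
  have hgc : Continuous g := (continuousOn_iff_continuous_domRestrict.1 hwc).Icc_extend'
  have hgw : ∀ t ∈ Icc a b, g t = w t := fun t ht => by
    rw [hg, IccExtend_of_mem hab _ ht]; rfl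
  -- a logarithm of `u`
  set L : ℝ → ℂ := fun t => Complex.log (u a) + ∫ s in a..t, g s with hL
  have hLd : ∀ t, HasDerivAt L (g t) t := fun t =>
    (hgc.integral_hasStrictDerivAt a t).hasDerivAt.const_add _
  have hconst : ∀ t ∈ Icc a b, u t * Complex.exp (-L t) = 1 := by
    have hd : ∀ t ∈ Icc a b, HasDerivWithinAt (fun t => u t * Complex.exp (-L t)) 0
        (Icc a b) t := fun t ht => by
      have h1 := (hu t ht).mul ((hLd t).neg.cexp.hasDerivWithinAt (s := Icc a b))
      refine h1.congr_deriv ?_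
      rw [hgw t ht, hw]
      have := hu0 t ht
      field_simp
      ring
    intro t ht
    have h1 := constant_of_has_deriv_right_zero (f := fun t => u t * Complex.exp (-L t))
      (fun t ht => (hd t ht).continuousWithinAt)
      (fun t ht => (hd t (Ico_subset_Icc_self ht)).Ici_of_Icc ht) t ht
    rw [h1]
    have ha := hu0 a (left_mem_Icc.2 hab)
    simp only [hL, intervalIntegral.integral_same, add_zero, Complex.exp_neg,
      Complex.exp_log ha]
    exact mul_inv_cancel₀ ha
  have huL : ∀ t ∈ Icc a b, u t = Complex.exp (L t) := fun t ht => by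
    have := hconst t ht
    rw [Complex.exp_neg] at this
    exact eq_of_mul_inv_eq_one this
  refine ⟨fun t => (L t).im, fun t => (g t).im, (Complex.continuous_im.comp hgc).continuousOn,
    fun t ht => ?_, fun t ht => ?_⟩
  · exact (Complex.imCLM.hasFDerivAt.comp_hasDerivAt t (hLd t)).hasDerivWithinAt
  · rw [huL t ht, Complex.norm_exp, Complex.ofReal_exp, ← Complex.exp_add, Complex.re_add_im]

end Polar

section LeftInverse

theorem exists_smooth_left_inverse {E G : Type*} [NormedAddCommGroup E] [NormedSpace ℝ E]
    [FiniteDimensional ℝ E] [NormedAddCommGroup G] [NormedSpace ℝ G] [FiniteDimensional ℝ G]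
    {Ψ : E → G} {p : E} (hΨ : ContDiffAt ℝ ∞ Ψ p) (hinj : Function.Injective (fderiv ℝ Ψ p)) :
    ∃ H : G → E, ContDiffAt ℝ ∞ H (Ψ p) ∧ ∀ᶠ p' in 𝓝 p, H (Ψ p') = p' := by
  have : CompleteSpace E := FiniteDimensional.complete ℝ E
  obtain ⟨T₀, hT₀⟩ := (fderiv ℝ Ψ p : E →ₗ[ℝ] G).exists_leftInverse_of_injective
    (LinearMap.ker_eq_bot.2 hinj)
  let T : G →L[ℝ] E := LinearMap.toContinuousLinearMap T₀
  have hTΨ : ContDiffAt ℝ ∞ (fun p => T (Ψ p)) p := T.contDiff.contDiffAt.comp p hΨ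
  have hd : HasFDerivAt (fun p => T (Ψ p)) ((ContinuousLinearEquiv.refl ℝ E : E ≃L[ℝ] E) :
      E →L[ℝ] E) p := by
    refine (T.hasFDerivAt.comp p (hΨ.differentiableAt (by simp)).hasFDerivAt).congr_fderiv ?_
    ext v
    exact LinearMap.congr_fun hT₀ v
  have hs := hTΨ.hasStrictFDerivAt' hd (by simp)
  refine ⟨fun y => hTΨ.localInverse hd (by simp) (T y), ?_, ?_⟩
  · exact (hTΨ.to_localInverse hd (by simp)).comp (Ψ p) T.contDiff.contDiffAt
  · exact hs.eventually_left_inverse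

end LeftInverse

section CharFibration

namespace GrowthFrame.IsFibration

variable {F : Type*} [NormedAddCommGroup F] [NormedSpace ℝ F]
  {𝓕 : GrowthFrame F} {X : Type*} [TopologicalSpace X] [ChartedSpace F X]
  [IsManifold 𝓘(ℝ, F) ∞ X] {B W : Set F} {M κ : ℝ} {f : F × ℝ → X} {y₁ : X}

/-- The map that sends `(p, r)` to the image of `r • ∂/∂θ` at `p`, in a chart. -/
noncomputable def velocityMap (f : F × ℝ → X) (y₁ : X) (k : (F × ℝ) × ℝ) : F × F :=
  (extChartAt 𝓘(ℝ, F) y₁ (f k.1),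
    fderiv ℝ (fun p => extChartAt 𝓘(ℝ, F) y₁ (f p)) k.1 (0, k.2))

theorem contDiffAt_velocityMap (h : 𝓕.IsFibration B W M κ f) {k : (F × ℝ) × ℝ} (hk : k.1.1 ∈ W)
    (hy : f k.1 ∈ (chartAt F y₁).source) : ContDiffAt ℝ ∞ (velocityMap f y₁) k := by
  have hG := h.contDiffAt_inChart hk hy
  refine ContDiffAt.prodMk (hG.comp k contDiffAt_fst) ?_
  exact ((hG.fderiv_right (m := ∞) (by simp)).comp k contDiffAt_fst).clm_apply
    (contDiffAt_const.prodMk contDiffAt_snd)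

variable [FiniteDimensional ℝ F]

/-- Along a fibre, the images of `∂/∂θ` at different points are linearly independent: otherwise
a covector of the base, pulled back along the fibre, is a costate that vanishes on `∂/∂θ` at both
ends, against `IsCharCurve.costate_neg`. -/
theorem false_of_fderiv_eq (h : 𝓕.IsFibration B W M κ f) {a b : ℝ} {z : ℝ → F × ℝ} {q Q : ℝ → ℝ}
    (hz : 𝓕.IsCharCurve W a b z q Q) (hab : a < b) {y : X} (hy : y ∈ (chartAt F y₁).source)
    (hf : ∀ t ∈ Icc a b, f (z t) = y) {r r' : ℝ} (hr' : r' ≠ 0)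
    (heq : fderiv ℝ (fun p => extChartAt 𝓘(ℝ, F) y₁ (f p)) (z a) (0, r) =
      fderiv ℝ (fun p => extChartAt 𝓘(ℝ, F) y₁ (f p)) (z b) (0, r')) : False := by
  set G : F × ℝ → F := fun p => extChartAt 𝓘(ℝ, F) y₁ (f p) with hG
  have ha := left_mem_Icc.2 hz.le
  have hb := right_mem_Icc.2 hz.le
  have hsrc : ∀ t ∈ Icc a b, f (z t) ∈ (chartAt F y₁).source := fun t ht => by
    rw [hf t ht]; exact hy
  have haΩ := h.subset_domain (hz.mem a ha)
  set ν : F × ℝ →L[ℝ] ℝ := (-Real.sin (z a).2 • 𝓕.α 0 (z a).1 +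
    Real.cos (z a).2 • 𝓕.α 1 (z a).1).comp (ContinuousLinearMap.fst ℝ F ℝ) with hν
  have hνchar : ν (𝓕.char (z a)) = 0 := by
    simp [hν, char, ell, dualA haΩ, dualB haΩ]
    ring
  -- `ν` descends to a covector `c` on the base
  obtain ⟨R, hR⟩ := (fderiv ℝ G (z a) : F × ℝ →ₗ[ℝ] F).exists_rightInverse_of_surjective
    (LinearMap.range_eq_top.2 (h.surjective_fderiv_inChart (hz.mem a ha) (hsrc a ha)))
  set c : F →L[ℝ] ℝ := LinearMap.toContinuousLinearMap (ν.toLinearMap.comp R) with hc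
  have hcν : c.comp (fderiv ℝ G (z a)) = ν := by
    refine ContinuousLinearMap.ext fun v => ?_
    have h1 : fderiv ℝ G (z a) (v - R (fderiv ℝ G (z a) v)) = 0 := by
      rw [map_sub, sub_eq_zero]
      exact (LinearMap.congr_fun hR (fderiv ℝ G (z a) v)).symm
    have h2 := h.fderiv_inChart_eq_zero (hz.mem a ha) (hsrc a ha) h1
    have h3 : ν (v - R (fderiv ℝ G (z a) v)) = 0 := by rw [h2, map_smul, hνchar, smul_zero]
    rw [map_sub, sub_eq_zero] at h3
    exact h3.symm
  have hneg := (hz.mono_set h.subset).costate_neg h.bound hab (h.length_le hz)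
    (l := fun t => c.comp (fderiv ℝ G (z t))) (fun t ht => by
      have hGs := h.contDiffAt_inChart (hz.mem t ht) (hsrc t ht)
      have hd : HasFDerivAt (fderiv ℝ G) (fderiv ℝ (fderiv ℝ G) (z t)) (z t) :=
        ((hGs.fderiv_right (m := ∞) (by simp)).differentiableAt (by simp)).hasFDerivAt
      have h1 := (hasDerivWithinAt_const t (Icc a b) c).clm_comp
        (hd.comp_hasDerivWithinAt t (hz.deriv t ht))
      refine h1.congr_deriv ?_
      refine ContinuousLinearMap.ext fun u => ?_
      have h2 := h.fderiv_fderiv_inChart_char (hz.mem t ht) (hsrc t ht) u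
      simp only [ContinuousLinearMap.zero_comp, zero_add, map_smul, ContinuousLinearMap.comp_apply,
        smul_apply, neg_apply]
      rw [h2, map_neg, smul_neg]) hcν
  have h1 : r' * c (fderiv ℝ G (z b) (0, 1)) = 0 := by
    have e1 : ((0 : F), r') = r' • ((0 : F), (1 : ℝ)) := by ext <;> simp
    have e2 : c (fderiv ℝ G (z b) (0, r')) = r' * c (fderiv ℝ G (z b) (0, 1)) := by
      rw [e1, map_smul, map_smul, smul_eq_mul]
    rw [← e2, ← heq]
    have e3 := congrArg (fun L : F × ℝ →L[ℝ] ℝ => L (0, r)) hcν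
    simp only [ContinuousLinearMap.comp_apply] at e3
    rw [e3]; simp [hν]
  exact hneg.ne ((mul_eq_zero.1 h1).resolve_left hr')

theorem fderiv_inChart_const_ne_zero (h : 𝓕.IsFibration B W M κ f) {p : F × ℝ} (hp : p.1 ∈ W)
    (hy : f p ∈ (chartAt F y₁).source) {r : ℝ}
    (hr : fderiv ℝ (fun p => extChartAt 𝓘(ℝ, F) y₁ (f p)) p (0, r) = 0) : r = 0 := by
  have h1 := h.fderiv_inChart_eq_zero hp hy hr
  rw [charCoeff_const, zero_smul] at h1
  exact congrArg Prod.snd h1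

/-- A vector of the base is the image of a multiple of `∂/∂θ` at not more than one oriented
line. -/
theorem eq_of_fderiv_eq (h : 𝓕.IsFibration B W M κ f) {p p' : F × ℝ} (hp : p.1 ∈ W)
    (hp' : p'.1 ∈ W) (hf : f p = f p') (hy : f p ∈ (chartAt F y₁).source) {r r' : ℝ} (hr : r ≠ 0)
    (heq : fderiv ℝ (fun p => extChartAt 𝓘(ℝ, F) y₁ (f p)) p (0, r) =
      fderiv ℝ (fun p => extChartAt 𝓘(ℝ, F) y₁ (f p)) p' (0, r')) :
    (∃ m : ℤ, p' = p + (0, m * (2 * Real.pi))) ∧ r' = r := by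
  have hr' : r' ≠ 0 := by
    rintro rfl
    exact hr (h.fderiv_inChart_const_ne_zero hp hy (heq.trans (map_zero _)))
  have hpp' : ∃ m : ℤ, p' = p + (0, m * (2 * Real.pi)) := by
    obtain ⟨a, b, z, q, Q, hz, hfz, hzab⟩ := h.fibre p p' hp hp' hf
    rcases hz.le.eq_or_lt with rfl | hab
    · rcases hzab with ⟨m, n, hm, hn⟩ | ⟨m, n, hm, hn⟩
      · refine ⟨m - n, ?_⟩
        have : p + (0, m * (2 * Real.pi)) = p' + (0, n * (2 * Real.pi)) := hm.symm.trans hn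
        rw [← sub_eq_iff_eq_add] at this
        rw [← this]; ext <;> simp
        ring
      · refine ⟨n - m, ?_⟩
        have : p' + (0, m * (2 * Real.pi)) = p + (0, n * (2 * Real.pi)) := hm.symm.trans hn
        rw [← eq_sub_iff_add_eq] at this
        rw [this]; ext <;> simp
        ring
    · exfalso
      rcases hzab with ⟨m, n, hm, hn⟩ | ⟨m, n, hm, hn⟩
      · exact h.false_of_fderiv_eq hz hab hy hfz hr' (r := r) (by
          rw [hm, hn, h.inChart_periodic, h.inChart_periodic, heq])
      · exact h.false_of_fderiv_eq hz hab hy hfz hr (r := r') (by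
          rw [hm, hn, h.inChart_periodic, h.inChart_periodic, heq])
  refine ⟨hpp', ?_⟩
  obtain ⟨m, rfl⟩ := hpp'
  rw [h.inChart_periodic, ← sub_eq_zero, ← map_sub] at heq
  have e : ((0 : F), r) - (0, r') = (0, r - r') := by ext <;> simp
  rw [e] at heq
  have := h.fderiv_inChart_const_ne_zero hp hy heq
  linarith

/-- The velocity map is an immersion away from the zero section, because `char` and its bracket
with `∂/∂θ` are independent modulo `∂/∂θ`. -/
theorem injective_fderiv_velocityMap (h : 𝓕.IsFibration B W M κ f) {k : (F × ℝ) × ℝ}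
    (hk : k.1.1 ∈ W) (hy : f k.1 ∈ (chartAt F y₁).source) (hr : k.2 ≠ 0) :
    Function.Injective (fderiv ℝ (velocityMap f y₁) k) := by
  set G : F × ℝ → F := fun p => extChartAt 𝓘(ℝ, F) y₁ (f p) with hG
  have hGs : ContDiffAt ℝ ∞ G k.1 := h.contDiffAt_inChart hk hy
  have hkΩ := h.subset_domain hk
  rw [injective_iff_map_eq_zero]
  intro v hv
  have hG1 : HasFDerivAt G (fderiv ℝ G k.1) k.1 := (hGs.differentiableAt (by simp)).hasFDerivAt
  have hG2 : HasFDerivAt (fderiv ℝ G) (fderiv ℝ (fderiv ℝ G) k.1) k.1 :=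
    ((hGs.fderiv_right (m := ∞) (by simp)).differentiableAt (by simp)).hasFDerivAt
  have d1 : HasFDerivAt (fun k : (F × ℝ) × ℝ => G k.1)
      ((fderiv ℝ G k.1).comp (ContinuousLinearMap.fst ℝ (F × ℝ) ℝ)) k :=
    hG1.comp k hasFDerivAt_fst
  have d2 : HasFDerivAt (fun k : (F × ℝ) × ℝ => fderiv ℝ G k.1 ((0 : F), k.2)) _ k :=
    HasFDerivAt.clm_apply (hG2.comp k hasFDerivAt_fst)
      (((ContinuousLinearMap.inr ℝ F ℝ).hasFDerivAt (x := k.2)).comp k hasFDerivAt_snd)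
  have d := d1.prodMk d2
  have hv' : fderiv ℝ (velocityMap f y₁) k v = _ :=
    congrArg (fun L : (F × ℝ) × ℝ →L[ℝ] F × F => L v) (HasFDerivAt.fderiv d)
  rw [hv] at hv'
  have e1 : fderiv ℝ G k.1 v.1 = 0 := (congrArg Prod.fst hv').symm
  have e2 := (congrArg Prod.snd hv').symm
  simp only [ContinuousLinearMap.prod_apply, add_apply, ContinuousLinearMap.comp_apply,
    ContinuousLinearMap.flip_apply, ContinuousLinearMap.coe_fst', ContinuousLinearMap.coe_snd',
    ContinuousLinearMap.inr_apply, Prod.snd_zero] at e2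
  have e3 := h.fderiv_inChart_eq_zero hk hy e1
  set s := 𝓕.charCoeff k.1 v.1
  rw [e3, map_smul, smul_apply, h.fderiv_fderiv_inChart_char hk hy] at e2
  have e4 : fderiv ℝ G k.1 ((0, v.2) - (s * k.2) • 𝓕.charDeriv k.1) = 0 := by
    have : fderiv ℝ 𝓕.char k.1 (0, k.2) = k.2 • 𝓕.charDeriv k.1 := by
      rw [charDeriv, ← map_smul]; congr 1; ext <;> simp
    rw [this, map_smul] at e2
    rw [smul_neg, smul_smul, ← sub_eq_add_neg] at e2
    rw [map_sub, map_smul]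
    exact e2
  have e5 := congrArg Prod.fst (h.fderiv_inChart_eq_zero hk hy e4)
  simp only [Prod.fst_sub, Prod.smul_fst, charDeriv_fst hkΩ, zero_sub] at e5
  set c := 𝓕.charCoeff k.1 ((0, v.2) - (s * k.2) • 𝓕.charDeriv k.1)
  have e6 : c • 𝓕.ell k.1 + (s * k.2) • 𝓕.ell' k.1 = 0 := by
    change -((s * k.2) • 𝓕.ell' k.1) = c • 𝓕.ell k.1 at e5
    rw [← e5]; abel
  obtain ⟨-, e7⟩ := eq_zero_of_ell_add_ell'_eq_zero hkΩ _ _ e6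
  have e8 : s = 0 := (mul_eq_zero.1 e7).resolve_right hr
  have e9 : v.1 = 0 := by rw [e3, e8, zero_smul]
  rw [e8, zero_mul, zero_smul, sub_zero] at e4
  exact Prod.ext e9 (h.fderiv_inChart_const_ne_zero hk hy e4)

end GrowthFrame.IsFibration

end CharFibration

/-! ### Lifting curves that move along the cone -/

theorem frequently_of_ae_Icc {a b : ℝ} (hab : a < b) {p : ℝ → Prop}
    (hp : ∀ᵐ t ∂(volume.restrict (Icc a b)), p t) {t₀ : ℝ} (ht₀ : t₀ ∈ Icc a b) :
    ∃ᶠ t in 𝓝 t₀, t ∈ Icc a b ∧ p t := by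
  intro hno
  rw [ae_restrict_iff' measurableSet_Icc] at hp
  obtain ⟨O, hO, hOo, htO⟩ := eventually_nhds_iff.1 hno
  have hne : (O ∩ Ioo a b).Nonempty := by
    rw [← closure_Ioo hab.ne] at ht₀
    exact mem_closure_iff.1 ht₀ O hOo htO
  refine ((hOo.inter isOpen_Ioo).measure_pos volume hne).ne' (measure_mono_null ?_ hp)
  exact fun t ht hh => hO t ht.1 ⟨Ioo_subset_Icc_self ht.2, hh (Ioo_subset_Icc_self ht.2)⟩

section VelocityLift

variable {F : Type*} [NormedAddCommGroup F] [NormedSpace ℝ F]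
  {𝓕 : GrowthFrame F} {X : Type*} [TopologicalSpace X] [ChartedSpace F X]
  {B W : Set F} {M κ : ℝ} {f : F × ℝ → X} {y₁ : X} {γ : ℝ → X} {a b t : ℝ}

/-- The velocity of `γ` at time `t` is the image under `f` of `r • ∂/∂θ` at `p`, where
`k = (p, r)`. -/
def IsVelocityLift (f : F × ℝ → X) (γ : ℝ → X) (a b t : ℝ) (k : (F × ℝ) × ℝ) : Prop :=
  HasVelocityWithinAt 𝓘(ℝ, F) γ (Icc a b) t
    (tangentMap 𝓘(ℝ, F × ℝ) 𝓘(ℝ, F) f (⟨k.1, (0, k.2)⟩ : TangentBundle 𝓘(ℝ, F × ℝ) (F × ℝ)))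

theorem IsVelocityLift.ne_zero (hab : a < b) (ht : t ∈ Icc a b)
    (hγ' : mfderivWithin 𝓘(ℝ, ℝ) 𝓘(ℝ, F) γ (Icc a b) t ≠ 0)
    {k : (F × ℝ) × ℝ} (hl : IsVelocityLift f γ a b t k) : k.2 ≠ 0 := by
  intro h0
  apply hγ'
  have h1 := hl.2.mfderivWithin
    (uniqueMDiffWithinAt_iff_uniqueDiffWithinAt.2 (uniqueDiffOn_Icc hab t ht))
  have h2 : (mfderiv 𝓘(ℝ, F × ℝ) 𝓘(ℝ, F) f k.1 : F × ℝ →L[ℝ] F) (0, k.2) = 0 := by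
    rw [h0]; exact map_zero _
  refine h1.trans ?_
  change (1 : ℝ →L[ℝ] ℝ).smulRight
    ((mfderiv 𝓘(ℝ, F × ℝ) 𝓘(ℝ, F) f k.1 : F × ℝ →L[ℝ] F) (0, k.2)) = 0
  rw [h2]; ext; simp

variable [IsManifold 𝓘(ℝ, F) ∞ X]

theorem contDiffWithinAt_inChart {y₁ : X} (hγ : ContMDiffOn 𝓘(ℝ, ℝ) 𝓘(ℝ, F) ∞ γ (Icc a b))
    (ht : t ∈ Icc a b) (hy : γ t ∈ (chartAt F y₁).source) :
    ContDiffWithinAt ℝ ∞ (fun t => extChartAt 𝓘(ℝ, F) y₁ (γ t)) (Icc a b) t :=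
  contMDiffWithinAt_iff_contDiffWithinAt.1
    ((contMDiffAt_extChartAt' (n := ∞) hy).comp_contMDiffWithinAt t (hγ t ht))

theorem contDiffWithinAt_derivWithin_inChart {y₁ : X} (hab : a < b)
    (hγ : ContMDiffOn 𝓘(ℝ, ℝ) 𝓘(ℝ, F) ∞ γ (Icc a b))
    (ht : t ∈ Icc a b) (hy : γ t ∈ (chartAt F y₁).source) :
    ContDiffWithinAt ℝ ∞ (derivWithin (fun t => extChartAt 𝓘(ℝ, F) y₁ (γ t)) (Icc a b))
      (Icc a b) t := by
  have h1 := (contDiffWithinAt_inChart hγ ht hy).fderivWithin_right (m := ∞)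
    (uniqueDiffOn_Icc hab) (by simp) ht
  exact h1.clm_apply contDiffWithinAt_const

namespace GrowthFrame.IsFibration

theorem isVelocityLift_iff (h : 𝓕.IsFibration B W M κ f) (hab : a < b)
    (hγ : MDifferentiableWithinAt 𝓘(ℝ, ℝ) 𝓘(ℝ, F) γ (Icc a b) t) (ht : t ∈ Icc a b)
    {k : (F × ℝ) × ℝ} (hk : k.1.1 ∈ W) (hy : γ t ∈ (chartAt F y₁).source) :
    IsVelocityLift f γ a b t k ↔ f k.1 = γ t ∧
      fderiv ℝ (fun p => extChartAt 𝓘(ℝ, F) y₁ (f p)) k.1 (0, k.2) =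
        derivWithin (fun t => extChartAt 𝓘(ℝ, F) y₁ (γ t)) (Icc a b) t := by
  have hχ : HasMFDerivAt 𝓘(ℝ, F) 𝓘(ℝ, F) (extChartAt 𝓘(ℝ, F) y₁) (γ t)
      (mfderiv 𝓘(ℝ, F) 𝓘(ℝ, F) (extChartAt 𝓘(ℝ, F) y₁) (γ t)) :=
    ((contMDiffAt_extChartAt' (n := ∞) hy).mdifferentiableAt (by simp)).hasMFDerivAt
  have hu := uniqueDiffOn_Icc hab t ht
  set dχ : F →L[ℝ] F := mfderiv 𝓘(ℝ, F) 𝓘(ℝ, F) (extChartAt 𝓘(ℝ, F) y₁) (γ t) with hdχ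
  set dγ : ℝ →L[ℝ] F := mfderivWithin 𝓘(ℝ, ℝ) 𝓘(ℝ, F) γ (Icc a b) t with hdγ
  set w : F := (mfderiv 𝓘(ℝ, F × ℝ) 𝓘(ℝ, F) f k.1 : F × ℝ →L[ℝ] F) (0, k.2) with hw
  have hcomp : HasFDerivWithinAt (fun t => extChartAt 𝓘(ℝ, F) y₁ (γ t)) (dχ.comp dγ)
      (Icc a b) t := (hχ.comp_hasMFDerivWithinAt t hγ.hasMFDerivWithinAt).hasFDerivWithinAt
  have hd : derivWithin (fun t => extChartAt 𝓘(ℝ, F) y₁ (γ t)) (Icc a b) t = dχ (dγ 1) :=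
    hcomp.hasDerivWithinAt.derivWithin hu
  have hbase : ∀ y y' : X, y = y' →
      (mfderiv 𝓘(ℝ, F) 𝓘(ℝ, F) (extChartAt 𝓘(ℝ, F) y₁) y : F →L[ℝ] F) =
        mfderiv 𝓘(ℝ, F) 𝓘(ℝ, F) (extChartAt 𝓘(ℝ, F) y₁) y' := by
    rintro y _ rfl; rfl
  have hG : f k.1 = γ t →
      fderiv ℝ (fun p => extChartAt 𝓘(ℝ, F) y₁ (f p)) k.1 (0, k.2) = dχ w := fun hf => by
    rw [h.fderiv_inChart hk (by rw [hf]; exact hy)]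
    exact congrArg (fun L : F →L[ℝ] F => L w) (hbase _ _ hf)
  have hone : (1 : ℝ →L[ℝ] ℝ).smulRight w 1 = w := by simp
  obtain ⟨e, he⟩ := isInvertible_mfderiv_extChartAt (I := 𝓘(ℝ, F)) (x := y₁) (y := γ t)
    (by simpa using hy)
  have hinj : Function.Injective dχ := by rw [hdχ, ← he]; exact e.injective
  constructor
  · rintro ⟨hf, hv⟩
    refine ⟨hf, ?_⟩
    rw [hd, hG hf]
    have h1 : dγ = (1 : ℝ →L[ℝ] ℝ).smulRight w :=
      hv.mfderivWithin (uniqueMDiffWithinAt_iff_uniqueDiffWithinAt.2 hu)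
    rw [h1, hone]
  · rintro ⟨hf, hv⟩
    refine ⟨hf, ?_⟩
    rw [hd, hG hf] at hv
    have h1 : dγ = (1 : ℝ →L[ℝ] ℝ).smulRight w :=
      ContinuousLinearMap.ext_ring ((hinj hv).symm.trans hone.symm)
    have h3 := hγ.hasMFDerivWithinAt
    exact h1 ▸ h3

theorem isVelocityLift_periodic (h : 𝓕.IsFibration B W M κ f) (hab : a < b)
    (hγ : MDifferentiableWithinAt 𝓘(ℝ, ℝ) 𝓘(ℝ, F) γ (Icc a b) t) (ht : t ∈ Icc a b)
    {p : F × ℝ} {r : ℝ} (hp : p.1 ∈ W) (hl : IsVelocityLift f γ a b t (p, r)) (m : ℤ) :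
    IsVelocityLift f γ a b t (p + (0, m * (2 * Real.pi)), r) := by
  rw [h.isVelocityLift_iff hab hγ ht (by simpa using hp) (mem_chart_source F (γ t))] at hl ⊢
  exact ⟨(h.periodic' p m).trans hl.1,
    (congrArg (fun L : F × ℝ →L[ℝ] F => L (0, r)) (h.inChart_periodic p m)).trans hl.2⟩

/-- The relation `IsVelocityLift` is closed. -/
theorem eventually_not_isVelocityLift [T2Space X] (h : 𝓕.IsFibration B W M κ f) (hab : a < b)
    (hγ : ContMDiffOn 𝓘(ℝ, ℝ) 𝓘(ℝ, F) ∞ γ (Icc a b)) {t₀ : ℝ} (ht₀ : t₀ ∈ Icc a b)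
    {k : (F × ℝ) × ℝ} (hk : k.1.1 ∈ W) (hl : ¬ IsVelocityLift f γ a b t₀ k) :
    ∀ᶠ z in 𝓝 (t₀, k), z.1 ∈ Icc a b → ¬ IsVelocityLift f γ a b z.1 z.2 := by
  have hmd : ∀ t ∈ Icc a b, MDifferentiableWithinAt 𝓘(ℝ, ℝ) 𝓘(ℝ, F) γ (Icc a b) t :=
    fun t ht => (hγ t ht).mdifferentiableWithinAt (by simp)
  have hfk : ContinuousAt f k.1 := (h.contMDiffAt hk).continuousAt
  have h1 : Tendsto (fun z : ℝ × ((F × ℝ) × ℝ) => γ z.1) (𝓝[Icc a b ×ˢ univ] (t₀, k))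
      (𝓝 (γ t₀)) :=
    (hγ t₀ ht₀).continuousWithinAt.tendsto.comp (by
      rw [nhdsWithin_prod_eq]; exact tendsto_fst)
  have h2 : Tendsto (fun z : ℝ × ((F × ℝ) × ℝ) => f z.2.1) (𝓝[Icc a b ×ˢ univ] (t₀, k))
      (𝓝 (f k.1)) := by
    have : ContinuousAt (fun z : ℝ × ((F × ℝ) × ℝ) => f z.2.1) (t₀, k) :=
      ContinuousAt.comp (f := fun z : ℝ × ((F × ℝ) × ℝ) => z.2.1) (g := f) hfk (by fun_prop)
    exact this.tendsto.mono_left nhdsWithin_le_nhds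
  have hW : ∀ᶠ z : ℝ × ((F × ℝ) × ℝ) in 𝓝[Icc a b ×ˢ univ] (t₀, k), z.2.1.1 ∈ W := by
    have : ContinuousAt (fun z : ℝ × ((F × ℝ) × ℝ) => z.2.1.1) (t₀, k) := by fun_prop
    exact (this.eventually_mem (h.isOpen.mem_nhds hk)).filter_mono nhdsWithin_le_nhds
  suffices ∀ᶠ z in 𝓝[Icc a b ×ˢ univ] (t₀, k), ¬ IsVelocityLift f γ a b z.1 z.2 by
    rw [eventually_nhdsWithin_iff] at this
    exact this.mono fun z hz hzt => hz ⟨hzt, mem_univ _⟩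
  by_cases hf : f k.1 = γ t₀
  · have hsrc := mem_chart_source F (γ t₀)
    have hd : fderiv ℝ (fun p => extChartAt 𝓘(ℝ, F) (γ t₀) (f p)) k.1 (0, k.2) ≠
        derivWithin (fun t => extChartAt 𝓘(ℝ, F) (γ t₀) (γ t)) (Icc a b) t₀ := fun hd =>
      hl ((h.isVelocityLift_iff hab (hmd t₀ ht₀) ht₀ hk hsrc).2 ⟨hf, hd⟩)
    have h3 : Tendsto (fun z : ℝ × ((F × ℝ) × ℝ) =>
        derivWithin (fun t => extChartAt 𝓘(ℝ, F) (γ t₀) (γ t)) (Icc a b) z.1)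
        (𝓝[Icc a b ×ˢ univ] (t₀, k))
        (𝓝 (derivWithin (fun t => extChartAt 𝓘(ℝ, F) (γ t₀) (γ t)) (Icc a b) t₀)) :=
      (contDiffWithinAt_derivWithin_inChart hab hγ ht₀ hsrc).continuousWithinAt.tendsto.comp (by
        rw [nhdsWithin_prod_eq]; exact tendsto_fst)
    have h4 : Tendsto (fun z : ℝ × ((F × ℝ) × ℝ) =>
        fderiv ℝ (fun p => extChartAt 𝓘(ℝ, F) (γ t₀) (f p)) z.2.1 (0, z.2.2))
        (𝓝[Icc a b ×ˢ univ] (t₀, k))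
        (𝓝 (fderiv ℝ (fun p => extChartAt 𝓘(ℝ, F) (γ t₀) (f p)) k.1 (0, k.2))) := by
      have e1 := (contDiffAt_velocityMap h hk (y₁ := γ t₀) (by rw [hf]; exact hsrc)).continuousAt
      have e2 : ContinuousAt (fun z : ℝ × ((F × ℝ) × ℝ) => velocityMap f (γ t₀) z.2) (t₀, k) :=
        ContinuousAt.comp (g := velocityMap f (γ t₀)) e1 continuousAt_snd
      exact ((continuous_snd.continuousAt.comp e2).tendsto).mono_left nhdsWithin_le_nhds
    filter_upwards [(h4.prodMk_nhds h3).eventually (isClosed_diagonal.isOpen_compl.mem_nhds hd), hW,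
      self_mem_nhdsWithin,
      h1.eventually_mem ((chartAt F (γ t₀)).open_source.mem_nhds hsrc)] with z hz hzW hzI hzs hzl
    exact hz ((h.isVelocityLift_iff hab (hmd _ hzI.1) hzI.1 hzW hzs).1 hzl).2
  · filter_upwards [(h2.prodMk_nhds h1).eventually
      (isClosed_diagonal.isOpen_compl.mem_nhds hf)] with z hz hzl
    exact hz hzl.1

/-- If the velocity of `γ` has lifts in a compact set at almost all times then it has one at all
times. -/
theorem exists_isVelocityLift [T2Space X] (h : 𝓕.IsFibration B W M κ f) (hab : a < b)
    (hγ : ContMDiffOn 𝓘(ℝ, ℝ) 𝓘(ℝ, F) ∞ γ (Icc a b)) {K : Set ((F × ℝ) × ℝ)} (hK : IsCompact K)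
    (hKW : ∀ k ∈ K, k.1.1 ∈ W)
    (hl : ∀ᵐ t ∂(volume.restrict (Icc a b)), ∃ k ∈ K, IsVelocityLift f γ a b t k) :
    ∀ t ∈ Icc a b, ∃ k ∈ K, IsVelocityLift f γ a b t k := by
  intro t₀ ht₀
  by_contra! hno
  have h1 : ∀ᶠ t in 𝓝 t₀, ∀ k ∈ K, t ∈ Icc a b → ¬ IsVelocityLift f γ a b t k :=
    hK.eventually_forall_of_forall_eventually
      (P := fun t k => t ∈ Icc a b → ¬ IsVelocityLift f γ a b t k)
      fun k hk => h.eventually_not_isVelocityLift hab hγ ht₀ (hKW k hk) (hno k hk)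
  obtain ⟨t, ⟨ht, k, hk, hkl⟩, hnot⟩ :=
    ((frequently_of_ae_Icc hab hl ht₀).and_eventually h1).exists
  exact hnot k hk ht hkl

variable [FiniteDimensional ℝ F]

theorem isVelocityLift_unique (h : 𝓕.IsFibration B W M κ f) (hab : a < b)
    (hγ : MDifferentiableWithinAt 𝓘(ℝ, ℝ) 𝓘(ℝ, F) γ (Icc a b) t) (ht : t ∈ Icc a b)
    (hγ' : mfderivWithin 𝓘(ℝ, ℝ) 𝓘(ℝ, F) γ (Icc a b) t ≠ 0)
    {k k' : (F × ℝ) × ℝ} (hk : k.1.1 ∈ W) (hk' : k'.1.1 ∈ W) (hl : IsVelocityLift f γ a b t k)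
    (hl' : IsVelocityLift f γ a b t k') :
    ∃ m : ℤ, k' = (k.1 + (0, m * (2 * Real.pi)), k.2) := by
  have hr := hl.ne_zero hab ht hγ'
  rw [h.isVelocityLift_iff hab hγ ht hk (mem_chart_source F (γ t))] at hl
  rw [h.isVelocityLift_iff hab hγ ht hk' (mem_chart_source F (γ t))] at hl'
  obtain ⟨⟨m, hm⟩, hr'⟩ := h.eq_of_fderiv_eq hk hk' (hl.1.trans hl'.1.symm)
    (by rw [hl.1]; exact mem_chart_source F (γ t)) hr (hl.2.trans hl'.2.symm)
  exact ⟨m, Prod.ext hm hr'⟩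

/-- Lifts of the velocities of a smooth immersed curve, in a compact set, can be chosen smoothly
near every time: they are unique up to a full turn of the angle, so they depend continuously on
time, and the velocity map is an immersion. -/
theorem exists_smooth_isVelocityLift [T2Space X] (h : 𝓕.IsFibration B W M κ f) (hab : a < b)
    (hγ : ContMDiffOn 𝓘(ℝ, ℝ) 𝓘(ℝ, F) ∞ γ (Icc a b))
    (hγ' : ∀ t ∈ Icc a b, mfderivWithin 𝓘(ℝ, ℝ) 𝓘(ℝ, F) γ (Icc a b) t ≠ 0)
    {K : Set ((F × ℝ) × ℝ)} (hK : IsCompact K) (hKW : ∀ k ∈ K, k.1.1 ∈ W)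
    (hl : ∀ t ∈ Icc a b, ∃ k ∈ K, IsVelocityLift f γ a b t k) {t₀ : ℝ} (ht₀ : t₀ ∈ Icc a b) :
    ∃ k : ℝ → (F × ℝ) × ℝ, ContDiffWithinAt ℝ ∞ k (Icc a b) t₀ ∧
      ∀ᶠ t in 𝓝[Icc a b] t₀, (k t).1.1 ∈ W ∧ IsVelocityLift f γ a b t (k t) := by
  have hmd : ∀ t ∈ Icc a b, MDifferentiableWithinAt 𝓘(ℝ, ℝ) 𝓘(ℝ, F) γ (Icc a b) t :=
    fun t ht => (hγ t ht).mdifferentiableWithinAt (by simp)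
  have hsrc := mem_chart_source F (γ t₀)
  obtain ⟨k₀, hk₀K, hk₀⟩ := hl t₀ ht₀
  have hk₀W := hKW k₀ hk₀K
  have hf₀ : f k₀.1 = γ t₀ := hk₀.1
  have hsrc₀ : f k₀.1 ∈ (chartAt F (γ t₀)).source := by rw [hf₀]; exact hsrc
  obtain ⟨H, hH, hHΨ⟩ := exists_smooth_left_inverse (contDiffAt_velocityMap h hk₀W hsrc₀)
    (h.injective_fderiv_velocityMap hk₀W hsrc₀
      (hk₀.ne_zero hab ht₀ (hγ' t₀ ht₀)))
  have hN : ∀ᶠ k in 𝓝 k₀, H (velocityMap f (γ t₀) k) = k ∧ k.1.1 ∈ W := by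
    have : ContinuousAt (fun k : (F × ℝ) × ℝ => k.1.1) k₀ := by fun_prop
    exact hHΨ.and (this.eventually_mem (h.isOpen.mem_nhds hk₀W))
  have h1 : ∀ᶠ t in 𝓝 t₀, ∀ k ∈ K, t ∈ Icc a b → IsVelocityLift f γ a b t k →
      ∃ m : ℤ, H (velocityMap f (γ t₀) (k.1 + (0, m * (2 * Real.pi)), k.2)) =
        (k.1 + (0, m * (2 * Real.pi)), k.2) ∧ k.1.1 ∈ W := by
    refine hK.eventually_forall_of_forall_eventually (P := fun t k => t ∈ Icc a b →
      IsVelocityLift f γ a b t k → ∃ m : ℤ, H (velocityMap f (γ t₀)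
        (k.1 + (0, m * (2 * Real.pi)), k.2)) = (k.1 + (0, m * (2 * Real.pi)), k.2) ∧ k.1.1 ∈ W)
      fun k hk => ?_
    by_cases hkl : IsVelocityLift f γ a b t₀ k
    · obtain ⟨m, hm⟩ := h.isVelocityLift_unique hab (hmd t₀ ht₀) ht₀ (hγ' t₀ ht₀) (hKW k hk) hk₀W
        hkl hk₀
      have hc : ContinuousAt (fun z : ℝ × ((F × ℝ) × ℝ) =>
          (z.2.1 + (0, m * (2 * Real.pi)), z.2.2)) (t₀, k) := by fun_prop
      have : ∀ᶠ z : ℝ × ((F × ℝ) × ℝ) in 𝓝 (t₀, k),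
          H (velocityMap f (γ t₀) (z.2.1 + (0, m * (2 * Real.pi)), z.2.2)) =
            (z.2.1 + (0, m * (2 * Real.pi)), z.2.2) ∧
            (z.2.1 + ((0, m * (2 * Real.pi)) : F × ℝ)).1 ∈ W := by
        refine hc.tendsto.eventually
          (p := fun k => H (velocityMap f (γ t₀) k) = k ∧ k.1.1 ∈ W) ?_
        change ∀ᶠ k in 𝓝 (k.1 + (0, m * (2 * Real.pi)), k.2), _
        rw [← hm]; exact hN
      filter_upwards [this] with z hz _ _
      exact ⟨m, hz.1, by simpa using hz.2⟩
    · filter_upwards [h.eventually_not_isVelocityLift hab hγ ht₀ (hKW k hk) hkl] with z hz hzt hzl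
      exact absurd hzl (hz hzt)
  set v : ℝ → F × F := fun t => (extChartAt 𝓘(ℝ, F) (γ t₀) (γ t),
    derivWithin (fun t => extChartAt 𝓘(ℝ, F) (γ t₀) (γ t)) (Icc a b) t) with hv
  have hvs : ContDiffWithinAt ℝ ∞ v (Icc a b) t₀ :=
    (contDiffWithinAt_inChart hγ ht₀ hsrc).prodMk
      (contDiffWithinAt_derivWithin_inChart hab hγ ht₀ hsrc)
  have hv₀ : v t₀ = velocityMap f (γ t₀) k₀ := by
    have := (h.isVelocityLift_iff hab (hmd t₀ ht₀) ht₀ hk₀W hsrc).1 hk₀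
    simp only [hv, velocityMap, this.1, this.2]
  refine ⟨fun t => H (v t), ?_, ?_⟩
  · exact ContDiffAt.comp_contDiffWithinAt t₀ (hv₀ ▸ hH) hvs
  · have h2 : ∀ᶠ t in 𝓝[Icc a b] t₀, γ t ∈ (chartAt F (γ t₀)).source :=
      (hγ t₀ ht₀).continuousWithinAt.eventually_mem
        ((chartAt F (γ t₀)).open_source.mem_nhds hsrc)
    filter_upwards [h1.filter_mono nhdsWithin_le_nhds, h2, self_mem_nhdsWithin] with t ht hts htI
    obtain ⟨k, hkK, hk⟩ := hl t htI
    obtain ⟨m, hm, hkW⟩ := ht k hkK htI hk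
    have h3 := h.isVelocityLift_periodic hab (hmd t htI) htI hkW hk m
    have hkW' : (k.1 + ((0, m * (2 * Real.pi)) : F × ℝ)).1 ∈ W := by simpa using hkW
    have h4 : v t = velocityMap f (γ t₀) (k.1 + (0, m * (2 * Real.pi)), k.2) := by
      have := (h.isVelocityLift_iff hab (hmd t htI) htI
        (k := (k.1 + (0, m * (2 * Real.pi)), k.2)) hkW' hts).1 h3
      simp only [hv, velocityMap, this.1, this.2]
    simp only [h4, hm]
    exact ⟨hkW', h3⟩

end GrowthFrame.IsFibration

end VelocityLift

section GlobalLift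

variable {F : Type*} [NormedAddCommGroup F] [NormedSpace ℝ F] [FiniteDimensional ℝ F]
  {𝓕 : GrowthFrame F} {X : Type*} [TopologicalSpace X] [T2Space X] [ChartedSpace F X]
  [IsManifold 𝓘(ℝ, F) ∞ X] {B W : Set F} {M κ : ℝ} {f : F × ℝ → X} {γ : ℝ → X} {a b : ℝ}

/-- A smooth immersed curve whose velocities lift, at almost all times, to a compact set of
multiples of `∂/∂θ` is the image of a `C¹` curve `z` with
`z' = r • ∂/∂θ + q • char` and `f` maps `r • ∂/∂θ` to the velocity of the curve. -/
theorem GrowthFrame.IsFibration.exists_lift (h : 𝓕.IsFibration B W M κ f) (hab : a < b)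
    (hγ : ContMDiffOn 𝓘(ℝ, ℝ) 𝓘(ℝ, F) ∞ γ (Icc a b))
    (hγ' : ∀ t ∈ Icc a b, mfderivWithin 𝓘(ℝ, ℝ) 𝓘(ℝ, F) γ (Icc a b) t ≠ 0)
    {K : Set ((F × ℝ) × ℝ)} (hK : IsCompact K) (hKW : ∀ k ∈ K, k.1.1 ∈ W)
    (hl : ∀ᵐ t ∂(volume.restrict (Icc a b)), ∃ k ∈ K, IsVelocityLift f γ a b t k) :
    ∃ (z : ℝ → F × ℝ) (r q : ℝ → ℝ), ContinuousOn r (Icc a b) ∧ ContinuousOn q (Icc a b) ∧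
      ContMDiffOn 𝓘(ℝ, ℝ) (𝓡 1) ∞ (fun t => Circle.exp (z t).2) (Icc a b) ∧
      ∀ t ∈ Icc a b, (z t).1 ∈ W ∧ IsVelocityLift f γ a b t (z t, r t) ∧
        HasDerivWithinAt z (r t • (0, 1) + q t • 𝓕.char (z t)) (Icc a b) t := by
  have hmd : ∀ t ∈ Icc a b, MDifferentiableWithinAt 𝓘(ℝ, ℝ) 𝓘(ℝ, F) γ (Icc a b) t :=
    fun t ht => (hγ t ht).mdifferentiableWithinAt (by simp)
  have hud := uniqueDiffOn_Icc hab
  have hl' := h.exists_isVelocityLift hab hγ hK hKW hl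
  choose! k hkK hk using hl'
  have hkW : ∀ t ∈ Icc a b, (k t).1.1 ∈ W := fun t ht => hKW _ (hkK t ht)
  have hloc : ∀ t₀ ∈ Icc a b, ∃ k' : ℝ → (F × ℝ) × ℝ, ContDiffWithinAt ℝ ∞ k' (Icc a b) t₀ ∧
      ∀ᶠ t in 𝓝[Icc a b] t₀, (k t).1.1 = (k' t).1.1 ∧ (k t).2 = (k' t).2 ∧
        Circle.exp (k t).1.2 = Circle.exp (k' t).1.2 := by
    intro t₀ ht₀
    obtain ⟨k', hk's, hk'⟩ := h.exists_smooth_isVelocityLift hab hγ hγ' hK hKW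
      (fun t ht => ⟨k t, hkK t ht, hk t ht⟩) ht₀
    refine ⟨k', hk's, ?_⟩
    filter_upwards [hk', self_mem_nhdsWithin] with t ht htI
    obtain ⟨m, hm⟩ := h.isVelocityLift_unique hab (hmd t htI) htI (hγ' t htI) (hkW t htI) ht.1
      (hk t htI) ht.2
    rw [hm]
    refine ⟨by simp, rfl, ?_⟩
    exact Circle.exp_eq_exp.2 ⟨-m, by simp⟩
  have hx : ContDiffOn ℝ ∞ (fun t => (k t).1.1) (Icc a b) := fun t₀ ht₀ => by
    obtain ⟨k', hk's, hk'⟩ := hloc t₀ ht₀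
    exact hk's.fst.fst.congr_of_eventuallyEq_of_mem (hk'.mono fun t ht => ht.1) ht₀
  have hr : ContDiffOn ℝ ∞ (fun t => (k t).2) (Icc a b) := fun t₀ ht₀ => by
    obtain ⟨k', hk's, hk'⟩ := hloc t₀ ht₀
    exact hk's.snd.congr_of_eventuallyEq_of_mem (hk'.mono fun t ht => ht.2.1) ht₀
  have hu : ContDiffOn ℝ ∞ (fun t => (Circle.exp (k t).1.2 : ℂ)) (Icc a b) := fun t₀ ht₀ => by
    obtain ⟨k', hk's, hk'⟩ := hloc t₀ ht₀
    have h1 : ContDiffWithinAt ℝ ∞ (fun t => (Circle.exp (k' t).1.2 : ℂ)) (Icc a b) t₀ := by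
      simp only [Circle.coe_exp]
      exact ContDiffWithinAt.cexp
        ((Complex.ofRealCLM.contDiff.comp_contDiffWithinAt hk's.fst.snd).mul contDiffWithinAt_const)
    exact h1.congr_of_eventuallyEq_of_mem (hk'.mono fun t ht =>
      congrArg (fun u : Circle => (u : ℂ)) ht.2.2) ht₀
  have huM : ContMDiffOn 𝓘(ℝ, ℝ) (𝓡 1) ∞ (fun t => Circle.exp (k t).1.2) (Icc a b) :=
    fun t₀ ht₀ => by
      obtain ⟨k', hk's, hk'⟩ := hloc t₀ ht₀
      have h1 : ContMDiffWithinAt 𝓘(ℝ, ℝ) (𝓡 1) ∞ (fun t => Circle.exp (k' t).1.2) (Icc a b) t₀ :=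
        contMDiff_circleExp.contMDiffAt.comp_contMDiffWithinAt t₀
          (hk's.fst.snd.contMDiffWithinAt)
      exact h1.congr_of_eventuallyEq_of_mem (hk'.mono fun t ht => ht.2.2) ht₀
  -- a continuous choice of the angle
  obtain ⟨θ, θ', hθ'c, hθ, huθ⟩ := exists_polar_angle hab.le
    (u' := derivWithin (fun t => (Circle.exp (k t).1.2 : ℂ)) (Icc a b))
    (fun t ht => (hu.differentiableOn (by simp) t ht).hasDerivWithinAt)
    (hu.continuousOn_derivWithin hud (by simp)) (fun t ht => Circle.coe_ne_zero _)
  have hθk : ∀ t ∈ Icc a b, Circle.exp (θ t) = Circle.exp (k t).1.2 := fun t ht => by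
    have := huθ t ht
    rw [Circle.norm_coe, Complex.ofReal_one, one_mul, ← Circle.coe_exp] at this
    exact (Circle.coe_inj.1 this).symm
  set z : ℝ → F × ℝ := fun t => ((k t).1.1, θ t) with hz
  set z' : ℝ → F × ℝ := fun t => (derivWithin (fun t => (k t).1.1) (Icc a b) t, θ' t) with hz'
  have hzd : ∀ t ∈ Icc a b, HasDerivWithinAt z (z' t) (Icc a b) t := fun t ht =>
    ((hx.differentiableOn (by simp) t ht).hasDerivWithinAt).prodMk (hθ t ht)
  have hz'c : ContinuousOn z' (Icc a b) := (hx.continuousOn_derivWithin hud (by simp)).prodMk hθ'c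
  have hzc : ContinuousOn z (Icc a b) := fun t ht => (hzd t ht).continuousWithinAt
  have hzl : ∀ t ∈ Icc a b, IsVelocityLift f γ a b t (z t, (k t).2) := fun t ht => by
    obtain ⟨m, hm⟩ := Circle.exp_eq_exp.1 (hθk t ht)
    have h1 : z t = (k t).1 + (0, m * (2 * Real.pi)) := by
      ext <;> simp [hz, hm]
    rw [h1]
    exact h.isVelocityLift_periodic hab (hmd t ht) ht (hkW t ht) (hk t ht) m
  refine ⟨z, fun t => (k t).2, fun t => 𝓕.charCoeff (z t) (z' t), hr.continuousOn, ?_,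
    huM.congr hθk, fun t ht => ⟨hkW t ht, hzl t ht, ?_⟩⟩
  · have hα : ∀ i, ContinuousOn (fun t => 𝓕.α i (z t).1) (Icc a b) := fun i =>
      (𝓕.smoothα i).continuousOn.comp hx.continuousOn fun t ht => h.subset_domain (hkW t ht)
    have hθc : ContinuousOn θ (Icc a b) := fun t ht => (hθ t ht).continuousWithinAt
    exact (((Real.continuous_cos.comp_continuousOn hθc).smul (hα 0)).add
      ((Real.continuous_sin.comp_continuousOn hθc).smul (hα 1))).clm_apply hz'c.fst
  · refine (hzd t ht).congr_deriv ?_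
    have hsrc := mem_chart_source F (γ t)
    obtain ⟨hf, hv⟩ := (h.isVelocityLift_iff hab (hmd t ht) ht (k := (z t, (k t).2)) (hkW t ht)
      hsrc).1 (hzl t ht)
    have hsrc' : f (z t) ∈ (chartAt F (γ t)).source := by
      have : f (z t) = γ t := hf
      rw [this]; exact hsrc
    have h1 := ((h.contDiffAt_inChart (p := z t) (hkW t ht) hsrc').differentiableAt
      (by simp)).hasFDerivAt.comp_hasDerivWithinAt t (hzd t ht)
    have h2 : HasDerivWithinAt (fun t' => extChartAt 𝓘(ℝ, F) (γ t) (γ t'))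
        (fderiv ℝ (fun p => extChartAt 𝓘(ℝ, F) (γ t) (f p)) (z t) (z' t)) (Icc a b) t :=
      h1.congr (fun s hs => congrArg _ (hzl s hs).1.symm) (congrArg _ hf.symm)
    have h3 : fderiv ℝ (fun p => extChartAt 𝓘(ℝ, F) (γ t) (f p)) (z t)
        (z' t - (0, (k t).2)) = 0 := by
      rw [map_sub, sub_eq_zero, ← h2.derivWithin (hud t ht)]
      exact hv.symm
    have h4 := h.fderiv_inChart_eq_zero (p := z t) (hkW t ht) hsrc' h3
    rw [map_sub, charCoeff_const, sub_zero, sub_eq_iff_eq_add] at h4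
    refine h4.trans ?_
    rw [add_comm]
    simp

end GlobalLift

/-! ### Functions that are almost constant along curves tangent to the cone -/

section RealLine

/-- The mean value inequality for a locally Lipschitz function, with a bound for the derivative at
almost all times. -/
theorem abs_sub_le_of_ae_hasDerivWithinAt {a b C : ℝ} (hab : a ≤ b) {g : ℝ → ℝ}
    (hg : LocallyLipschitzOn (Icc a b) g)
    (hd : ∀ᵐ t ∂(volume.restrict (Icc a b)), ∃ g', HasDerivWithinAt g g' (Icc a b) t ∧ |g'| ≤ C) :
    |g b - g a| ≤ C * (b - a) := by
  obtain ⟨K, hK⟩ := hg.exists_lipschitzOnWith_of_compact isCompact_Icc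
  rw [← uIcc_of_le hab] at hK
  rw [← hK.absolutelyContinuousOnInterval.integral_deriv_eq_sub, ← Real.norm_eq_abs]
  have hne : ∀ᵐ t : ℝ ∂volume, t ≠ b := by simp [ae_iff]
  refine (intervalIntegral.norm_integral_le_of_norm_le_const_ae (C := C) ?_).trans_eq
    (by rw [abs_of_nonneg (sub_nonneg.2 hab)])
  rw [ae_restrict_iff' measurableSet_Icc] at hd
  filter_upwards [hd, hne] with t ht htb htI
  rw [uIoc_of_le hab] at htI
  obtain ⟨g', h1, h2⟩ := ht (Ioc_subset_Icc_self htI)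
  have h3 : HasDerivAt g g' t := h1.hasDerivAt (Icc_mem_nhds htI.1 (lt_of_le_of_ne htI.2 htb))
  rw [h3.deriv]; exact h2

end RealLine

section Potential

variable {F : Type*} [NormedAddCommGroup F] [NormedSpace ℝ F]
  {𝓕 : GrowthFrame F} {X : Type*} [TopologicalSpace X] [ChartedSpace F X]
  [IsManifold 𝓘(ℝ, F) ∞ X] {B W : Set F} {M κ : ℝ} {f : F × ℝ → X}

/-- A `C³` function that is `l ∘ fst` to first order along `{x₀} × ℝ` is independent of `θ` to
second order. -/
theorem abs_fderiv_le_sq_of_fderiv_eq {ψ : F × ℝ → ℝ} {x₀ : F} {θ₀ : ℝ} {l : F →L[ℝ] ℝ}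
    (hψ : ContDiffAt ℝ 3 ψ (x₀, θ₀))
    (hl : ∀ᶠ θ in 𝓝 θ₀, fderiv ℝ ψ (x₀, θ) = l.comp (ContinuousLinearMap.fst ℝ F ℝ)) :
    ∃ L, ∀ᶠ p in 𝓝 (x₀, θ₀), |fderiv ℝ ψ p (0, 1)| ≤ L * ‖p.1 - x₀‖ ^ 2 := by
  set g : F × ℝ → ℝ := fun p => fderiv ℝ ψ p (0, 1) with hg
  have hψe : ∀ᶠ p in 𝓝 (x₀, θ₀), ContDiffAt ℝ 3 ψ p := hψ.eventually (by simp)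
  have hg2 : ∀ p, ContDiffAt ℝ 3 ψ p → ContDiffAt ℝ 2 g p := fun p hp =>
    (hp.fderiv_right (m := 2) (by norm_num)).clm_apply contDiffAt_const
  have hDg : ContDiffAt ℝ 1 (fderiv ℝ g) (x₀, θ₀) :=
    (hg2 _ hψ).fderiv_right (m := 1) (by norm_num)
  obtain ⟨L, s, hs, hL⟩ := hDg.exists_lipschitzOnWith
  -- `g` and its differential vanish on the axis
  have hg0 : ∀ᶠ θ in 𝓝 θ₀, g (x₀, θ) = 0 := hl.mono fun θ hθ => by simp [hg, hθ]
  have hax : Tendsto (fun θ : ℝ => (x₀, θ)) (𝓝 θ₀) (𝓝 (x₀, θ₀)) :=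
    (Continuous.prodMk_right x₀).tendsto θ₀
  have hDg0 : ∀ᶠ θ in 𝓝 θ₀, fderiv ℝ g (x₀, θ) = 0 := by
    filter_upwards [hl.eventually_nhds, hax.eventually hψe] with θ hθ hθψ
    have hd : HasFDerivAt (fderiv ℝ ψ) (fderiv ℝ (fderiv ℝ ψ) (x₀, θ)) (x₀, θ) :=
      ((hθψ.fderiv_right (m := 2) (by norm_num)).differentiableAt (by simp)).hasFDerivAt
    have hsymm : IsSymmSndFDerivAt ℝ ψ (x₀, θ) := hθψ.isSymmSndFDerivAt (by
      rw [minSmoothness_of_isRCLikeNormedField]; norm_num)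
    refine ContinuousLinearMap.ext fun v => ?_
    have h1 : fderiv ℝ g (x₀, θ) v = fderiv ℝ (fderiv ℝ ψ) (x₀, θ) v (0, 1) := by
      have := hd.clm_apply (hasFDerivAt_const ((0 : F), (1 : ℝ)) (x₀, θ))
      rw [HasFDerivAt.fderiv this]
      simp
    rw [h1, hsymm.eq]
    have h2 : HasDerivAt (fun τ : ℝ => (x₀, τ)) ((0 : F), (1 : ℝ)) θ :=
      (hasDerivAt_const θ x₀).prodMk (hasDerivAt_id θ)
    have h3 := (hd.comp_hasDerivAt θ h2).unique ((hasDerivAt_const θ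
      (l.comp (ContinuousLinearMap.fst ℝ F ℝ))).congr_of_eventuallyEq hθ)
    rw [h3, zero_apply]
  obtain ⟨δ, hδ, hball⟩ := Metric.eventually_nhds_iff_ball.1 (hψe.and hs)
  obtain ⟨δ', hδ', hball'⟩ := Metric.eventually_nhds_iff_ball.1 (hg0.and hDg0)
  refine ⟨L, Metric.eventually_nhds_iff_ball.2 ⟨min δ δ', lt_min hδ hδ', fun p hp => ?_⟩⟩
  have hpb : ∀ {p' : F × ℝ}, p' ∈ Metric.ball (x₀, θ₀) (min δ δ') →
      p' ∈ Metric.ball (x₀, θ₀) δ ∧ p'.2 ∈ Metric.ball θ₀ δ' := fun {p'} hp' => by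
    refine ⟨Metric.ball_subset_ball (min_le_left _ _) hp', ?_⟩
    have : dist p'.2 θ₀ ≤ dist p' (x₀, θ₀) := le_max_right _ _
    exact this.trans_lt (hp'.trans_le (min_le_right _ _))
  have hpax : ∀ {p' : F × ℝ}, p' ∈ Metric.ball (x₀, θ₀) (min δ δ') →
      (x₀, p'.2) ∈ Metric.ball (x₀, θ₀) (min δ δ') := fun {p'} hp' => by
    have : dist (x₀, p'.2) (x₀, θ₀) ≤ dist p' (x₀, θ₀) := by
      rw [Prod.dist_eq, Prod.dist_eq]; simp
    exact this.trans_lt hp'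
  set S : Set (F × ℝ) := Metric.ball (x₀, θ₀) (min δ δ') ∩
    (Metric.closedBall x₀ ‖p.1 - x₀‖ ×ˢ univ) with hS
  have hSc : Convex ℝ S := (convex_ball _ _).inter ((convex_closedBall _ _).prod convex_univ)
  have hbound : ∀ p' ∈ S, ‖fderiv ℝ g p'‖ ≤ L * ‖p.1 - x₀‖ := fun p' hp' => by
    have h1 := hL.norm_sub_le (hball p' (hpb hp'.1).1).2 (hball _ (hpb (hpax hp'.1)).1).2
    rw [(hball' p'.2 (hpb hp'.1).2).2, sub_zero] at h1
    refine h1.trans (mul_le_mul_of_nonneg_left ?_ L.2)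
    have h2 : p' - (x₀, p'.2) = (p'.1 - x₀, 0) := by ext <;> simp
    have h3 : ‖p'.1 - x₀‖ ≤ ‖p.1 - x₀‖ := mem_closedBall_iff_norm.1 hp'.2.1
    rw [h2, Prod.norm_def]
    simpa using h3
  have h4 := hSc.norm_image_sub_le_of_norm_fderiv_le (𝕜 := ℝ) (f := g)
    (fun p' hp' => (hg2 p' (hball p' (hpb hp'.1).1).1).differentiableAt (by simp)) hbound
    (x := (x₀, p.2)) (y := p) ⟨hpax hp, by simp⟩ ⟨hp, (dist_eq_norm p.1 x₀).le, mem_univ _⟩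
  have h5 : p - (x₀, p.2) = (p.1 - x₀, 0) := by ext <;> simp
  rw [(hball' p.2 (hpb hp).2).1, sub_zero, h5, Prod.norm_def, Real.norm_eq_abs] at h4
  simp only [norm_zero, norm_nonneg, sup_of_le_left] at h4
  calc _ ≤ _ := h4
    _ = _ := by ring

variable [FiniteDimensional ℝ F]

/-- A covector `l` at `x₀` that annihilates the plane there descends, along the fibre of lines over
`x₀`, to the differential of a function on the base; by `abs_fderiv_le_sq_of_fderiv_eq` this
function changes only to second order along curves near the fibre of lines that are tangent to the
cone. -/
theorem GrowthFrame.IsFibration.exists_potential (h : 𝓕.IsFibration B W M κ f) {x₀ : F}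
    (hx₀ : x₀ ∈ W) {l : F →L[ℝ] ℝ} (hlA : l (𝓕.A x₀) = 0) (hlB : l (𝓕.B x₀) = 0) (θ₀ : ℝ) {y₁ : X}
    (hy : f (x₀, θ₀) ∈ (chartAt F y₁).source) :
    ∃ (φ : F → ℝ) (δ L : ℝ), 0 < δ ∧
      (∀ p : F × ℝ, ‖p - (x₀, θ₀)‖ < δ → p.1 ∈ W ∧ f p ∈ (chartAt F y₁).source ∧
        ContDiffAt ℝ 3 φ (extChartAt 𝓘(ℝ, F) y₁ (f p)) ∧
        |fderiv ℝ (fun p => φ (extChartAt 𝓘(ℝ, F) y₁ (f p))) p (0, 1)| ≤ L * ‖p.1 - x₀‖ ^ 2) ∧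
      ∀ θ, |θ - θ₀| < δ → φ (extChartAt 𝓘(ℝ, F) y₁ (f (x₀, θ))) = 0 ∧
        HasFDerivAt (fun p => φ (extChartAt 𝓘(ℝ, F) y₁ (f p)))
          (l.comp (ContinuousLinearMap.fst ℝ F ℝ)) (x₀, θ) := by
  set G : F × ℝ → F := fun p => extChartAt 𝓘(ℝ, F) y₁ (f p) with hG
  have hGs : ContDiffAt ℝ ∞ G (x₀, θ₀) := h.contDiffAt_inChart hx₀ hy
  have hx₀Ω := h.subset_domain hx₀
  have hlell : ∀ θ, l (𝓕.ell (x₀, θ)) = 0 := fun θ => by simp [ell, hlA, hlB]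
  -- the slice `ξ (x - x₀) = 0` is transverse to the fibres of `f` and contains `{x₀} × ℝ`
  set ξ : F →L[ℝ] ℝ := Real.cos θ₀ • 𝓕.α 0 x₀ + Real.sin θ₀ • 𝓕.α 1 x₀ with hξ
  have hξell : ξ (𝓕.ell (x₀, θ₀)) = 1 := by
    have hsc := Real.sin_sq_add_cos_sq θ₀
    simp [hξ, ell, dualA hx₀Ω, dualB hx₀Ω]
    linear_combination hsc
  have hξe : ∀ᶠ θ in 𝓝 θ₀, ξ (𝓕.ell (x₀, θ)) ≠ 0 := by
    have : Continuous fun θ => ξ (𝓕.ell (x₀, θ)) := by simp only [ell]; fun_prop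
    exact this.continuousAt.eventually_ne (by rw [hξell]; exact one_ne_zero)
  set Θ : F × ℝ → F × ℝ := fun p => (G p, ξ (p.1 - x₀)) with hΘ
  have hΘs : ContDiffAt ℝ ∞ Θ (x₀, θ₀) :=
    hGs.prodMk (ξ.contDiff.contDiffAt.comp _ (contDiffAt_fst.sub contDiffAt_const))
  have hΘd : HasFDerivAt Θ ((fderiv ℝ G (x₀, θ₀)).prod (ξ.comp (ContinuousLinearMap.fst ℝ F ℝ)))
      (x₀, θ₀) :=
    (hGs.differentiableAt (by simp)).hasFDerivAt.prodMk
      (ξ.hasFDerivAt.comp _ (hasFDerivAt_fst.sub_const x₀))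
  obtain ⟨H, hH, hHΘ⟩ := exists_smooth_left_inverse hΘs (by
    rw [hΘd.fderiv, injective_iff_map_eq_zero]
    intro v hv
    have e1 : fderiv ℝ G (x₀, θ₀) v = 0 := congrArg Prod.fst hv
    have e2 : ξ v.1 = 0 := congrArg Prod.snd hv
    have e3 := h.fderiv_inChart_eq_zero (p := (x₀, θ₀)) hx₀ hy e1
    rw [e3] at e2
    simp only [Prod.smul_fst, map_smul, smul_eq_mul] at e2
    change 𝓕.charCoeff (x₀, θ₀) v * ξ (𝓕.ell (x₀, θ₀)) = 0 at e2
    rw [hξell, mul_one] at e2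
    rw [e3, e2, zero_smul])
  have hΘ₀ : Θ (x₀, θ₀) = (G (x₀, θ₀), 0) := by simp [hΘ]
  rw [hΘ₀] at hH
  set φ : F → ℝ := fun w => l ((H (w, 0)).1 - x₀) with hφ
  have hφs : ContDiffAt ℝ ∞ φ (G (x₀, θ₀)) := by
    have h1 : ContDiffAt ℝ ∞ (fun w : F => H (w, (0 : ℝ))) (G (x₀, θ₀)) :=
      ContDiffAt.comp (f := fun w : F => (w, (0 : ℝ))) (G (x₀, θ₀)) hH
        (contDiffAt_id.prodMk contDiffAt_const)
    exact l.contDiff.contDiffAt.comp _ (h1.fst.sub contDiffAt_const)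
  set ψ : F × ℝ → ℝ := fun p => φ (G p) with hψ
  have hψs : ContDiffAt ℝ ∞ ψ (x₀, θ₀) := hφs.comp (x₀, θ₀) hGs
  have h3 : (3 : ℕ∞ω) ≤ ∞ := WithTop.coe_le_coe.2 le_top
  have hψ3 : ContDiffAt ℝ 3 ψ (x₀, θ₀) := hψs.of_le h3
  have hslice : ∀ᶠ p in 𝓝 (x₀, θ₀), ξ (p.1 - x₀) = 0 → ψ p = l (p.1 - x₀) := by
    filter_upwards [hHΘ] with p hp hξp
    have : Θ p = (G p, 0) := by
      change (G p, ξ (p.1 - x₀)) = (G p, 0)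
      rw [hξp]
    rw [this] at hp
    simp only [hψ, hφ, hp]
  have hax : Tendsto (fun θ : ℝ => (x₀, θ)) (𝓝 θ₀) (𝓝 (x₀, θ₀)) :=
    (Continuous.prodMk_right x₀).tendsto θ₀
  have hdom := h.eventually_mem_chartDomain (p := (x₀, θ₀)) hx₀ hy
  have hψd : ∀ᶠ θ in 𝓝 θ₀, HasFDerivAt ψ (l.comp (ContinuousLinearMap.fst ℝ F ℝ)) (x₀, θ) := by
    filter_upwards [hξe, hax.eventually hslice.eventually_nhds, hax.eventually hdom,
      hax.eventually (hψ3.eventually (by simp)),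
      hax.eventually (hGs.continuousAt.eventually ((hφs.of_le h3).eventually (by simp)))]
      with θ hθξ hθs hθd hθψ hθφ
    have hd := (hθψ.differentiableAt (by simp)).hasFDerivAt
    -- directions in the slice
    have d1 : ∀ v : F × ℝ, ξ v.1 = 0 → fderiv ℝ ψ (x₀, θ) v = l v.1 := by
      intro v hv
      have h1 : HasDerivAt (fun τ : ℝ => (x₀, θ) + τ • v) v 0 := by
        simpa using ((hasDerivAt_id (0 : ℝ)).smul_const v).const_add (x₀, θ)
      have h2 : HasFDerivAt ψ (fderiv ℝ ψ (x₀, θ)) ((x₀, θ) + (0 : ℝ) • v) := by simpa using hd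
      have h3 := h2.comp_hasDerivAt (0 : ℝ) h1
      have h4 : HasDerivAt (fun τ : ℝ => τ * l v.1) (l v.1) 0 := by
        simpa using (hasDerivAt_id (0 : ℝ)).mul_const (l v.1)
      refine h3.unique (h4.congr_of_eventuallyEq ?_)
      have h5 : Tendsto (fun τ : ℝ => (x₀, θ) + τ • v) (𝓝 0) (𝓝 (x₀, θ)) := by
        simpa using h1.continuousAt.tendsto
      filter_upwards [h5.eventually hθs] with τ hτ
      have := hτ (by simp [hv])
      simpa using this
    -- the direction of the fibre
    have d2 : fderiv ℝ ψ (x₀, θ) (𝓕.char (x₀, θ)) = 0 := by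
      have h1 : HasFDerivAt ψ _ (x₀, θ) := (hθφ.differentiableAt (by simp)).hasFDerivAt.comp (x₀, θ)
        ((h.contDiffAt_inChart hθd.1 hθd.2).differentiableAt (by simp)).hasFDerivAt
      rw [h1.fderiv, ContinuousLinearMap.comp_apply, h.fderiv_inChart_char hθd.1 hθd.2, map_zero]
    refine hd.congr_fderiv (ContinuousLinearMap.ext fun v => ?_)
    set e := ξ v.1 / ξ (𝓕.ell (x₀, θ)) with he
    have h1 := d1 (v - e • 𝓕.char (x₀, θ)) (by
      change ξ (v.1 - e • 𝓕.ell (x₀, θ)) = 0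
      rw [map_sub, map_smul, smul_eq_mul, he, div_mul_cancel₀ _ hθξ, sub_self])
    have h2 : l (v - e • 𝓕.char (x₀, θ)).1 = l v.1 := by
      change l (v.1 - e • 𝓕.ell (x₀, θ)) = l v.1
      rw [map_sub, map_smul, hlell, smul_zero, sub_zero]
    rw [map_sub, map_smul, d2, smul_zero, sub_zero, h2] at h1
    exact h1
  have hψ0 : ∀ᶠ θ in 𝓝 θ₀, ψ (x₀, θ) = 0 := by
    filter_upwards [hax.eventually hslice] with θ hθ
    simpa using hθ (by simp)
  obtain ⟨L, hL⟩ := abs_fderiv_le_sq_of_fderiv_eq hψ3 (hψd.mono fun θ hθ => hθ.fderiv)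
  obtain ⟨δ, hδ, hball⟩ := Metric.eventually_nhds_iff_ball.1 (hdom.and
    ((hGs.continuousAt.eventually ((hφs.of_le h3).eventually (by simp))).and hL))
  obtain ⟨δ', hδ', hball'⟩ := Metric.eventually_nhds_iff_ball.1 (hψ0.and hψd)
  refine ⟨φ, min δ δ', L, lt_min hδ hδ', fun p hp => ?_, fun θ hθ => ?_⟩
  · obtain ⟨e1, e2, e3⟩ := hball p (mem_ball_iff_norm.2 (hp.trans_le (min_le_left _ _)))
    exact ⟨e1.1, e1.2, e2, e3⟩
  · exact hball' θ (by
      rw [Metric.mem_ball, Real.dist_eq]; exact hθ.trans_le (min_le_right _ _))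

end Potential

/-! ### A constraint on the endpoints of curves near a fibre of lines -/

section LipschitzCurve

variable {E : Type*} [NormedAddCommGroup E] [NormedSpace ℝ E]
  {M : Type*} [TopologicalSpace M] [ChartedSpace E M] [IsManifold 𝓘(ℝ, E) ∞ M]

theorem IsLipschitzCurve.exists_lipschitzOnWith_comp {a b : ℝ} {γ : ℝ → M}
    (hγ : IsLipschitzCurve 𝓘(ℝ, E) a b γ) {t : ℝ} (ht : t ∈ Icc a b) {u : M → ℝ}
    (hu : ContMDiffAt 𝓘(ℝ, E) 𝓘(ℝ, ℝ) 1 u (γ t)) :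
    ∃ K, ∃ s ∈ 𝓝[Icc a b] t, LipschitzOnWith K (fun t => u (γ t)) s := by
  obtain ⟨K, s, hs, hK⟩ := hγ.2 t ht
  have h1 : ContDiffAt ℝ 1 (fun w => u ((extChartAt 𝓘(ℝ, E) (γ t)).symm w))
      (extChartAt 𝓘(ℝ, E) (γ t) (γ t)) := by
    rw [← contMDiffAt_iff_contDiffAt]
    refine ContMDiffAt.comp_of_eq (g := u) hu ?_ (by simp)
    have h2 := contMDiffOn_extChartAt_symm (n := 1) (I := 𝓘(ℝ, E)) (γ t)
    exact h2.contMDiffAt (extChartAt_target_mem_nhds (γ t))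
  obtain ⟨L, s', hs', hL⟩ := h1.exists_lipschitzOnWith
  have hc : ContinuousWithinAt (fun t' => extChartAt 𝓘(ℝ, E) (γ t) (γ t')) (Icc a b) t :=
    (continuousAt_extChartAt (γ t)).comp_continuousWithinAt (hγ.1 t ht)
  have hsrc : ∀ᶠ t' in 𝓝[Icc a b] t, γ t' ∈ (extChartAt 𝓘(ℝ, E) (γ t)).source :=
    (hγ.1 t ht).eventually_mem (extChartAt_source_mem_nhds (γ t))
  refine ⟨L * K, _, inter_mem hs (inter_mem (hc hs') hsrc), ?_⟩
  intro t₁ ht₁ t₂ ht₂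
  have h3 := hL.comp (hK.mono inter_subset_left) (fun t' ht' => ht'.2.1) ht₁ ht₂
  simp only [Function.comp_apply] at h3
  rwa [(extChartAt 𝓘(ℝ, E) (γ t)).left_inv ht₁.2.2,
    (extChartAt 𝓘(ℝ, E) (γ t)).left_inv ht₂.2.2] at h3

end LipschitzCurve

section EndpointMap

variable {F : Type*} [NormedAddCommGroup F] [NormedSpace ℝ F]
  {X : Type*} [TopologicalSpace X] [ChartedSpace F X] {f : F × ℝ → X}

theorem HasVelocityWithinAt.hasDerivWithinAt_comp {γ : ℝ → X} {s : Set ℝ} {t : ℝ} {y : X} {w : F}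
    (h : HasVelocityWithinAt 𝓘(ℝ, F) γ s t (⟨y, w⟩ : TangentBundle 𝓘(ℝ, F) X)) {u : X → ℝ}
    (hu : MDifferentiableAt 𝓘(ℝ, F) 𝓘(ℝ, ℝ) u y) :
    HasDerivWithinAt (fun t => u (γ t)) ((mfderiv 𝓘(ℝ, F) 𝓘(ℝ, ℝ) u y : F →L[ℝ] ℝ) w) s t := by
  obtain ⟨h1, h2⟩ := h
  have h1' : y = γ t := h1
  set T : F →L[ℝ] ℝ := mfderiv 𝓘(ℝ, F) 𝓘(ℝ, ℝ) u y with hT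
  have hu' : HasMFDerivAt 𝓘(ℝ, F) 𝓘(ℝ, ℝ) u (γ t) T := by
    rw [← h1']; exact hu.hasMFDerivAt
  have h3 : HasFDerivWithinAt (fun t => u (γ t)) (T.comp ((1 : ℝ →L[ℝ] ℝ).smulRight w)) s t :=
    (hu'.comp_hasMFDerivWithinAt t h2).hasFDerivWithinAt
  have h4 := h3.hasDerivWithinAt
  have h5 : (T.comp ((1 : ℝ →L[ℝ] ℝ).smulRight w)) 1 = T w := by simp
  rw [h5] at h4
  exact h4

theorem IsVelocityLift.hasDerivWithinAt_comp {γ : ℝ → X} {a b t : ℝ} {k : (F × ℝ) × ℝ}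
    (hl : IsVelocityLift f γ a b t k) {u : X → ℝ} (hu : MDifferentiableAt 𝓘(ℝ, F) 𝓘(ℝ, ℝ) u (f k.1))
    (hf : MDifferentiableAt 𝓘(ℝ, F × ℝ) 𝓘(ℝ, F) f k.1) :
    HasDerivWithinAt (fun t => u (γ t)) (fderiv ℝ (fun p => u (f p)) k.1 (0, k.2)) (Icc a b) t := by
  set T : F →L[ℝ] ℝ := mfderiv 𝓘(ℝ, F) 𝓘(ℝ, ℝ) u (f k.1) with hT
  set T' : F × ℝ →L[ℝ] F := mfderiv 𝓘(ℝ, F × ℝ) 𝓘(ℝ, F) f k.1 with hT'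
  have h4 : HasFDerivAt (fun p => u (f p)) (T.comp T') k.1 :=
    (hu.hasMFDerivAt.comp k.1 hf.hasMFDerivAt).hasFDerivAt
  rw [h4.fderiv]
  exact HasVelocityWithinAt.hasDerivWithinAt_comp hl hu

/-- A potential of `l` agrees to first order with `l` along curves of points that leave `p₀` with
bounded speed. -/
theorem isLittleO_potential {l : F →L[ℝ] ℝ} {ψ : F × ℝ → ℝ} {p₀ : F × ℝ}
    (hψ : HasFDerivAt ψ (l.comp (ContinuousLinearMap.fst ℝ F ℝ)) p₀) (hψ0 : ψ p₀ = 0) {K : ℝ}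
    {z : ℝ → F × ℝ} (hz : ∀ᶠ s in 𝓝 (0 : ℝ), ‖z s - p₀‖ ≤ K * |s|) :
    (fun s => ψ (z s) - l ((z s).1 - p₀.1)) =o[𝓝 0] fun s => s := by
  have hO : (fun s => z s - p₀) =O[𝓝 0] fun s : ℝ => s :=
    Asymptotics.IsBigO.of_bound K (by simpa using hz)
  have ht : Tendsto z (𝓝 0) (𝓝 p₀) := by
    have := hO.trans_tendsto (continuous_id.tendsto (0 : ℝ))
    simpa using this.add_const p₀
  have h1 := (hψ.isLittleO.comp_tendsto ht).trans_isBigO hO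
  refine h1.congr_left fun s => ?_
  simp [hψ0]

variable {𝓕 : GrowthFrame F} {B W : Set F} {M κ : ℝ}

namespace GrowthFrame.IsFibration

/-- If almost all values of a curve have preimages near `(x₀, θ t)`, then all values have. -/
theorem exists_near_of_ae [T2Space X] [FiniteDimensional ℝ F] (h : 𝓕.IsFibration B W M κ f)
    {a b : ℝ} (hab : a < b)
    {x₀ : F} {θ : ℝ → ℝ} (hθ : ContinuousOn θ (Icc a b)) {g : ℝ → X}
    (hg : ContinuousOn g (Icc a b)) {ρ : ℝ} (hρ : Metric.closedBall x₀ ρ ⊆ W)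
    (hae : ∀ᵐ t ∂(volume.restrict (Icc a b)), ∃ p : F × ℝ, ‖p - (x₀, θ t)‖ ≤ ρ ∧ f p = g t)
    {t : ℝ} (ht : t ∈ Icc a b) : ∃ p : F × ℝ, ‖p - (x₀, θ t)‖ ≤ ρ ∧ f p = g t := by
  by_contra! hno
  have hK : IsCompact (Metric.closedBall (0 : F × ℝ) ρ) := isCompact_closedBall 0 ρ
  have h1 : ∀ᶠ t' in 𝓝 t, ∀ e ∈ Metric.closedBall (0 : F × ℝ) ρ,
      t' ∈ Icc a b → f ((x₀, θ t') + e) ≠ g t' := by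
    refine hK.eventually_forall_of_forall_eventually
      (P := fun t' e => t' ∈ Icc a b → f ((x₀, θ t') + e) ≠ g t') fun e he => ?_
    suffices ∀ᶠ z : ℝ × (F × ℝ) in 𝓝[Icc a b ×ˢ univ] (t, e), f ((x₀, θ z.1) + z.2) ≠ g z.1 by
      rw [eventually_nhdsWithin_iff] at this
      exact this.mono fun z hz hzt => hz ⟨hzt, mem_univ _⟩
    have hfst : Tendsto Prod.fst (𝓝[Icc a b ×ˢ univ] (t, e)) (𝓝[Icc a b] t) := by
      rw [nhdsWithin_prod_eq]; exact tendsto_fst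
    have hsnd : Tendsto Prod.snd (𝓝[Icc a b ×ˢ univ] (t, e)) (𝓝 e) :=
      continuous_snd.continuousAt.tendsto.mono_left nhdsWithin_le_nhds
    have hθ' := (hθ t ht).tendsto.comp hfst
    have he' : ‖e.1‖ ≤ ρ := (norm_fst_le e).trans (by simpa using he)
    have hW : ((x₀, θ t) + e).1 ∈ W := hρ (by simpa [mem_closedBall_iff_norm] using he')
    have h2 := (h.contMDiffAt hW).continuousAt.tendsto.comp
      ((tendsto_const_nhds.prodMk_nhds hθ').add hsnd)
    exact (h2.prodMk_nhds ((hg t ht).tendsto.comp hfst)).eventually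
      (isClosed_diagonal.isOpen_compl.mem_nhds
        (hno _ (by rw [add_sub_cancel_left]; simpa using he)))
  obtain ⟨t', ⟨ht', p, hp, hpg⟩, hall⟩ :=
    ((frequently_of_ae_Icc hab hae ht).and_eventually h1).exists
  exact hall (p - (x₀, θ t')) (by simpa using hp) ht' (by rw [add_sub_cancel]; exact hpg)

variable [IsManifold 𝓘(ℝ, F) ∞ X] [FiniteDimensional ℝ F]

/-- For lifts `z` of curves near the fibre of lines over `x₀` that are tangent to the cone, the
first-order constraint `l = 0` propagates along the time interval: locally in time the potential of
`l` detects it, and the potential is constant up to second order. -/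
theorem isLittleO_congr_of_near [T2Space X] (h : 𝓕.IsFibration B W M κ f) {a b : ℝ}
    {x₀ : F} (hx₀ : x₀ ∈ W) {l : F →L[ℝ] ℝ} (hlA : l (𝓕.A x₀) = 0) (hlB : l (𝓕.B x₀) = 0)
    {θ : ℝ → ℝ} (hθ : ContinuousOn θ (Icc a b)) {Γ : ℝ → ℝ → X} {K : ℝ} (hK : 0 ≤ K)
    (hΓ : ∀ᶠ s in 𝓝 (0 : ℝ), IsLipschitzCurve 𝓘(ℝ, F) a b (Γ s))
    (hlift : ∀ᶠ s in 𝓝 (0 : ℝ), ∀ᵐ t ∂(volume.restrict (Icc a b)), ∃ k : (F × ℝ) × ℝ,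
      ‖k.1 - (x₀, θ t)‖ ≤ K * |s| ∧ |k.2| ≤ K ∧ IsVelocityLift f (Γ s) a b t k)
    {z : ℝ → ℝ → F × ℝ} (hz : ∀ᶠ s in 𝓝 (0 : ℝ), ∀ t ∈ Icc a b,
      ‖z s t - (x₀, θ t)‖ ≤ K * |s| ∧ f (z s t) = Γ s t) {t₀ : ℝ} (ht₀ : t₀ ∈ Icc a b) :
    ∀ᶠ t in 𝓝[Icc a b] t₀, ((fun s => l ((z s t).1 - x₀)) =o[𝓝 0] fun s : ℝ => s) ↔
      (fun s => l ((z s t₀).1 - x₀)) =o[𝓝 0] fun s : ℝ => s := by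
  obtain ⟨φ, δ, L, hδ, hφ, hax⟩ := h.exists_potential hx₀ hlA hlB (θ t₀)
    (mem_chart_source F (f (x₀, θ t₀)))
  set y₁ := f (x₀, θ t₀) with hy₁
  set u : X → ℝ := fun y => φ (extChartAt 𝓘(ℝ, F) y₁ y) with hu
  have hcont : ∀ᶠ t in 𝓝[Icc a b] t₀, |θ t - θ t₀| < δ / 2 := by
    have := (hθ t₀ ht₀).eventually (Metric.ball_mem_nhds (θ t₀) (half_pos hδ))
    simpa [Real.dist_eq] using this
  obtain ⟨ε, hε, hεt⟩ := Metric.mem_nhdsWithin_iff.1 hcont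
  refine Metric.mem_nhdsWithin_iff.2 ⟨ε, hε, fun t ht => ?_⟩
  -- `ψ` controls `l` to first order at both times
  have key : ∀ τ ∈ Metric.ball t₀ ε ∩ Icc a b,
      (fun s => u (Γ s τ) - l ((z s τ).1 - x₀)) =o[𝓝 0] fun s : ℝ => s := by
    intro τ hτ
    have hτδ : |θ τ - θ t₀| < δ := (hεt hτ).trans (half_lt_self hδ)
    refine (isLittleO_potential (hax _ hτδ).2 (hax _ hτδ).1 (K := K)
      (hz.mono fun s hs => (hs τ hτ.2).1)).congr' ?_ EventuallyEq.rfl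
    filter_upwards [hz] with s hs
    rw [(hs τ hτ.2).2]
  have hinterval : uIcc t₀ t ⊆ Metric.ball t₀ ε ∩ Icc a b := by
    intro τ hτ
    refine ⟨?_, uIcc_subset_Icc ht₀ ht.2 hτ⟩
    rw [Metric.mem_ball, Real.dist_eq]
    exact (abs_sub_left_of_mem_uIcc hτ).trans_lt (by simpa [Real.dist_eq] using ht.1)
  have hsmall : ∀ᶠ s in 𝓝 (0 : ℝ), K * |s| < δ / 2 := by
    have : Tendsto (fun s : ℝ => K * |s|) (𝓝 0) (𝓝 0) := by
      have : Continuous fun s : ℝ => K * |s| := by fun_prop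
      simpa using this.tendsto 0
    exact this.eventually (gt_mem_nhds (half_pos hδ))
  have hdist : ∀ {s τ : ℝ} {p : F × ℝ}, K * |s| < δ / 2 → τ ∈ uIcc t₀ t →
      ‖p - (x₀, θ τ)‖ ≤ K * |s| → ‖p - (x₀, θ t₀)‖ < δ := by
    intro s τ p hs hτ hp
    have h1 : ‖((x₀, θ τ) - (x₀, θ t₀) : F × ℝ)‖ < δ / 2 := by
      have : ((x₀, θ τ) - (x₀, θ t₀) : F × ℝ) = (0, θ τ - θ t₀) := by simp
      rw [this, Prod.norm_def]
      simpa using hεt (hinterval hτ)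
    calc ‖p - (x₀, θ t₀)‖ ≤ ‖p - (x₀, θ τ)‖ + ‖((x₀, θ τ) - (x₀, θ t₀) : F × ℝ)‖ :=
          norm_sub_le_norm_sub_add_norm_sub _ _ _
      _ < δ := by linarith
  have huat : ∀ p : F × ℝ, ‖p - (x₀, θ t₀)‖ < δ → ContMDiffAt 𝓘(ℝ, F) 𝓘(ℝ, ℝ) 1 u (f p) := by
    intro p hp
    obtain ⟨-, h2, h3, -⟩ := hφ p hp
    exact ContMDiffAt.comp (g := φ) (f p) ((h3.of_le (by norm_num)).contMDiffAt)
      (contMDiffAt_extChartAt' (n := 1) h2)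
  -- along the curve `u` changes only to second order
  have hdiff : (fun s => u (Γ s t) - u (Γ s t₀)) =o[𝓝 0] fun s : ℝ => s := by
    have hO : (fun s => u (Γ s t) - u (Γ s t₀)) =O[𝓝 0] fun s : ℝ => s ^ 2 := by
      refine Asymptotics.IsBigO.of_bound (K * (|L| * K ^ 2) * |t - t₀|) ?_
      filter_upwards [hΓ, hlift, hz, hsmall] with s hsΓ hsl hsz hss
      have hlip : LocallyLipschitzOn (uIcc t₀ t) fun τ => u (Γ s τ) := by
        intro τ hτ
        have hτI := (hinterval hτ).2
        obtain ⟨hz1, hz2⟩ := hsz τ hτI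
        have h1 := huat (z s τ) (hdist hss hτ hz1)
        rw [hz2] at h1
        obtain ⟨K', s', hs', hK'⟩ := hsΓ.exists_lipschitzOnWith_comp hτI h1
        exact ⟨K', s', nhdsWithin_mono _ (fun x hx => (hinterval hx).2) hs', hK'⟩
      have hder : ∀ᵐ τ ∂(volume.restrict (uIcc t₀ t)), ∃ g',
          HasDerivWithinAt (fun τ => u (Γ s τ)) g' (uIcc t₀ t) τ ∧
            |g'| ≤ K * (|L| * K ^ 2) * s ^ 2 := by
        have hsub : uIcc t₀ t ⊆ Icc a b := fun x hx => (hinterval hx).2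
        filter_upwards [ae_restrict_of_ae_restrict_of_subset hsub hsl,
          ae_restrict_mem measurableSet_uIcc] with τ ⟨k, hk1, hk2, hk3⟩ hτ
        have hkδ := hdist hss hτ hk1
        obtain ⟨p1, -, -, p4⟩ := hφ k.1 hkδ
        refine ⟨_, (hk3.hasDerivWithinAt_comp ((huat k.1 hkδ).mdifferentiableAt (by simp))
          ((h.contMDiffAt p1).mdifferentiableAt (by simp))).mono hsub, ?_⟩
        have e1 : ((0 : F), k.2) = k.2 • ((0 : F), (1 : ℝ)) := by simp
        rw [e1, map_smul, smul_eq_mul, abs_mul]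
        have e2 : ‖k.1.1 - x₀‖ ≤ K * |s| := (norm_fst_le (k.1 - (x₀, θ τ))).trans hk1
        have e3 : L * ‖k.1.1 - x₀‖ ^ 2 ≤ |L| * (K * |s|) ^ 2 :=
          mul_le_mul (le_abs_self L) (pow_le_pow_left₀ (norm_nonneg _) e2 2) (by positivity)
            (abs_nonneg L)
        calc |k.2| * _ ≤ K * (|L| * (K * |s|) ^ 2) :=
              mul_le_mul hk2 (p4.trans e3) (abs_nonneg _) hK
          _ = _ := by rw [mul_pow, sq_abs]; ring
      have hmin : ∀ {p q : ℝ}, p ≤ q → LocallyLipschitzOn (Icc p q) (fun τ => u (Γ s τ)) →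
          (∀ᵐ τ ∂(volume.restrict (Icc p q)), ∃ g',
            HasDerivWithinAt (fun τ => u (Γ s τ)) g' (Icc p q) τ ∧
              |g'| ≤ K * (|L| * K ^ 2) * s ^ 2) →
          |u (Γ s q) - u (Γ s p)| ≤ K * (|L| * K ^ 2) * s ^ 2 * (q - p) :=
        fun hpq h1 h2 => abs_sub_le_of_ae_hasDerivWithinAt hpq h1 h2
      rw [Real.norm_eq_abs, norm_pow, Real.norm_eq_abs, sq_abs]
      rcases le_total t₀ t with hle | hle
      · rw [uIcc_of_le hle] at hlip hder
        refine (hmin hle hlip hder).trans_eq ?_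
        rw [abs_of_nonneg (sub_nonneg.2 hle)]; ring
      · rw [uIcc_of_ge hle] at hlip hder
        rw [abs_sub_comm]
        refine (hmin hle hlip hder).trans_eq ?_
        rw [abs_sub_comm, abs_of_nonneg (sub_nonneg.2 hle)]; ring
    refine hO.trans_isLittleO ?_
    have := Asymptotics.isLittleO_pow_pow (𝕜 := ℝ) (m := 1) (n := 2) one_lt_two
    simpa using this
  have h1 := key t ht
  have h2 := key t₀ ⟨Metric.mem_ball_self hε, ht₀⟩
  have h3 : (fun s => l ((z s t).1 - x₀) - l ((z s t₀).1 - x₀)) =o[𝓝 0] fun s : ℝ => s :=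
    ((hdiff.sub h1).add h2).congr_left fun s => by ring
  constructor
  · intro h4; exact (h4.sub h3).congr_left fun s => by ring
  · intro h4; exact (h3.add h4).congr_left fun s => by ring

/-- The endpoint map of the cone is not a submersion at a fibre of lines `θ ↦ f (x₀, θ)`: every
curve of trajectories with velocity lifts `O(s)`-close to those of the fibre of lines satisfies, to
first order, the constraint `l = 0` at all times, where `l` is a covector at `x₀` that annihilates
the distribution. -/
theorem exists_not_endpoint [T2Space X] (h : 𝓕.IsFibration B W M κ f) {a b : ℝ} (hab : a < b)
    {x₀ : F} (hx₀ : x₀ ∈ W) {θ : ℝ → ℝ} (hθ : ContinuousOn θ (Icc a b)) :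
    ∃ v : F, ∀ Γ : ℝ → ℝ → X, (∀ᶠ s in 𝓝 (0 : ℝ), IsLipschitzCurve 𝓘(ℝ, F) a b (Γ s)) →
      (∀ᶠ s in 𝓝 (0 : ℝ), Γ s a = f (x₀, θ a)) → ∀ K : ℝ,
      (∀ᶠ s in 𝓝 (0 : ℝ), ∀ᵐ t ∂(volume.restrict (Icc a b)), ∃ k : (F × ℝ) × ℝ,
        ‖k.1 - (x₀, θ t)‖ ≤ K * |s| ∧ |k.2| ≤ K ∧ IsVelocityLift f (Γ s) a b t k) →
      ¬ HasVelocityWithinAt 𝓘(ℝ, F) (fun s => Γ s b) univ 0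
        (⟨f (x₀, θ b), v⟩ : TangentBundle 𝓘(ℝ, F) X) := by
  have hx₀Ω := h.subset_domain hx₀
  set l := 𝓕.α 3 x₀ with hl
  have hlA : l (𝓕.A x₀) = 0 := by rw [hl, dualA hx₀Ω]; simp
  have hlB : l (𝓕.B x₀) = 0 := by rw [hl, dualB hx₀Ω]; simp
  obtain ⟨e, he⟩ : ∃ e, l e = 1 := ⟨_, by simpa using 𝓕.dual x₀ hx₀Ω 3 3⟩
  refine ⟨(mfderiv 𝓘(ℝ, F × ℝ) 𝓘(ℝ, F) f (x₀, θ b) : F × ℝ →L[ℝ] F) (e, 0),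
    fun Γ hΓ hini K hlift hvel => ?_⟩
  have ha : a ∈ Icc a b := left_mem_Icc.2 hab.le
  have hb : b ∈ Icc a b := right_mem_Icc.2 hab.le
  have hK : 0 ≤ K := by
    obtain ⟨t, -, k, -, hk, -⟩ := (frequently_of_ae_Icc hab hlift.self_of_nhds ha).exists
    exact (abs_nonneg _).trans hk
  -- all values of the curves have preimages close to the fibre of lines
  have hsmall : ∀ᶠ s in 𝓝 (0 : ℝ), Metric.closedBall x₀ (K * |s|) ⊆ W := by
    obtain ⟨ε, hε, hεW⟩ := Metric.nhds_basis_closedBall.mem_iff.1 (h.isOpen.mem_nhds hx₀)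
    have : Tendsto (fun s : ℝ => K * |s|) (𝓝 0) (𝓝 0) := by
      have : Continuous fun s : ℝ => K * |s| := by fun_prop
      simpa using this.tendsto 0
    filter_upwards [this.eventually (ge_mem_nhds hε)] with s hs
    exact (Metric.closedBall_subset_closedBall hs).trans hεW
  have hex : ∀ s, (∀ t ∈ Icc a b, ∃ p : F × ℝ, ‖p - (x₀, θ t)‖ ≤ K * |s| ∧ f p = Γ s t) →
      ∃ z : ℝ → F × ℝ, ∀ t ∈ Icc a b, ‖z t - (x₀, θ t)‖ ≤ K * |s| ∧ f (z t) = Γ s t := by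
    intro s hs
    choose! z hz using hs
    exact ⟨z, hz⟩
  have hz' : ∀ᶠ s in 𝓝 (0 : ℝ), ∃ z : ℝ → F × ℝ, ∀ t ∈ Icc a b,
      ‖z t - (x₀, θ t)‖ ≤ K * |s| ∧ f (z t) = Γ s t := by
    filter_upwards [hsmall, hΓ, hlift] with s hs1 hs2 hs3
    refine hex s fun t ht => h.exists_near_of_ae hab hθ hs2.1 hs1 ?_ ht
    filter_upwards [hs3] with τ ⟨k, hk1, _, hk3⟩ using ⟨k.1, hk1, hk3.1⟩
  obtain ⟨z, hz⟩ := hz'.choice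
  set S : ℝ → Prop := fun t => (fun s => l ((z s t).1 - x₀)) =o[𝓝 0] fun s : ℝ => s with hS
  have hloc : ∀ t₀ ∈ Icc a b, ∀ᶠ t in 𝓝[Icc a b] t₀, (S t ↔ S t₀) := fun t₀ ht₀ =>
    h.isLittleO_congr_of_near hx₀ hlA hlB hθ hK hΓ hlift hz ht₀
  have hSab : S a ↔ S b := by
    refine isPreconnected_Icc.induction₂ (fun t t' => S t ↔ S t')
      (fun t ht => (hloc t ht).mono fun t' h => h.symm) (fun _ _ _ _ _ _ h1 h2 => h1.trans h2)
      (fun _ _ _ _ h1 => h1.symm) ha hb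
  -- the constraint at time `a`
  have hSa : S a := by
    obtain ⟨φ, δ, L, hδ, -, hax⟩ := h.exists_potential hx₀ hlA hlB (θ a)
      (mem_chart_source F (f (x₀, θ a)))
    obtain ⟨h0, h1⟩ := hax (θ a) (by simpa using hδ)
    have h2 := isLittleO_potential h1 h0 (hz.mono fun s hs => (hs a ha).1)
    refine (h2.neg_left).congr' ?_ EventuallyEq.rfl
    filter_upwards [hz, hini] with s hs1 hs2
    rw [(hs1 a ha).2, hs2, h0]; ring
  -- the constraint at time `b` contradicts the velocity of the endpoint
  obtain ⟨φ, δ, L, hδ, hφ, hax⟩ := h.exists_potential hx₀ hlA hlB (θ b)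
    (mem_chart_source F (f (x₀, θ b)))
  obtain ⟨h0, h1⟩ := hax (θ b) (by simpa using hδ)
  set y₁ := f (x₀, θ b) with hy₁
  set u : X → ℝ := fun y => φ (extChartAt 𝓘(ℝ, F) y₁ y) with hu
  have h2 := (isLittleO_potential h1 h0 (hz.mono fun s hs => (hs b hb).1)).add (hSab.1 hSa)
  have h3 : (fun s => u (Γ s b)) =o[𝓝 0] fun s : ℝ => s := by
    refine h2.congr' ?_ EventuallyEq.rfl
    filter_upwards [hz] with s hs
    simp only [sub_add_cancel, hu]
    rw [(hs b hb).2]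
  have hΓ0 : y₁ = Γ 0 b := hvel.1
  have hu0 : u (Γ 0 b) = 0 := by rw [← hΓ0]; exact h0
  have h4 : HasDerivAt (fun s => u (Γ s b)) 0 0 := by
    rw [hasDerivAt_iff_isLittleO]
    simpa [hu0] using h3
  obtain ⟨-, q2, q3, -⟩ := hφ (x₀, θ b) (by simpa using hδ)
  have huat : MDifferentiableAt 𝓘(ℝ, F) 𝓘(ℝ, ℝ) u y₁ :=
    (ContMDiffAt.comp (g := φ) y₁ (q3.contMDiffAt)
      (contMDiffAt_extChartAt' (n := 3) q2)).mdifferentiableAt (by simp)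
  have h5 := hvel.hasDerivWithinAt_comp huat
  have h6 := (hasDerivWithinAt_univ.1 h5).unique h4
  set T : F →L[ℝ] ℝ := mfderiv 𝓘(ℝ, F) 𝓘(ℝ, ℝ) u y₁ with hT
  set T' : F × ℝ →L[ℝ] F := mfderiv 𝓘(ℝ, F × ℝ) 𝓘(ℝ, F) f (x₀, θ b) with hT'
  have h7 : HasFDerivAt (fun p => u (f p)) (T.comp T') (x₀, θ b) :=
    (huat.hasMFDerivAt.comp (x₀, θ b)
      ((h.contMDiffAt hx₀).mdifferentiableAt (by simp)).hasMFDerivAt).hasFDerivAt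
  have h8 : T (T' (e, 0)) = l e :=
    congrArg (fun T : F × ℝ →L[ℝ] ℝ => T (e, 0)) (h7.unique h1)
  have h9 : (0 : ℝ) = 1 := h6.symm.trans (h8.trans he)
  exact zero_ne_one h9

end GrowthFrame.IsFibration

end EndpointMap

/-! ### Local models of the space of oriented lines -/

section LocalModel

local notation "𝔼" => EuclideanSpace ℝ (Fin 5)

variable {Y : Type u} [TopologicalSpace Y] [ChartedSpace 𝔼 Y]

/-- The open set `V ⊂ Y`, with the distribution `D` and its frame `η`, is parametrised by
`s : W → V`, with inverse `χ`, for an open set `W` in a small convex set `B` of the model space. The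
frame `η` corresponds to the frame `𝓕`, and the constants `M` and `κ` control the geometry on `B` as
in `GrowthFrame.exists_radius`. -/
structure IsLocalModel (D : ∀ y : Y, Submodule ℝ (TangentSpace (𝓡 5) y))
    (η : Fin 2 → ∀ y : Y, TangentSpace (𝓡 5) y) (V : Opens Y) (𝓕 : GrowthFrame 𝔼) (B W : Set 𝔼)
    (M κ : ℝ) (s : 𝔼 → V) (χ : Y → 𝔼) : Prop where
  isOpen : IsOpen W
  subset : W ⊆ B
  convex : Convex ℝ B
  bound : 𝓕.IsBound B M
  pos : 0 < κ
  length_le : ∀ {a b : ℝ} {z : ℝ → 𝔼 × ℝ} {q Q : ℝ → ℝ}, 𝓕.IsCharCurve W a b z q Q →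
    Q b ≤ 1 / (16 * M ^ 3)
  le_chord : ∀ {a b : ℝ} {z : ℝ → 𝔼 × ℝ} {q Q : ℝ → ℝ}, 𝓕.IsCharCurve W a b z q Q →
    κ * Q b ≤ ‖(z b).1 - (z a).1‖
  smooth : ContMDiffOn 𝓘(ℝ, 𝔼) (𝓡 5) ∞ s W
  smooth_coord : ContMDiffOn (𝓡 5) 𝓘(ℝ, 𝔼) ∞ χ V
  coord_mem : ∀ y ∈ V, χ y ∈ W
  right_inv : ∀ y : V, s (χ y) = y
  left_inv : ∀ x ∈ W, χ (s x) = x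
  map_A : ∀ x ∈ W, mfderiv 𝓘(ℝ, 𝔼) (𝓡 5) (fun x => (s x : Y)) x (𝓕.A x) = η 0 (s x : Y)
  map_B : ∀ x ∈ W, mfderiv 𝓘(ℝ, 𝔼) (𝓡 5) (fun x => (s x : Y)) x (𝓕.B x) = η 1 (s x : Y)
  span : ∀ y ∈ V, D y = Submodule.span ℝ (range fun i => η i y)

/-- All small open sets near a point have local models, with the same constants. -/
theorem exists_isLocalModel [IsManifold (𝓡 5) ∞ Y]
    {D : ∀ y : Y, Submodule ℝ (TangentSpace (𝓡 5) y)} (hD : HasGrowth235 (𝓡 5) D)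
    {U : Opens Y} {η : Fin 2 → ∀ y : Y, TangentSpace (𝓡 5) y}
    (hη : IsFrameOn (𝓡 5) D η (U : Set Y)) {y₀ : Y} (hy₀ : y₀ ∈ U) :
    ∃ V₀ : Opens Y, y₀ ∈ V₀ ∧ V₀ ≤ U ∧ ∀ V : Opens Y, V ≤ V₀ → Nonempty V →
      ∃ (𝓕 : GrowthFrame 𝔼) (B W : Set 𝔼) (M κ : ℝ) (s : 𝔼 → V) (χ : Y → 𝔼),
        IsLocalModel D η V 𝓕 B W M κ s χ := by
  set e := extChartAt (𝓡 5) y₀ with he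
  have hes : IsOpen e.source := isOpen_extChartAt_source y₀
  have het : IsOpen e.target := isOpen_extChartAt_target y₀
  have hsymm : ContMDiffOn 𝓘(ℝ, 𝔼) (𝓡 5) ∞ e.symm e.target := contMDiffOn_extChartAt_symm y₀
  have hcoord : ContMDiffOn (𝓡 5) 𝓘(ℝ, 𝔼) ∞ e e.source := by
    rw [he, extChartAt_source]; exact contMDiffOn_extChartAt
  have hΩ : IsOpen (e.target ∩ e.symm ⁻¹' (U : Set Y)) :=
    hsymm.continuousOn.isOpen_inter_preimage het U.2
  obtain ⟨𝓕, hFΩ, hFA, hFB⟩ := hD.exists_growthFrame (F := 𝔼) (by simp) U.2 hη hΩ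
    (hsymm.mono inter_subset_left) (fun x hx => by
      have := isInvertible_mfderivWithin_extChartAt_symm (I := 𝓡 5) (x := y₀) (y := x) hx.1
      rwa [(𝓡 5).range_eq_univ, mfderivWithin_univ] at this) (fun x hx => hx.2)
  have hx₀ : e y₀ ∈ 𝓕.Ω := by
    rw [hFΩ]
    refine ⟨e.map_source (mem_extChartAt_source y₀), ?_⟩
    rw [mem_preimage, e.left_inv (mem_extChartAt_source y₀)]
    exact hy₀
  obtain ⟨ρ, M, κ, hρ, hκ, hM, hchar⟩ := 𝓕.exists_radius hx₀
  refine ⟨⟨(e.source ∩ e ⁻¹' Metric.ball (e y₀) ρ) ∩ U,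
    (hcoord.continuousOn.isOpen_inter_preimage hes Metric.isOpen_ball).inter U.2⟩,
    ⟨⟨mem_extChartAt_source y₀, Metric.mem_ball_self hρ⟩, hy₀⟩, fun y hy => hy.2,
    fun V hV hne => ?_⟩
  obtain ⟨v₀⟩ := hne
  classical
  set W := e.target ∩ e.symm ⁻¹' (V : Set Y) with hW
  have hWo : IsOpen W := hsymm.continuousOn.isOpen_inter_preimage het V.2
  set s : 𝔼 → V := fun x => if h : e.symm x ∈ V then ⟨e.symm x, h⟩ else v₀ with hs
  have hsW : ∀ x ∈ W, (s x : Y) = e.symm x := fun x hx => by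
    have : e.symm x ∈ V := hx.2
    simp only [hs, dif_pos this]
  have hVs : ∀ y ∈ V, y ∈ e.source := fun y hy => (hV hy).1.1
  have hWB : W ⊆ Metric.ball (e y₀) ρ := fun x hx => by
    have := (hV hx.2).1.2
    rwa [mem_preimage, e.right_inv hx.1] at this
  have hWΩ : W ⊆ e.target ∩ e.symm ⁻¹' (U : Set Y) := fun x hx => ⟨hx.1, (hV hx.2).2⟩
  have hcW : ∀ y ∈ V, e y ∈ W := fun y hy => ⟨e.map_source (hVs y hy), by
    rw [mem_preimage, e.left_inv (hVs y hy)]; exact hy⟩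
  have hd : ∀ x ∈ W, mfderiv 𝓘(ℝ, 𝔼) (𝓡 5) (fun x => (s x : Y)) x =
      mfderiv 𝓘(ℝ, 𝔼) (𝓡 5) e.symm x := fun x hx =>
    Filter.EventuallyEq.mfderiv_eq (Filter.eventuallyEq_of_mem (hWo.mem_nhds hx) hsW)
  refine ⟨𝓕, Metric.ball (e y₀) ρ, W, M, κ, s, e, hWo, hWB, convex_ball _ _, hM, hκ,
    fun h => (hchar hWB h).1, fun h => (hchar hWB h).2, fun x hx => ?_, hcoord.mono hVs, hcW,
    fun y => ?_, fun x hx => ?_, fun x hx => ?_, fun x hx => ?_, fun y hy => ?_⟩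
  · rw [← ContMDiffWithinAt.subtypeVal_comp_iff]
    exact ((hsymm.mono inter_subset_left) x hx).congr (fun x hx => hsW x hx) (hsW x hx)
  · apply Subtype.ext
    rw [hsW _ (hcW _ y.2), e.left_inv (hVs _ y.2)]
  · rw [hsW x hx, e.right_inv hx.1]
  · rw [hd x hx, hsW x hx]; exact hFA x (hWΩ hx)
  · rw [hd x hx, hsW x hx]; exact hFB x (hWΩ hx)
  · exact (hη.2 y (hV hy).2).2

end LocalModel

section LineParam

local notation "𝔼" => EuclideanSpace ℝ (Fin 5)

variable {Y : Type u} [TopologicalSpace Y] [ChartedSpace 𝔼 Y]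

/-- The parametrisation of the oriented lines over `V` by points and angles that a parametrisation
`s` of `V` induces. -/
noncomputable def lineParam {V : Opens Y} (s : 𝔼 → V) (p : 𝔼 × ℝ) : LineSpace V :=
  (s p.1, Circle.exp p.2)

theorem contMDiff_coe_circle : ContMDiff (𝓡 1) 𝓘(ℝ, ℂ) ∞ (fun u : Circle => (u : ℂ)) :=
  have : Fact (Module.finrank ℝ ℂ = 1 + 1) := finrank_real_complex_fact'
  contMDiff_coe_sphere

theorem contMDiff_lineSpace_circle {V : Opens Y} :
    ContMDiff modelZ 𝓘(ℝ, ℂ) ∞ (fun z : LineSpace V => (z.2 : ℂ)) :=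
  contMDiff_coe_circle.comp contMDiff_snd

theorem contMDiff_projY {V : Opens Y} : ContMDiff modelZ (𝓡 5) ∞ (projY (V := V)) :=
  contMDiff_subtype_val.comp contMDiff_fst

namespace IsLocalModel

variable {D : ∀ y : Y, Submodule ℝ (TangentSpace (𝓡 5) y)}
  {η : Fin 2 → ∀ y : Y, TangentSpace (𝓡 5) y} {V : Opens Y} {𝓕 : GrowthFrame 𝔼} {B W : Set 𝔼}
  {M κ : ℝ} {s : 𝔼 → V} {χ : Y → 𝔼}

theorem isOpen_prod (h : IsLocalModel D η V 𝓕 B W M κ s χ) : IsOpen (W ×ˢ (univ : Set ℝ)) :=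
  h.isOpen.prod isOpen_univ

theorem contMDiffOn_lineParam (h : IsLocalModel D η V 𝓕 B W M κ s χ) :
    ContMDiffOn 𝓘(ℝ, 𝔼 × ℝ) modelZ ∞ (lineParam s) (W ×ˢ univ) := by
  refine ContMDiffOn.prodMk (h.smooth.comp (t := W) contDiff_fst.contMDiff.contMDiffOn
    fun p hp => hp.1) ?_
  exact (contMDiff_circleExp.comp contDiff_snd.contMDiff).contMDiffOn

theorem contMDiffAt_lineParam (h : IsLocalModel D η V 𝓕 B W M κ s χ) {p : 𝔼 × ℝ} (hp : p.1 ∈ W) :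
    ContMDiffAt 𝓘(ℝ, 𝔼 × ℝ) modelZ ∞ (lineParam s) p :=
  h.contMDiffOn_lineParam.contMDiffAt (h.isOpen_prod.mem_nhds ⟨hp, mem_univ _⟩)

theorem contMDiffAt_val (h : IsLocalModel D η V 𝓕 B W M κ s χ) {x : 𝔼} (hx : x ∈ W) :
    ContMDiffAt 𝓘(ℝ, 𝔼) (𝓡 5) ∞ (fun x => (s x : Y)) x :=
  contMDiff_subtype_val.contMDiffAt.comp x (h.smooth.contMDiffAt (h.isOpen.mem_nhds hx))

theorem contMDiffAt_coord (h : IsLocalModel D η V 𝓕 B W M κ s χ) {y : Y} (hy : y ∈ V) :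
    ContMDiffAt (𝓡 5) 𝓘(ℝ, 𝔼) ∞ χ y :=
  h.smooth_coord.contMDiffAt (V.2.mem_nhds hy)

theorem contMDiff_lineCoord (h : IsLocalModel D η V 𝓕 B W M κ s χ) :
    ContMDiff modelZ 𝓘(ℝ, 𝔼) ∞ (fun z : LineSpace V => χ z.1) := fun z =>
  (h.contMDiffAt_coord z.1.2).comp z contMDiff_projY.contMDiffAt

theorem mfderiv_coord_mfderiv_val (h : IsLocalModel D η V 𝓕 B W M κ s χ) {x : 𝔼} (hx : x ∈ W)
    (v : 𝔼) : (mfderiv (𝓡 5) 𝓘(ℝ, 𝔼) χ (s x : Y) : 𝔼 →L[ℝ] 𝔼)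
      ((mfderiv 𝓘(ℝ, 𝔼) (𝓡 5) (fun x => (s x : Y)) x : 𝔼 →L[ℝ] 𝔼) v) = v := by
  have h1 := (((h.contMDiffAt_coord (s x).2).mdifferentiableAt (by simp)).hasMFDerivAt.comp x
    ((h.contMDiffAt_val hx).mdifferentiableAt (by simp)).hasMFDerivAt)
  have h2 : HasMFDerivAt 𝓘(ℝ, 𝔼) 𝓘(ℝ, 𝔼) (χ ∘ fun x => (s x : Y)) x
      (ContinuousLinearMap.id ℝ 𝔼) :=
    (hasMFDerivAt_id x).congr_of_eventuallyEq
      (Filter.eventuallyEq_of_mem (h.isOpen.mem_nhds hx) fun x hx => h.left_inv x hx)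
  exact congrArg (fun L : 𝔼 →L[ℝ] 𝔼 => L v) (hasMFDerivAt_unique h1 h2)

theorem injective_mfderiv_val (h : IsLocalModel D η V 𝓕 B W M κ s χ) {x : 𝔼} (hx : x ∈ W) :
    Function.Injective (mfderiv 𝓘(ℝ, 𝔼) (𝓡 5) (fun x => (s x : Y)) x : 𝔼 →L[ℝ] 𝔼) :=
  Function.LeftInverse.injective (h.mfderiv_coord_mfderiv_val hx)

theorem surjective_mfderiv_val (h : IsLocalModel D η V 𝓕 B W M κ s χ) {x : 𝔼} (hx : x ∈ W) :
    Function.Surjective (mfderiv 𝓘(ℝ, 𝔼) (𝓡 5) (fun x => (s x : Y)) x : 𝔼 →L[ℝ] 𝔼) := by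
  have hinj := h.injective_mfderiv_val hx
  set T : 𝔼 →L[ℝ] 𝔼 := mfderiv 𝓘(ℝ, 𝔼) (𝓡 5) (fun x => (s x : Y)) x with hT
  exact (LinearMap.injective_iff_surjective (f := T.toLinearMap)).1 hinj

theorem lineParam_coord (h : IsLocalModel D η V 𝓕 B W M κ s χ) (z : LineSpace V) :
    lineParam s (χ z.1, Complex.arg (z.2 : ℂ)) = z := by
  refine Prod.ext (h.right_inv z.1) ?_
  exact Circle.exp_arg z.2

theorem lineParam_eq_iff (h : IsLocalModel D η V 𝓕 B W M κ s χ) {p p' : 𝔼 × ℝ} (hp : p.1 ∈ W)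
    (hp' : p'.1 ∈ W) :
    lineParam s p = lineParam s p' ↔ ∃ m : ℤ, p = p' + (0, m * (2 * Real.pi)) := by
  constructor
  · intro he
    have h1 : s p.1 = s p'.1 := congrArg Prod.fst he
    have h2 : Circle.exp p.2 = Circle.exp p'.2 := congrArg Prod.snd he
    obtain ⟨m, hm⟩ := Circle.exp_eq_exp.1 h2
    refine ⟨m, Prod.ext ?_ hm⟩
    rw [← h.left_inv p.1 hp, h1, h.left_inv _ hp']
    simp
  · rintro ⟨m, rfl⟩
    refine Prod.ext (by simp [lineParam]) ?_
    exact Circle.exp_eq_exp.2 ⟨m, rfl⟩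

/-- The differential of the base point of a line. -/
theorem mfderiv_lineCoord (h : IsLocalModel D η V 𝓕 B W M κ s χ) {p : 𝔼 × ℝ} (hp : p.1 ∈ W)
    (v : 𝔼 × ℝ) :
    (mfderiv modelZ 𝓘(ℝ, 𝔼) (fun z : LineSpace V => χ z.1) (lineParam s p) :
        EuclideanSpace ℝ (Fin 5) × EuclideanSpace ℝ (Fin 1) →L[ℝ] 𝔼)
      ((mfderiv 𝓘(ℝ, 𝔼 × ℝ) modelZ (lineParam s) p :
        𝔼 × ℝ →L[ℝ] EuclideanSpace ℝ (Fin 5) × EuclideanSpace ℝ (Fin 1)) v) = v.1 := by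
  have h1 :=
    ((h.contMDiff_lineCoord (lineParam s p)).mdifferentiableAt (by simp)).hasMFDerivAt.comp p
    ((h.contMDiffAt_lineParam hp).mdifferentiableAt (by simp)).hasMFDerivAt
  have h2 : HasMFDerivAt 𝓘(ℝ, 𝔼 × ℝ) 𝓘(ℝ, 𝔼) ((fun z : LineSpace V => χ z.1) ∘ lineParam s) p
      (ContinuousLinearMap.fst ℝ 𝔼 ℝ) :=
    (hasFDerivAt_fst.hasMFDerivAt).congr_of_eventuallyEq
      (Filter.eventuallyEq_of_mem (h.isOpen_prod.mem_nhds ⟨hp, mem_univ _⟩)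
        fun p hp => h.left_inv p.1 hp.1)
  exact congrArg (fun L : 𝔼 × ℝ →L[ℝ] 𝔼 => L v) (hasMFDerivAt_unique h1 h2)

/-- The differential of the direction of a line. -/
theorem mfderiv_lineSpace_circle (h : IsLocalModel D η V 𝓕 B W M κ s χ) {p : 𝔼 × ℝ} (hp : p.1 ∈ W)
    (v : 𝔼 × ℝ) :
    (mfderiv modelZ 𝓘(ℝ, ℂ) (fun z : LineSpace V => (z.2 : ℂ)) (lineParam s p) :
        EuclideanSpace ℝ (Fin 5) × EuclideanSpace ℝ (Fin 1) →L[ℝ] ℂ)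
      ((mfderiv 𝓘(ℝ, 𝔼 × ℝ) modelZ (lineParam s) p :
        𝔼 × ℝ →L[ℝ] EuclideanSpace ℝ (Fin 5) × EuclideanSpace ℝ (Fin 1)) v) =
      (v.2 : ℂ) * (Complex.exp ((p.2 : ℂ) * Complex.I) * Complex.I) := by
  have h1 := ((contMDiff_lineSpace_circle (lineParam s p)).mdifferentiableAt
    (by simp)).hasMFDerivAt.comp p
    ((h.contMDiffAt_lineParam hp).mdifferentiableAt (by simp)).hasMFDerivAt
  have h3 : HasDerivAt (fun θ : ℝ => Complex.exp (θ * Complex.I))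
      (Complex.exp (p.2 * Complex.I) * Complex.I) p.2 := by
    simpa using ((hasDerivAt_id p.2).ofReal_comp.mul_const Complex.I).cexp
  have h2 : HasMFDerivAt 𝓘(ℝ, 𝔼 × ℝ) 𝓘(ℝ, ℂ)
      ((fun z : LineSpace V => (z.2 : ℂ)) ∘ lineParam s) p
      (((1 : ℝ →L[ℝ] ℝ).smulRight (Complex.exp (p.2 * Complex.I) * Complex.I)).comp
        (ContinuousLinearMap.snd ℝ 𝔼 ℝ)) := by
    refine HasFDerivAt.hasMFDerivAt ?_
    have h4 := h3.hasFDerivAt.comp p (hasFDerivAt_snd (𝕜 := ℝ) (E := 𝔼) (F := ℝ))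
    refine HasFDerivAt.congr_of_eventuallyEq (f := (fun θ : ℝ => Complex.exp (θ * Complex.I)) ∘
      Prod.snd) ?_ (Filter.Eventually.of_forall fun p => ?_)
    · exact h4
    · simp [lineParam, Circle.coe_exp]
  have h5 := congrArg (fun L : 𝔼 × ℝ →L[ℝ] ℂ => L v) (hasMFDerivAt_unique h1 h2)
  refine Eq.trans h5 ?_
  change (v.2 : ℝ) • (Complex.exp (p.2 * Complex.I) * Complex.I) = _
  rw [Complex.real_smul]

theorem bijective_mfderiv_lineParam (h : IsLocalModel D η V 𝓕 B W M κ s χ) {p : 𝔼 × ℝ}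
    (hp : p.1 ∈ W) : Function.Bijective (mfderiv 𝓘(ℝ, 𝔼 × ℝ) modelZ (lineParam s) p :
      𝔼 × ℝ →L[ℝ] EuclideanSpace ℝ (Fin 5) × EuclideanSpace ℝ (Fin 1)) := by
  set T : 𝔼 × ℝ →L[ℝ] EuclideanSpace ℝ (Fin 5) × EuclideanSpace ℝ (Fin 1) :=
    mfderiv 𝓘(ℝ, 𝔼 × ℝ) modelZ (lineParam s) p with hT
  have hinj : Function.Injective T.toLinearMap := by
    rw [← LinearMap.ker_eq_bot, LinearMap.ker_eq_bot']
    intro v hv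
    have hv' : T v = 0 := hv
    obtain ⟨S, hS⟩ : ∃ S : EuclideanSpace ℝ (Fin 5) × EuclideanSpace ℝ (Fin 1) →L[ℝ] 𝔼,
        ∀ v, S (T v) = v.1 := ⟨_, h.mfderiv_lineCoord hp⟩
    obtain ⟨S', hS'⟩ : ∃ S' : EuclideanSpace ℝ (Fin 5) × EuclideanSpace ℝ (Fin 1) →L[ℝ] ℂ,
        ∀ v, S' (T v) = (v.2 : ℂ) * (Complex.exp ((p.2 : ℂ) * Complex.I) * Complex.I) :=
      ⟨_, h.mfderiv_lineSpace_circle hp⟩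
    have h1 := hS v
    have h2 := hS' v
    rw [hv', map_zero] at h1 h2
    refine Prod.ext h1.symm ?_
    have := h2.symm
    simpa [Complex.exp_ne_zero] using this
  have hdim : Module.finrank ℝ (𝔼 × ℝ) =
      Module.finrank ℝ (EuclideanSpace ℝ (Fin 5) × EuclideanSpace ℝ (Fin 1)) := by simp
  exact ⟨hinj, (LinearMap.injective_iff_surjective_of_finrank_eq_finrank hdim).1 hinj⟩

theorem mfderiv_projY (h : IsLocalModel D η V 𝓕 B W M κ s χ) {p : 𝔼 × ℝ} (hp : p.1 ∈ W)
    (v : 𝔼 × ℝ) :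
    (mfderiv modelZ (𝓡 5) (projY (V := V)) (lineParam s p) :
        EuclideanSpace ℝ (Fin 5) × EuclideanSpace ℝ (Fin 1) →L[ℝ] 𝔼)
      ((mfderiv 𝓘(ℝ, 𝔼 × ℝ) modelZ (lineParam s) p :
        𝔼 × ℝ →L[ℝ] EuclideanSpace ℝ (Fin 5) × EuclideanSpace ℝ (Fin 1)) v) =
      (mfderiv 𝓘(ℝ, 𝔼) (𝓡 5) (fun x => (s x : Y)) p.1 : 𝔼 →L[ℝ] 𝔼) v.1 := by
  have h1 := ((contMDiff_projY (lineParam s p)).mdifferentiableAt (by simp)).hasMFDerivAt.comp p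
    ((h.contMDiffAt_lineParam hp).mdifferentiableAt (by simp)).hasMFDerivAt
  have h2 := (((h.contMDiffAt_val hp).mdifferentiableAt (by simp)).hasMFDerivAt).comp p
    (hasFDerivAt_fst (𝕜 := ℝ) (E := 𝔼) (F := ℝ) (p := p)).hasMFDerivAt
  exact congrArg (fun L : 𝔼 × ℝ →L[ℝ] 𝔼 => L v) (hasMFDerivAt_unique h1 h2)

theorem mfderiv_mem_kerY_iff (h : IsLocalModel D η V 𝓕 B W M κ s χ) {p : 𝔼 × ℝ} (hp : p.1 ∈ W)
    (v : 𝔼 × ℝ) :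
    mfderiv 𝓘(ℝ, 𝔼 × ℝ) modelZ (lineParam s) p v ∈ kerY (lineParam s p) ↔ v.1 = 0 := by
  have h1 : mfderiv 𝓘(ℝ, 𝔼 × ℝ) modelZ (lineParam s) p v ∈ kerY (lineParam s p) ↔
      (mfderiv 𝓘(ℝ, 𝔼) (𝓡 5) (fun x => (s x : Y)) p.1 : 𝔼 →L[ℝ] 𝔼) v.1 = 0 := by
    rw [← h.mfderiv_projY hp v]
    exact LinearMap.mem_ker
  rw [h1]
  exact map_eq_zero_iff _ (h.injective_mfderiv_val hp)

theorem lineVector_lineParam (h : IsLocalModel D η V 𝓕 B W M κ s χ) {p : 𝔼 × ℝ} (hp : p.1 ∈ W) :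
    lineVector η (lineParam s p) =
      (mfderiv 𝓘(ℝ, 𝔼) (𝓡 5) (fun x => (s x : Y)) p.1 : 𝔼 →L[ℝ] 𝔼) (𝓕.ell p) := by
  have h1 := h.map_A p.1 hp
  have h2 := h.map_B p.1 hp
  set T : 𝔼 →L[ℝ] 𝔼 := mfderiv 𝓘(ℝ, 𝔼) (𝓡 5) (fun x => (s x : Y)) p.1 with hT
  have h3 : T (𝓕.ell p) = Real.cos p.2 • T (𝓕.A p.1) + Real.sin p.2 • T (𝓕.B p.1) := by
    rw [GrowthFrame.ell, map_add, map_smul, map_smul]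
  refine Eq.trans ?_ h3.symm
  have e1 : ((lineParam s p).2 : ℂ).re = Real.cos p.2 := by
    simp [lineParam, Circle.coe_exp, Complex.exp_ofReal_mul_I_re]
  have e2 : ((lineParam s p).2 : ℂ).im = Real.sin p.2 := by
    simp [lineParam, Circle.coe_exp, Complex.exp_ofReal_mul_I_im]
  simp only [lineVector]
  rw [e1, e2]
  exact congrArg₂ (fun v w : 𝔼 => Real.cos p.2 • v + Real.sin p.2 • w) h1.symm h2.symm

end IsLocalModel

end LineParam

/-! ### The space of singular paths of the distribution as a fibration -/

section Velocity

variable {E : Type*} [NormedAddCommGroup E] [NormedSpace ℝ E] {H : Type*} [TopologicalSpace H]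
  {I : ModelWithCorners ℝ E H} {M : Type*} [TopologicalSpace M] [ChartedSpace H M]

theorem HasVelocityWithinAt.unique {a b t : ℝ} (hab : a < b) (ht : t ∈ Icc a b) {γ : ℝ → M}
    {w w' : TangentBundle I M} (hw : HasVelocityWithinAt I γ (Icc a b) t w)
    (hw' : HasVelocityWithinAt I γ (Icc a b) t w') : w = w' := by
  obtain ⟨p, v⟩ := w
  obtain ⟨p', v'⟩ := w'
  obtain ⟨h1, h2⟩ := hw
  obtain ⟨h1', h2'⟩ := hw'
  change p = γ t at h1
  change p' = γ t at h1'
  subst h1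
  subst h1'
  congr 1
  have hu : UniqueMDiffWithinAt 𝓘(ℝ, ℝ) (Icc a b) t :=
    uniqueMDiffWithinAt_iff_uniqueDiffWithinAt.2 (uniqueDiffOn_Icc hab t ht)
  have h3 := congrArg (fun L : ℝ →L[ℝ] E => L 1) (hu.eq h2 h2')
  change (1 : ℝ) • (v : E) = (1 : ℝ) • (v' : E) at h3
  rwa [one_smul, one_smul] at h3

theorem HasVelocityWithinAt.congr {s : Set ℝ} {t : ℝ} {γ γ' : ℝ → M} {w : TangentBundle I M}
    (h : HasVelocityWithinAt I γ s t w) (ht : t ∈ s) (he : EqOn γ' γ s) :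
    HasVelocityWithinAt I γ' s t w :=
  ⟨h.1.trans (he ht).symm, h.2.congr_of_eventuallyEq (he.eventuallyEq_of_mem self_mem_nhdsWithin)
    (he ht)⟩

theorem exists_primitive {a b : ℝ} (hab : a ≤ b) {q : ℝ → ℝ} (hq : ContinuousOn q (Icc a b)) :
    ∃ Q : ℝ → ℝ, Q a = 0 ∧ ∀ t ∈ Icc a b, HasDerivWithinAt Q (q t) (Icc a b) t := by
  have hgc : Continuous (IccExtend hab ((Icc a b).domRestrict q)) :=
    (continuousOn_iff_continuous_domRestrict.1 hq).Icc_extend'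
  refine ⟨fun t => ∫ s in a..t, IccExtend hab ((Icc a b).domRestrict q) s, by simp,
    fun t ht => ?_⟩
  have h1 := (hgc.integral_hasStrictDerivAt a t).hasDerivAt.hasDerivWithinAt (s := Icc a b)
  rw [IccExtend_of_mem hab _ ht] at h1
  exact h1

theorem eq_zero_of_ae_Icc {a b : ℝ} (hab : a < b) {g : ℝ → ℝ} (hg : ContinuousOn g (Icc a b))
    (h0 : ∀ᵐ t ∂(volume.restrict (Icc a b)), g t = 0) : ∀ t ∈ Icc a b, g t = 0 := by
  intro t ht
  by_contra hne
  have h1 := eventually_nhdsWithin_iff.1 ((hg t ht).eventually_ne hne)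
  obtain ⟨t', ⟨h2, h3⟩, h4⟩ := ((frequently_of_ae_Icc hab h0 ht).and_eventually h1).exists
  exact h4 h2 h3

theorem GrowthFrame.IsCharCurve.restrict {F : Type*} [NormedAddCommGroup F] [NormedSpace ℝ F]
    {𝓕 : GrowthFrame F} {V : Set F} {a b : ℝ} {z : ℝ → F × ℝ} {q Q : ℝ → ℝ}
    (h : 𝓕.IsCharCurve V a b z q Q) {t₁ t₂ : ℝ} (h₁ : t₁ ∈ Icc a b) (h₂ : t₂ ∈ Icc a b)
    (hle : t₁ ≤ t₂) : 𝓕.IsCharCurve V t₁ t₂ z q (fun t => Q t - Q t₁) :=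
  have hs : Icc t₁ t₂ ⊆ Icc a b := Icc_subset_Icc h₁.1 h₂.2
  ⟨hle, fun t ht => h.mem t (hs ht), fun t ht => h.pos t (hs ht),
    fun t ht => (h.deriv t (hs ht)).mono hs, sub_self _,
    fun t ht => ((h.length_deriv t (hs ht)).mono hs).sub_const _⟩

end Velocity

section Fibration

local notation "𝔼" => EuclideanSpace ℝ (Fin 5)

variable {Y : Type u} [TopologicalSpace Y] [ChartedSpace 𝔼 Y]

namespace IsLocalModel

variable {D : ∀ y : Y, Submodule ℝ (TangentSpace (𝓡 5) y)}
  {η : Fin 2 → ∀ y : Y, TangentSpace (𝓡 5) y} {V : Opens Y} {𝓕 : GrowthFrame 𝔼} {B W : Set 𝔼}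
  {M κ : ℝ} {s : 𝔼 → V} {χ : Y → 𝔼}

theorem subset_domain (h : IsLocalModel D η V 𝓕 B W M κ s χ) : W ⊆ 𝓕.Ω :=
  h.subset.trans h.bound.subset

theorem mem_distribution_iff (h : IsLocalModel D η V 𝓕 B W M κ s χ) {x : 𝔼} (hx : x ∈ W)
    (v : 𝔼) : mfderiv 𝓘(ℝ, 𝔼) (𝓡 5) (fun x => (s x : Y)) x v ∈ D (s x : Y) ↔
      ∃ w w' : ℝ, v = w • 𝓕.A x + w' • 𝓕.B x := by
  have hA := h.map_A x hx
  have hB := h.map_B x hx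
  have hinj := h.injective_mfderiv_val hx
  rw [h.span _ (s x).2, Submodule.mem_span_range_iff_exists_fun]
  obtain ⟨T, hT⟩ : ∃ T : 𝔼 →L[ℝ] 𝔼, T = mfderiv 𝓘(ℝ, 𝔼) (𝓡 5) (fun x => (s x : Y)) x := ⟨_, rfl⟩
  rw [← hT] at hinj
  have hA' : T (𝓕.A x) = (η 0 (s x : Y) : 𝔼) := by rw [hT]; exact hA
  have hB' : T (𝓕.B x) = (η 1 (s x : Y) : 𝔼) := by rw [hT]; exact hB
  have e : (mfderiv 𝓘(ℝ, 𝔼) (𝓡 5) (fun x => (s x : Y)) x v : 𝔼) = T v := by rw [hT]; rfl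
  have key : ∀ w w' : ℝ, w • (η 0 (s x : Y) : 𝔼) + w' • (η 1 (s x : Y) : 𝔼) =
      T (w • 𝓕.A x + w' • 𝓕.B x) := fun w w' => by
    rw [map_add, map_smul, map_smul, hA', hB']
    rfl
  constructor
  · rintro ⟨c, hc⟩
    rw [Fin.sum_univ_two] at hc
    exact ⟨c 0, c 1, hinj (e.symm.trans (hc.symm.trans (key _ _)))⟩
  · rintro ⟨w, w', rfl⟩
    refine ⟨![w, w'], ?_⟩
    rw [Fin.sum_univ_two]
    exact (key w w').trans e.symm

variable [IsManifold (𝓡 5) ∞ Y]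

/-- The lift of a singular path of the distribution to the space of oriented lines is a
characteristic curve. -/
theorem exists_isCharCurve (h : IsLocalModel D η V 𝓕 B W M κ s χ) {a b : ℝ} {γ : ℝ → Y}
    (hγ : IsSingularPath (𝓡 5) (𝓡 5) D (id : Y → Y) a b γ) (hV : ∀ t ∈ Icc a b, γ t ∈ V) :
    ∃ (z : ℝ → 𝔼 × ℝ) (q Q : ℝ → ℝ), 𝓕.IsCharCurve W a b z q Q ∧
      ∀ t ∈ Icc a b, ∀ l : LineSpace V, LiftsThrough η a b γ t l ↔ l = lineParam s (z t) := by
  obtain ⟨hab, ⟨hγs, hγ'⟩, c, hc, hce⟩ := hγ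
  have hu : UniqueDiffOn ℝ (Icc a b) := uniqueDiffOn_Icc hab
  set x : ℝ → 𝔼 := fun t => χ (γ t) with hx
  have hxs : ContDiffOn ℝ ∞ x (Icc a b) :=
    contMDiffOn_iff_contDiffOn.1 (h.smooth_coord.comp hγs hV)
  set x' : ℝ → 𝔼 := derivWithin x (Icc a b) with hx'
  have hxd : ∀ t ∈ Icc a b, HasDerivWithinAt x (x' t) (Icc a b) t := fun t ht =>
    ((hxs t ht).differentiableWithinAt (by simp)).hasDerivWithinAt
  have hx's : ContDiffOn ℝ ∞ x' (Icc a b) := hxs.derivWithin hu (by simp)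
  have hxW : ∀ t ∈ Icc a b, x t ∈ W := fun t ht => h.coord_mem _ (hV t ht)
  have hxΩ : ∀ t ∈ Icc a b, x t ∈ 𝓕.Ω := fun t ht => h.subset_domain (hxW t ht)
  have hsx : ∀ t ∈ Icc a b, (s (x t) : Y) = γ t := fun t ht =>
    congrArg Subtype.val (h.right_inv ⟨γ t, hV t ht⟩)
  have hvel : ∀ t ∈ Icc a b, HasVelocityWithinAt (𝓡 5) γ (Icc a b) t
      (⟨(s (x t) : Y), mfderiv 𝓘(ℝ, 𝔼) (𝓡 5) (fun x => (s x : Y)) (x t) (x' t)⟩ :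
        TangentBundle (𝓡 5) Y) := fun t ht =>
    (hasVelocityWithinAt_comp ((h.contMDiffAt_val (hxW t ht)).mdifferentiableAt (by simp))
      (hxd t ht)).congr ht fun t ht => (hsx t ht).symm
  have hcv : ∀ᵐ t ∂(volume.restrict (Icc a b)), c t = (⟨(s (x t) : Y),
      mfderiv 𝓘(ℝ, 𝔼) (𝓡 5) (fun x => (s x : Y)) (x t) (x' t)⟩ : TangentBundle (𝓡 5) Y) := by
    filter_upwards [hc.velocity, ae_restrict_mem measurableSet_Icc] with t h1 ht
    rw [tangentMap_id] at h1
    exact h1.unique hab ht (hvel t ht)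
  -- the velocity lies in the plane that the frame spans
  have hα : ∀ i : Fin 5, i ≠ 0 → i ≠ 1 → ∀ t ∈ Icc a b, 𝓕.α i (x t) (x' t) = 0 := by
    intro i hi0 hi1
    refine eq_zero_of_ae_Icc hab ?_ ?_
    · exact ((𝓕.smoothα i).continuousOn.comp hxs.continuousOn hxΩ).clm_apply hx's.continuousOn
    · filter_upwards [hcv, hc.mem, ae_restrict_mem measurableSet_Icc] with t h1 h2 ht
      rw [h1] at h2
      obtain ⟨w, w', hw⟩ := (h.mem_distribution_iff (hxW t ht) _).1 h2
      rw [hw, map_add, map_smul, map_smul, GrowthFrame.dualA (hxΩ t ht),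
        GrowthFrame.dualB (hxΩ t ht), if_neg hi0, if_neg hi1]
      simp
  set w : Fin 5 → ℝ → ℝ := fun i t => 𝓕.α i (x t) (x' t) with hw
  have hws : ∀ i, ContDiffOn ℝ ∞ (w i) (Icc a b) := fun i =>
    ((𝓕.smoothα i).comp hxs hxΩ).clm_apply hx's
  have hx'w : ∀ t ∈ Icc a b, x' t = w 0 t • 𝓕.A (x t) + w 1 t • 𝓕.B (x t) := fun t ht => by
    have h1 := 𝓕.expand (x t) (hxΩ t ht) (x' t)
    rw [hα 2 (by decide) (by decide) t ht, hα 3 (by decide) (by decide) t ht,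
      hα 4 (by decide) (by decide) t ht] at h1
    simpa using h1
  -- polar coordinates of the velocity
  set υ : ℝ → ℂ := fun t => (w 0 t : ℂ) + w 1 t * Complex.I with hυ
  have hυs : ContDiffOn ℝ ∞ υ (Icc a b) :=
    (Complex.ofRealCLM.contDiff.comp_contDiffOn (hws 0)).add
      ((Complex.ofRealCLM.contDiff.comp_contDiffOn (hws 1)).mul contDiffOn_const)
  have hυ0 : ∀ t ∈ Icc a b, υ t ≠ 0 := by
    intro t ht h0
    have e0 : w 0 t = 0 := by simpa [hυ] using congrArg Complex.re h0
    have e1 : w 1 t = 0 := by simpa [hυ] using congrArg Complex.im h0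
    have e2 : x' t = 0 := by rw [hx'w t ht, e0, e1]; simp
    refine hγ' t ht ?_
    have h1 := (hvel t ht).2.mfderivWithin
      (uniqueMDiffWithinAt_iff_uniqueDiffWithinAt.2 (hu t ht))
    refine h1.trans (ContinuousLinearMap.ext fun r => ?_)
    have h2 : (mfderiv 𝓘(ℝ, 𝔼) (𝓡 5) (fun x => (s x : Y)) (x t) : 𝔼 →L[ℝ] 𝔼) (x' t) = 0 := by
      rw [e2]; exact map_zero _
    change r • (mfderiv 𝓘(ℝ, 𝔼) (𝓡 5) (fun x => (s x : Y)) (x t) : 𝔼 →L[ℝ] 𝔼) (x' t) = 0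
    rw [h2, smul_zero]
  obtain ⟨θ, θ', -, hθ, hυθ⟩ := exists_polar_angle hab.le
    (fun t ht => ((hυs t ht).differentiableWithinAt (by simp)).hasDerivWithinAt)
    (hυs.derivWithin hu (m := ∞) (by simp)).continuousOn hυ0
  set q : ℝ → ℝ := fun t => ‖υ t‖ with hq
  have hqc : ContinuousOn q (Icc a b) := hυs.continuousOn.norm
  have hq0 : ∀ t ∈ Icc a b, 0 < q t := fun t ht => norm_pos_iff.2 (hυ0 t ht)
  have hw0 : ∀ t ∈ Icc a b, w 0 t = q t * Real.cos (θ t) := fun t ht => by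
    have := congrArg Complex.re (hυθ t ht)
    simpa [hυ, hq, Complex.exp_ofReal_mul_I_re] using this
  have hw1 : ∀ t ∈ Icc a b, w 1 t = q t * Real.sin (θ t) := fun t ht => by
    have := congrArg Complex.im (hυθ t ht)
    simpa [hυ, hq, Complex.exp_ofReal_mul_I_im] using this
  have hxell : ∀ t ∈ Icc a b, x' t = q t • 𝓕.ell (x t, θ t) := fun t ht => by
    rw [hx'w t ht, hw0 t ht, hw1 t ht, GrowthFrame.ell]
    module
  -- a costate, since the control is singular
  obtain ⟨l, hl⟩ := exists_costate_of_isSingularControl (W := 𝔼) (I := 𝓡 5) (J := 𝓡 5) (G := D)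
    (π := (id : Y → Y)) contMDiff_id h.isOpen (P := fun x => (s x : Y))
    (fun x hx => (h.contMDiffAt_val hx).contMDiffWithinAt) (X := 𝓕.A) (X' := 𝓕.B) (Y := 𝓕.A)
    (Y' := 𝓕.B) (𝓕.smoothA.mono h.subset_domain) (𝓕.smoothB.mono h.subset_domain)
    (𝓕.smoothA.mono h.subset_domain) (𝓕.smoothB.mono h.subset_domain)
    (fun x hx => (h.mem_distribution_iff hx _).2 ⟨1, 0, by simp⟩)
    (fun x hx => (h.mem_distribution_iff hx _).2 ⟨0, 1, by simp⟩)
    (fun x _ => rfl) (fun x _ => rfl) hab (hws 0).continuousOn (hws 1).continuousOn hxW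
    (fun t ht => (hxd t ht).congr_deriv (hx'w t ht)) hce
    (by
      filter_upwards [hcv, ae_restrict_mem measurableSet_Icc] with t h1 ht
      rw [h1, hx'w t ht]
      rfl)
    (fun t ht => (hsx t ht).symm) (h.surjective_mfderiv_val (hxW b (right_mem_Icc.2 hab.le)))
  have hang := GrowthFrame.angle_deriv_eq hab hxΩ hqc
    (fun t ht => (hxd t ht).congr_deriv (hxell t ht)) hθ
    (fun t ht => by
      have := (hl t ht).2.1
      rwa [hw0 t ht, hw1 t ht] at this)
    (fun t ht => (hl t ht).2.2.1) (fun t ht => (hl t ht).2.2.2) (fun t ht => (hl t ht).1)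
  obtain ⟨Q, hQ0, hQ⟩ := exists_primitive hab.le hqc
  refine ⟨fun t => (x t, θ t), q, Q, ⟨hab.le, hxW, hq0, fun t ht => ?_, hQ0, hQ⟩,
    fun t ht L => ⟨?_, ?_⟩⟩
  · refine ((hxd t ht).prodMk (hθ t ht)).congr_deriv ?_
    rw [hxell t ht, hang t ht (hq0 t ht).ne']
    rfl
  · rintro ⟨r, hr, hL⟩
    have h1 := hL.unique hab ht (hvel t ht)
    set ϑ := Complex.arg (L.2 : ℂ) with hϑ
    have hLp := h.lineParam_coord L
    have hbase : (L.1 : Y) = s (x t) := congrArg Bundle.TotalSpace.proj h1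
    have hχL : χ L.1 = x t := by rw [hbase, h.left_inv _ (hxW t ht)]
    rw [hχL] at hLp
    rw [← hLp] at h1
    have h2 := Bundle.TotalSpace.mk_inj.1 h1
    rw [h.lineVector_lineParam (p := (x t, ϑ)) (hxW t ht), hxell t ht] at h2
    have h3 : r • 𝓕.ell (x t, ϑ) = q t • 𝓕.ell (x t, θ t) := by
      apply h.injective_mfderiv_val (hxW t ht)
      refine Eq.trans ?_ h2
      exact map_smul (mfderiv 𝓘(ℝ, 𝔼) (𝓡 5) (fun x => (s x : Y)) (x t) : 𝔼 →L[ℝ] 𝔼) r _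
    have e0 := congrArg (𝓕.α 0 (x t)) h3
    have e1 := congrArg (𝓕.α 1 (x t)) h3
    simp [GrowthFrame.ell, GrowthFrame.dualA (hxΩ t ht), GrowthFrame.dualB (hxΩ t ht)] at e0 e1
    have hrq : r = q t := by
      have h4 : r ^ 2 = q t ^ 2 := by
        have s1 := Real.sin_sq_add_cos_sq ϑ
        have s2 := Real.sin_sq_add_cos_sq (θ t)
        linear_combination (r * Real.cos ϑ + q t * Real.cos (θ t)) * e0 +
          (r * Real.sin ϑ + q t * Real.sin (θ t)) * e1 - r ^ 2 * s1 + q t ^ 2 * s2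
      exact (pow_left_inj₀ hr.le (hq0 t ht).le two_ne_zero).1 h4
    rw [hrq] at e0 e1
    have hne := (hq0 t ht).ne'
    rw [← hLp]
    refine Prod.ext rfl (Circle.ext ?_)
    change ((Circle.exp ϑ : Circle) : ℂ) = (Circle.exp (θ t) : Circle)
    rw [Circle.coe_exp, Circle.coe_exp]
    refine Complex.ext ?_ ?_
    · rw [Complex.exp_ofReal_mul_I_re, Complex.exp_ofReal_mul_I_re]
      exact mul_left_cancel₀ hne e0
    · rw [Complex.exp_ofReal_mul_I_im, Complex.exp_ofReal_mul_I_im]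
      exact mul_left_cancel₀ hne e1
  · rintro rfl
    refine ⟨q t, hq0 t ht, ?_⟩
    have h1 := hvel t ht
    have e1 : (mfderiv 𝓘(ℝ, 𝔼) (𝓡 5) (fun x => (s x : Y)) (x t) : 𝔼 →L[ℝ] 𝔼) (x' t) =
        q t • lineVector η (lineParam s (x t, θ t)) := by
      rw [hxell t ht, h.lineVector_lineParam (p := (x t, θ t)) (hxW t ht)]
      exact map_smul (mfderiv 𝓘(ℝ, 𝔼) (𝓡 5) (fun x => (s x : Y)) (x t) : 𝔼 →L[ℝ] 𝔼) _ _
    have e2 : (⟨(s (x t) : Y), mfderiv 𝓘(ℝ, 𝔼) (𝓡 5) (fun x => (s x : Y)) (x t) (x' t)⟩ :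
        TangentBundle (𝓡 5) Y) = ⟨(s (x t) : Y), q t • lineVector η (lineParam s (x t, θ t))⟩ :=
      congrArg (Bundle.TotalSpace.mk _) e1
    rw [e2] at h1
    exact h1

/-- In the parametrisation by points and angles, a double fibration is a submersion whose fibres
consist of characteristic curves. -/
theorem isFibration (h : IsLocalModel D η V 𝓕 B W M κ s χ) {X : Type v} [TopologicalSpace X]
    [ChartedSpace 𝔼 X] {πX : LineSpace V → X} (hX : IsDoubleFibration D η V πX) :
    𝓕.IsFibration B W M κ (fun p => πX (lineParam s p)) := by
  refine ⟨h.isOpen, h.subset, h.convex, h.bound, h.pos, h.length_le, h.le_chord,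
    hX.smooth.comp_contMDiffOn h.contMDiffOn_lineParam, fun p hp => ?_, fun x θ n => ?_,
    fun p p' hp hp' he => ?_⟩
  · have h1 := mfderiv_comp p ((hX.smooth (lineParam s p)).mdifferentiableAt (by simp))
      ((h.contMDiffAt_lineParam hp).mdifferentiableAt (by simp))
    intro v
    obtain ⟨w, hw⟩ := hX.submersion (lineParam s p) v
    obtain ⟨w', hw'⟩ := (h.bijective_mfderiv_lineParam hp).2 w
    refine ⟨w', ?_⟩
    refine (congrArg (fun L : 𝔼 × ℝ →L[ℝ] 𝔼 => L w') h1).trans ?_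
    rw [← hw, ← hw']
    rfl
  · have : lineParam s (x, θ + n * (2 * Real.pi)) = lineParam s (x, θ) :=
      Prod.ext rfl (Circle.exp_eq_exp.2 ⟨n, rfl⟩)
    change πX _ = πX _
    rw [this]
  · obtain ⟨a, b, γ, hγ, hV, t, ht, t', ht', hl, hl'⟩ := (hX.fibre _ _).1 he
    obtain ⟨z, q, Q, hz, hlift⟩ := h.exists_isCharCurve hγ hV
    have hf : ∀ τ ∈ Icc a b, πX (lineParam s (z τ)) = πX (lineParam s p) := fun τ hτ =>
      (hX.fibre _ _).2 ⟨a, b, γ, hγ, hV, τ, hτ, t, ht, (hlift τ hτ _).2 rfl, hl⟩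
    have e1 := (h.lineParam_eq_iff (hz.mem t ht) hp).1 ((hlift t ht _).1 hl).symm
    have e2 := (h.lineParam_eq_iff (hz.mem t' ht') hp').1 ((hlift t' ht' _).1 hl').symm
    obtain ⟨m, hm⟩ := e1
    obtain ⟨n, hn⟩ := e2
    rcases le_total t t' with hle | hle
    · exact ⟨t, t', z, q, _, hz.restrict ht ht' hle,
        fun τ hτ => hf τ ⟨ht.1.trans hτ.1, hτ.2.trans ht'.2⟩, Or.inl ⟨m, n, hm, hn⟩⟩
    · exact ⟨t', t, z, q, _, hz.restrict ht' ht hle,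
        fun τ hτ => hf τ ⟨ht'.1.trans hτ.1, hτ.2.trans ht.2⟩, Or.inr ⟨n, m, hn, hm⟩⟩

end IsLocalModel

end Fibration

/-! ### Singular paths of the cone are fibres of lines -/

section SingularConePath

local notation "𝔼" => EuclideanSpace ℝ (Fin 5)

variable {Y : Type u} [TopologicalSpace Y] [ChartedSpace 𝔼 Y] {V : Opens Y}

theorem isSmoothImmersed_circleExp_comp {a b : ℝ} (hab : a < b) {θ r : ℝ → ℝ}
    (hs : ContMDiffOn 𝓘(ℝ, ℝ) (𝓡 1) ∞ (fun t => Circle.exp (θ t)) (Icc a b))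
    (hθ : ∀ t ∈ Icc a b, HasDerivWithinAt θ (r t) (Icc a b) t ∧ r t ≠ 0) :
    IsSmoothImmersed (𝓡 1) a b (fun t => Circle.exp (θ t)) := by
  refine ⟨hs, fun t ht h0 => ?_⟩
  have h1 : HasDerivWithinAt (fun t => Complex.exp (θ t * Complex.I))
      (Complex.exp (θ t * Complex.I) * (r t * Complex.I)) (Icc a b) t := by
    have h2 : HasDerivWithinAt (fun t => (θ t : ℂ)) (r t : ℂ) (Icc a b) t :=
      (hθ t ht).1.ofReal_comp
    exact (h2.mul_const Complex.I).cexp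
  have h2 := (contMDiff_coe_circle (Circle.exp (θ t))).mdifferentiableAt
    (by simp) |>.hasMFDerivAt.comp_hasMFDerivWithinAt t
    (((hs t ht).mdifferentiableWithinAt (by simp)).hasMFDerivWithinAt)
  rw [h0] at h2
  have h3 : HasFDerivWithinAt (fun t => Complex.exp (θ t * Complex.I)) (0 : ℝ →L[ℝ] ℂ)
      (Icc a b) t := by
    have h4 := h2.hasFDerivWithinAt
    refine (h4.congr_fderiv ?_).congr_of_eventuallyEq (Filter.Eventually.of_forall fun t => ?_) ?_
    · exact ContinuousLinearMap.comp_zero _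
    · exact (Circle.coe_exp _).symm
    · exact (Circle.coe_exp _).symm
  have h5 := (uniqueDiffOn_Icc hab t ht).eq_deriv _ h1 h3.hasDerivWithinAt
  simp [Complex.exp_ne_zero, (hθ t ht).2] at h5

/-- The velocity in `ℂ` of the direction of a moving oriented line. -/
noncomputable def circleVel (τ : TangentBundle modelZ (LineSpace V)) : ℂ :=
  (tangentMap modelZ 𝓘(ℝ, ℂ) (fun z : LineSpace V => (z.2 : ℂ)) τ).snd

/-- The angular velocity of a tangent vector of the space of oriented lines. -/
noncomputable def rotSpeed (τ : TangentBundle modelZ (LineSpace V)) : ℝ :=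
  (starRingEnd ℂ (τ.proj.2 : ℂ) * circleVel τ).im

namespace IsLocalModel

variable {D : ∀ y : Y, Submodule ℝ (TangentSpace (𝓡 5) y)}
  {η : Fin 2 → ∀ y : Y, TangentSpace (𝓡 5) y} {𝓕 : GrowthFrame 𝔼} {B W : Set 𝔼}
  {M κ : ℝ} {s : 𝔼 → V} {χ : Y → 𝔼}

theorem rotSpeed_tangentMap (h : IsLocalModel D η V 𝓕 B W M κ s χ) {p : 𝔼 × ℝ} (hp : p.1 ∈ W)
    (v : 𝔼 × ℝ) :
    rotSpeed (tangentMap 𝓘(ℝ, 𝔼 × ℝ) modelZ (lineParam s)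
      (⟨p, v⟩ : TangentBundle 𝓘(ℝ, 𝔼 × ℝ) (𝔼 × ℝ))) = v.2 := by
  have h1 := h.mfderiv_lineSpace_circle hp v
  have h2 : rotSpeed (tangentMap 𝓘(ℝ, 𝔼 × ℝ) modelZ (lineParam s)
      (⟨p, v⟩ : TangentBundle 𝓘(ℝ, 𝔼 × ℝ) (𝔼 × ℝ))) =
      (starRingEnd ℂ (Complex.exp (p.2 * Complex.I)) *
        ((v.2 : ℂ) * (Complex.exp ((p.2 : ℂ) * Complex.I) * Complex.I))).im := by
    rw [← h1, ← Circle.coe_exp]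
    rfl
  have h3 : starRingEnd ℂ (Complex.exp (p.2 * Complex.I)) * Complex.exp (p.2 * Complex.I) = 1 := by
    rw [← Complex.normSq_eq_conj_mul_self, Complex.normSq_eq_norm_sq,
      Complex.norm_exp_ofReal_mul_I]
    simp
  rw [h2, show starRingEnd ℂ (Complex.exp (p.2 * Complex.I)) *
        ((v.2 : ℂ) * (Complex.exp ((p.2 : ℂ) * Complex.I) * Complex.I)) =
      (starRingEnd ℂ (Complex.exp (p.2 * Complex.I)) * Complex.exp (p.2 * Complex.I)) *
        ((v.2 : ℂ) * Complex.I) by ring, h3]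
  simp

theorem eq_tangentMap_lineParam (h : IsLocalModel D η V 𝓕 B W M κ s χ)
    {τ : TangentBundle modelZ (LineSpace V)} (hτ : τ.snd ∈ kerY τ.proj) {p : 𝔼 × ℝ}
    (hp : p.1 ∈ W) (hpτ : lineParam s p = τ.proj) :
    τ = tangentMap 𝓘(ℝ, 𝔼 × ℝ) modelZ (lineParam s)
      (⟨p, (0, rotSpeed τ)⟩ : TangentBundle 𝓘(ℝ, 𝔼 × ℝ) (𝔼 × ℝ)) := by
  obtain ⟨z, w⟩ := τ
  change lineParam s p = z at hpτ
  subst hpτ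
  obtain ⟨v, hv⟩ : ∃ v : 𝔼 × ℝ, mfderiv 𝓘(ℝ, 𝔼 × ℝ) modelZ (lineParam s) p v = w :=
    (h.bijective_mfderiv_lineParam hp).2 w
  have hv' : (⟨lineParam s p, w⟩ : TangentBundle modelZ (LineSpace V)) =
      tangentMap 𝓘(ℝ, 𝔼 × ℝ) modelZ (lineParam s)
        (⟨p, v⟩ : TangentBundle 𝓘(ℝ, 𝔼 × ℝ) (𝔼 × ℝ)) :=
    congrArg (Bundle.TotalSpace.mk _) hv.symm
  have h1 : v.1 = 0 := by
    rw [← h.mfderiv_mem_kerY_iff hp]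
    rw [hv]
    exact hτ
  have h3 := h.rotSpeed_tangentMap hp v
  rw [hv', h3]
  congr 2
  exact Prod.ext h1 rfl

variable [IsManifold (𝓡 5) ∞ Y]

theorem _root_.contMDiff_rotSpeed : ContMDiff modelZ.tangent 𝓘(ℝ, ℝ) ∞ (rotSpeed (V := V)) := by
  have h1 : ContMDiff modelZ.tangent 𝓘(ℝ, ℂ).tangent ∞
      (tangentMap modelZ 𝓘(ℝ, ℂ) (fun z : LineSpace V => (z.2 : ℂ))) :=
    contMDiff_lineSpace_circle.contMDiff_tangentMap (by simp)
  have h2 := (contMDiff_snd_tangentBundle_modelSpace (n := ∞) ℂ 𝓘(ℝ, ℂ)).comp h1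
  have h3 : ContMDiff modelZ.tangent modelZ ∞
      (fun τ : TangentBundle modelZ (LineSpace V) => τ.proj) :=
    Bundle.contMDiff_proj _
  have h4 := Complex.conjCLE.contDiff.contMDiff.comp (contMDiff_lineSpace_circle.comp h3)
  have h5 : ContDiff ℝ ∞ (fun w : ℂ × ℂ => (w.1 * w.2).im) :=
    Complex.imCLM.contDiff.comp (contDiff_fst.mul contDiff_snd)
  exact h5.contMDiff.comp (h4.prodMk_space h2)

variable {X : Type v} [TopologicalSpace X] [ChartedSpace 𝔼 X] {πX : LineSpace V → X}

theorem tangentMap_lineParam (h : IsLocalModel D η V 𝓕 B W M κ s χ)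
    (hX : IsDoubleFibration D η V πX) {p : 𝔼 × ℝ} (hp : p.1 ∈ W) (v : 𝔼 × ℝ) :
    tangentMap 𝓘(ℝ, 𝔼 × ℝ) 𝓘(ℝ, 𝔼) (fun p => πX (lineParam s p))
      (⟨p, v⟩ : TangentBundle 𝓘(ℝ, 𝔼 × ℝ) (𝔼 × ℝ)) =
    tangentMap modelZ (𝓡 5) πX (tangentMap 𝓘(ℝ, 𝔼 × ℝ) modelZ (lineParam s)
      (⟨p, v⟩ : TangentBundle 𝓘(ℝ, 𝔼 × ℝ) (𝔼 × ℝ))) :=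
  tangentMap_comp_at (⟨p, v⟩ : TangentBundle 𝓘(ℝ, 𝔼 × ℝ) (𝔼 × ℝ))
    ((hX.smooth (lineParam s p)).mdifferentiableAt (by simp))
    ((h.contMDiffAt_lineParam hp).mdifferentiableAt (by simp))

theorem isVelocityLift_of_hasVelocityWithinAt (h : IsLocalModel D η V 𝓕 B W M κ s χ)
    (hX : IsDoubleFibration D η V πX) {γ : ℝ → X} {a b t : ℝ}
    {τ : TangentBundle modelZ (LineSpace V)} (hτ : τ.snd ∈ kerY τ.proj)
    (hv : HasVelocityWithinAt (𝓡 5) γ (Icc a b) t (tangentMap modelZ (𝓡 5) πX τ)) {p : 𝔼 × ℝ}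
    (hp : p.1 ∈ W) (hpτ : lineParam s p = τ.proj) :
    IsVelocityLift (fun p => πX (lineParam s p)) γ a b t (p, rotSpeed τ) := by
  rw [IsVelocityLift, h.tangentMap_lineParam hX hp, ← h.eq_tangentMap_lineParam hτ hp hpτ]
  exact hv

variable [T2Space X] [IsManifold (𝓡 5) ∞ X]

/-- A singular path of the cone is the image of an arc of a fibre of lines: it lifts to a curve
`z' = r • ∂/∂θ + q • char`, and the costate of the singular control forces `q = 0`. -/
theorem exists_of_isSingularConePath (h : IsLocalModel D η V 𝓕 B W M κ s χ)
    (hX : IsDoubleFibration D η V πX) {a b : ℝ} {γ : ℝ → X}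
    (hγ : IsSingularConePath πX a b γ) :
    ∃ (y : V) (σ : ℝ → Circle), IsSmoothImmersed (𝓡 1) a b σ ∧
      ∀ t ∈ Icc a b, γ t = πX (y, σ t) := by
  obtain ⟨hab, ⟨hγs, hγ'⟩, c, hc, hce⟩ := hγ
  have hf := h.isFibration hX
  set f : 𝔼 × ℝ → X := fun p => πX (lineParam s p) with hfdef
  obtain ⟨K, hK, hcK⟩ := hc.bounded
  -- the lifts of the velocities stay in a compact set
  set K₁ : Set 𝔼 := (fun τ : TangentBundle modelZ (LineSpace V) => χ (τ.proj.1 : Y)) '' K with hK₁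
  set K₂ : Set ℝ := rotSpeed '' K with hK₂
  have hK₁c : IsCompact K₁ := hK.image
    (h.contMDiff_lineCoord.continuous.comp (FiberBundle.continuous_proj _ _))
  have hK₂c : IsCompact K₂ := hK.image contMDiff_rotSpeed.continuous
  have hlift : ∀ τ ∈ K, τ.snd ∈ kerY τ.proj → ∀ t,
      HasVelocityWithinAt (𝓡 5) γ (Icc a b) t (tangentMap modelZ (𝓡 5) πX τ) →
      ∃ k ∈ (K₁ ×ˢ Icc (-Real.pi) Real.pi) ×ˢ K₂, k.1.1 ∈ W ∧ lineParam s k.1 = τ.proj ∧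
        k.2 = rotSpeed τ ∧ IsVelocityLift f γ a b t k := by
    intro τ hτK hτ t hv
    refine ⟨((χ (τ.proj.1 : Y), Complex.arg (τ.proj.2 : ℂ)), rotSpeed τ),
      ⟨⟨mem_image_of_mem _ hτK, (Complex.neg_pi_lt_arg _).le, Complex.arg_le_pi _⟩,
        mem_image_of_mem _ hτK⟩, h.coord_mem _ τ.proj.1.2, h.lineParam_coord _, rfl, ?_⟩
    exact h.isVelocityLift_of_hasVelocityWithinAt hX hτ hv (h.coord_mem _ τ.proj.1.2)
      (h.lineParam_coord _)
  obtain ⟨z, r, q, hrc, hqc, hσs, hz⟩ := hf.exists_lift hab hγs hγ'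
    ((hK₁c.prod isCompact_Icc).prod hK₂c)
    (fun k hk => by
      obtain ⟨τ, -, hτ⟩ := hk.1.1
      rw [← hτ]
      exact h.coord_mem _ τ.proj.1.2)
    (by
      filter_upwards [hcK, hc.mem, hc.velocity] with t h1 h2 h3
      obtain ⟨k, hk, -, -, -, hkl⟩ := hlift _ h1 h2 t h3
      exact ⟨k, hk, hkl⟩)
  have hr0 : ∀ t ∈ Icc a b, r t ≠ 0 := fun t ht => (hz t ht).2.1.ne_zero hab ht (hγ' t ht)
  have hbW := (hz b (right_mem_Icc.2 hab.le)).1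
  -- the control is `r • ∂/∂θ` along `z`
  have hcz : c =ᵐ[volume.restrict (Icc a b)] fun t => tangentMap 𝓘(ℝ, 𝔼 × ℝ) modelZ (lineParam s)
      (⟨z t, r t • ((0, 1) : 𝔼 × ℝ) + q t • (0 : 𝔼 × ℝ)⟩ :
        TangentBundle 𝓘(ℝ, 𝔼 × ℝ) (𝔼 × ℝ)) := by
    filter_upwards [hcK, hc.mem, hc.velocity, ae_restrict_mem measurableSet_Icc] with t h1 h2 h3 ht
    obtain ⟨k, -, hkW, hkτ, hkr, hkl⟩ := hlift _ h1 h2 t h3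
    obtain ⟨m, hm⟩ := hf.isVelocityLift_unique hab ((hγs t ht).mdifferentiableWithinAt (by simp))
      ht (hγ' t ht) hkW (hz t ht).1 hkl (hz t ht).2.1
    have h4 : z t = k.1 + (0, m * (2 * Real.pi)) := congrArg Prod.fst hm
    have h5 : r t = k.2 := congrArg Prod.snd hm
    have h6 : lineParam s (z t) = (c t).proj := by
      rw [← hkτ]
      exact (h.lineParam_eq_iff (hz t ht).1 hkW).2 ⟨m, h4⟩
    have h7 : r t • ((0, 1) : 𝔼 × ℝ) + q t • (0 : 𝔼 × ℝ) = (0, rotSpeed (c t)) := by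
      rw [h5, hkr]; simp
    rw [h7]
    exact h.eq_tangentMap_lineParam h2 (hz t ht).1 h6
  have hmd : ∀ p : 𝔼 × ℝ, p.1 ∈ W →
      mfderiv 𝓘(ℝ, 𝔼 × ℝ) (𝓡 5) (fun p => πX (lineParam s p)) p (𝓕.char p) =
        mfderiv 𝓘(ℝ, 𝔼 × ℝ) (𝓡 5) (fun p => πX (lineParam s p)) p 0 := fun p hp =>
    (hf.mfderiv_char hp).trans (map_zero
      (mfderiv 𝓘(ℝ, 𝔼 × ℝ) (𝓡 5) (fun p => πX (lineParam s p)) p : 𝔼 × ℝ →L[ℝ] 𝔼)).symm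
  obtain ⟨l, hl⟩ := exists_costate_of_isSingularControl (W := 𝔼 × ℝ) (I := 𝓡 5) (J := modelZ)
    (G := kerY (V := V)) hX.smooth h.isOpen_prod h.contMDiffOn_lineParam
    (X := fun _ => ((0, 1) : 𝔼 × ℝ)) (X' := 𝓕.char) (Y := fun _ => ((0, 1) : 𝔼 × ℝ))
    (Y' := fun _ => (0 : 𝔼 × ℝ)) contDiffOn_const
    (𝓕.smooth_char.mono (prod_mono h.subset_domain subset_rfl)) contDiffOn_const contDiffOn_const
    (fun p hp => (h.mfderiv_mem_kerY_iff hp.1 _).2 rfl)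
    (fun p hp => (h.mfderiv_mem_kerY_iff hp.1 _).2 rfl)
    (fun p _ => rfl) (fun p hp => hmd p hp.1) hab hrc hqc
    (fun t ht => ⟨(hz t ht).1, mem_univ _⟩) (fun t ht => (hz t ht).2.2) hce hcz
    (fun t ht => (hz t ht).2.1.1.symm) (hf.submersion _ hbW)
  have hq : ∀ t ∈ Icc a b, q t = 0 := GrowthFrame.eq_zero_of_costate hab
    (fun t ht => h.subset_domain (hz t ht).1) hqc hr0 (fun t ht => (hz t ht).2.2)
    (fun t ht => (hl t ht).2.1) (fun t ht => (hl t ht).2.2.1) (fun t ht => (hl t ht).2.2.2)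
    (fun t ht => (hl t ht).1)
  have hzd : ∀ t ∈ Icc a b, HasDerivWithinAt z (0, r t) (Icc a b) t := fun t ht => by
    have := (hz t ht).2.2
    rw [hq t ht] at this
    simpa using this
  have hzd1 : ∀ t ∈ Icc a b, HasDerivWithinAt (fun t => (z t).1) 0 (Icc a b) t := fun t ht =>
    (ContinuousLinearMap.fst ℝ 𝔼 ℝ).hasFDerivAt.comp_hasDerivWithinAt t (hzd t ht)
  have hzd2 : ∀ t ∈ Icc a b, HasDerivWithinAt (fun t => (z t).2) (r t) (Icc a b) t := fun t ht =>
    (ContinuousLinearMap.snd ℝ 𝔼 ℝ).hasFDerivAt.comp_hasDerivWithinAt t (hzd t ht)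
  have hconst : ∀ t ∈ Icc a b, (z t).1 = (z a).1 := by
    refine constant_of_derivWithin_zero (fun t ht => ?_) fun t ht => ?_
    · exact (hzd1 t ht).differentiableWithinAt
    · exact (hzd1 t (Ico_subset_Icc_self ht)).derivWithin
        (uniqueDiffOn_Icc hab t (Ico_subset_Icc_self ht))
  refine ⟨s (z a).1, fun t => Circle.exp (z t).2,
    isSmoothImmersed_circleExp_comp hab hσs fun t ht => ⟨hzd2 t ht, hr0 t ht⟩, fun t ht => ?_⟩
  have h1 := (hz t ht).2.1.1
  rw [← h1]
  change πX (lineParam s (z t)) = _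
  rw [lineParam, hconst t ht]

end IsLocalModel

end SingularConePath

/-! ### Arcs of fibres of lines are singular paths of the cone -/

section Variation

variable {E : Type*} [NormedAddCommGroup E] [NormedSpace ℝ E] {H : Type*} [TopologicalSpace H]
  {I : ModelWithCorners ℝ E H} {M : Type*} [TopologicalSpace M] [ChartedSpace H M]
  {E' : Type*} [NormedAddCommGroup E'] [NormedSpace ℝ E'] {H' : Type*} [TopologicalSpace H']
  {J : ModelWithCorners ℝ E' H'} {N : Type*} [TopologicalSpace N] [ChartedSpace H' N]
  [IsManifold J ∞ N] {G : ∀ z : N, Submodule ℝ (TangentSpace J z)} {π : N → M} {a b : ℝ}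
  {c : ℝ → TangentBundle J N} {γ : ℝ → M}

/-- A smooth function of the control changes by `O(s)`, uniformly in time, along a variation. -/
theorem IsVariation.exists_ae_abs_sub_le {C : ℝ → ℝ → TangentBundle J N} {Γ : ℝ → ℝ → M}
    (hv : IsVariation I J G π a b c γ C Γ) {φ : TangentBundle J N → ℝ}
    (hφ : ContMDiff J.tangent 𝓘(ℝ, ℝ) ∞ φ) :
    ∃ K, 0 ≤ K ∧ ∀ᶠ s in 𝓝 (0 : ℝ), ∀ᵐ t ∂(volume.restrict (Icc a b)),
      |φ (C s t) - φ (c t)| ≤ K * |s| := by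
  obtain ⟨Φ, hΦ, hΦC⟩ := hv.differentiable φ hφ
  obtain ⟨K, hK0, hK⟩ := hΦ.isBigO_sub.exists_nonneg
  refine ⟨K, hK0, ?_⟩
  filter_upwards [hK.bound, hΦC] with s hs hsC
  have h1 : ∀ᵐ t ∂(volume.restrict (Icc a b)), ‖(Φ s - Φ 0) t‖ ≤ ‖Φ s - Φ 0‖ := by
    filter_upwards [ae_le_eLpNormEssSup (f := (Φ s - Φ 0 : Lp ℝ ⊤ (volume.restrict (Icc a b))))]
      with t ht
    rw [← eLpNorm_exponent_top, ← Lp.enorm_def] at ht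
    exact enorm_le_iff_norm_le.1 ht
  filter_upwards [h1, hsC, hΦC.self_of_nhds, hv.control_zero, Lp.coeFn_sub (Φ s) (Φ 0)]
    with t h1 h2 h3 h4 h5
  rw [h5, Pi.sub_apply, h2, h3, h4, Real.norm_eq_abs] at h1
  refine h1.trans (hs.trans_eq ?_)
  simp

theorem IsLipschitzCurve.congr {γ' : ℝ → M} (h : IsLipschitzCurve I a b γ)
    (he : EqOn γ' γ (Icc a b)) : IsLipschitzCurve I a b γ' := by
  refine ⟨h.1.congr he, fun t ht => ?_⟩
  obtain ⟨K, s, hs, hK⟩ := h.2 t ht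
  refine ⟨K, s ∩ Icc a b, inter_mem hs self_mem_nhdsWithin, ?_⟩
  intro t₁ ht₁ t₂ ht₂
  have := hK ht₁.1 ht₂.1
  simp only [he ht, he ht₁.2, he ht₂.2]
  exact this

theorem IsControl.congr {γ' : ℝ → M} (h : IsControl I J G π a b c γ) (he : EqOn γ' γ (Icc a b)) :
    IsControl I J G π a b c γ' := by
  refine ⟨h.measurable, h.bounded, h.mem, h.lipschitz.congr he, ?_⟩
  filter_upwards [h.velocity, ae_restrict_mem measurableSet_Icc] with t h1 ht
  exact h1.congr ht he

end Variation

section FibreArc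

theorem EuclideanSpace.norm_le_sum_abs {n : ℕ} (v : EuclideanSpace ℝ (Fin n)) :
    ‖v‖ ≤ ∑ i, |v i| := by
  have h1 := (EuclideanSpace.basisFun (Fin n) ℝ).sum_repr v
  calc ‖v‖ = ‖∑ i, (EuclideanSpace.basisFun (Fin n) ℝ).repr v i •
        EuclideanSpace.basisFun (Fin n) ℝ i‖ := by rw [h1]
    _ ≤ ∑ i, ‖(EuclideanSpace.basisFun (Fin n) ℝ).repr v i •
        EuclideanSpace.basisFun (Fin n) ℝ i‖ := norm_sum_le _ _
    _ = ∑ i, |v i| := by simp [norm_smul]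

/-- Near a unit complex number with a given argument, arguments can be chosen Lipschitz close. -/
theorem exists_exp_eq_abs_sub_le (u : Circle) (θ : ℝ) :
    ∃ ϑ : ℝ, Circle.exp ϑ = u ∧ |ϑ - θ| ≤ Real.pi / 2 * ‖(u : ℂ) - Circle.exp θ‖ := by
  refine ⟨θ + Complex.arg ((u / Circle.exp θ : Circle) : ℂ), ?_, ?_⟩
  · rw [Circle.exp_add, Circle.exp_arg]
    exact mul_div_cancel _ _
  · rw [add_sub_cancel_left]
    have h1 := Complex.angle_le_mul_norm_sub (Circle.norm_coe u) (Circle.norm_coe (Circle.exp θ))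
    rwa [Complex.angle_eq_abs_arg (Circle.coe_ne_zero _) (Circle.coe_ne_zero _),
      ← Circle.coe_div] at h1

/-- A smooth immersed curve in the circle has an angle function. -/
theorem exists_angle_of_isSmoothImmersed {a b : ℝ} (hab : a < b) {σ : ℝ → Circle}
    (hσ : IsSmoothImmersed (𝓡 1) a b σ) :
    ∃ θ r : ℝ → ℝ, ContinuousOn r (Icc a b) ∧
      ∀ t ∈ Icc a b, HasDerivWithinAt θ (r t) (Icc a b) t ∧ r t ≠ 0 ∧ σ t = Circle.exp (θ t) := by
  have hu := uniqueDiffOn_Icc hab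
  have hus : ContDiffOn ℝ ∞ (fun t => (σ t : ℂ)) (Icc a b) :=
    contMDiffOn_iff_contDiffOn.1 (contMDiff_coe_circle.comp_contMDiffOn hσ.1)
  obtain ⟨θ, r, hr, hθ, hσθ⟩ := exists_polar_angle hab.le
    (fun t ht => ((hus t ht).differentiableWithinAt (by simp)).hasDerivWithinAt)
    (hus.derivWithin hu (m := ∞) (by simp)).continuousOn (fun t _ => Circle.coe_ne_zero _)
  have hσe : ∀ t ∈ Icc a b, σ t = Circle.exp (θ t) := fun t ht => Circle.ext (by
    have := hσθ t ht
    rw [Circle.norm_coe] at this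
    rw [Circle.coe_exp]
    simpa using this)
  refine ⟨θ, r, hr, fun t ht => ⟨hθ t ht, fun h0 => hσ.2 t ht ?_, hσe t ht⟩⟩
  have h1 := (contMDiff_circleExp (m := ∞) (θ t)).mdifferentiableAt (by simp)
    |>.hasMFDerivAt.comp_hasMFDerivWithinAt t ((hθ t ht).hasFDerivWithinAt.hasMFDerivWithinAt)
  have h2 := h1.congr_of_eventuallyEq
    (f₁ := σ) (Filter.eventuallyEq_of_mem self_mem_nhdsWithin hσe) (hσe t ht)
  refine (h2.mfderivWithin (uniqueMDiffWithinAt_iff_uniqueDiffWithinAt.2 (hu t ht))).trans ?_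
  rw [h0]
  have h3 : (ContinuousLinearMap.toSpanSingleton ℝ (0 : ℝ)) = (0 : ℝ →L[ℝ] ℝ) := by
    ext; simp
  have h4 : ∀ T : ℝ →L[ℝ] EuclideanSpace ℝ (Fin 1),
      T.comp (ContinuousLinearMap.toSpanSingleton ℝ (0 : ℝ)) = 0 := fun T => by
    rw [h3, ContinuousLinearMap.comp_zero]
  exact h4 _

end FibreArc

section FibreArc

local notation "𝔼" => EuclideanSpace ℝ (Fin 5)

namespace IsLocalModel

variable {Y : Type u} [TopologicalSpace Y] [ChartedSpace 𝔼 Y] [IsManifold (𝓡 5) ∞ Y] {V : Opens Y}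
  {D : ∀ y : Y, Submodule ℝ (TangentSpace (𝓡 5) y)}
  {η : Fin 2 → ∀ y : Y, TangentSpace (𝓡 5) y} {𝓕 : GrowthFrame 𝔼} {B W : Set 𝔼}
  {M κ : ℝ} {s : 𝔼 → V} {χ : Y → 𝔼}
  {X : Type v} [TopologicalSpace X] [ChartedSpace 𝔼 X] {πX : LineSpace V → X}

/-- The controls of a differentiable variation of a fibre of lines are given by lines and angular
velocities close to those of the fibre of lines. -/
theorem exists_ae_isVelocityLift (h : IsLocalModel D η V 𝓕 B W M κ s χ)
    (hX : IsDoubleFibration D η V πX) {a b : ℝ} (hab : a < b) {x₀ : 𝔼} (hx₀ : x₀ ∈ W)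
    {θ r : ℝ → ℝ} (hr : ContinuousOn r (Icc a b)) {γ : ℝ → X}
    {C : ℝ → ℝ → TangentBundle modelZ (LineSpace V)} {Γ : ℝ → ℝ → X}
    (hC : IsVariation (𝓡 5) modelZ (kerY (V := V)) πX a b
      (fun t => tangentMap 𝓘(ℝ, 𝔼 × ℝ) modelZ (lineParam s)
        (⟨(x₀, θ t), (0, r t)⟩ : TangentBundle 𝓘(ℝ, 𝔼 × ℝ) (𝔼 × ℝ))) γ C Γ) :
    ∃ K : ℝ, ∀ᶠ ε in 𝓝 (0 : ℝ), ∀ᵐ t ∂(volume.restrict (Icc a b)), ∃ k : (𝔼 × ℝ) × ℝ,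
      ‖k.1 - (x₀, θ t)‖ ≤ K * |ε| ∧ |k.2| ≤ K ∧
        IsVelocityLift (fun p => πX (lineParam s p)) (Γ ε) a b t k := by
  have hproj : ContMDiff modelZ.tangent modelZ ∞
      (fun τ : TangentBundle modelZ (LineSpace V) => τ.proj) := Bundle.contMDiff_proj _
  -- the functions on the control bundle that determine a line and its angular velocity
  have hcoord : ∀ i : Fin 5, ContMDiff modelZ.tangent 𝓘(ℝ, ℝ) ∞
      (fun τ : TangentBundle modelZ (LineSpace V) => χ (τ.proj.1 : Y) i) := fun i =>
    (EuclideanSpace.proj (𝕜 := ℝ) i).contDiff.contMDiff.comp (h.contMDiff_lineCoord.comp hproj)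
  have hre : ContMDiff modelZ.tangent 𝓘(ℝ, ℝ) ∞
      (fun τ : TangentBundle modelZ (LineSpace V) => (τ.proj.2 : ℂ).re) :=
    Complex.reCLM.contDiff.contMDiff.comp (contMDiff_lineSpace_circle.comp hproj)
  have him : ContMDiff modelZ.tangent 𝓘(ℝ, ℝ) ∞
      (fun τ : TangentBundle modelZ (LineSpace V) => (τ.proj.2 : ℂ).im) :=
    Complex.imCLM.contDiff.contMDiff.comp (contMDiff_lineSpace_circle.comp hproj)
  choose K₁ hK₁0 hK₁ using fun i => hC.exists_ae_abs_sub_le (hcoord i)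
  obtain ⟨K₂, hK₂0, hK₂⟩ := hC.exists_ae_abs_sub_le hre
  obtain ⟨K₃, hK₃0, hK₃⟩ := hC.exists_ae_abs_sub_le him
  obtain ⟨K₄, hK₄0, hK₄⟩ := hC.exists_ae_abs_sub_le contMDiff_rotSpeed
  obtain ⟨R, hR⟩ := isCompact_Icc.exists_bound_of_continuousOn hr
  have hR0 : 0 ≤ R := (norm_nonneg _).trans (hR a (left_mem_Icc.2 hab.le))
  have hone : ∀ᶠ ε : ℝ in 𝓝 0, |ε| ≤ 1 := by
    filter_upwards [Metric.closedBall_mem_nhds (0 : ℝ) one_pos] with ε hε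
    simpa using hε
  have hS : 0 ≤ ∑ i, K₁ i := Finset.sum_nonneg fun i _ => hK₁0 i
  have hπ := Real.pi_pos
  refine ⟨∑ i, K₁ i + Real.pi / 2 * (K₂ + K₃) + (R + K₄), ?_⟩
  filter_upwards [eventually_all.2 hK₁, hK₂, hK₃, hK₄, hC.control, hone]
    with ε h1 h2 h3 h4 h5 h6
  filter_upwards [ae_all_iff.2 h1, h2, h3, h4, h5.mem, h5.velocity,
    ae_restrict_mem measurableSet_Icc] with t g1 g2 g3 g4 g5 g6 ht
  obtain ⟨ϑ, hϑ, hϑθ⟩ := exists_exp_eq_abs_sub_le (C ε t).proj.2 (θ t)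
  have hp : χ ((C ε t).proj.1 : Y) ∈ W := h.coord_mem _ (C ε t).proj.1.2
  have hpτ : lineParam s (χ ((C ε t).proj.1 : Y), ϑ) = (C ε t).proj :=
    Prod.ext (h.right_inv _) hϑ
  refine ⟨((χ ((C ε t).proj.1 : Y), ϑ), rotSpeed (C ε t)), ?_, ?_,
    h.isVelocityLift_of_hasVelocityWithinAt hX g5 g6 hp hpτ⟩
  · have e1 : ‖χ ((C ε t).proj.1 : Y) - x₀‖ ≤ (∑ i, K₁ i) * |ε| := by
      refine (EuclideanSpace.norm_le_sum_abs _).trans ?_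
      rw [Finset.sum_mul]
      refine Finset.sum_le_sum fun i _ => ?_
      have := g1 i
      change |χ ((C ε t).proj.1 : Y) i - χ (s x₀ : Y) i| ≤ _ at this
      rwa [h.left_inv x₀ hx₀] at this
    have e2 : ‖((C ε t).proj.2 : ℂ) - Circle.exp (θ t)‖ ≤ (K₂ + K₃) * |ε| := by
      refine (Complex.norm_le_abs_re_add_abs_im _).trans ?_
      rw [Complex.sub_re, Complex.sub_im, add_mul]
      exact add_le_add g2 g3
    have e3 : |ϑ - θ t| ≤ Real.pi / 2 * (K₂ + K₃) * |ε| := by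
      rw [mul_assoc]
      exact hϑθ.trans (mul_le_mul_of_nonneg_left e2 (by positivity))
    have hε := abs_nonneg ε
    rw [Prod.norm_def]
    refine max_le ?_ ?_
    · refine e1.trans (mul_le_mul_of_nonneg_right ?_ hε)
      have : 0 ≤ Real.pi / 2 * (K₂ + K₃) := by positivity
      linarith
    · refine e3.trans (mul_le_mul_of_nonneg_right ?_ hε)
      linarith
  · have e1 : |rotSpeed (C ε t) - r t| ≤ K₄ * |ε| := by
      have := g4
      rwa [h.rotSpeed_tangentMap hx₀] at this
    have e2 : |r t| ≤ R := hR t ht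
    have e3 : K₄ * |ε| ≤ K₄ := mul_le_of_le_one_right hK₄0 h6
    have e4 : |rotSpeed (C ε t)| ≤ |rotSpeed (C ε t) - r t| + |r t| := by
      simpa using abs_add_le (rotSpeed (C ε t) - r t) (r t)
    have : 0 ≤ Real.pi / 2 * (K₂ + K₃) := by positivity
    change |rotSpeed (C ε t)| ≤ _
    linarith

variable [T2Space X] [IsManifold (𝓡 5) ∞ X]

/-- The image of an arc of a fibre of lines is a singular path of the cone. -/
theorem isSingularConePath (h : IsLocalModel D η V 𝓕 B W M κ s χ)
    (hX : IsDoubleFibration D η V πX) {a b : ℝ} (hab : a < b) {y : V} {σ : ℝ → Circle}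
    (hσ : IsSmoothImmersed (𝓡 1) a b σ) {γ : ℝ → X} (hγ : ∀ t ∈ Icc a b, γ t = πX (y, σ t)) :
    IsSingularConePath πX a b γ := by
  have hf := h.isFibration hX
  obtain ⟨θ, r, hr, hθ⟩ := exists_angle_of_isSmoothImmersed hab hσ
  set x₀ : 𝔼 := χ (y : Y) with hx₀def
  have hx₀ : x₀ ∈ W := h.coord_mem _ y.2
  have hγf : EqOn γ (fun t => πX (lineParam s (x₀, θ t))) (Icc a b) := fun t ht => by
    change γ t = πX (s x₀, Circle.exp (θ t))
    rw [h.right_inv, ← (hθ t ht).2.2, hγ t ht]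
  have hz : ∀ t ∈ Icc a b, HasDerivWithinAt (fun t => (x₀, θ t)) ((0 : 𝔼), r t) (Icc a b) t :=
    fun t ht => (hasDerivWithinAt_const t _ x₀).prodMk (hθ t ht).1
  have hb : b ∈ Icc a b := right_mem_Icc.2 hab.le
  refine ⟨hab, ⟨?_, fun t ht h0 => (hθ t ht).2.1 ?_⟩,
    fun t => tangentMap 𝓘(ℝ, 𝔼 × ℝ) modelZ (lineParam s)
      (⟨(x₀, θ t), (0, r t)⟩ : TangentBundle 𝓘(ℝ, 𝔼 × ℝ) (𝔼 × ℝ)), ?_, fun huniv => ?_⟩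
  · exact (hX.smooth.comp_contMDiffOn (contMDiffOn_const.prodMk hσ.1)).congr hγ
  · -- the tangents of the fibre of lines are transverse to the fibres of `πX`
    have h1 := (hasVelocityWithinAt_comp (I := 𝓡 5) (f := fun p => πX (lineParam s p))
      (z := fun t => (x₀, θ t))
      ((hf.contMDiffAt (p := (x₀, θ t)) hx₀).mdifferentiableAt (by simp)) (hz t ht)).congr ht hγf
    have h2 := h1.2.mfderivWithin
      (uniqueMDiffWithinAt_iff_uniqueDiffWithinAt.2 (uniqueDiffOn_Icc hab t ht))
    have h3 := congrArg (fun L : ℝ →L[ℝ] 𝔼 => L 1) (h2.symm.trans h0)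
    change (1 : ℝ) • (mfderiv 𝓘(ℝ, 𝔼 × ℝ) 𝓘(ℝ, 𝔼) (fun p => πX (lineParam s p)) (x₀, θ t) :
      𝔼 × ℝ →L[ℝ] 𝔼) (0, r t) = 0 at h3
    rw [one_smul] at h3
    have h4 := hf.eq_smul_char_of_mfderiv_eq_zero (p := (x₀, θ t)) hx₀ h3
    rw [GrowthFrame.charCoeff_const, zero_smul] at h4
    exact congrArg Prod.snd h4
  · refine IsControl.congr ?_ hγf
    exact isControl_of_lift (I := 𝓡 5) (J := modelZ) hX.smooth h.isOpen_prod
      h.contMDiffOn_lineParam hab.le (z := fun t => (x₀, θ t))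
      (z' := fun t => ((0 : 𝔼), r t)) (v := fun t => ((0 : 𝔼), r t))
      (fun t _ => ⟨hx₀, mem_univ _⟩) hz (continuousOn_const.prodMk hr)
      (continuousOn_const.prodMk hr)
      (fun t _ => (h.mfderiv_mem_kerY_iff (p := (x₀, θ t)) hx₀ _).2 rfl) (fun t _ => rfl)
  · obtain ⟨v, hv⟩ := hf.exists_not_endpoint hab hx₀
      (fun t ht => (hθ t ht).1.continuousWithinAt)
    have hv' : (v : TangentSpace (𝓡 5) (γ b)) ∈ (univ : Set (TangentSpace (𝓡 5) (γ b))) :=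
      mem_univ _
    rw [← huniv] at hv'
    obtain ⟨C, Γ, hC, hCv⟩ := hv'
    obtain ⟨K, hK⟩ := h.exists_ae_isVelocityLift hX hab hx₀ hr hC
    refine hv Γ (hC.control.mono fun ε hε => hε.lipschitz) ?_ K hK
      ⟨(hγf hb).symm.trans hCv.1, hCv.2⟩
    filter_upwards [hC.initial] with ε hε
    rw [hε, hγf (left_mem_Icc.2 hab.le)]

end IsLocalModel

end FibreArc

/-! ### Fibres of lines are determined by their arcs -/

section Uniqueness

namespace GrowthFrame.IsFibration

variable {F : Type*} [NormedAddCommGroup F] [NormedSpace ℝ F] [FiniteDimensional ℝ F]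
  {𝓕 : GrowthFrame F} {X : Type*} [TopologicalSpace X] [T2Space X] [ChartedSpace F X]
  [IsManifold 𝓘(ℝ, F) ∞ X] {B W : Set F} {M κ : ℝ} {f : F × ℝ → X}

/-- If an arc of the fibre of lines over `x₀` lies in the image of the fibre of lines over `x₁`,
then the two images are tangent to each other at a point of the arc, and so `x₀ = x₁`. -/
theorem eq_of_arc_subset (h : 𝓕.IsFibration B W M κ f) {a b : ℝ} (hab : a < b) {x₀ x₁ : F}
    (hx₀ : x₀ ∈ W) (hx₁ : x₁ ∈ W) {θ : ℝ → ℝ} {r : ℝ} (hθ : HasDerivWithinAt θ r (Icc a b) a)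
    (hr : r ≠ 0) {K : Set ℝ} (hK : IsCompact K)
    (hsub : ∀ t ∈ Icc a b, ∃ ϑ ∈ K, f (x₀, θ t) = f (x₁, ϑ)) : x₀ = x₁ := by
  choose! ϑ hϑK hϑ using hsub
  have ha : a ∈ Icc a b := left_mem_Icc.2 hab.le
  set l : Filter ℝ := 𝓝[Icc a b \ {a}] a with hl
  have hle : l ≤ 𝓝[Icc a b] a := nhdsWithin_mono _ sdiff_subset
  have hlmem : ∀ᶠ t in l, t ∈ Icc a b := by
    filter_upwards [self_mem_nhdsWithin] with t ht using ht.1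
  have hne : NeBot l := by
    have : Icc a b \ {a} = Ioc a b := Icc_sdiff_left
    rw [hl, this]
    rw [nhdsWithin_Ioc_eq_nhdsGT hab]
    infer_instance
  -- a limit of the angles over `x₁`, for times tending to `a`
  obtain ⟨ϑ₀, -, hcl⟩ := hK.exists_mapClusterPt (f := l) (u := ϑ)
    (by
      rw [le_principal_iff]
      exact hlmem.mono fun t ht => hϑK t ht)
  have hγc : Tendsto (fun t => f (x₀, θ t)) l (𝓝 (f (x₀, θ a))) :=
    (h.contMDiffAt (p := (x₀, θ a)) hx₀).continuousAt.tendsto.comp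
      (tendsto_const_nhds.prodMk_nhds (hθ.continuousWithinAt.tendsto.mono_left hle))
  have hfx₁ : ContinuousAt (fun τ => f (x₁, τ)) ϑ₀ :=
    ContinuousAt.comp (f := fun τ : ℝ => (x₁, τ)) (h.contMDiffAt (p := (x₁, ϑ₀)) hx₁).continuousAt
      (by fun_prop)
  have hlim : f (x₁, ϑ₀) = f (x₀, θ a) := by
    by_contra hne'
    obtain ⟨u, v, hu, hv, huv⟩ := t2_separation_nhds hne'
    obtain ⟨t, ⟨h1, h2⟩, ht⟩ := (((hcl.frequently (hfx₁ hu)).and_eventually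
      (hγc hv)).and_eventually hlmem).exists
    refine (disjoint_left.1 huv) h1 ?_
    have h3 : f (x₀, θ t) ∈ v := h2
    rwa [hϑ t ht] at h3
  -- charts, and the velocities
  set y₁ := f (x₀, θ a) with hy₁
  set G : F × ℝ → F := fun p => extChartAt 𝓘(ℝ, F) y₁ (f p) with hG
  have hs₀ : f (x₀, θ a) ∈ (chartAt F y₁).source := mem_chart_source F y₁
  have hs₁ : f (x₁, ϑ₀) ∈ (chartAt F y₁).source := by rw [hlim]; exact mem_chart_source F y₁
  have hG₀ := h.contDiffAt_inChart (p := (x₀, θ a)) hx₀ hs₀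
  have hG₁ := h.contDiffAt_inChart (p := (x₁, ϑ₀)) hx₁ hs₁
  have hGd : ∀ {x : F} {τ₀ : ℝ}, ContDiffAt ℝ ∞ G (x, τ₀) → HasFDerivAt (fun τ => G (x, τ))
      ((fderiv ℝ G (x, τ₀)).comp (ContinuousLinearMap.inr ℝ F ℝ)) τ₀ := fun {x τ₀} hx =>
    HasFDerivAt.comp τ₀ (f := fun τ : ℝ => (x, τ)) (hx.differentiableAt (by simp)).hasFDerivAt
      (hasFDerivAt_prodMk_right x τ₀)
  -- `H` recovers the angle over `x₁`
  obtain ⟨H, hH, hHG⟩ := exists_smooth_left_inverse (Ψ := fun τ : ℝ => G (x₁, τ)) (p := ϑ₀)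
    (ContDiffAt.comp (f := fun τ : ℝ => (x₁, τ)) ϑ₀ hG₁
      (contDiffAt_const.prodMk contDiffAt_id))
    (by
      rw [(hGd hG₁).fderiv, injective_iff_map_eq_zero]
      intro v hv
      exact h.fderiv_inChart_const_ne_zero (p := (x₁, ϑ₀)) hx₁ hs₁ hv)
  have hGeq : G (x₁, ϑ₀) = G (x₀, θ a) := by simp only [hG, hlim, hy₁]
  have hHa : H (G (x₀, θ a)) = ϑ₀ := by rw [← hGeq]; exact hHG.self_of_nhds
  have hd₀ : HasDerivWithinAt (fun t => G (x₀, θ t)) (fderiv ℝ G (x₀, θ a) (0, r)) (Icc a b) a :=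
    ((hGd hG₀).comp_hasDerivWithinAt a hθ).congr_deriv (by simp)
  obtain ⟨r', hr'⟩ : ∃ r', HasDerivWithinAt (fun t => H (G (x₀, θ t))) r' (Icc a b) a := by
    rw [hGeq] at hH
    exact ⟨_, (hH.differentiableAt (by simp)).hasFDerivAt.comp_hasDerivWithinAt a hd₀⟩
  have hd₁ : HasDerivWithinAt (fun t => G (x₁, H (G (x₀, θ t)))) (fderiv ℝ G (x₁, ϑ₀) (0, r'))
      (Icc a b) a := by
    have h1 := hGd hG₁
    rw [← hHa] at h1
    have h2 := (h1.comp_hasDerivWithinAt a hr').congr_deriv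
      (f' := _) (g' := fderiv ℝ G (x₁, ϑ₀) (0, r')) (by rw [hHa]; simp)
    exact h2
  -- the two curves agree at times that accumulate at `a`
  have hfreq : ∃ᶠ t in l, G (x₁, H (G (x₀, θ t))) - G (x₀, θ t) = 0 := by
    refine ((hcl.frequently hHG).and_eventually hlmem).mono ?_
    rintro t ⟨h1, ht⟩
    have h2 : G (x₀, θ t) = G (x₁, ϑ t) := by simp only [hG, hϑ t ht]
    rw [h2, h1, sub_self]
  have hD := hasDerivWithinAt_iff_tendsto_slope.1 (hd₁.sub hd₀)
  have hzero : fderiv ℝ G (x₁, ϑ₀) (0, r') - fderiv ℝ G (x₀, θ a) (0, r) ∈ ({0} : Set F) := by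
    refine isClosed_singleton.mem_of_frequently_of_tendsto (hfreq.mono fun t ht => ?_) hD
    simp only [slope, mem_singleton_iff, Pi.sub_apply, vsub_eq_sub]
    rw [ht, hHa, hGeq]
    simp
  obtain ⟨⟨m, hm⟩, -⟩ := h.eq_of_fderiv_eq (p := (x₀, θ a)) (p' := (x₁, ϑ₀)) hx₀ hx₁ hlim.symm hs₀
    hr (sub_eq_zero.1 hzero).symm
  have := congrArg Prod.fst hm
  simpa using this.symm

end GrowthFrame.IsFibration

local notation "𝔼" => EuclideanSpace ℝ (Fin 5)

namespace IsLocalModel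

variable {Y : Type u} [TopologicalSpace Y] [ChartedSpace 𝔼 Y] [IsManifold (𝓡 5) ∞ Y] {V : Opens Y}
  {D : ∀ y : Y, Submodule ℝ (TangentSpace (𝓡 5) y)}
  {η : Fin 2 → ∀ y : Y, TangentSpace (𝓡 5) y} {𝓕 : GrowthFrame 𝔼} {B W : Set 𝔼}
  {M κ : ℝ} {s : 𝔼 → V} {χ : Y → 𝔼}
  {X : Type v} [TopologicalSpace X] [ChartedSpace 𝔼 X] [T2Space X] [IsManifold (𝓡 5) ∞ X]
  {πX : LineSpace V → X}

theorem eq_of_arc_subset_fibreImage (h : IsLocalModel D η V 𝓕 B W M κ s χ)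
    (hX : IsDoubleFibration D η V πX) {a b : ℝ} (hab : a < b) {y y' : V} {σ : ℝ → Circle}
    (hσ : IsSmoothImmersed (𝓡 1) a b σ)
    (hsub : ∀ t ∈ Icc a b, πX (y, σ t) ∈ fibreImage πX y') : y = y' := by
  obtain ⟨θ, r, -, hθ⟩ := exists_angle_of_isSmoothImmersed hab hσ
  have ha : a ∈ Icc a b := left_mem_Icc.2 hab.le
  have h1 := (h.isFibration hX).eq_of_arc_subset hab (h.coord_mem y y.2) (h.coord_mem y' y'.2)
    (hθ a ha).1 (hθ a ha).2.1 (isCompact_Icc (a := -Real.pi) (b := Real.pi)) (fun t ht => by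
      obtain ⟨z, hz, hzt⟩ := hsub t ht
      refine ⟨Complex.arg (z.2 : ℂ), ⟨(Complex.neg_pi_lt_arg _).le, Complex.arg_le_pi _⟩, ?_⟩
      have hz' : (z.1 : Y) = y' := hz
      have h2 := h.lineParam_coord z
      rw [hz'] at h2
      change πX (s (χ y), Circle.exp (θ t)) = πX (lineParam s (χ y', Complex.arg (z.2 : ℂ)))
      rw [h2, hzt, h.right_inv, (hθ t ht).2.2])
  rw [← h.right_inv y, h1, h.right_inv]

end IsLocalModel

end Uniqueness

section FullFibre

theorem isSmoothImmersed_circleExp {a b : ℝ} (hab : a < b) :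
    IsSmoothImmersed (𝓡 1) a b Circle.exp :=
  isSmoothImmersed_circleExp_comp hab contMDiff_circleExp.contMDiffOn
    fun t _ => ⟨hasDerivWithinAt_id t _, one_ne_zero⟩

variable {Y : Type u} [TopologicalSpace Y] {V : Opens Y} {X : Type v} {πX : LineSpace V → X}

theorem mem_fibreImage (y : V) (u : Circle) : πX (y, u) ∈ fibreImage πX y := ⟨(y, u), rfl, rfl⟩

theorem image_circleExp_eq_fibreImage (y : V) :
    (fun t => πX (y, Circle.exp t)) '' Icc (-Real.pi) Real.pi = fibreImage πX y := by
  refine Subset.antisymm (image_subset_iff.2 fun t _ => mem_fibreImage y _) ?_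
  rintro _ ⟨z, hz, rfl⟩
  refine ⟨Complex.arg (z.2 : ℂ), ⟨(Complex.neg_pi_lt_arg _).le, Complex.arg_le_pi _⟩, ?_⟩
  have h1 : z.1 = y := Subtype.ext hz
  change πX (y, Circle.exp (Complex.arg (z.2 : ℂ))) = πX z
  rw [Circle.exp_arg, ← h1]

end FullFibre

theorem theorem4p8 {Y : Type u} [TopologicalSpace Y] [T2Space Y]
    [ChartedSpace (EuclideanSpace ℝ (Fin 5)) Y] [IsManifold (𝓡 5) ∞ Y]
    (D : ∀ y : Y, Submodule ℝ (TangentSpace (𝓡 5) y)) (hD : HasGrowth235 (𝓡 5) D)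
    (U : Opens Y) (η : Fin 2 → ∀ y : Y, TangentSpace (𝓡 5) y)
    (hη : IsFrameOn (𝓡 5) D η (U : Set Y)) (y₀ : Y) (hy₀ : y₀ ∈ U) :
    ∃ V₀ : Opens Y, y₀ ∈ V₀ ∧ V₀ ≤ U ∧
      ∀ V : Opens Y, V ≤ V₀ →
      ∀ (X : Type v) [TopologicalSpace X] [T2Space X]
        [ChartedSpace (EuclideanSpace ℝ (Fin 5)) X] [IsManifold (𝓡 5) ∞ X]
        (πX : LineSpace V → X), IsDoubleFibration D η V πX →
        (∀ (a b : ℝ) (γ : ℝ → X), a < b →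
          (IsSingularConePath πX a b γ ↔
            ∃ (y : V) (σ : ℝ → Circle), IsSmoothImmersed (𝓡 1) a b σ ∧
              ∀ t ∈ Icc a b, γ t = πX (y, σ t))) ∧
        (∀ (a b : ℝ) (γ : ℝ → X), IsSingularConePath πX a b γ →
          ∃! y : V, γ '' Icc a b ⊆ fibreImage πX y) ∧
        BijOn (fibreImage πX) univ (completeConePaths πX) := by
  obtain ⟨V₀, hyV₀, hV₀U, hmodel⟩ := exists_isLocalModel hD hη hy₀
  refine ⟨V₀, hyV₀, hV₀U, fun V hV X _ _ _ _ πX hX => ?_⟩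
  rcases isEmpty_or_nonempty V with hVe | hVne
  · have : IsEmpty X := ⟨fun x => (hX.surjective x).elim fun z _ => hVe.elim z.1⟩
    refine ⟨fun _ _ γ _ => isEmptyElim (γ 0), fun _ _ γ _ => isEmptyElim (γ 0),
      fun y _ => isEmptyElim y, fun y _ => isEmptyElim y, ?_⟩
    rintro A ⟨⟨_, _, γ, _⟩, _⟩
    exact isEmptyElim (γ 0)
  obtain ⟨𝓕, B, W, M, κ, s, χ, h⟩ := hmodel V hV hVne
  have hsub : ∀ {a b : ℝ} {γ : ℝ → X}, IsSingularConePath πX a b γ →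
      ∃ y : V, γ '' Icc a b ⊆ fibreImage πX y := by
    intro a b γ hγ
    obtain ⟨y, σ, -, hσ⟩ := h.exists_of_isSingularConePath hX hγ
    refine ⟨y, ?_⟩
    rintro _ ⟨t, ht, rfl⟩
    rw [hσ t ht]
    exact mem_fibreImage y (σ t)
  have hπ : -Real.pi < Real.pi := neg_lt_self Real.pi_pos
  have hfull : ∀ y : V, IsSingularConePath πX (-Real.pi) Real.pi
      (fun t => πX (y, Circle.exp t)) := fun y =>
    h.isSingularConePath hX hπ (isSmoothImmersed_circleExp hπ) fun t _ => rfl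
  have hinj : ∀ {y y' : V}, fibreImage πX y ⊆ fibreImage πX y' → y = y' := fun {y y'} hle =>
    h.eq_of_arc_subset_fibreImage hX hπ (isSmoothImmersed_circleExp hπ)
      fun t _ => hle (mem_fibreImage y (Circle.exp t))
  refine ⟨fun a b γ hab => ⟨h.exists_of_isSingularConePath hX, ?_⟩, fun a b γ hγ => ?_,
    fun y _ => ⟨⟨_, _, _, hfull y, (image_circleExp_eq_fibreImage y).symm⟩, ?_⟩,
    fun y _ y' _ hyy => hinj hyy.le, ?_⟩
  · rintro ⟨y, σ, hσ, hγσ⟩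
    exact h.isSingularConePath hX hab hσ hγσ
  · obtain ⟨y, σ, hσ, hγσ⟩ := h.exists_of_isSingularConePath hX hγ
    have hy : ∀ y' : V, γ '' Icc a b ⊆ fibreImage πX y' → y = y' := fun y' hy' =>
      h.eq_of_arc_subset_fibreImage hX hγ.1 hσ fun t ht =>
        hγσ t ht ▸ hy' (mem_image_of_mem γ ht)
    obtain ⟨y', hy'⟩ := hsub hγ
    exact ⟨y', hy', fun y'' hy'' => (hy y'' hy'').symm.trans (hy y' hy')⟩
  · -- a larger traced set lies in one fibre image, which is then the given one
    rintro A ⟨a, b, γ, hγ, rfl⟩ hle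
    obtain ⟨y', hy'⟩ := hsub hγ
    obtain rfl := hinj (hle.trans hy')
    exact hy'
  · rintro A ⟨⟨a, b, γ, hγ, rfl⟩, hmax⟩
    obtain ⟨y, hy⟩ := hsub hγ
    exact ⟨y, mem_univ y,
      (hmax ⟨_, _, _, hfull y, (image_circleExp_eq_fibreImage y).symm⟩ hy).antisymm hy⟩
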